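/- Let $R$ be a commutative ring and let $\mathrm{Ch}$ be the category of ($\mathbb Z$-graded) chain complexes of $R$-modules, with the usual tensor product and Koszul sign conventions; $sK$ denotes the suspension, $(sK)_n=K_{n-1}$, $\partial(sx)=-s\,\partial x$. Let $\mathbb A$ be the category whose objects are the finite rooted (non-planar) trees with at least one vertex, all of whose vertices have at least two inputs, and whose morphisms are the maps of trees which preserve the root and induce a bijection on leaves (compositions of an isomorphism and an inclusion $S'\to T$ of a tree $S'$ obtained from $T$ by contracting inner edges). For a leaf $a$ of $S$, let $S\circ_a Q$ be the tree obtained by grafting $Q$ on top of $S$ at $a$; its inner edges are those of $S$, those of $Q$, and $a$. A *linear $\infty$-operad* is a functor $M:\mathbb A^{op}\to \mathrm{Ch}$ with quasi-isomorphisms $\theta_{S,Q,a}:M(S\circ_a Q)\to M(S)\otimes M(Q)$ that are natural in $S$ and $Q$ and associative: the two maps $M((S\circ_aQ)\circ_bP)\to M(S)\otimes M(Q)\otimes M(P)$ obtained through $(S\circ_aQ)\circ_bP\cong S\circ_a(Q\circ_bP)$ ($b$ a leaf of $Q$) agree, and the two obtained through $(S\circ_aQ)\circ_bP\cong(S\circ_bP)\circ_aQ$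 ($b\neq a$ leaves of $S$) agree up to the symmetry of $\otimes$. Dually, a *linear $\infty$-cooperad* is a functor $Y:\mathbb A\to \mathrm{Ch}$ with quasi-isomorphisms $\Delta_{S,Q,a}:Y(S\circ_aQ)\to Y(S)\otimes Y(Q)$ that are natural in $S$ and $Q$ and satisfy the two analogous coassociativity conditions. A morphism of linear $\infty$-(co)operads is a natural transformation compatible with the structure maps. For $M:\mathbb A^{op}\to \mathrm{Ch}$, the bar construction $B(M):\mathbb A\to \mathrm{Ch}$ is the following functor. $B(M)(S)_m$ is the $R$-module spanned by the classes $(\alpha,d|e,sx)$, linear in $x$, where $\alpha:S\to T$ is a morphism of $\mathbb A$, $d=(d_0,\dots,d_{q-1})$ enumerates the inner edges of $S$, $e=(e_0,\dots,e_{p-1})$ enumerates the (inner) edges of $T$ not in the image of $\alpha$, and $x\in M(T)_{n}$, $m=q+p+n+1$, modulo $(\alpha,d|e,s\,\varphi^*x')=(\varphi\alpha,d|\varphi e,sx')$ for isomorphisms $\varphi:T\to T'$ and $(\alpha,d|e,sx)=(-1)^\sigma(-1)^\tau(\alpha,d\sigma|e\tau,sx)$ for permutations $\sigma,\tau$. The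 differential is $\partial_{ext}+\partial_{int}$, where, with $\partial_{e_i}:\partial_{e_i}T\to T$ the inner face contracting $e_i$ and $\alpha=\partial_{e_i}\circ\alpha_i$, $$\partial_{ext}(\alpha,d|e,sx)=\sum_{i}(-1)^{q+i}(\alpha_i,d|(e_0,\dots,\widehat{e_i},\dots,e_{p-1}),s\,\partial_{e_i}^*x),\qquad \partial_{int}(\alpha,d|e,sx)=(-1)^{q+p}(\alpha,d|e,\partial(sx)).$$ For $\gamma:S\to S'$, $\gamma_*(\alpha,d|e,sx)=0$ if $\alpha$ does not factor through $\gamma$; if $\alpha=\beta\gamma$ and $e$ is permuted, with its sign, so that $e_0,\dots,e_{c-1}$ are the entries in the image of $\beta$, then $\gamma_*(\alpha,d|e,sx)=(\beta,(\gamma d,\beta^{-1}e_0,\dots,\beta^{-1}e_{c-1})|(e_c,\dots,e_{p-1}),sx)$. **Proposition.** For every linear $\infty$-operad $(M,\theta)$ there are maps $\Delta_{S,Q,a}:B(M)(S\circ_aQ)\to B(M)(S)\otimes B(M)(Q)$ which make $B(M)$ a linear $\infty$-cooperad; that is, they are chain maps, natural in $S$ and $Q$, coassociative, and quasi-isomorphisms.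 They are given by $$\Delta\big(\alpha\circ_a\beta,\,(a,d_S,d_Q)|(e_S,e_Q),\,sx\big)=\sum(-1)^{\varepsilon}\,(\alpha,d_S|e_S,sx_1)\otimes(\beta,d_Q|e_Q,sx_2)$$ for $\alpha:S\to T$, $\beta:Q\to U$, $x\in M(T\circ_{\alpha(a)}U)$, $\theta(x)=\sum x_1\otimes x_2$, with the Koszul sign $$\varepsilon=1+|d_S|+|e_S|+|d_Q|+|e_Q|+|e_S||d_Q|+(|x_1|+1)(|d_Q|+|e_Q|)+|x_1|,$$ where $|d_S|$, etc., are the lengths of the enumerations. The construction is natural in $M$: a morphism of linear $\infty$-operads $M\to M'$ induces a morphism of linear $\infty$-cooperads $B(M)\to B(M')$. -/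

import Mathlib

open CategoryTheory MonoidalCategory

universe u

/-- A finite partial order is regarded as a rooted tree through its edges: `x ≤ y` means that the
path from `x` down to the root passes through `y`. So the root edge is the greatest element, the
leaves are the minimal elements, and every edge `y` which is not a leaf has exactly one vertex
directly above it, whose inputs are the edges covered by `y`. The conditions say that there is a root
edge, that the poset is a tree, that there is at least one vertex, and that every vertex has at
least two inputs. -/
structure IsReducedTree (E : Type) [PartialOrder E] : Prop where
  exists_root : ∃ r : E, ∀ x, x ≤ r
  exists_vertex : ∃ y : E, ¬ IsMin y
  chain : ∀ x y z : E, x ≤ y → x ≤ z → y ≤ z ∨ z ≤ y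
  branching : ∀ y : E, ¬ IsMin y → ∃ x z, x ⋖ y ∧ z ⋖ y ∧ x ≠ z

/-- Finite rooted (non-planar) trees with at least one vertex, all of whose vertices have at least
two inputs. The edges are labelled by `Fin card`, so that the trees form a small category which
contains every finite tree up to isomorphism. -/
structure RTree : Type where
  card : ℕ
  order : PartialOrder (Fin card)
  isTree : @IsReducedTree (Fin card) order

namespace RTree

/-- The set of edges of a tree, partially ordered with the root as greatest element. -/
def Edge (T : RTree) : Type := Fin T.card

instance (T : RTree) : PartialOrder T.Edge := T.order
instance (T : RTree) : Fintype T.Edge := inferInstanceAs (Fintype (Fin T.card))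
instance (T : RTree) : DecidableEq T.Edge := inferInstanceAs (DecidableEq (Fin T.card))

theorem isReducedTree (T : RTree) : IsReducedTree T.Edge := T.isTree

/-- The root edge. -/
noncomputable def root (T : RTree) : T.Edge := T.isReducedTree.exists_root.choose

theorem le_root (T : RTree) (x : T.Edge) : x ≤ T.root :=
  T.isReducedTree.exists_root.choose_spec x

theorem chain (T : RTree) {x y z : T.Edge} (h : x ≤ y) (h' : x ≤ z) : y ≤ z ∨ z ≤ y :=
  T.isReducedTree.chain x y z h h'

theorem eq_root_of_le {T : RTree} {x : T.Edge} (h : T.root ≤ x) : x = T.root :=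
  le_antisymm (T.le_root x) h

/-- The leaves are the minimal edges. -/
def IsLeaf (T : RTree) (x : T.Edge) : Prop := IsMin x

/-- The inner edges are those which are neither a leaf nor the root. -/
def IsInner (T : RTree) (x : T.Edge) : Prop := ¬ T.IsLeaf x ∧ x ≠ T.root

/-- The leaves of a tree. -/
abbrev Leaf (T : RTree) : Type := {x : T.Edge // T.IsLeaf x}

theorem root_not_isLeaf (T : RTree) : ¬ T.IsLeaf T.root := by
  intro h
  obtain ⟨y, hy⟩ := T.isReducedTree.exists_vertex
  apply hy
  have : y = T.root := le_antisymm (T.le_root y) (h (T.le_root y))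
  rw [this]
  exact h

theorem exists_leaf_le {T : RTree} (x : T.Edge) : ∃ l, T.IsLeaf l ∧ l ≤ x := by
  obtain ⟨l, hl, h⟩ := (Set.toFinite (Set.Iic x)).exists_le_minimal (le_refl x : x ∈ Set.Iic x)
  exact ⟨l, fun b hb => h.2 (le_trans hb hl) hb, hl⟩

/-- Edges are determined by the leaves above them -/
theorem eq_of_leaves {T : RTree} {y z : T.Edge}
    (h : ∀ l, T.IsLeaf l → (l ≤ y ↔ l ≤ z)) : y = z := by
  have key : ∀ y z : T.Edge, (∀ l, T.IsLeaf l → (l ≤ y ↔ l ≤ z)) → ¬ y < z := by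
    intro y z h hyz
    obtain ⟨c, c', hc, hc', hne⟩ := T.isReducedTree.branching z (fun hm => hyz.not_ge (hm hyz.le))
    have main : ∀ c : T.Edge, c ⋖ z → y ≤ c := by
      intro c hc
      obtain ⟨l, hl, hlc⟩ := exists_leaf_le c
      have hly := (h l hl).2 (hlc.trans hc.le)
      rcases T.chain hly hlc with h1 | h1
      · exact h1
      · rcases h1.eq_or_lt with h2 | h2
        · exact h2.ge
        · exact absurd hyz (hc.2 h2)
    rcases T.chain (main c hc) (main c' hc') with h1 | h1
    · exact hc.2 (h1.lt_of_ne hne) hc'.lt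
    · exact hc'.2 (h1.lt_of_ne hne.symm) hc.lt
  obtain ⟨l, hl, hly⟩ := exists_leaf_le y
  have hlz := (h l hl).1 hly
  rcases T.chain hly hlz with h1 | h1
  · exact (h1.eq_or_lt).resolve_right (key _ _ h)
  · exact ((h1.eq_or_lt).resolve_right (key _ _ (fun l hl => (h l hl).symm))).symm

/-- The morphisms `S ⟶ T` of trees considered here preserve the root and are bijective on leaves:
an isomorphism of `S` with a tree obtained from `T` by contracting inner edges. On
edges this is an order embedding which preserves the root and restricts to a bijection of leaves. -/
@[ext]
structure Hom (S T : RTree) : Type where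
  toEmb : S.Edge ↪o T.Edge
  map_root : toEmb S.root = T.root
  map_leaf : ∀ x, S.IsLeaf x → T.IsLeaf (toEmb x)
  leaf_surj : ∀ y, T.IsLeaf y → ∃ x, S.IsLeaf x ∧ toEmb x = y

instance : Category RTree where
  Hom := Hom
  id S := ⟨RelEmbedding.refl _, rfl, fun _ h => h, fun y h => ⟨y, h, rfl⟩⟩
  comp f g := ⟨f.toEmb.trans g.toEmb, by simp [f.map_root, g.map_root],
    fun x h => g.map_leaf _ (f.map_leaf _ h), fun z hz => by
      obtain ⟨y, hy, rfl⟩ := g.leaf_surj z hz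
      obtain ⟨x, hx, rfl⟩ := f.leaf_surj y hy
      exact ⟨x, hx, rfl⟩⟩

instance {S T : RTree} : CoeFun (S ⟶ T) (fun _ => S.Edge → T.Edge) := ⟨fun f => f.toEmb⟩

@[simp] theorem id_apply {S : RTree} (x : S.Edge) : (𝟙 S : S ⟶ S) x = x := rfl
@[simp] theorem comp_apply {S T U : RTree} (f : S ⟶ T) (g : T ⟶ U) (x : S.Edge) :
    (f ≫ g) x = g (f x) := rfl

theorem hom_ext {S T : RTree} {f g : S ⟶ T} (h : ∀ x, f x = g x) : f = g :=
  Hom.ext (RelEmbedding.ext h)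

theorem le_iff {S T : RTree} (f : S ⟶ T) {x y : S.Edge} : f x ≤ f y ↔ x ≤ y := f.toEmb.le_iff_le
theorem inj {S T : RTree} (f : S ⟶ T) : Function.Injective f := f.toEmb.injective

theorem isLeaf_iff {S T : RTree} (f : S ⟶ T) {x : S.Edge} : T.IsLeaf (f x) ↔ S.IsLeaf x :=
  ⟨fun h y hy => (le_iff f).1 (h ((le_iff f).2 hy)), f.map_leaf x⟩

theorem root_iff {S T : RTree} (f : S ⟶ T) {x : S.Edge} : f x = T.root ↔ x = S.root :=
  ⟨fun h => inj f (h.trans f.map_root.symm), fun h => by rw [h]; exact f.map_root⟩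

theorem leaf_mem_range {S T : RTree} (f : S ⟶ T) {y : T.Edge} (h : T.IsLeaf y) :
    y ∈ Set.range f := by
  obtain ⟨x, -, rfl⟩ := f.leaf_surj y h
  exact ⟨x, rfl⟩

theorem inner_of_not_mem_range {S T : RTree} (f : S ⟶ T) {y : T.Edge} (h : y ∉ Set.range f) :
    T.IsInner y :=
  ⟨fun hl => h (leaf_mem_range f hl), fun hr => h ⟨S.root, by rw [hr]; exact f.map_root⟩⟩

theorem hom_ext_leaf {S T : RTree} {f g : S ⟶ T} (h : ∀ x, S.IsLeaf x → f x = g x) : f = g := by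
  apply hom_ext
  intro x
  apply eq_of_leaves
  intro l hl
  obtain ⟨k, hk, rfl⟩ := f.leaf_surj l hl
  rw [le_iff f, h k hk, le_iff g]

theorem epi_ext {S T U : RTree} (c : S ⟶ T) {f g : T ⟶ U} (h : c ≫ f = c ≫ g) : f = g := by
  apply hom_ext_leaf
  intro x hx
  obtain ⟨y, -, rfl⟩ := c.leaf_surj x hx
  exact congrArg (fun k : S ⟶ U => k y) h

theorem mono_ext {S T U : RTree} {f g : S ⟶ T} (c : T ⟶ U) (h : f ≫ c = g ≫ c) : f = g :=
  hom_ext fun x => inj c (congrArg (fun k : S ⟶ U => k x) h)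

theorem exists_factor {S T U : RTree} (f : S ⟶ T) (g : U ⟶ T) (h : Set.range f ⊆ Set.range g) :
    ∃ k : S ⟶ U, k ≫ g = f := by
  choose k hk using fun x => h ⟨x, rfl⟩
  refine ⟨⟨⟨⟨k, fun x y hxy => inj f ?_⟩, ?_⟩, ?_, ?_, ?_⟩, hom_ext hk⟩
  · rw [← hk x, ← hk y, hxy]
  · intro x y
    change k x ≤ k y ↔ _
    rw [← le_iff g, hk, hk, le_iff f]
  · refine inj g ((hk _).trans (f.map_root.trans g.map_root.symm))
  · intro x hx
    exact (isLeaf_iff g).1 ((hk x).symm ▸ f.map_leaf x hx : T.IsLeaf (g (k x)))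
  · intro y hy
    obtain ⟨x, hx, h⟩ := f.leaf_surj (g y) (g.map_leaf y hy)
    exact ⟨x, hx, inj g ((hk x).trans h)⟩

theorem exists_iso {S T U : RTree} (f : S ⟶ T) (g : U ⟶ T) (h : Set.range f = Set.range g) :
    ∃ k : S ≅ U, k.hom ≫ g = f := by
  obtain ⟨k, hk⟩ := exists_factor f g h.le
  obtain ⟨l, hl⟩ := exists_factor g f h.ge
  exact ⟨⟨k, l, mono_ext f (by simp [hk, hl]), mono_ext g (by simp [hk, hl])⟩, hk⟩

theorem range_iso {S T : RTree} (k : S ≅ T) (y : T.Edge) : k.hom (k.inv y) = y :=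
  congrArg (fun f : T ⟶ T => f y) k.inv_hom_id

theorem iso_range {S T : RTree} (k : S ≅ T) (y : S.Edge) : k.inv (k.hom y) = y :=
  congrArg (fun f : S ⟶ S => f y) k.hom_inv_id

theorem _root_.IsReducedTree.of_iso {E F : Type} [PartialOrder E] [PartialOrder F] (i : E ≃o F)
    (h : IsReducedTree F) : IsReducedTree E where
  exists_root := by
    obtain ⟨r, hr⟩ := h.exists_root
    exact ⟨i.symm r, fun x => i.le_symm_apply.2 (hr _)⟩
  exists_vertex := by
    obtain ⟨r, hr⟩ := h.exists_vertex
    exact ⟨i.symm r, fun hm => hr fun b hb => by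
      simpa using i.monotone (hm (i.symm.monotone hb))⟩
  chain x y z hxy hxz := by
    simpa using h.chain (i x) (i y) (i z) (i.monotone hxy) (i.monotone hxz)
  branching y hy := by
    obtain ⟨x, z, hx, hz, hne⟩ := h.branching (i y) (fun hm => hy fun b hb =>
      i.le_iff_le.1 (hm (i.monotone hb)))
    refine ⟨i.symm x, i.symm z, ?_, ?_, fun h => hne (i.symm.injective h)⟩
    · simpa using (apply_covBy_apply_iff i.symm).2 hx
    · simpa using (apply_covBy_apply_iff i.symm).2 hz

noncomputable section

/-- The tree given by a finite partial order. -/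
def ofPoset (E : Type) [Fintype E] [PartialOrder E] (h : IsReducedTree E) : RTree where
  card := Fintype.card E
  order := PartialOrder.lift (Fintype.equivFin E).symm (Equiv.injective _)
  isTree := by
    let _ : PartialOrder (Fin (Fintype.card E)) :=
      PartialOrder.lift (Fintype.equivFin E).symm (Equiv.injective _)
    exact IsReducedTree.of_iso (E := Fin (Fintype.card E)) (F := E)
      ⟨(Fintype.equivFin E).symm, Iff.rfl⟩ h

/-- The edges of `ofPoset E h` are the elements of `E`. -/
def edgeIso (E : Type) [Fintype E] [PartialOrder E] (h : IsReducedTree E) :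
    (ofPoset E h).Edge ≃o E :=
  ⟨(Fintype.equivFin E).symm, Iff.rfl⟩

theorem isReducedTree_compl (T : RTree) (y : T.Edge) (hy : T.IsInner y) :
    IsReducedTree {x : T.Edge // x ≠ y} where
  exists_root := ⟨⟨T.root, hy.2.symm⟩, fun x => T.le_root x.1⟩
  exists_vertex := by
    refine ⟨⟨T.root, hy.2.symm⟩, fun hm => ?_⟩
    obtain ⟨l, hl, hly⟩ := exists_leaf_le y
    have hne : l ≠ y := fun h => hy.1 (h ▸ hl)
    have h1 : T.root ≤ l := hm (b := ⟨l, hne⟩) (T.le_root l)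
    exact T.root_not_isLeaf (eq_root_of_le h1 ▸ hl)
  chain x u v h h' := T.chain h h'
  branching := by
    rintro ⟨v, hv⟩ hm
    have cov : ∀ x : T.Edge, x ⋖ v → ∃ x' : {x : T.Edge // x ≠ y}, x' ⋖ ⟨v, hv⟩ ∧ x'.1 ≤ x := by
      intro x hx
      by_cases hxy : x = y
      · subst hxy
        obtain ⟨w, -, hw, -⟩ := T.isReducedTree.branching x hy.1
        refine ⟨⟨w, hw.lt.ne⟩, ⟨hw.lt.trans hx.lt, ?_⟩, hw.le⟩
        rintro ⟨u, hu⟩ h1 h2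
        have h1 : w < u := h1
        have h2 : u < v := h2
        rcases T.chain hw.le h1.le with h3 | h3
        · exact hx.2 (h3.lt_of_ne hu.symm) h2
        · exact hw.2 h1 (h3.lt_of_ne hu)
      · exact ⟨⟨x, hxy⟩, ⟨hx.lt, fun c h1 h2 => hx.2 (c := c.1) h1 h2⟩, le_rfl⟩
    obtain ⟨x, z, hx, hz, hne⟩ := T.isReducedTree.branching v (fun h => hm fun b hb => h hb)
    obtain ⟨x', hx', hxx⟩ := cov x hx
    obtain ⟨z', hz', hzz⟩ := cov z hz
    refine ⟨x', z', hx', hz', ?_⟩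
    rintro rfl
    rcases T.chain hxx hzz with h1 | h1
    · exact hx.2 (h1.lt_of_ne hne) hz.lt
    · exact hz.2 (h1.lt_of_ne hne.symm) hx.lt

/-- A morphism out of `ofPoset E h`, from an order embedding of `E`. -/
def homOfPoset {E : Type} [Fintype E] [PartialOrder E] (h : IsReducedTree E) {X : RTree}
    (f : E → X.Edge) (hle : ∀ x y, f x ≤ f y ↔ x ≤ y) (hroot : ∃ x, f x = X.root)
    (hleaf : ∀ x, IsMin x → X.IsLeaf (f x)) (hsurj : ∀ y, X.IsLeaf y → ∃ x, f x = y) :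
    ofPoset E h ⟶ X where
  toEmb := (edgeIso E h).toOrderEmbedding.trans (OrderEmbedding.ofMapLEIff f hle)
  map_root := by
    obtain ⟨r, hr⟩ := hroot
    refine eq_root_of_le ?_
    rw [← hr]
    refine (hle _ _).2 ((edgeIso E h).symm_apply_le.1 (le_root _ _))
  map_leaf x hx := hleaf _ ((edgeIso E h).isMin_apply.2 hx)
  leaf_surj y hy := by
    obtain ⟨x, rfl⟩ := hsurj y hy
    refine ⟨(edgeIso E h).symm x, (edgeIso E h).symm.isMin_apply.2 fun b hb => ?_, ?_⟩
    · exact (hle _ _).1 (hy ((hle _ _).2 hb))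
    · exact congrArg f ((edgeIso E h).apply_symm_apply x)

theorem homOfPoset_apply {E : Type} [Fintype E] [PartialOrder E] (h : IsReducedTree E) {X : RTree}
    (f : E → X.Edge) (hle : ∀ x y, f x ≤ f y ↔ x ≤ y) (hroot : ∃ x, f x = X.root)
    (hleaf : ∀ x, IsMin x → X.IsLeaf (f x)) (hsurj : ∀ y, X.IsLeaf y → ∃ x, f x = y)
    (x : (ofPoset E h).Edge) :
    homOfPoset h f hle hroot hleaf hsurj x = f (edgeIso E h x) := rfl

/-- The tree obtained from `T` by contracting the inner edge `y`. -/
def contract (T : RTree) (y : T.Edge) (hy : T.IsInner y) : RTree :=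
  ofPoset {x : T.Edge // x ≠ y} (isReducedTree_compl T y hy)

/-- The inner face map `∂_y : ∂_y T ⟶ T`, which misses exactly the edge `y`. -/
def contractHom (T : RTree) (y : T.Edge) (hy : T.IsInner y) : T.contract y hy ⟶ T :=
  homOfPoset (isReducedTree_compl T y hy) Subtype.val (fun _ _ => Iff.rfl)
    ⟨⟨T.root, hy.2.symm⟩, rfl⟩
    (by
      rintro ⟨x, hxy⟩ hx b hb
      by_cases hby : b = y
      · obtain ⟨l, hl, hly⟩ := exists_leaf_le y
        have hne : l ≠ y := fun h => hy.1 (h ▸ hl)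
        have : x ≤ l := hx (b := ⟨l, hne⟩) (hly.trans (hby ▸ hb))
        rw [hby]
        exact this.trans hly
      · exact hx (b := ⟨b, hby⟩) hb)
    (fun x hx => ⟨⟨x, fun h => hy.1 (h ▸ hx)⟩, rfl⟩)

theorem range_contractHom (T : RTree) (y : T.Edge) (hy : T.IsInner y) :
    Set.range (T.contractHom y hy) = {y}ᶜ := by
  ext x
  constructor
  · rintro ⟨z, rfl⟩
    exact (edgeIso _ (isReducedTree_compl T y hy) z).2
  · intro hx
    exact ⟨(edgeIso _ (isReducedTree_compl T y hy)).symm ⟨x, hx⟩,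
      congrArg Subtype.val ((edgeIso _ (isReducedTree_compl T y hy)).apply_symm_apply _)⟩

attribute [irreducible] contract contractHom

/-- The edges of the tree obtained by grafting `R` on top of `S` at the leaf `a`: those of `S` and
those of `R`, where the root of `R` is identified with `a`. -/
inductive GraftEdge (S R : RTree) (a : S.Leaf) : Type
  | below (s : S.Edge) : GraftEdge S R a
  | above (r : R.Edge) (h : r ≠ R.root) : GraftEdge S R a

namespace GraftEdge

variable {S R : RTree} {a : S.Leaf}

/-- The order on the edges of a grafting. -/
def le : GraftEdge S R a → GraftEdge S R a → Prop
  | below s, below s' => s ≤ s'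
  | above r _, above r' _ => r ≤ r'
  | above _ _, below s => a.1 ≤ s
  | below _, above _ _ => False

instance : PartialOrder (GraftEdge S R a) where
  le := le
  le_refl := by
    rintro (s | ⟨r, h⟩)
    · exact le_refl s
    · exact le_refl r
  le_trans := by
    rintro (x | ⟨x, hx⟩) (y | ⟨y, hy⟩) (z | ⟨z, hz⟩) h h'
    · exact le_trans (α := S.Edge) h h'
    · exact h'
    · exact h.elim
    · exact h.elim
    · exact le_trans (α := S.Edge) h h'
    · exact h'.elim
    · exact h'
    · exact le_trans (α := R.Edge) h h'
  le_antisymm := by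
    rintro (x | ⟨x, hx⟩) (y | ⟨y, hy⟩) h h'
    · rw [le_antisymm (α := S.Edge) h h']
    · exact h.elim
    · exact h'.elim
    · obtain rfl := le_antisymm (α := R.Edge) h h'
      rfl

instance : Fintype (GraftEdge S R a) :=
  letI := Classical.decEq (GraftEdge S R a)
  Fintype.ofSurjective (Sum.elim below (fun r : {r : R.Edge // r ≠ R.root} => above r.1 r.2)) (by
    rintro (s | ⟨r, h⟩)
    · exact ⟨Sum.inl s, rfl⟩
    · exact ⟨Sum.inr ⟨r, h⟩, rfl⟩)

/-- The inclusion of the edges of `S`. -/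
abbrev gl (a : S.Leaf) (s : S.Edge) : GraftEdge S R a := below s

/-- The inclusion of the edges of `R`, which sends the root to `a`. -/
def gr (a : S.Leaf) (r : R.Edge) : GraftEdge S R a :=
  if h : r = R.root then below a.1 else above r h

/-- Case distinction. -/
def elim {α : Type} (f : S.Edge → α) (g : R.Edge → α) : GraftEdge S R a → α
  | below s => f s
  | above r _ => g r

theorem gr_root : gr a R.root = gl a a.1 := dif_pos rfl

theorem gl_le_gl {s s' : S.Edge} : (gl a s : GraftEdge S R a) ≤ gl a s' ↔ s ≤ s' := Iff.rfl

theorem gr_le_gl {s : S.Edge} {r : R.Edge} : gr a r ≤ gl a s ↔ a.1 ≤ s := by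
  unfold gr
  split_ifs <;> exact Iff.rfl

theorem gl_le_gr {s : S.Edge} {r : R.Edge} : gl a s ≤ gr a r ↔ s = a.1 ∧ r = R.root := by
  unfold gr
  split_ifs with h
  · exact ⟨fun h1 => ⟨le_antisymm h1 (a.2 h1), h⟩, fun h1 => h1.1.le⟩
  · exact ⟨fun h1 => h1.elim, fun h1 => (h h1.2).elim⟩

theorem gr_le_gr {r r' : R.Edge} : (gr a r : GraftEdge S R a) ≤ gr a r' ↔ r ≤ r' := by
  by_cases h' : r' = R.root
  · subst h'
    rw [gr_root, gr_le_gl]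
    exact iff_of_true le_rfl (R.le_root r)
  · by_cases h : r = R.root
    · subst h
      rw [gr_root, gl_le_gr]
      exact iff_of_false (fun h1 => h' h1.2) fun h1 => h' (eq_root_of_le h1)
    · rw [gr, gr, dif_neg h, dif_neg h']
      exact Iff.rfl

theorem cases (x : GraftEdge S R a) :
    (∃ s, x = gl a s) ∨ (∃ r, r ≠ R.root ∧ x = gr a r) := by
  rcases x with s | ⟨r, h⟩
  · exact Or.inl ⟨s, rfl⟩
  · exact Or.inr ⟨r, h, by rw [gr, dif_neg h]⟩

theorem isMin_gr {r : R.Edge} : IsMin (gr a r) ↔ R.IsLeaf r := by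
  constructor
  · exact fun h b hb => gr_le_gr.1 (h (gr_le_gr.2 hb))
  · intro h b hb
    rcases cases b with ⟨s, rfl⟩ | ⟨r', -, rfl⟩
    · exact absurd (gl_le_gr.1 hb).2 fun h1 => R.root_not_isLeaf (h1 ▸ h)
    · exact gr_le_gr.2 (h (gr_le_gr.1 hb))

theorem isMin_gl {s : S.Edge} : IsMin (gl a s : GraftEdge S R a) ↔ S.IsLeaf s ∧ s ≠ a.1 := by
  constructor
  · refine fun h => ⟨fun b hb => gl_le_gl.1 (h (gl_le_gl.2 hb)), ?_⟩
    rintro rfl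
    exact R.root_not_isLeaf (isMin_gr.1 (gr_root (R := R) ▸ h))
  · rintro ⟨h, hne⟩ b hb
    rcases cases b with ⟨s', rfl⟩ | ⟨r', -, rfl⟩
    · exact gl_le_gl.2 (h (gl_le_gl.1 hb))
    · exact absurd (le_antisymm (h (gr_le_gl.1 hb)) (gr_le_gl.1 hb)) hne

theorem isReducedTree (S R : RTree) (a : S.Leaf) : IsReducedTree (GraftEdge S R a) where
  exists_root := by
    refine ⟨gl a S.root, fun x => ?_⟩
    rcases cases x with ⟨s, rfl⟩ | ⟨r, -, rfl⟩
    · exact gl_le_gl.2 (S.le_root s)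
    · exact gr_le_gl.2 (S.le_root _)
  exists_vertex := ⟨gl a a.1, fun h => (isMin_gl.1 h).2 rfl⟩
  chain x y z hxy hxz := by
    rcases cases y with ⟨y, rfl⟩ | ⟨y, hy, rfl⟩ <;> rcases cases z with ⟨z, rfl⟩ | ⟨z, hz, rfl⟩
    · rw [gl_le_gl, gl_le_gl]
      rcases cases x with ⟨x, rfl⟩ | ⟨x, hx, rfl⟩
      · exact S.chain (gl_le_gl.1 hxy) (gl_le_gl.1 hxz)
      · exact S.chain (gr_le_gl.1 hxy) (gr_le_gl.1 hxz)
    · rcases cases x with ⟨x, rfl⟩ | ⟨x, hx, rfl⟩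
      · exact absurd (gl_le_gr.1 hxz).2 hz
      · exact Or.inr (gr_le_gl.2 (gr_le_gl.1 hxy))
    · rcases cases x with ⟨x, rfl⟩ | ⟨x, hx, rfl⟩
      · exact absurd (gl_le_gr.1 hxy).2 hy
      · exact Or.inl (gr_le_gl.2 (gr_le_gl.1 hxz))
    · rw [gr_le_gr, gr_le_gr]
      rcases cases x with ⟨x, rfl⟩ | ⟨x, hx, rfl⟩
      · exact absurd (gl_le_gr.1 hxy).2 hy
      · exact R.chain (gr_le_gr.1 hxy) (gr_le_gr.1 hxz)
  branching := by
    have covr : ∀ x y : R.Edge, x ⋖ y → (gr a x : GraftEdge S R a) ⋖ gr a y := by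
      intro x y h
      refine ⟨⟨gr_le_gr.2 h.le, fun h1 => h.lt.not_ge (gr_le_gr.1 h1)⟩, fun c h1 h2 => ?_⟩
      rcases cases c with ⟨c, rfl⟩ | ⟨c, hc, rfl⟩
      · have h3 := gl_le_gr.1 h2.le
        rw [h3.1, h3.2, gr_root] at h2
        exact h2.ne rfl
      · exact h.2 (lt_of_le_not_ge (gr_le_gr.1 h1.le) fun h3 => h1.not_ge (gr_le_gr.2 h3))
          (lt_of_le_not_ge (gr_le_gr.1 h2.le) fun h3 => h2.not_ge (gr_le_gr.2 h3))
    have brr : ∀ y : R.Edge, ¬ R.IsLeaf y →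
        ∃ x z : GraftEdge S R a, x ⋖ gr a y ∧ z ⋖ gr a y ∧ x ≠ z := by
      intro y hy
      obtain ⟨x, z, hx, hz, hne⟩ := R.isReducedTree.branching y hy
      exact ⟨gr a x, gr a z, covr _ _ hx, covr _ _ hz, fun h => hne
        (le_antisymm (gr_le_gr.1 h.le) (gr_le_gr.1 h.ge))⟩
    intro y hy
    rcases cases y with ⟨y, rfl⟩ | ⟨y, -, rfl⟩
    · by_cases hya : y = a.1
      · subst hya
        rw [← gr_root (R := R)]
        exact brr _ R.root_not_isLeaf
      · have hl : ¬ S.IsLeaf y := fun h => hy (isMin_gl.2 ⟨h, hya⟩)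
        have covl : ∀ x : S.Edge, x ⋖ y → (gl a x : GraftEdge S R a) ⋖ gl a y := by
          intro x h
          refine ⟨lt_of_le_not_ge h.le (fun h1 => h.lt.not_ge (gl_le_gl.1 h1)), fun c h1 h2 => ?_⟩
          rcases cases c with ⟨c, rfl⟩ | ⟨c, hc, rfl⟩
          · exact h.2 (lt_of_le_not_ge (gl_le_gl.1 h1.le) fun h3 => h1.not_ge (gl_le_gl.2 h3))
              (lt_of_le_not_ge (gl_le_gl.1 h2.le) fun h3 => h2.not_ge (gl_le_gl.2 h3))
          · exact hc (gl_le_gr.1 h1.le).2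
        obtain ⟨x, z, hx, hz, hne⟩ := S.isReducedTree.branching y hl
        exact ⟨gl a x, gl a z, covl _ hx, covl _ hz, fun h => hne (below.inj h)⟩
    · exact brr y fun h => hy (isMin_gr.2 h)

end GraftEdge

/-- The tree `S ∘_a R` obtained by grafting `R` on top of `S` at the leaf `a`. -/
def graft (S R : RTree) (a : S.Leaf) : RTree :=
  ofPoset (GraftEdge S R a) (GraftEdge.isReducedTree S R a)

variable {S R Q : RTree}

/-- The inclusion of the edges of `S` into those of `S ∘_a R`. -/
def inl (R : RTree) (a : S.Leaf) (s : S.Edge) : (graft S R a).Edge :=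
  (edgeIso _ (GraftEdge.isReducedTree S R a)).symm (GraftEdge.gl a s)

/-- The inclusion of the edges of `R` into those of `S ∘_a R`. -/
def inr (a : S.Leaf) (r : R.Edge) : (graft S R a).Edge :=
  (edgeIso _ (GraftEdge.isReducedTree S R a)).symm (GraftEdge.gr a r)

theorem inr_root (a : S.Leaf) : inr a R.root = inl R a a.1 := by
  rw [inr, GraftEdge.gr_root, inl]

theorem inl_le_inl {a : S.Leaf} {s s' : S.Edge} : inl R a s ≤ inl R a s' ↔ s ≤ s' :=
  (edgeIso _ (GraftEdge.isReducedTree S R a)).symm.le_iff_le.trans GraftEdge.gl_le_gl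

theorem inr_le_inr {a : S.Leaf} {r r' : R.Edge} : inr a r ≤ inr a r' ↔ r ≤ r' :=
  (edgeIso _ (GraftEdge.isReducedTree S R a)).symm.le_iff_le.trans GraftEdge.gr_le_gr

theorem inr_le_inl {a : S.Leaf} {r : R.Edge} {s : S.Edge} : inr a r ≤ inl R a s ↔ a.1 ≤ s :=
  (edgeIso _ (GraftEdge.isReducedTree S R a)).symm.le_iff_le.trans GraftEdge.gr_le_gl

theorem inl_le_inr {a : S.Leaf} {r : R.Edge} {s : S.Edge} :
    inl R a s ≤ inr a r ↔ s = a.1 ∧ r = R.root :=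
  (edgeIso _ (GraftEdge.isReducedTree S R a)).symm.le_iff_le.trans GraftEdge.gl_le_gr

theorem isLeaf_inl {a : S.Leaf} {s : S.Edge} :
    (graft S R a).IsLeaf (inl R a s) ↔ S.IsLeaf s ∧ s ≠ a.1 :=
  (edgeIso _ (GraftEdge.isReducedTree S R a)).symm.isMin_apply.trans GraftEdge.isMin_gl

theorem isLeaf_inr {a : S.Leaf} {r : R.Edge} : (graft S R a).IsLeaf (inr a r) ↔ R.IsLeaf r :=
  (edgeIso _ (GraftEdge.isReducedTree S R a)).symm.isMin_apply.trans GraftEdge.isMin_gr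

theorem graft_cases {a : S.Leaf} (x : (graft S R a).Edge) :
    (∃ s, x = inl R a s) ∨ (∃ r, r ≠ R.root ∧ x = inr a r) := by
  obtain ⟨x, rfl⟩ := (edgeIso _ (GraftEdge.isReducedTree S R a)).symm.surjective x
  rcases GraftEdge.cases x with ⟨s, rfl⟩ | ⟨r, hr, rfl⟩
  · exact Or.inl ⟨s, rfl⟩
  · exact Or.inr ⟨r, hr, rfl⟩

theorem inl_root (a : S.Leaf) : inl R a S.root = (graft S R a).root := by
  refine eq_root_of_le ?_
  rcases graft_cases (graft S R a).root with ⟨s, h⟩ | ⟨r, -, h⟩ <;> rw [h]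
  · exact inl_le_inl.2 (S.le_root s)
  · exact inr_le_inl.2 (S.le_root _)

theorem inl_injective {a : S.Leaf} : Function.Injective (inl R a) := fun _ _ h =>
  le_antisymm (inl_le_inl.1 h.le) (inl_le_inl.1 h.ge)

theorem inr_injective {a : S.Leaf} : Function.Injective (inr (R := R) a) := fun _ _ h =>
  le_antisymm (inr_le_inr.1 h.le) (inr_le_inr.1 h.ge)

/-- Define a function on the edges of `S ∘_a R` by its values on the edges of `S` and of `R`. -/
def graftElim {α : Type} {a : S.Leaf} (f : S.Edge → α) (g : R.Edge → α)
    (x : (graft S R a).Edge) : α :=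
  GraftEdge.elim f g (edgeIso _ (GraftEdge.isReducedTree S R a) x)

theorem graftElim_inl {α : Type} {a : S.Leaf} (f : S.Edge → α) (g : R.Edge → α) (s : S.Edge) :
    graftElim f g (inl R a s) = f s := by
  rw [graftElim, inl, OrderIso.apply_symm_apply]
  rfl

theorem graftElim_inr {α : Type} {a : S.Leaf} (f : S.Edge → α) (g : R.Edge → α)
    (h : f a.1 = g R.root) (r : R.Edge) : graftElim f g (inr a r) = g r := by
  by_cases hr : r = R.root
  · subst hr
    rw [inr_root, graftElim_inl, h]
  · rw [graftElim, inr, OrderIso.apply_symm_apply, GraftEdge.gr, dif_neg hr]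
    rfl

/-- Define a morphism out of `S ∘_a R` by its values on the edges of `S` and of `R`. -/
def graftDesc {a : S.Leaf} {X : RTree} (f : S.Edge → X.Edge) (g : R.Edge → X.Edge)
    (hff : ∀ s s', f s ≤ f s' ↔ s ≤ s') (hgg : ∀ r r', g r ≤ g r' ↔ r ≤ r')
    (hgf : ∀ r s, g r ≤ f s ↔ a.1 ≤ s) (hfg : ∀ s r, f s ≤ g r ↔ s = a.1 ∧ r = R.root)
    (hroot : f S.root = X.root) (hfl : ∀ s, S.IsLeaf s → s ≠ a.1 → X.IsLeaf (f s))
    (hgl : ∀ r, R.IsLeaf r → X.IsLeaf (g r))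
    (hsurj : ∀ x, X.IsLeaf x → (∃ s, f s = x) ∨ ∃ r, g r = x) : graft S R a ⟶ X :=
  homOfPoset (GraftEdge.isReducedTree S R a) (GraftEdge.elim f g)
    (by
      rintro (x | ⟨x, hx⟩) (y | ⟨y, hy⟩)
      · exact hff x y
      · exact (hfg x y).trans ⟨fun h => (hy h.2).elim, fun h => h.elim⟩
      · exact hgf x y
      · exact hgg x y)
    ⟨.below S.root, hroot⟩
    (by
      intro x hx
      rcases GraftEdge.cases x with ⟨s, rfl⟩ | ⟨r, hr, rfl⟩
      · have h := GraftEdge.isMin_gl.1 hx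
        exact hfl s h.1 h.2
      · have h := hgl r (GraftEdge.isMin_gr.1 hx)
        rw [GraftEdge.gr, dif_neg hr]
        exact h)
    (by
      intro x hx
      rcases hsurj x hx with ⟨s, rfl⟩ | ⟨r, rfl⟩
      · exact ⟨.below s, rfl⟩
      · have hr : r ≠ R.root := by
          rintro rfl
          apply R.root_not_isLeaf
          intro b hb
          exact (hgg _ _).1 (hx ((hgg _ _).2 hb))
        exact ⟨.above r hr, rfl⟩)

theorem graftDesc_apply {a : S.Leaf} {X : RTree} (f : S.Edge → X.Edge) (g : R.Edge → X.Edge)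
    (hff : ∀ s s', f s ≤ f s' ↔ s ≤ s') (hgg : ∀ r r', g r ≤ g r' ↔ r ≤ r')
    (hgf : ∀ r s, g r ≤ f s ↔ a.1 ≤ s) (hfg : ∀ s r, f s ≤ g r ↔ s = a.1 ∧ r = R.root)
    (hroot : f S.root = X.root) (hfl : ∀ s, S.IsLeaf s → s ≠ a.1 → X.IsLeaf (f s))
    (hgl : ∀ r, R.IsLeaf r → X.IsLeaf (g r))
    (hsurj : ∀ x, X.IsLeaf x → (∃ s, f s = x) ∨ ∃ r, g r = x) (x : (graft S R a).Edge) :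
    graftDesc f g hff hgg hgf hfg hroot hfl hgl hsurj x = graftElim f g x := rfl

/-- The image of a leaf under a morphism. -/
def leafMap {S S' : RTree} (β : S ⟶ S') (a : S.Leaf) : S'.Leaf := ⟨β a.1, β.map_leaf _ a.2⟩

/-- The morphism `β ∘_a γ : S ∘_a R ⟶ S' ∘_{β a} R'`. -/
def graftMap {S S' R R' : RTree} (β : S ⟶ S') (γ : R ⟶ R') (a : S.Leaf) :
    graft S R a ⟶ graft S' R' (leafMap β a) :=
  graftDesc (fun s => inl R' (leafMap β a) (β s)) (fun r => inr (leafMap β a) (γ r))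
    (fun _ _ => inl_le_inl.trans (le_iff β)) (fun _ _ => inr_le_inr.trans (le_iff γ))
    (fun _ _ => inr_le_inl.trans (le_iff β))
    (fun _ _ => inl_le_inr.trans (and_congr (inj β).eq_iff (root_iff γ)))
    (by rw [show β S.root = S'.root from β.map_root, inl_root])
    (fun _ h h' => isLeaf_inl.2 ⟨β.map_leaf _ h, (inj β).ne h'⟩)
    (fun _ h => isLeaf_inr.2 (γ.map_leaf _ h))
    (by
      intro x hx
      rcases graft_cases x with ⟨s, rfl⟩ | ⟨r, -, rfl⟩
      · obtain ⟨t, -, ht⟩ := β.leaf_surj s (isLeaf_inl.1 hx).1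
        exact Or.inl ⟨t, congrArg (inl R' (leafMap β a)) ht⟩
      · obtain ⟨t, -, ht⟩ := γ.leaf_surj r (isLeaf_inr.1 hx)
        exact Or.inr ⟨t, congrArg (inr (leafMap β a)) ht⟩)

/-- A leaf `b ≠ a` of `S`, regarded as a leaf of `S ∘_a R`. -/
def inlLeaf (R : RTree) (a b : S.Leaf) (h : b ≠ a) : (graft S R a).Leaf :=
  ⟨inl R a b.1, isLeaf_inl.2 ⟨b.2, fun heq => h (Subtype.ext heq)⟩⟩

/-- A leaf of `R`, regarded as a leaf of `S ∘_a R`. -/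
def inrLeaf (a : S.Leaf) (b : R.Leaf) : (graft S R a).Leaf := ⟨inr a b.1, isLeaf_inr.2 b.2⟩

theorem inlLeaf_val (a b : S.Leaf) (h : b ≠ a) : (inlLeaf R a b h).1 = inl R a b.1 := rfl
theorem inrLeaf_val (a : S.Leaf) (b : R.Leaf) : (inrLeaf a b).1 = inr a b.1 := rfl

/-- Auxiliary function for `seqHom`. -/
def seqFun (Q : RTree) (a : S.Leaf) (b : R.Leaf) :
    (graft S R a).Edge → (graft S (graft R Q b) a).Edge :=
  graftElim (inl (graft R Q b) a) (fun r => inr a (inl Q b r))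

theorem seqFun_inl (a : S.Leaf) (b : R.Leaf) (s : S.Edge) :
    seqFun Q a b (inl R a s) = inl (graft R Q b) a s := graftElim_inl _ _ _

theorem seqFun_inr (a : S.Leaf) (b : R.Leaf) (r : R.Edge) :
    seqFun Q a b (inr a r) = inr a (inl Q b r) :=
  graftElim_inr _ _ (by rw [inl_root, inr_root]) _

/-- The canonical isomorphism `(S ∘_a R) ∘_b Q ⟶ S ∘_a (R ∘_b Q)` for a leaf `a` of `S` and a leaf
`b` of `R`; it is the identity on the edges of `S`, `R` and `Q`. -/
def seqHom (Q : RTree) (a : S.Leaf) (b : R.Leaf) :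
    graft (graft S R a) Q (inrLeaf a b) ⟶ graft S (graft R Q b) a :=
  graftDesc (seqFun Q a b) (fun q => inr a (inr b q))
    (by
      intro x y
      rcases graft_cases x with ⟨x, rfl⟩ | ⟨x, -, rfl⟩ <;>
        rcases graft_cases y with ⟨y, rfl⟩ | ⟨y, -, rfl⟩ <;>
        simp only [seqFun_inl, seqFun_inr, inl_le_inl, inl_le_inr, inr_le_inl,
          inr_le_inr, ← inl_root, inl_injective.eq_iff])
    (fun _ _ => inr_le_inr.trans inr_le_inr)
    (by
      intro q x
      rcases graft_cases x with ⟨x, rfl⟩ | ⟨x, -, rfl⟩ <;>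
        simp only [seqFun_inl, seqFun_inr, inl_le_inl, inr_le_inl, inr_le_inr, inrLeaf_val])
    (by
      intro x q
      rcases graft_cases x with ⟨x, rfl⟩ | ⟨x, hx, rfl⟩
      · simp only [seqFun_inl, inl_le_inr, inrLeaf_val]
        refine iff_of_false (fun h1 => ?_) (fun h1 => ?_)
        · have h2 := (inl_le_inr.1 ((inl_root b).trans h1.2.symm).le).1
          exact R.root_not_isLeaf (h2 ▸ b.2)
        · have h2 := (inl_le_inr.1 h1.1.le).2
          exact R.root_not_isLeaf (h2 ▸ b.2)
      · simp only [seqFun_inr, inr_le_inr, inl_le_inr, inrLeaf_val, inr_injective.eq_iff])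
    (by rw [← inl_root, seqFun_inl, inl_root])
    (by
      intro x hx hne
      rcases graft_cases x with ⟨x, rfl⟩ | ⟨x, -, rfl⟩
      · rw [seqFun_inl]
        exact isLeaf_inl.2 (isLeaf_inl.1 hx)
      · rw [seqFun_inr]
        refine isLeaf_inr.2 (isLeaf_inl.2 ⟨isLeaf_inr.1 hx, ?_⟩)
        rintro rfl
        exact hne rfl)
    (fun _ h => isLeaf_inr.2 (isLeaf_inr.2 h))
    (by
      intro x hx
      rcases graft_cases x with ⟨x, rfl⟩ | ⟨x, -, rfl⟩
      · exact Or.inl ⟨inl R a x, seqFun_inl _ _ _⟩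
      · rcases graft_cases x with ⟨x, rfl⟩ | ⟨x, -, rfl⟩
        · exact Or.inl ⟨inr a x, seqFun_inr _ _ _⟩
        · exact Or.inr ⟨x, rfl⟩)

/-- Auxiliary function for `parHom`. -/
def parFun (R Q : RTree) (a b : S.Leaf) (h : b ≠ a) :
    (graft S R a).Edge → (graft (graft S Q b) R (inlLeaf Q b a h.symm)).Edge :=
  graftElim (fun s => inl R (inlLeaf Q b a h.symm) (inl Q b s)) (inr (inlLeaf Q b a h.symm))

theorem parFun_inl (a b : S.Leaf) (h : b ≠ a) (s : S.Edge) :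
    parFun R Q a b h (inl R a s) = inl R (inlLeaf Q b a h.symm) (inl Q b s) :=
  graftElim_inl _ _ _

theorem parFun_inr (a b : S.Leaf) (h : b ≠ a) (r : R.Edge) :
    parFun R Q a b h (inr a r) = inr (inlLeaf Q b a h.symm) r :=
  graftElim_inr (fun s => inl R (inlLeaf Q b a h.symm) (inl Q b s))
    (inr (R := R) (inlLeaf Q b a h.symm)) (inr_root (R := R) (inlLeaf Q b a h.symm)).symm r

/-- The canonical isomorphism `(S ∘_a R) ∘_b Q ⟶ (S ∘_b Q) ∘_a R` for two distinct leaves `a`, `b`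
of `S`; it is the identity on the edges of `S`, `R` and `Q`. -/
def parHom (R Q : RTree) (a b : S.Leaf) (h : b ≠ a) :
    graft (graft S R a) Q (inlLeaf R a b h) ⟶ graft (graft S Q b) R (inlLeaf Q b a h.symm) :=
  graftDesc (parFun R Q a b h) (fun q => inl R (inlLeaf Q b a h.symm) (inr b q))
    (by
      intro x y
      rcases graft_cases x with ⟨x, rfl⟩ | ⟨x, -, rfl⟩ <;>
        rcases graft_cases y with ⟨y, rfl⟩ | ⟨y, -, rfl⟩ <;>
        simp only [parFun_inl, parFun_inr, inl_le_inl, inl_le_inr, inr_le_inl,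
          inr_le_inr, inlLeaf_val, inl_injective.eq_iff])
    (fun _ _ => inl_le_inl.trans inr_le_inr)
    (by
      intro q x
      rcases graft_cases x with ⟨x, rfl⟩ | ⟨x, -, rfl⟩
      · simp only [parFun_inl, inl_le_inl, inr_le_inl, inlLeaf_val]
      · simp only [parFun_inr, inl_le_inr, inlLeaf_val]
        refine iff_of_false (fun h1 => ?_) (fun h1 => ?_)
        · exact h (Subtype.ext (inl_le_inr.1 h1.1.ge).1.symm)
        · exact h (Subtype.ext h1.1))
    (by
      intro x q
      rcases graft_cases x with ⟨x, rfl⟩ | ⟨x, hx, rfl⟩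
      · simp only [parFun_inl, inl_le_inl, inl_le_inr, inlLeaf_val, inl_injective.eq_iff]
      · simp only [parFun_inr, inr_le_inl, inlLeaf_val]
        refine iff_of_false (fun h1 => ?_) (fun h1 => ?_)
        · exact h (Subtype.ext (inl_le_inr.1 h1).1.symm)
        · exact hx (inl_le_inr.1 h1.1.ge).2)
    (by rw [← inl_root, parFun_inl, inl_root, inl_root])
    (by
      intro x hx hne
      rcases graft_cases x with ⟨x, rfl⟩ | ⟨x, -, rfl⟩
      · rw [parFun_inl]
        have h1 := isLeaf_inl.1 hx
        refine isLeaf_inl.2 ⟨isLeaf_inl.2 ⟨h1.1, ?_⟩, inl_injective.ne h1.2⟩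
        rintro rfl
        exact hne rfl
      · rw [parFun_inr]
        exact isLeaf_inr.2 (isLeaf_inr.1 hx))
    (by
      intro q hq
      refine isLeaf_inl.2 ⟨isLeaf_inr.2 hq, fun h1 => ?_⟩
      have h2 := inl_le_inr.1 h1.ge
      exact h (Subtype.ext h2.1.symm))
    (by
      intro x hx
      rcases graft_cases x with ⟨x, rfl⟩ | ⟨x, -, rfl⟩
      · rcases graft_cases x with ⟨x, rfl⟩ | ⟨x, -, rfl⟩
        · exact Or.inl ⟨inl R a x, parFun_inl _ _ _ _⟩
        · exact Or.inr ⟨x, rfl⟩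
      · exact Or.inl ⟨inr a x, parFun_inr _ _ _ _⟩)

end

end RTree

/-- The sign convention `d (x ⊗ y) = d x ⊗ y + (-1)^|x| x ⊗ d y` for tensor products of chain
complexes, see `Ch.ι_d`. -/
instance tensorSignsDownInt : (ComplexShape.down ℤ).TensorSigns where
  ε' := MonoidHom.mk' Int.negOnePow Int.negOnePow_add
  rel_add p q r (hpq : q + 1 = p) := show q + r + 1 = p + r by lia
  add_rel p q r (hpq : q + 1 = p) := show r + q + 1 = r + p by lia
  ε'_succ p q (hpq : q + 1 = p) := by
    subst hpq
    change Int.negOnePow q = - Int.negOnePow (q + 1)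
    rw [Int.negOnePow_succ, neg_neg]

/-- Chain complexes of `R`-modules, graded by the integers, with differential of degree `-1`. The
tensor product is Mathlib's monoidal structure on homological complexes. -/
abbrev Ch (R : Type u) [CommRing R] : Type (u + 1) := ChainComplex (ModuleCat.{u} R) ℤ

noncomputable section
namespace Ch
variable {R : Type u} [CommRing R]

/-- The inclusion of a summand `K_i ⊗ L_j` into `(K ⊗ L)_n`. -/
abbrev ι (K L : Ch R) (i j n : ℤ) (h : i + j = n) : K.X i ⊗ L.X j ⟶ (K ⊗ L).X n :=
  HomologicalComplex.ιTensorObj K L i j n h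

/-- A map out of `(K ⊗ L)_n`, given on the summands. -/
abbrev desc {K L : Ch R} {n : ℤ} {V : ModuleCat.{u} R}
    (f : ∀ i j : ℤ, i + j = n → (K.X i ⊗ L.X j ⟶ V)) : (K ⊗ L).X n ⟶ V :=
  HomologicalComplex.mapBifunctorDesc f

theorem ι_desc {K L : Ch R} {n : ℤ} {V : ModuleCat.{u} R}
    (f : ∀ i j : ℤ, i + j = n → (K.X i ⊗ L.X j ⟶ V)) (i j : ℤ) (h : i + j = n) :
    ι K L i j n h ≫ desc f = f i j h :=
  HomologicalComplex.ι_mapBifunctorDesc _ _ _ _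

theorem tensor_hom_ext {K L : Ch R} {n : ℤ} {V : ModuleCat.{u} R} {f g : (K ⊗ L).X n ⟶ V}
    (h : ∀ (i j : ℤ) (h : i + j = n), ι K L i j n h ≫ f = ι K L i j n h ≫ g) : f = g :=
  HomologicalComplex.mapBifunctor.hom_ext h

theorem ι_d (K L : Ch R) (i j i' j' n m : ℤ) (h : i + j = n) (hi : i' + 1 = i) (hj : j' + 1 = j)
    (hm : m + 1 = n) :
    ι K L i j n h ≫ (K ⊗ L).d n m =
      (K.d i i' ▷ L.X j) ≫ ι K L i' j m (by lia) +
        i.negOnePow • ((K.X i ◁ L.d j j') ≫ ι K L i j' m (by lia)) := by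
  erw [HomologicalComplex.mapBifunctor.d_eq]
  rw [Preadditive.comp_add]
  erw [HomologicalComplex.mapBifunctor.ι_D₁, HomologicalComplex.mapBifunctor.ι_D₂]
  refine congrArg₂ (· + ·) ?_ ?_
  · refine (HomologicalComplex.mapBifunctor.d₁_eq K L _ _ (i₁' := i') hi j m
      (show i' + j = m by lia)).trans ?_
    exact one_smul ℤˣ _
  · exact HomologicalComplex.mapBifunctor.d₂_eq K L _ _ i (i₂' := j') hj m
      (show i + j' = m by lia)

/-- The symmetry `x ⊗ y ↦ (-1)^{|x||y|} y ⊗ x`. -/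
def swap (K L : Ch R) : K ⊗ L ⟶ L ⊗ K where
  f n := desc (fun i j h =>
    (i * j).negOnePow • ((β_ (K.X i) (L.X j)).hom ≫ ι L K j i n (by rw [← h]; exact add_comm j i)))
  comm' := by
    intro n m (hnm : m + 1 = n)
    apply tensor_hom_ext
    intro i j h
    rw [← Category.assoc, ι_desc, ← Category.assoc,
      ι_d K L i j (i - 1) (j - 1) n m h (by lia) (by lia) hnm, Preadditive.add_comp,
      Linear.units_smul_comp, Linear.units_smul_comp, Category.assoc, Category.assoc,
      Category.assoc, ι_d L K j i (j - 1) (i - 1) n m (by lia) (by lia) (by lia) hnm,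
      ι_desc, ι_desc, Preadditive.comp_add, Linear.comp_units_smul, Linear.comp_units_smul, Linear.comp_units_smul,
      smul_add, add_comm, smul_smul, smul_smul, ← Int.negOnePow_add, ← Int.negOnePow_add,
      BraidedCategory.braiding_naturality_left_assoc,
      BraidedCategory.braiding_naturality_right_assoc]
    congr 2
    · rw [sub_mul, one_mul, Int.negOnePow_add, Int.negOnePow_sub]
    · rw [mul_sub, mul_one, add_sub_cancel]

/-- The suspension: `(sK)_n = K_{n-1}`, with differential `d (s x) = - s (d x)`. -/
def susp : Ch R ⥤ Ch R where
  obj K :=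
    { X := fun n => K.X (n - 1)
      d := fun i j => - K.d (i - 1) (j - 1)
      shape := fun i j h => by
        rw [K.shape _ _ (fun h' : j - 1 + 1 = i - 1 => h (show j + 1 = i by lia)), neg_zero]
      d_comp_d' := by simp }
  map f :=
    { f := fun n => f.f (n - 1)
      comm' := by simp }

/-- The map `x ↦ s x` of degree one. -/
def suspMap (K : Ch R) (k n : ℤ) (h : k + 1 = n) : K.X k ⟶ (susp.obj K).X n :=
  (K.XIsoOfEq (show k = n - 1 by lia)).hom

end Ch
end

noncomputable section
namespace Bar
open Opposite RTree
open scoped Classical DirectSum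

variable {S S' T T' U : RTree}

section lists
variable {X Y Z : Type}

/-- The list `l` enumerates the set `s`, without repetitions. -/
def IsEnum (l : List X) (s : Set X) : Prop := l.Nodup ∧ ∀ x, x ∈ l ↔ x ∈ s

/-- The list `β⁻¹ l` of the preimages of those entries of `l` which lie in the image of the injective
map `β`, in the same order. -/
def pull (β : X → Y) (l : List Y) : List X := l.filterMap (Function.partialInv β)

/-- The number of inversions of the permutation which moves the entries satisfying `P` to the front
(and keeps the order among these and among the others): the number of pairs consisting of an entry
that does not satisfy `P` and a later one that does. -/
def inversions (P : X → Prop) : List X → ℕ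
  | [] => 0
  | x :: l => (if P x then 0 else l.countP (fun y => decide (P y))) + inversions P l

theorem partialInv_none {β : X → Y} {y : Y} (h : y ∉ Set.range β) :
    Function.partialInv β y = none := dif_neg h

theorem pull_cons_range {β : X → Y} (hβ : Function.Injective β) (x : X) (l : List Y) :
    pull β (β x :: l) = x :: pull β l := by
  simp [pull, Function.partialInv_left hβ]

theorem pull_cons_not {β : X → Y} {y : Y} (h : y ∉ Set.range β) (l : List Y) :
    pull β (y :: l) = pull β l := by
  simp [pull, partialInv_none h]

theorem pull_append (β : X → Y) (l l' : List Y) : pull β (l ++ l') = pull β l ++ pull β l' :=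
  List.filterMap_append

theorem map_pull {β : X → Y} (hβ : Function.Injective β) (l : List Y) :
    (pull β l).map β = l.filter (fun y => decide (y ∈ Set.range β)) := by
  induction l with
  | nil => rfl
  | cons y l ih =>
    by_cases h : y ∈ Set.range β
    · obtain ⟨x, rfl⟩ := h
      rw [pull_cons_range hβ, List.map_cons, ih, List.filter_cons_of_pos (by simp)]
    · rw [pull_cons_not h, ih, List.filter_cons_of_neg (by simpa using h)]

theorem mem_pull {β : X → Y} (hβ : Function.Injective β) {l : List Y} {x : X} :
    x ∈ pull β l ↔ β x ∈ l := by
  rw [← List.mem_map_of_injective hβ, map_pull hβ]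
  simp

theorem nodup_pull {β : X → Y} (hβ : Function.Injective β) {l : List Y} (h : l.Nodup) :
    (pull β l).Nodup :=
  List.Nodup.of_map β (by rw [map_pull hβ]; exact h.filter _)

theorem pull_comp {β : X → Y} {γ : Y → Z} (hβ : Function.Injective β) (hγ : Function.Injective γ)
    (l : List Z) : pull β (pull γ l) = pull (γ ∘ β) l := by
  induction l with
  | nil => rfl
  | cons z l ih =>
    by_cases h : z ∈ Set.range γ
    · obtain ⟨y, rfl⟩ := h
      rw [pull_cons_range hγ]
      by_cases h : y ∈ Set.range β
      · obtain ⟨x, rfl⟩ := h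
        rw [pull_cons_range hβ, ih]
        exact (pull_cons_range (hγ.comp hβ) x l).symm
      · rw [pull_cons_not h, ih, pull_cons_not (β := γ ∘ β)]
        rintro ⟨x, hx⟩
        exact h ⟨x, hγ hx⟩
    · rw [pull_cons_not h, ih, pull_cons_not (β := γ ∘ β)]
      rintro ⟨x, rfl⟩
      exact h ⟨_, rfl⟩

theorem length_pull_add {β : X → Y} (hβ : Function.Injective β) (l : List Y) :
    (pull β l).length + (l.filter (fun y => decide (y ∉ Set.range β))).length = l.length := by
  rw [← List.length_map (f := β), map_pull hβ]
  induction l with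
  | nil => rfl
  | cons y l ih => by_cases h : y ∈ Set.range β <;> simp_all <;> omega

theorem IsEnum.length_pull {β : X → Y} (hβ : Function.Injective β) {y : Y}
    (h : Set.range β = {y}ᶜ) {l : List Y} (hl : l.Nodup) (hy : y ∈ l) :
    (pull β l).length + 1 = l.length := by
  have : (pull β l).map β = l.erase y := by
    rw [hl.erase_eq_filter, map_pull hβ]
    congr 1
    funext z
    simp [h, bne, beq_eq_decide]
  rw [← List.length_map (f := β), this, List.length_erase_of_mem hy]
  have := List.length_pos_of_mem hy
  omega

theorem inversions_map {f : X → Y} (P : Y → Prop) (l : List X) :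
    inversions P (l.map f) = inversions (fun x => P (f x)) l := by
  induction l with
  | nil => rfl
  | cons x l ih => simp [inversions, ih, List.countP_map, Function.comp_def]

end lists

/-- The data `(α, d | e, x)` with `x` of degree `n` is admissible in total degree `m`: `d` enumerates
the inner edges of `S`, `e` enumerates the edges of `T` not in the image of `α` (these are inner
edges of `T`), and `m = q + p + n` where `q` and `p` are the lengths of `d` and `e`. -/
def Valid (α : S ⟶ T) (d : List S.Edge) (e : List T.Edge) (n m : ℤ) : Prop :=
  IsEnum d {x | S.IsInner x} ∧ IsEnum e (Set.range α)ᶜ ∧ (d.length : ℤ) + e.length + n = m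

/-- The index set of the direct sum in total degree `m`. -/
structure Index (S : RTree) (m : ℤ) : Type where
  T : RTree
  α : S ⟶ T
  d : List S.Edge
  e : List T.Edge
  n : ℤ
  valid : Valid α d e n m

universe v
variable {R : Type v} [CommRing R] (N : RTreeᵒᵖ ⥤ Ch R)

/-- The direct sum of the modules `N(T)_n` over all `(α : S ⟶ T, d, e, n)` of total degree `m`. -/
abbrev Pre (S : RTree) (m : ℤ) : Type v := ⨁ g : Index S m, ((N.obj (op g.T)).X g.n : Type v)

/-- The element `(α, d | e, x)` of the direct sum (zero if the data are not admissible). -/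
def pre (m : ℤ) {n : ℤ} (α : S ⟶ T) (d : List S.Edge) (e : List T.Edge) :
    ((N.obj (op T)).X n : Type v) →ₗ[R] Pre N S m :=
  if h : Valid α d e n m then
    DirectSum.lof R (Index S m) (fun g => ((N.obj (op g.T)).X g.n : Type v)) ⟨T, α, d, e, n, h⟩
  else 0

/-- The relations which define the coinvariants:
`(α, d | e, θ^* x) = (θ α, d | θ e, x)` for isomorphisms `θ : T ≅ T'`, and a transposition of two
adjacent entries of `d`, or of `e`, changes the sign (so that a permutation of `d` or of `e` acts by
its signature). -/
inductive Rel (S : RTree) (m : ℤ) : Pre N S m → Prop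
  | iso {T T' : RTree} {n : ℤ} (α : S ⟶ T) (d : List S.Edge) (e : List T.Edge) (θ : T ≅ T')
      (x : ((N.obj (op T')).X n : Type v)) :
      Rel S m (pre N m α d e (((N.map θ.hom.op).f n).hom x) -
        pre N m (α ≫ θ.hom) d (e.map θ.hom) x)
  | swap_left {T : RTree} {n : ℤ} (α : S ⟶ T) (d₁ d₂ : List S.Edge) (a b : S.Edge)
      (e : List T.Edge) (x : ((N.obj (op T)).X n : Type v)) :
      Rel S m (pre N m α (d₁ ++ a :: b :: d₂) e x + pre N m α (d₁ ++ b :: a :: d₂) e x)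
  | swap_right {T : RTree} {n : ℤ} (α : S ⟶ T) (d : List S.Edge) (e₁ e₂ : List T.Edge)
      (a b : T.Edge) (x : ((N.obj (op T)).X n : Type v)) :
      Rel S m (pre N m α d (e₁ ++ a :: b :: e₂) x + pre N m α d (e₁ ++ b :: a :: e₂) x)

/-- The coinvariants in total degree `m = q + p + n`. -/
abbrev Mod (S : RTree) (m : ℤ) : Type v := Pre N S m ⧸ Submodule.span R {z | Rel N S m z}

/-- The class of `(α, d | e, x)`, as a function of `x`. -/
def gen (m : ℤ) {n : ℤ} (α : S ⟶ T) (d : List S.Edge) (e : List T.Edge) :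
    ((N.obj (op T)).X n : Type v) →ₗ[R] Mod N S m :=
  (Submodule.mkQ _) ∘ₗ pre N m α d e

variable {N}

theorem gen_of_not {m n : ℤ} {α : S ⟶ T} {d : List S.Edge} {e : List T.Edge}
    (h : ¬ Valid α d e n m) (x : ((N.obj (op T)).X n : Type v)) : gen N m α d e x = 0 := by
  simp [gen, pre, h]

theorem gen_iso {m n : ℤ} (α : S ⟶ T) (d : List S.Edge) (e : List T.Edge) (θ : T ≅ T')
    (x : ((N.obj (op T')).X n : Type v)) :
    gen N m α d e (((N.map θ.hom.op).f n).hom x) = gen N m (α ≫ θ.hom) d (e.map θ.hom) x :=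
  (Submodule.Quotient.eq _).2 (Submodule.subset_span (Rel.iso α d e θ x))

theorem gen_swap_left {m n : ℤ} (α : S ⟶ T) (d₁ d₂ : List S.Edge) (a b : S.Edge)
    (e : List T.Edge) (x : ((N.obj (op T)).X n : Type v)) :
    gen N m α (d₁ ++ a :: b :: d₂) e x = - gen N m α (d₁ ++ b :: a :: d₂) e x :=
  eq_neg_of_add_eq_zero_left
    ((Submodule.Quotient.mk_eq_zero _).2 (Submodule.subset_span (Rel.swap_left α d₁ d₂ a b e x)))

theorem gen_swap_right {m n : ℤ} (α : S ⟶ T) (d : List S.Edge) (e₁ e₂ : List T.Edge)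
    (a b : T.Edge) (x : ((N.obj (op T)).X n : Type v)) :
    gen N m α d (e₁ ++ a :: b :: e₂) x = - gen N m α d (e₁ ++ b :: a :: e₂) x :=
  eq_neg_of_add_eq_zero_left
    ((Submodule.Quotient.mk_eq_zero _).2 (Submodule.subset_span (Rel.swap_right α d e₁ e₂ a b x)))

theorem isEnum_swap {X : Type} {l₁ l₂ : List X} {a b : X} {s : Set X} :
    IsEnum (l₁ ++ a :: b :: l₂) s ↔ IsEnum (l₁ ++ b :: a :: l₂) s := by
  have h : (l₁ ++ a :: b :: l₂).Perm (l₁ ++ b :: a :: l₂) := (List.Perm.swap _ _ _).append_left _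
  simp only [IsEnum, h.nodup_iff, h.mem_iff]

theorem valid_swap_left {m n : ℤ} {α : S ⟶ T} {d₁ d₂ : List S.Edge} {a b : S.Edge}
    {e : List T.Edge} :
    Valid α (d₁ ++ a :: b :: d₂) e n m ↔ Valid α (d₁ ++ b :: a :: d₂) e n m := by
  rw [Valid, Valid, isEnum_swap]
  simp

theorem valid_swap_right {m n : ℤ} {α : S ⟶ T} {d : List S.Edge} {e₁ e₂ : List T.Edge}
    {a b : T.Edge} :
    Valid α d (e₁ ++ a :: b :: e₂) n m ↔ Valid α d (e₁ ++ b :: a :: e₂) n m := by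
  rw [Valid, Valid, isEnum_swap]
  simp

theorem isEnum_map {X Y : Type} {f : X → Y} (hf : Function.Bijective f) {l : List X} {s : Set X}
    {t : Set Y} (hst : ∀ x, x ∈ s ↔ f x ∈ t) : IsEnum (l.map f) t ↔ IsEnum l s := by
  rw [IsEnum, IsEnum, List.nodup_map_iff hf.1]
  refine and_congr_right' ⟨fun h x => ?_, fun h y => ?_⟩
  · rw [hst, ← h, List.mem_map_of_injective hf.1] 
  · obtain ⟨x, rfl⟩ := hf.2 y
    rw [List.mem_map_of_injective hf.1, h, hst]

theorem iso_bijective (θ : T ≅ T') : Function.Bijective (θ.hom : T.Edge → T'.Edge) :=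
  ⟨inj θ.hom, fun y => ⟨θ.inv y, range_iso θ y⟩⟩

theorem valid_iso {m n : ℤ} {α : S ⟶ T} {d : List S.Edge} {e : List T.Edge} (θ : T ≅ T') :
    Valid (α ≫ θ.hom) d (e.map θ.hom) n m ↔ Valid α d e n m := by
  rw [Valid, Valid, isEnum_map (iso_bijective θ) (s := (Set.range α)ᶜ) (fun x => ?_)]
  · simp
  · apply not_congr
    constructor
    · rintro ⟨s, rfl⟩
      exact ⟨s, rfl⟩
    · rintro ⟨s, hs⟩
      exact ⟨s, inj θ.hom hs⟩

/-- The universal property of the coinvariants. -/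
def lift {V : Type v} [AddCommGroup V] [Module R V] (m : ℤ)
    (φ : ∀ {T : RTree} {n : ℤ} (_ : S ⟶ T) (_ : List S.Edge) (_ : List T.Edge),
      ((N.obj (op T)).X n : Type v) →ₗ[R] V)
    (h_iso : ∀ {T T' : RTree} {n : ℤ} (α : S ⟶ T) (d : List S.Edge) (e : List T.Edge) (θ : T ≅ T')
      (x : ((N.obj (op T')).X n : Type v)), Valid α d e n m →
      φ α d e (((N.map θ.hom.op).f n).hom x) = φ (α ≫ θ.hom) d (e.map θ.hom) x)
    (h_left : ∀ {T : RTree} {n : ℤ} (α : S ⟶ T) (d₁ d₂ : List S.Edge) (a b : S.Edge)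
      (e : List T.Edge) (x : ((N.obj (op T)).X n : Type v)), Valid α (d₁ ++ a :: b :: d₂) e n m →
      φ α (d₁ ++ a :: b :: d₂) e x = - φ α (d₁ ++ b :: a :: d₂) e x)
    (h_right : ∀ {T : RTree} {n : ℤ} (α : S ⟶ T) (d : List S.Edge) (e₁ e₂ : List T.Edge)
      (a b : T.Edge) (x : ((N.obj (op T)).X n : Type v)), Valid α d (e₁ ++ a :: b :: e₂) n m →
      φ α d (e₁ ++ a :: b :: e₂) x = - φ α d (e₁ ++ b :: a :: e₂) x) :
    Mod N S m →ₗ[R] V :=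
  Submodule.liftQ _ (DirectSum.toModule R (Index S m) V fun g => φ g.α g.d g.e) (by
    rw [Submodule.span_le]
    rintro z (@⟨T, T', n, α, d, e, θ, x⟩ | @⟨T, n, α, d₁, d₂, a, b, e, x⟩ | @⟨T, n, α, d, e₁, e₂, a, b, x⟩)
    · rw [SetLike.mem_coe, LinearMap.mem_ker, map_sub, sub_eq_zero]
      by_cases h : Valid α d e n m
      · rw [pre, pre, dif_pos h, dif_pos ((valid_iso θ).2 h), DirectSum.toModule_lof,
          DirectSum.toModule_lof]
        exact h_iso α d e θ x h
      · rw [pre, pre, dif_neg h, dif_neg (fun h' => h ((valid_iso θ).1 h'))]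
        simp
    · rw [SetLike.mem_coe, LinearMap.mem_ker, map_add]
      by_cases h : Valid α (d₁ ++ a :: b :: d₂) e n m
      · rw [pre, pre, dif_pos h, dif_pos (valid_swap_left.1 h), DirectSum.toModule_lof,
          DirectSum.toModule_lof, h_left α d₁ d₂ a b e x h, neg_add_cancel]
      · rw [pre, pre, dif_neg h, dif_neg (fun h' => h (valid_swap_left.1 h'))]
        simp
    · rw [SetLike.mem_coe, LinearMap.mem_ker, map_add]
      by_cases h : Valid α d (e₁ ++ a :: b :: e₂) n m
      · rw [pre, pre, dif_pos h, dif_pos (valid_swap_right.1 h), DirectSum.toModule_lof,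
          DirectSum.toModule_lof, h_right α d e₁ e₂ a b x h, neg_add_cancel]
      · rw [pre, pre, dif_neg h, dif_neg (fun h' => h (valid_swap_right.1 h'))]
        simp)

theorem lift_gen {V : Type v} [AddCommGroup V] [Module R V] {m n : ℤ}
    (φ : ∀ {T : RTree} {n : ℤ} (_ : S ⟶ T) (_ : List S.Edge) (_ : List T.Edge),
      ((N.obj (op T)).X n : Type v) →ₗ[R] V) (h_iso) (h_left) (h_right)
    {α : S ⟶ T} {d : List S.Edge} {e : List T.Edge} (h : Valid α d e n m)
    (x : ((N.obj (op T)).X n : Type v)) :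
    lift (N := N) (V := V) m φ h_iso h_left h_right (gen N m α d e x) = φ α d e x := by
  rw [gen, lift, LinearMap.comp_apply, Submodule.mkQ_apply, Submodule.liftQ_apply, pre, dif_pos h,
    DirectSum.toModule_lof]

theorem mod_hom_ext {V : Type v} [AddCommGroup V] [Module R V] {m : ℤ} {f g : Mod N S m →ₗ[R] V}
    (h : ∀ {T : RTree} {n : ℤ} (α : S ⟶ T) (d : List S.Edge) (e : List T.Edge), Valid α d e n m →
      ∀ x : ((N.obj (op T)).X n : Type v), f (gen N m α d e x) = g (gen N m α d e x)) : f = g := by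
  apply Submodule.linearMap_qext
  apply DirectSum.linearMap_ext
  rintro ⟨T, α, d, e, n, hv⟩
  ext x
  have := h α d e hv x
  simp only [gen, pre, dif_pos hv] at this
  exact this

end Bar
end

noncomputable section
namespace Bar
open Opposite RTree
open scoped Classical DirectSum

variable {S S' S'' T T' U U' : RTree}
universe v
variable {R : Type v} [CommRing R] {N : RTreeᵒᵖ ⥤ Ch R}

theorem gen_move_left {m n : ℤ} (α : S ⟶ T) (a : S.Edge) (l d₁ d₂ : List S.Edge)
    (e : List T.Edge) (x : ((N.obj (op T)).X n : Type v)) :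
    gen N m α (d₁ ++ a :: l ++ d₂) e x =
      (-1 : R) ^ l.length • gen N m α (d₁ ++ l ++ a :: d₂) e x := by
  induction l generalizing d₁ with
  | nil => simp
  | cons b l ih =>
    have h1 := gen_swap_left (m := m) α d₁ (l ++ d₂) a b e x
    have h2 := ih (d₁ ++ [b])
    simp only [List.append_assoc, List.cons_append, List.nil_append] at h1 h2 ⊢
    rw [h1, h2, List.length_cons, pow_succ, mul_smul, neg_smul, one_smul, smul_neg]

theorem gen_unshuffle_left {m n : ℤ} (α : S ⟶ T) (P : S.Edge → Prop) (l d : List S.Edge)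
    (e : List T.Edge) (x : ((N.obj (op T)).X n : Type v)) :
    gen N m α (d ++ l) e x = (-1 : R) ^ inversions P l •
      gen N m α (d ++ l.filter (fun y => decide (P y)) ++ l.filter (fun y => decide (¬ P y))) e x := by
  induction l generalizing d with
  | nil => simp [inversions]
  | cons a l ih =>
    have h2 := ih (d ++ [a])
    by_cases h : P a
    · rw [List.filter_cons_of_pos (by simpa using h), List.filter_cons_of_neg (by simpa using h)]
      simp only [List.append_assoc, List.cons_append, List.nil_append] at h2 ⊢
      simpa [inversions, h] using h2
    · rw [List.filter_cons_of_neg (by simpa using h), List.filter_cons_of_pos (by simpa using h)]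
      have h3 := gen_move_left (m := m) α a (l.filter (fun y => decide (P y))) d
        (l.filter (fun y => decide (¬ P y))) e x
      simp only [List.append_assoc, List.cons_append, List.nil_append] at h2 h3 ⊢
      rw [h2, h3, smul_smul, ← pow_add, inversions, if_neg h, List.countP_eq_length_filter, add_comm]

theorem gen_face_eq {m n : ℤ} (αU : S ⟶ U) (αU' : S ⟶ U') (β : U ⟶ T) (β' : U' ⟶ T)
    (d : List S.Edge) (e : List U.Edge) (e' : List U'.Edge)
    (hr : Set.range β = Set.range β') (hα : αU ≫ β = αU' ≫ β') (he : e.map β = e'.map β')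
    (x : ((N.obj (op T)).X n : Type v)) :
    gen N m αU d e (((N.map β.op).f n).hom x) = gen N m αU' d e' (((N.map β'.op).f n).hom x) := by
  obtain ⟨k, hk⟩ := exists_iso β β' hr
  have h1 : αU' = αU ≫ k.hom := mono_ext β' (by rw [← hα, Category.assoc, hk])
  have h2 : e' = e.map k.hom := by
    apply (inj β').list_map
    rw [← he, ← hk, List.map_map]
    rfl
  have h3 : ((N.map β.op).f n).hom x =
      ((N.map k.hom.op).f n).hom (((N.map β'.op).f n).hom x) := by
    rw [← hk, op_comp, N.map_comp]
    rfl
  rw [h1, h2, h3, gen_iso]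

theorem range_iso_comp (α : S ⟶ T) (θ : T ≅ T') (y : T.Edge) :
    θ.hom y ∈ Set.range (α ≫ θ.hom) ↔ y ∈ Set.range α := by
  constructor
  · rintro ⟨s, hs⟩
    exact ⟨s, inj θ.hom hs⟩
  · rintro ⟨s, rfl⟩
    exact ⟨s, rfl⟩

/-- The tree `∂_y T`, for an edge `y` of `T` not in the image of `α : S ⟶ T`. -/
abbrev face (α : S ⟶ T) (y : T.Edge) (h : y ∉ Set.range α) : RTree :=
  T.contract y (inner_of_not_mem_range α h)

/-- The inner face map `∂_y : ∂_y T ⟶ T`. -/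
abbrev faceHom (α : S ⟶ T) (y : T.Edge) (h : y ∉ Set.range α) : face α y h ⟶ T :=
  T.contractHom y (inner_of_not_mem_range α h)

theorem range_faceHom (α : S ⟶ T) (y : T.Edge) (h : y ∉ Set.range α) :
    Set.range (faceHom α y h) = {y}ᶜ := range_contractHom _ _ _

theorem exists_faceFactor (α : S ⟶ T) (y : T.Edge) (h : y ∉ Set.range α) :
    ∃ k : S ⟶ face α y h, k ≫ faceHom α y h = α :=
  exists_factor _ _ (by
    rw [range_faceHom]
    intro z hz hzy
    exact h (hzy ▸ hz))

/-- The unique morphism `∂_y^* α` with `∂_y ∘ ∂_y^* α = α`. -/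
def faceFactor (α : S ⟶ T) (y : T.Edge) (h : y ∉ Set.range α) : S ⟶ face α y h :=
  (exists_faceFactor α y h).choose

theorem faceFactor_comp (α : S ⟶ T) (y : T.Edge) (h : y ∉ Set.range α) :
    faceFactor α y h ≫ faceHom α y h = α := (exists_faceFactor α y h).choose_spec

theorem faceFactor_range (α : S ⟶ T) (y : T.Edge) (h : y ∉ Set.range α) (z : (face α y h).Edge) :
    z ∈ Set.range (faceFactor α y h) ↔ faceHom α y h z ∈ Set.range α := by
  have key : ∀ s, faceHom α y h (faceFactor α y h s) = α s := fun s =>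
    congrArg (fun f : S ⟶ T => f s) (faceFactor_comp α y h)
  constructor
  · rintro ⟨s, rfl⟩
    exact ⟨s, (key s).symm⟩
  · rintro ⟨s, hs⟩
    exact ⟨s, inj (faceHom α y h) ((key s).trans hs)⟩

variable (N) in
/-- The term `(∂_y^* α, d | e without y, ∂_y^* x)` of the external differential. -/
def faceTerm (m : ℤ) {n : ℤ} (α : S ⟶ T) (d : List S.Edge) (e : List T.Edge) (y : T.Edge)
    (h : y ∉ Set.range α) : ((N.obj (op T)).X n : Type v) →ₗ[R] Mod N S m :=
  gen N m (faceFactor α y h) d (pull (faceHom α y h) e) ∘ₗ ((N.map (faceHom α y h).op).f n).hom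

variable (N) in
/-- The external differential `∑ (-1)^(q + i) (∂_{e_i}^* α, d | e without e_i, ∂_{e_i}^* x)`. -/
def dExt (m : ℤ) {n : ℤ} (α : S ⟶ T) (d : List S.Edge) (e : List T.Edge) :
    ((N.obj (op T)).X n : Type v) →ₗ[R] Mod N S m :=
  ∑ y : {y : T.Edge // y ∉ Set.range α},
    (-1 : R) ^ (d.length + e.idxOf y.1) • faceTerm N m α d e y.1 y.2

variable (N) in
/-- The internal differential `(-1)^(q + p) (α, d | e, ∂ x)`. -/
def dInt (m : ℤ) {n : ℤ} (α : S ⟶ T) (d : List S.Edge) (e : List T.Edge) :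
    ((N.obj (op T)).X n : Type v) →ₗ[R] Mod N S m :=
  (-1 : R) ^ (d.length + e.length) • gen N m α d e ∘ₗ ((N.obj (op T)).d n (n - 1)).hom

theorem faceTerm_iso {m n : ℤ} (α : S ⟶ T) (d : List S.Edge) (e : List T.Edge) (θ : T ≅ T')
    (y : T.Edge) (h : y ∉ Set.range α) (h' : θ.hom y ∉ Set.range (α ≫ θ.hom))
    (x : ((N.obj (op T')).X n : Type v)) :
    faceTerm N m α d e y h (((N.map θ.hom.op).f n).hom x) =
      faceTerm N m (α ≫ θ.hom) d (e.map θ.hom) (θ.hom y) h' x := by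
  have h3 : ((N.map (faceHom α y h).op).f n).hom (((N.map θ.hom.op).f n).hom x) =
      ((N.map (faceHom α y h ≫ θ.hom).op).f n).hom x := by
    rw [op_comp, N.map_comp]
    rfl
  rw [faceTerm, faceTerm, LinearMap.comp_apply, LinearMap.comp_apply, h3]
  have hr : Set.range (faceHom α y h ≫ θ.hom) = Set.range (faceHom (α ≫ θ.hom) (θ.hom y) h') := by
    rw [range_faceHom]
    ext z
    obtain ⟨z, rfl⟩ := (iso_bijective θ).2 z
    rw [range_iso_comp, range_faceHom]
    exact (inj θ.hom).ne_iff.symm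
  refine gen_face_eq _ _ _ _ _ _ _ hr ?_ ?_ x
  · rw [← Category.assoc, faceFactor_comp, faceFactor_comp]
  · rw [map_pull (inj _), ← hr]
    change List.map (θ.hom ∘ faceHom α y h) _ = _
    rw [← List.map_map, map_pull (inj _), List.filter_map]
    congr 1
    apply List.filter_congr
    intro z _
    exact decide_eq_decide.2 (range_iso_comp _ _ _).symm

theorem faceTerm_swap_left {m n : ℤ} (α : S ⟶ T) (d₁ d₂ : List S.Edge) (a b : S.Edge)
    (e : List T.Edge) (y : T.Edge) (h : y ∉ Set.range α) (x : ((N.obj (op T)).X n : Type v)) :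
    faceTerm N m α (d₁ ++ a :: b :: d₂) e y h x = - faceTerm N m α (d₁ ++ b :: a :: d₂) e y h x :=
  gen_swap_left _ _ _ _ _ _ _

theorem idxOf_map {X Y : Type} [DecidableEq X] [DecidableEq Y] {f : X → Y}
    (hf : Function.Injective f) (l : List X) (x : X) : (l.map f).idxOf (f x) = l.idxOf x := by
  induction l with
  | nil => rfl
  | cons y l ih =>
    rw [List.map_cons]
    by_cases h : y = x
    · rw [h, List.idxOf_cons_self, List.idxOf_cons_self]
    · rw [List.idxOf_cons_ne _ h, List.idxOf_cons_ne _ (hf.ne h), ih]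

theorem faceTerm_swap_right {m n : ℤ} (α : S ⟶ T) (d : List S.Edge) (e₁ e₂ : List T.Edge)
    (a b : T.Edge) (he : (e₁ ++ a :: b :: e₂).Nodup) (y : T.Edge) (h : y ∉ Set.range α)
    (x : ((N.obj (op T)).X n : Type v)) :
    (-1 : R) ^ ((e₁ ++ a :: b :: e₂).idxOf y) • faceTerm N m α d (e₁ ++ a :: b :: e₂) y h x =
      - (-1 : R) ^ ((e₁ ++ b :: a :: e₂).idxOf y) •
        faceTerm N m α d (e₁ ++ b :: a :: e₂) y h x := by
  have hab : a ≠ b := by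
    rintro rfl
    exact (List.nodup_cons.1 (List.nodup_append.1 he).2.1).1 List.mem_cons_self
  have hae : a ∉ e₁ := fun h =>
    (List.nodup_append.1 he).2.2 a h a List.mem_cons_self rfl
  have hbe : b ∉ e₁ := fun h =>
    (List.nodup_append.1 he).2.2 b h b (List.mem_cons_of_mem _ List.mem_cons_self) rfl
  have hpull : ∀ c : T.Edge, c = y → ∀ l, pull (faceHom α y h) (c :: l) = pull (faceHom α y h) l := by
    rintro c rfl l
    exact pull_cons_not (by rw [range_faceHom]; simp) l
  have hpull' : ∀ c : T.Edge, c ≠ y → ∃ c', ∀ l,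
      pull (faceHom α y h) (c :: l) = c' :: pull (faceHom α y h) l := by
    intro c hc
    have : c ∈ Set.range (faceHom α y h) := by rw [range_faceHom]; exact hc
    obtain ⟨c', rfl⟩ := this
    exact ⟨c', pull_cons_range (inj _) c'⟩
  rw [faceTerm, faceTerm, LinearMap.comp_apply, LinearMap.comp_apply, pull_append, pull_append]
  by_cases hay : a = y
  · obtain ⟨b', hb'⟩ := hpull' b (fun h => hab (hay.trans h.symm))
    rw [hpull a hay, hb', hb', hpull a hay]
    subst hay
    rw [List.idxOf_append_of_notMem hae, List.idxOf_append_of_notMem hae, List.idxOf_cons_self,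
      List.idxOf_cons_ne _ hab.symm, List.idxOf_cons_self, add_zero]
    simp [pow_succ]
  · by_cases hby : b = y
    · obtain ⟨a', ha'⟩ := hpull' a hay
      rw [hpull b hby, ha', ha', hpull b hby]
      subst hby
      rw [List.idxOf_append_of_notMem hbe, List.idxOf_append_of_notMem hbe, List.idxOf_cons_self,
        List.idxOf_cons_ne _ hab, List.idxOf_cons_self, add_zero]
      simp [pow_succ]
    · obtain ⟨a', ha'⟩ := hpull' a hay
      obtain ⟨b', hb'⟩ := hpull' b hby
      rw [ha', hb', hb', ha', gen_swap_right, smul_neg]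
      have : (e₁ ++ a :: b :: e₂).idxOf y = (e₁ ++ b :: a :: e₂).idxOf y := by
        by_cases hy : y ∈ e₁
        · rw [List.idxOf_append_of_mem hy, List.idxOf_append_of_mem hy]
        · rw [List.idxOf_append_of_notMem hy, List.idxOf_append_of_notMem hy,
            List.idxOf_cons_ne _ hay, List.idxOf_cons_ne _ hby, List.idxOf_cons_ne _ hby,
            List.idxOf_cons_ne _ hay]
      rw [this]
      simp

/-- The differential of the total complex: the sum of the external and the internal differential. -/
def D (i j : ℤ) : Mod N S i →ₗ[R] Mod N S j :=
  lift i (fun α d e => dExt N j α d e + dInt N j α d e)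
    (by
      intro T T' n α d e θ x _
      rw [LinearMap.add_apply, LinearMap.add_apply]
      congr 1
      · rw [dExt, dExt, LinearMap.sum_apply, LinearMap.sum_apply]
        refine Fintype.sum_equiv ((Equiv.ofBijective _ (iso_bijective θ)).subtypeEquiv
          (fun y => not_congr (range_iso_comp α θ y).symm)) _ _ ?_
        rintro ⟨y, hy⟩
        rw [LinearMap.smul_apply, LinearMap.smul_apply, faceTerm_iso α d e θ y hy
          (fun h => hy ((range_iso_comp α θ y).1 h))]
        rw [← idxOf_map (inj θ.hom) e y]
        rfl
      · rw [dInt, dInt, LinearMap.smul_apply, LinearMap.smul_apply, LinearMap.comp_apply,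
          LinearMap.comp_apply, List.length_map, ← gen_iso]
        congr 2
        exact congrArg (fun f => f.hom x) ((N.map θ.hom.op).comm n (n - 1)))
    (by
      intro T n α d₁ d₂ a b e x _
      rw [LinearMap.add_apply, LinearMap.add_apply, neg_add]
      congr 1
      · rw [dExt, dExt, LinearMap.sum_apply, LinearMap.sum_apply, ← Finset.sum_neg_distrib]
        refine Finset.sum_congr rfl fun y _ => ?_
        rw [LinearMap.smul_apply, LinearMap.smul_apply, faceTerm_swap_left, smul_neg]
        simp
      · rw [dInt, dInt, LinearMap.smul_apply, LinearMap.smul_apply, LinearMap.comp_apply,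
          LinearMap.comp_apply, gen_swap_left, smul_neg]
        simp)
    (by
      intro T n α d e₁ e₂ a b x h
      rw [LinearMap.add_apply, LinearMap.add_apply, neg_add]
      congr 1
      · rw [dExt, dExt, LinearMap.sum_apply, LinearMap.sum_apply, ← Finset.sum_neg_distrib]
        refine Finset.sum_congr rfl fun y _ => ?_
        rw [LinearMap.smul_apply, LinearMap.smul_apply, pow_add, pow_add, mul_smul, mul_smul,
          faceTerm_swap_right α d e₁ e₂ a b h.2.1.1, neg_smul, smul_neg]
      · rw [dInt, dInt, LinearMap.smul_apply, LinearMap.smul_apply, LinearMap.comp_apply,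
          LinearMap.comp_apply, gen_swap_right, smul_neg]
        simp)

theorem D_gen {i j n : ℤ} {α : S ⟶ T} {d : List S.Edge} {e : List T.Edge} (h : Valid α d e n i)
    (x : ((N.obj (op T)).X n : Type v)) :
    D i j (gen N i α d e x) = dExt N j α d e x + dInt N j α d e x :=
  lift_gen _ _ _ _ h x

end Bar
end

noncomputable section
namespace Bar
open Opposite RTree
open scoped Classical DirectSum

variable {S S' S'' T T' U U' : RTree}

section lists
variable {X Y : Type}

theorem filter_ne_eq_self [DecidableEq X] {y : X} {l : List X} (h : y ∉ l) :
    l.filter (fun z => decide (z ≠ y)) = l :=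
  List.filter_eq_self.2 fun z hz => by simpa using fun h' : z = y => h (h' ▸ hz)

theorem idxOf_parity [DecidableEq X] {y w : X} (hne : y ≠ w) (l : List X) (hl : l.Nodup)
    (hy : y ∈ l) (hw : w ∈ l) :
    (l.idxOf y + (l.filter (fun z => decide (z ≠ y))).idxOf w +
      (l.idxOf w + (l.filter (fun z => decide (z ≠ w))).idxOf y)) % 2 = 1 := by
  induction l with
  | nil => simp at hy
  | cons c l ih =>
    rw [List.nodup_cons] at hl
    by_cases hcy : c = y
    · subst hcy
      rw [List.filter_cons_of_neg (by simp), List.filter_cons_of_pos (by simpa using hne),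
        filter_ne_eq_self hl.1, List.idxOf_cons_self, List.idxOf_cons_self,
        List.idxOf_cons_ne _ hne]
      omega
    · by_cases hcw : c = w
      · subst hcw
        rw [List.filter_cons_of_neg (p := fun z => decide (z ≠ c)) (by simp),
          List.filter_cons_of_pos (p := fun z => decide (z ≠ y)) (by simpa using hne.symm),
          filter_ne_eq_self hl.1, List.idxOf_cons_self, List.idxOf_cons_self,
          List.idxOf_cons_ne _ hcy]
        omega
      · rw [List.filter_cons_of_pos (by simpa using hcy), List.filter_cons_of_pos (by simpa using hcw),
          List.idxOf_cons_ne _ hcy, List.idxOf_cons_ne _ hcw, List.idxOf_cons_ne _ hcw,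
          List.idxOf_cons_ne _ hcy]
        have := ih hl.2 ((List.mem_cons.1 hy).resolve_left (Ne.symm hcy))
          ((List.mem_cons.1 hw).resolve_left (Ne.symm hcw))
        omega

theorem neg_one_pow_congr {R : Type*} [CommRing R] {a b : ℕ} (h : (a + b) % 2 = 0) :
    (-1 : R) ^ a = (-1) ^ b := by
  rw [neg_one_pow_eq_pow_mod_two (n := a), neg_one_pow_eq_pow_mod_two (n := b)]
  congr 1
  omega

theorem neg_one_pow_congr' {R : Type*} [CommRing R] {a b : ℕ} (h : (a + b) % 2 = 1) :
    (-1 : R) ^ a = - (-1) ^ b := by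
  rw [neg_one_pow_congr (a := a) (b := b + 1) (by omega), pow_succ]
  ring

theorem inversions_parity [DecidableEq X] (P : X → Prop) {y : X} (hP : ¬ P y) (l : List X)
    (hl : l.Nodup) (hy : y ∈ l) :
    (inversions P l + (l.countP (fun z => decide (P z)) +
      (l.filter (fun z => decide (¬ P z))).idxOf y) +
      (l.idxOf y + inversions P (l.filter (fun z => decide (z ≠ y))))) % 2 = 0 := by
  induction l with
  | nil => simp at hy
  | cons c l ih =>
    rw [List.nodup_cons] at hl
    by_cases hcy : c = y
    · subst hcy
      rw [List.filter_cons_of_neg (p := fun z => decide (z ≠ c)) (by simp), filter_ne_eq_self hl.1,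
        List.filter_cons_of_pos (by simpa using hP), List.idxOf_cons_self, List.idxOf_cons_self,
        List.countP_cons_of_neg (by simpa using hP), inversions, if_neg hP]
      omega
    · have h1 := ih hl.2 ((List.mem_cons.1 hy).resolve_left (Ne.symm hcy))
      rw [List.filter_cons_of_pos (p := fun z => decide (z ≠ y)) (by simpa using hcy),
        List.idxOf_cons_ne _ hcy]
      by_cases hc : P c
      · rw [List.filter_cons_of_neg (by simpa using hc), List.countP_cons_of_pos (by simpa using hc),
          inversions, inversions, if_pos hc, if_pos hc]
        omega
      · have h2 : (l.filter (fun z => decide (z ≠ y))).countP (fun z => decide (P z)) =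
            l.countP (fun z => decide (P z)) := by
          rw [List.countP_filter]
          apply List.countP_congr
          intro z _
          simp only [Bool.and_eq_true, decide_eq_true_eq]
          exact ⟨fun h => h.1, fun h => ⟨h, fun h' => hP (h' ▸ h)⟩⟩
        rw [List.filter_cons_of_pos (by simpa using hc), List.countP_cons_of_neg (by simpa using hc),
          inversions, inversions, if_neg hc, if_neg hc, List.idxOf_cons_ne _ hcy, h2]
        omega

theorem inversions_swap_eq (P : X → Prop) {a b : X} (h : P a ↔ P b) (l₁ l₂ : List X) :
    inversions P (l₁ ++ a :: b :: l₂) = inversions P (l₁ ++ b :: a :: l₂) := by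
  induction l₁ with
  | nil => by_cases ha : P a <;> simp [inversions, ← h, ha]
  | cons c l ih => simp [inversions, ih, List.countP_append, List.countP_cons, h]

theorem inversions_swap_succ (P : X → Prop) {a b : X} (ha : P a) (hb : ¬ P b) (l₁ l₂ : List X) :
    inversions P (l₁ ++ b :: a :: l₂) = inversions P (l₁ ++ a :: b :: l₂) + 1 := by
  induction l₁ with
  | nil => simp [inversions, ha, hb]; omega
  | cons c l ih =>
    simp only [List.cons_append, inversions, ih, List.countP_append, List.countP_cons, ha, hb]
    by_cases hc : P c <;> simp [hc] <;> omega

theorem filter_pull {β : X → Y} (hβ : Function.Injective β) (P : Y → Prop) (l : List Y) :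
    (pull β l).filter (fun x => decide (P (β x))) = pull β (l.filter (fun y => decide (P y))) := by
  apply hβ.list_map
  have h := List.filter_map (f := β) (p := fun y => decide (P y)) (l := pull β l)
  refine h.symm.trans ?_
  rw [map_pull hβ, map_pull hβ, List.filter_comm]

theorem inversions_congr {P Q : X → Prop} (h : ∀ x, P x ↔ Q x) (l : List X) :
    inversions P l = inversions Q l := by
  rw [funext fun x => propext (h x)]

end lists

universe v
variable {R : Type v} [CommRing R] {N : RTreeᵒᵖ ⥤ Ch R}

theorem Valid.mem {n m : ℤ} {α : S ⟶ T} {d : List S.Edge} {e : List T.Edge} (h : Valid α d e n m)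
    {y : T.Edge} (hy : y ∉ Set.range α) : y ∈ e := (h.2.1.2 y).2 hy

theorem Valid.face {n m k : ℤ} {α : S ⟶ T} {d : List S.Edge} {e : List T.Edge}
    (h : Valid α d e n m) (hk : k + 1 = m) {y : T.Edge} (hy : y ∉ Set.range α) :
    Valid (faceFactor α y hy) d (pull (faceHom α y hy) e) n k := by
  refine ⟨h.1, ⟨nodup_pull (inj _) h.2.1.1, fun x => ?_⟩, ?_⟩
  · rw [mem_pull (inj _), h.2.1.2, Set.mem_compl_iff, Set.mem_compl_iff, faceFactor_range]
  · have := IsEnum.length_pull (inj (faceHom α y hy)) (range_faceHom α y hy) h.2.1.1 (h.mem hy)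
    have := h.2.2
    omega

theorem Valid.int {n m k : ℤ} {α : S ⟶ T} {d : List S.Edge} {e : List T.Edge}
    (h : Valid α d e n m) (hk : k + 1 = m) : Valid α d e (n - 1) k :=
  ⟨h.1, h.2.1, by have := h.2.2; omega⟩

theorem map_pull_faceHom (α : S ⟶ T) (e : List T.Edge) (y : T.Edge) (hy : y ∉ Set.range α) :
    (pull (faceHom α y hy) e).map (faceHom α y hy) = e.filter (fun z => decide (z ≠ y)) := by
  rw [map_pull (inj _), range_faceHom]
  exact List.filter_congr fun z _ => decide_eq_decide.2 Iff.rfl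

theorem map_comp_apply' {A B C : RTree} (f : A ⟶ B) (g : B ⟶ C) {n : ℤ}
    (x : ((N.obj (op C)).X n : Type v)) :
    ((N.map f.op).f n).hom (((N.map g.op).f n).hom x) = ((N.map (f ≫ g).op).f n).hom x := by
  rw [op_comp, N.map_comp]
  rfl

theorem sum_sum_eq_zero {I A : Type*} [Fintype I] [AddCommGroup A] (J : I → Type)
    [∀ i, Fintype (J i)] (r : ∀ i, J i → I) (hr : ∀ i, Function.Injective (r i))
    (hne : ∀ i j, r i j ≠ i) (hex : ∀ i j, ∃ j' : J (r i j), r _ j' = i)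
    (F : ∀ i, J i → A) (hF : ∀ i j j', r (r i j) j' = i → F i j + F (r i j) j' = 0) :
    ∑ i, ∑ j, F i j = 0 := by
  choose s hs using hex
  rw [Finset.sum_sigma']
  refine Finset.sum_involution (fun a _ => ⟨r a.1 a.2, s a.1 a.2⟩) ?_ ?_ ?_ ?_
  · rintro ⟨i, j⟩ -
    exact hF i j _ (hs i j)
  · rintro ⟨i, j⟩ - - h
    exact hne i j (congrArg Sigma.fst h)
  · intro a _
    exact Finset.mem_sigma.2 ⟨Finset.mem_univ _, Finset.mem_univ _⟩
  · rintro ⟨i, j⟩ -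
    have aux : ∀ (i' : I) (j' : J i'), i' = i → r i' j' = r i j →
        (⟨i', j'⟩ : Σ i, J i) = ⟨i, j⟩ := by
      rintro i' j' rfl h
      rw [hr _ h]
    exact aux _ _ (hs i j) (hs _ _)

theorem range_face_face (α : S ⟶ T) (y : T.Edge) (hy : y ∉ Set.range α) (z : (face α y hy).Edge)
    (hz : z ∉ Set.range (faceFactor α y hy)) :
    Set.range (faceHom (faceFactor α y hy) z hz ≫ faceHom α y hy) = {y, faceHom α y hy z}ᶜ := by
  have h0 : Set.range (faceHom (faceFactor α y hy) z hz ≫ faceHom α y hy) =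
      faceHom α y hy '' Set.range (faceHom (faceFactor α y hy) z hz) :=
    Set.range_comp (faceHom α y hy) (faceHom (faceFactor α y hy) z hz)
  rw [h0, range_faceHom, Set.image_compl_eq_range_sdiff_image (inj (faceHom α y hy)),
    range_faceHom, Set.image_singleton]
  ext w
  simp [not_or]

theorem map_pull_face_face (α : S ⟶ T) (e : List T.Edge) (y : T.Edge) (hy : y ∉ Set.range α)
    (z : (face α y hy).Edge) (hz : z ∉ Set.range (faceFactor α y hy)) (s : Set T.Edge)
    (hs : s = {y, faceHom α y hy z}ᶜ) :
    (pull (faceHom (faceFactor α y hy) z hz) (pull (faceHom α y hy) e)).map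
      (faceHom (faceFactor α y hy) z hz ≫ faceHom α y hy) =
      e.filter (fun w => decide (w ∈ s)) := by
  rw [hs.trans (range_face_face α y hy z hz).symm, ← map_pull (inj _), pull_comp (inj _) (inj _)]
  rfl

theorem face_face_eq {k n : ℤ} (α : S ⟶ T) (d : List S.Edge) (e : List T.Edge)
    (y : T.Edge) (hy : y ∉ Set.range α) (z : (face α y hy).Edge)
    (hz : z ∉ Set.range (faceFactor α y hy)) (w : T.Edge) (hw : w ∉ Set.range α)
    (v : (face α w hw).Edge) (hv : v ∉ Set.range (faceFactor α w hw))
    (h1 : faceHom α y hy z = w) (h2 : faceHom α w hw v = y)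
    (x : ((N.obj (op T)).X n : Type v)) :
    faceTerm N k (faceFactor α y hy) d (pull (faceHom α y hy) e) z hz
        (((N.map (faceHom α y hy).op).f n).hom x) =
      faceTerm N k (faceFactor α w hw) d (pull (faceHom α w hw) e) v hv
        (((N.map (faceHom α w hw).op).f n).hom x) := by
  rw [faceTerm, faceTerm, LinearMap.comp_apply, LinearMap.comp_apply, map_comp_apply',
    map_comp_apply']
  have hr : ({y, faceHom α y hy z}ᶜ : Set T.Edge) = {w, faceHom α w hw v}ᶜ := by
    rw [h1, h2, Set.pair_comm]
  refine gen_face_eq _ _ _ _ _ _ _ ?_ ?_ ?_ x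
  · rw [range_face_face, range_face_face, hr]
  · rw [← Category.assoc, faceFactor_comp, faceFactor_comp, ← Category.assoc, faceFactor_comp,
      faceFactor_comp]
  · rw [map_pull_face_face α e y hy z hz _ rfl, map_pull_face_face α e w hw v hv _ hr]

theorem idxOf_pull (α : S ⟶ T) (e : List T.Edge) (y : T.Edge) (hy : y ∉ Set.range α)
    (z : (face α y hy).Edge) : (pull (faceHom α y hy) e).idxOf z =
      (e.filter (fun w => decide (w ≠ y))).idxOf (faceHom α y hy z) := by
  rw [← map_pull_faceHom α e y hy, idxOf_map (inj _)]

theorem faceHom_ne (α : S ⟶ T) (y : T.Edge) (hy : y ∉ Set.range α) (z : (face α y hy).Edge) :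
    faceHom α y hy z ≠ y := by
  have : faceHom α y hy z ∈ ({y}ᶜ : Set T.Edge) := by
    rw [← range_faceHom α y hy]
    exact ⟨z, rfl⟩
  exact this

theorem dExt_dExt {i k n : ℤ} {α : S ⟶ T} {d : List S.Edge}
    {e : List T.Edge} (h : Valid α d e n i) (x : ((N.obj (op T)).X n : Type v)) :
    ∑ y : {y : T.Edge // y ∉ Set.range α}, (-1 : R) ^ (d.length + e.idxOf y.1) •
      dExt N k (faceFactor α y.1 y.2) d (pull (faceHom α y.1 y.2) e)
        (((N.map (faceHom α y.1 y.2).op).f n).hom x) = 0 := by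
  simp only [dExt, LinearMap.sum_apply, Finset.smul_sum, LinearMap.smul_apply, smul_smul]
  refine sum_sum_eq_zero
    (fun y : {y : T.Edge // y ∉ Set.range α} =>
      {z : (face α y.1 y.2).Edge // z ∉ Set.range (faceFactor α y.1 y.2)})
    (fun y z => ⟨faceHom α y.1 y.2 z.1, fun h => z.2 ((faceFactor_range α y.1 y.2 z.1).2 h)⟩)
    ?_ ?_ ?_ _ ?_
  · intro y z z' hzz
    exact Subtype.ext (inj _ (congrArg Subtype.val hzz))
  · intro y z hzy
    exact faceHom_ne α y.1 y.2 z.1 (congrArg Subtype.val hzy)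
  · rintro ⟨y, hy⟩ ⟨z, hz⟩
    have hw : faceHom α y hy z ∉ Set.range α := fun h => hz ((faceFactor_range α y hy z).2 h)
    have : y ∈ Set.range (faceHom α _ hw) := by
      rw [range_faceHom]
      exact (faceHom_ne α y hy z).symm
    obtain ⟨v, hv⟩ := this
    exact ⟨⟨v, fun h => hy (hv ▸ (faceFactor_range α _ hw v).1 h)⟩, Subtype.ext hv⟩
  · rintro ⟨y, hy⟩ ⟨z, hz⟩ ⟨v, hv⟩ hvy
    have hw : faceHom α y hy z ∉ Set.range α := fun h => hz ((faceFactor_range α y hy z).2 h)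
    have hvy : faceHom α _ hw v = y := congrArg Subtype.val hvy
    have hs := idxOf_parity (faceHom_ne α y hy z).symm e h.2.1.1 (h.mem hy) (h.mem hw)
    have h2 : (pull (faceHom α _ hw) e).idxOf v = (e.filter (fun w =>
        decide (w ≠ faceHom α y hy z))).idxOf y := by rw [idxOf_pull, hvy]
    have hsign : (-1 : R) ^ (d.length + e.idxOf y) *
        (-1) ^ (d.length + (pull (faceHom α y hy) e).idxOf z) =
        - ((-1 : R) ^ (d.length + e.idxOf (faceHom α y hy z)) *
        (-1) ^ (d.length + (pull (faceHom α _ hw) e).idxOf v)) := by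
      have hs' : (e.idxOf y + (pull (faceHom α y hy) e).idxOf z + (e.idxOf (faceHom α y hy z) +
          (pull (faceHom α _ hw) e).idxOf v)) % 2 = 1 := by
        rw [h2, idxOf_pull]
        exact hs
      rw [← pow_add, ← pow_add]
      exact neg_one_pow_congr' (by omega)
    have hface := face_face_eq (k := k) α d e y hy z hz _ hw v hv rfl hvy x
    refine (congrArg (_ • · + _) hface).trans ((add_smul _ _ _).symm.trans ?_)
    exact (congrArg (· • _) (add_eq_zero_iff_eq_neg.2 hsign)).trans (zero_smul _ _)

theorem D_D {i j k : ℤ} (hi : j + 1 = i) :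
    (D (N := N) (S := S) j k) ∘ₗ D i j = 0 := by
  apply mod_hom_ext
  intro T n α d e h x
  rw [LinearMap.comp_apply, D_gen h, dInt, dExt, LinearMap.sum_apply, map_add, map_sum,
    LinearMap.smul_apply, LinearMap.comp_apply, map_smul, D_gen (h.int hi)]
  have h1 : ∀ y : {y : T.Edge // y ∉ Set.range α},
      D j k (((-1 : R) ^ (d.length + e.idxOf y.1) • faceTerm N j α d e y.1 y.2) x) =
      (-1 : R) ^ (d.length + e.idxOf y.1) •
        dExt N k (faceFactor α y.1 y.2) d (pull (faceHom α y.1 y.2) e)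
        (((N.map (faceHom α y.1 y.2).op).f n).hom x) -
      (-1 : R) ^ (d.length + e.length) • (-1 : R) ^ (d.length + e.idxOf y.1) •
        faceTerm N k α d e y.1 y.2 (((N.obj (op T)).d n (n - 1)).hom x) := by
    intro y
    rw [LinearMap.smul_apply, map_smul, faceTerm, LinearMap.comp_apply, D_gen (h.face hi y.2),
      smul_add, sub_eq_add_neg]
    congr 1
    rw [dInt, LinearMap.smul_apply, LinearMap.comp_apply, faceTerm, LinearMap.comp_apply]
    have h2 : ((N.obj (op (face α y.1 y.2))).d n (n - 1)).hom
        (((N.map (faceHom α y.1 y.2).op).f n).hom x) =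
        ((N.map (faceHom α y.1 y.2).op).f (n - 1)).hom (((N.obj (op T)).d n (n - 1)).hom x) :=
      congrArg (fun f => f.hom x) ((N.map (faceHom α y.1 y.2).op).comm n (n - 1))
    have h3 := IsEnum.length_pull (inj (faceHom α y.1 y.2)) (range_faceHom α y.1 y.2) h.2.1.1
      (h.mem y.2)
    rw [h2, smul_smul, smul_smul, ← neg_smul, ← h3]
    congr 1
    ring
  have h4 : (((N.obj (op T)).d (n - 1) (n - 1 - 1)).hom (((N.obj (op T)).d n (n - 1)).hom x)) = 0 :=
    congrArg (fun f => f.hom x) ((N.obj (op T)).d_comp_d n (n - 1) (n - 1 - 1))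
  rw [Finset.sum_congr rfl fun y _ => h1 y, Finset.sum_sub_distrib, dExt_dExt h, zero_sub,
    ← Finset.smul_sum, dInt, LinearMap.smul_apply, LinearMap.comp_apply, h4, map_zero, smul_zero,
    add_zero, dExt, LinearMap.sum_apply]
  simp

end Bar
end

noncomputable section
namespace Bar
open Opposite RTree
open scoped Classical DirectSum


section lists
variable {X Y : Type}

/-- The sublist of entries satisfying `P` -/
def filt (P : X → Prop) (l : List X) : List X := l.filter (fun y => decide (P y))

theorem filt_eq (P : X → Prop) [inst : ∀ x, Decidable (P x)] (l : List X) :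
    filt P l = l.filter (fun y => decide (P y)) :=
  List.filter_congr fun _ _ => decide_eq_decide.2 Iff.rfl

theorem filt_nil (P : X → Prop) : filt P [] = [] := rfl

theorem filt_pos {P : X → Prop} {x : X} (h : P x) (l : List X) : filt P (x :: l) = x :: filt P l :=
  List.filter_cons_of_pos (by simpa using h)

theorem filt_neg {P : X → Prop} {x : X} (h : ¬ P x) (l : List X) : filt P (x :: l) = filt P l :=
  List.filter_cons_of_neg (by simpa using h)

theorem filt_append (P : X → Prop) (l l' : List X) : filt P (l ++ l') = filt P l ++ filt P l' :=
  List.filter_append ..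

theorem mem_filt {P : X → Prop} {l : List X} {x : X} : x ∈ filt P l ↔ x ∈ l ∧ P x := by
  simp [filt]

theorem nodup_filt {P : X → Prop} {l : List X} (h : l.Nodup) : (filt P l).Nodup := h.filter _

theorem filt_congr {P Q : X → Prop} (h : ∀ x, P x ↔ Q x) (l : List X) : filt P l = filt Q l := by
  rw [funext fun x => propext (h x)]

theorem filt_map (f : X → Y) (P : Y → Prop) (l : List X) :
    filt P (l.map f) = (filt (fun x => P (f x)) l).map f := List.filter_map

theorem filt_filt (P Q : X → Prop) (l : List X) :
    filt P (filt Q l) = filt (fun x => P x ∧ Q x) l := by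
  rw [filt, filt, List.filter_filter]
  exact List.filter_congr fun x _ => by simp

theorem filt_eq_self {P : X → Prop} {l : List X} (h : ∀ x ∈ l, P x) : filt P l = l :=
  List.filter_eq_self.2 fun x hx => by simpa using h x hx

theorem filt_eq_nil {P : X → Prop} {l : List X} (h : ∀ x ∈ l, ¬ P x) : filt P l = [] :=
  List.filter_eq_nil_iff.2 fun x hx => by simpa using h x hx

theorem map_pull_filt {β : X → Y} (hβ : Function.Injective β) (l : List Y) :
    (pull β l).map β = filt (· ∈ Set.range β) l := map_pull hβ l

theorem length_pull_filt {β : X → Y} (hβ : Function.Injective β) (l : List Y) :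
    (pull β l).length + (filt (· ∉ Set.range β) l).length = l.length := by
  rw [filt_eq]
  exact length_pull_add hβ l

theorem filt_pull {β : X → Y} (hβ : Function.Injective β) (P : Y → Prop) (l : List Y) :
    filt (fun x => P (β x)) (pull β l) = pull β (filt P l) := filter_pull hβ P l

theorem pull_filt {β : X → Y} (P : Y → Prop) (hP : ∀ x, P (β x)) (l : List Y) :
    pull β (filt P l) = pull β l := by
  induction l with
  | nil => rfl
  | cons y l ih =>
    by_cases h : P y
    · rw [filt_pos h, pull, pull, List.filterMap_cons, List.filterMap_cons]
      rw [pull, pull] at ih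
      rw [ih]
    · rw [filt_neg h, ih, pull_cons_not]
      rintro ⟨x, rfl⟩
      exact h (hP x)

theorem inversions_cons_pos {P : X → Prop} {x : X} (h : P x) (l : List X) :
    inversions P (x :: l) = inversions P l := by simp [inversions, h]

theorem inversions_cons_neg {P : X → Prop} {x : X} (h : ¬ P x) (l : List X) :
    inversions P (x :: l) = (filt P l).length + inversions P l := by
  simp [inversions, h, filt, List.countP_eq_length_filter]

theorem inversions_filt_parity (P : X → Prop) {y : X} (hP : ¬ P y) (l : List X)
    (hl : l.Nodup) (hy : y ∈ l) [DecidableEq X] :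
    (inversions P l + ((filt P l).length + (filt (fun z => ¬ P z) l).idxOf y) +
      (l.idxOf y + inversions P (filt (· ≠ y) l))) % 2 = 0 := by
  have h := inversions_parity P hP l hl hy
  rw [List.countP_eq_length_filter] at h
  rw [filt_eq, filt_eq, filt_eq]
  exact h

theorem inversions_eq_zero {P : X → Prop} {l : List X} (h : ∀ x ∈ l, ¬ P x) :
    inversions P l = 0 := by
  induction l with
  | nil => rfl
  | cons x l ih =>
    have h1 : ∀ y ∈ l, ¬ P y := fun y hy => h y (List.mem_cons_of_mem _ hy)
    rw [inversions_cons_neg (h x List.mem_cons_self), ih h1, filt_eq_nil h1]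
    rfl

theorem inversions_nested {P Q : X → Prop} (hPQ : ∀ x, Q x → P x) (l : List X) :
    inversions Q l + inversions P (filt (fun x => ¬ Q x) l) =
      inversions P l + inversions Q (filt P l) := by
  induction l with
  | nil => rfl
  | cons x l ih =>
    by_cases hQ : Q x
    · rw [filt_pos (hPQ x hQ), filt_neg (P := fun x => ¬ Q x) (not_not.2 hQ), inversions_cons_pos hQ,
        inversions_cons_pos hQ, inversions_cons_pos (hPQ x hQ), ih]
    · have h1 : (filt Q (filt P l)).length = (filt Q l).length := by
        rw [filt_filt]
        exact congrArg _ (filt_congr (fun x => ⟨fun h => h.1, fun h => ⟨h, hPQ x h⟩⟩) l)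
      have h2 : (filt P (filt (fun x => ¬ Q x) l)).length + (filt Q l).length =
          (filt P l).length := by
        clear ih h1
        induction l with
        | nil => rfl
        | cons z l ih =>
          by_cases hz : Q z
          · rw [filt_neg (P := fun x => ¬ Q x) (not_not.2 hz), filt_pos hz, filt_pos (hPQ z hz)]
            simp only [List.length_cons]
            omega
          · rw [filt_pos (P := fun x => ¬ Q x) hz, filt_neg hz]
            by_cases hz' : P z
            · rw [filt_pos hz', filt_pos hz']
              simp only [List.length_cons]
              omega
            · rw [filt_neg hz', filt_neg hz', ih]
      rw [filt_pos (P := fun x => ¬ Q x) hQ, inversions_cons_neg hQ]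
      by_cases hP : P x
      · rw [filt_pos hP, inversions_cons_pos hP, inversions_cons_pos hP, inversions_cons_neg hQ, h1]
        omega
      · rw [filt_neg hP, inversions_cons_neg hP, inversions_cons_neg hP]
        omega

end lists

variable {S S' S'' T T' U U' : RTree}
universe v
variable {R : Type v} [CommRing R] {N : RTreeᵒᵖ ⥤ Ch R}

variable (N) in
/-- The value of `γ_*` on `(β γ, d | e, x)`: after a permutation of `e` which moves the edges in the
image of `β` to the front, with its sign, these edges are appended to `γ d`. -/
def pushFac (m : ℤ) {n : ℤ} (γ : S ⟶ S') (β : S' ⟶ T) (d : List S.Edge) (e : List T.Edge) :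
    ((N.obj (op T)).X n : Type v) →ₗ[R] Mod N S' m :=
  (-1 : R) ^ inversions (· ∈ Set.range β) e •
    gen N m β (d.map γ ++ pull β e) (filt (· ∉ Set.range β) e)

variable (N) in
/-- The value of `γ_*` on `(α, d | e, x)`, which is zero if `α` does not factor through `γ`. -/
def pushGen (m : ℤ) {n : ℤ} (γ : S ⟶ S') (α : S ⟶ T) (d : List S.Edge) (e : List T.Edge) :
    ((N.obj (op T)).X n : Type v) →ₗ[R] Mod N S' m :=
  if h : ∃ β : S' ⟶ T, γ ≫ β = α then pushFac N m γ h.choose d e else 0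

theorem pushGen_fac {m n : ℤ} (γ : S ⟶ S') (β : S' ⟶ T) (d : List S.Edge) (e : List T.Edge) :
    pushGen N m (n := n) γ (γ ≫ β) d e = pushFac N m γ β d e := by
  have h : ∃ β' : S' ⟶ T, γ ≫ β' = γ ≫ β := ⟨β, rfl⟩
  rw [pushGen, dif_pos h, epi_ext γ h.choose_spec]

theorem pushGen_not {m n : ℤ} {γ : S ⟶ S'} {α : S ⟶ T} (h : ¬ ∃ β : S' ⟶ T, γ ≫ β = α)
    (d : List S.Edge) (e : List T.Edge) : pushGen N m (n := n) γ α d e = 0 := dif_neg h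

theorem pull_iso (β : S' ⟶ T) (θ : T ≅ T') (e : List T.Edge) :
    pull (β ≫ θ.hom) (e.map θ.hom) = pull β e := by
  apply (inj (β ≫ θ.hom)).list_map
  rw [map_pull (inj _)]
  change _ = List.map (θ.hom ∘ β) _
  rw [← List.map_map, map_pull (inj _), List.filter_map]
  congr 1
  exact List.filter_congr fun z _ => decide_eq_decide.2 (range_iso_comp _ _ _)

theorem pushGen_iso {m n : ℤ} (γ : S ⟶ S') (α : S ⟶ T) (d : List S.Edge) (e : List T.Edge)
    (θ : T ≅ T') (x : ((N.obj (op T')).X n : Type v)) :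
    pushGen N m γ α d e (((N.map θ.hom.op).f n).hom x) =
      pushGen N m γ (α ≫ θ.hom) d (e.map θ.hom) x := by
  by_cases h : ∃ β : S' ⟶ T, γ ≫ β = α
  · obtain ⟨β, rfl⟩ := h
    rw [Category.assoc, pushGen_fac, pushGen_fac, pushFac, pushFac, LinearMap.smul_apply,
      LinearMap.smul_apply, gen_iso, inversions_map, pull_iso,
      inversions_congr (P := fun z => θ.hom z ∈ Set.range (β ≫ θ.hom)) (range_iso_comp β θ),
      filt_map, filt_congr (fun z => not_congr (range_iso_comp β θ z).symm)]
  · rw [pushGen_not h, pushGen_not]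
    · rfl
    · rintro ⟨β, hβ⟩
      refine h ⟨β ≫ θ.inv, ?_⟩
      rw [← Category.assoc, hβ, Category.assoc, θ.hom_inv_id, Category.comp_id]

theorem pushFac_swap_right {m n : ℤ} (γ : S ⟶ S') (β : S' ⟶ T) (d : List S.Edge)
    (e₁ e₂ : List T.Edge) (a b : T.Edge) (x : ((N.obj (op T)).X n : Type v)) :
    pushFac N m γ β d (e₁ ++ a :: b :: e₂) x = - pushFac N m γ β d (e₁ ++ b :: a :: e₂) x := by
  rw [pushFac, pushFac, LinearMap.smul_apply, LinearMap.smul_apply, pull_append, pull_append,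
    filt_append, filt_append]
  by_cases ha : a ∈ Set.range β
  · by_cases hb : b ∈ Set.range β
    · rw [inversions_swap_eq _ (iff_of_true ha hb)]
      obtain ⟨a, rfl⟩ := ha
      obtain ⟨b, rfl⟩ := hb
      rw [pull_cons_range (inj _), pull_cons_range (inj _), pull_cons_range (inj _),
        pull_cons_range (inj _), filt_neg (by simp),
        filt_neg (by simp), filt_neg (by simp),
        filt_neg (by simp), ← List.append_assoc, gen_swap_left, smul_neg,
        ← List.append_assoc]
    · rw [inversions_swap_succ _ ha hb, pull_cons_not hb]
      obtain ⟨a, rfl⟩ := ha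
      rw [pull_cons_range (inj _), pull_cons_not hb, pull_cons_range (inj _),
        filt_neg (by simp), filt_pos (by simpa using hb),
        filt_pos (by simpa using hb), filt_neg (by simp), pow_succ,
        mul_neg, mul_one, neg_smul, neg_neg]
  · by_cases hb : b ∈ Set.range β
    · rw [inversions_swap_succ _ hb ha, pull_cons_not ha]
      obtain ⟨b, rfl⟩ := hb
      rw [pull_cons_range (inj _), pull_cons_range (inj _), pull_cons_not ha,
        filt_pos (by simpa using ha), filt_neg (by simp),
        filt_neg (by simp), filt_pos (by simpa using ha), pow_succ,
        mul_neg, mul_one, neg_smul]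
    · rw [inversions_swap_eq _ (iff_of_false ha hb), pull_cons_not ha, pull_cons_not hb,
        pull_cons_not hb, pull_cons_not ha, filt_pos (by simpa using ha),
        filt_pos (by simpa using hb), filt_pos (by simpa using hb),
        filt_pos (by simpa using ha), gen_swap_right, smul_neg]

/-- The map `γ_*` induced by a morphism `γ : S ⟶ S'`. -/
def push (m : ℤ) (γ : S ⟶ S') : Mod N S m →ₗ[R] Mod N S' m :=
  lift m (fun α d e => pushGen N m γ α d e)
    (fun α d e θ x _ => pushGen_iso γ α d e θ x)
    (by
      intro T n α d₁ d₂ a b e x _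
      by_cases h : ∃ β : S' ⟶ T, γ ≫ β = α
      · obtain ⟨β, rfl⟩ := h
        rw [pushGen_fac, pushGen_fac, pushFac, pushFac, LinearMap.smul_apply,
          LinearMap.smul_apply, List.map_append, List.map_append, List.map_cons, List.map_cons,
          List.map_cons, List.map_cons, List.append_assoc, List.append_assoc, List.cons_append,
          List.cons_append, List.cons_append, List.cons_append, gen_swap_left, smul_neg]
      · rw [pushGen_not h, pushGen_not h]
        simp)
    (by
      intro T n α d e₁ e₂ a b x _
      by_cases h : ∃ β : S' ⟶ T, γ ≫ β = α
      · obtain ⟨β, rfl⟩ := h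
        rw [pushGen_fac, pushGen_fac, pushFac_swap_right]
      · rw [pushGen_not h, pushGen_not h]
        simp)

theorem push_gen {m n : ℤ} (γ : S ⟶ S') {α : S ⟶ T} {d : List S.Edge} {e : List T.Edge}
    (h : Valid α d e n m) (x : ((N.obj (op T)).X n : Type v)) :
    push m γ (gen N m α d e x) = pushGen N m γ α d e x :=
  lift_gen _ _ _ _ h x

theorem isInner_iff (γ : S ⟶ S') {x : S.Edge} : S'.IsInner (γ x) ↔ S.IsInner x :=
  and_congr (not_congr (isLeaf_iff γ)) (not_congr (root_iff γ))

theorem comp_mem_range {γ : S ⟶ S'} {β : S' ⟶ T} {x : S'.Edge} :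
    β x ∈ Set.range (γ ≫ β) ↔ x ∈ Set.range γ := by
  constructor
  · rintro ⟨s, hs⟩
    exact ⟨s, inj β hs⟩
  · rintro ⟨s, rfl⟩
    exact ⟨s, rfl⟩

theorem Valid.push {m n : ℤ} {γ : S ⟶ S'} {β : S' ⟶ T} {d : List S.Edge} {e : List T.Edge}
    (h : Valid (γ ≫ β) d e n m) :
    Valid β (d.map γ ++ pull β e) (filt (· ∉ Set.range β) e) n m := by
  refine ⟨⟨?_, fun x => ?_⟩, ⟨nodup_filt h.2.1.1, fun y => ?_⟩, ?_⟩
  · rw [List.nodup_append]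
    refine ⟨h.1.1.map (inj γ), nodup_pull (inj β) h.2.1.1, ?_⟩
    rintro a ha b hb rfl
    obtain ⟨s, -, rfl⟩ := List.mem_map.1 ha
    exact (h.2.1.2 _).1 ((mem_pull (inj β)).1 hb) ⟨s, rfl⟩
  · rw [List.mem_append, mem_pull (inj β), h.2.1.2, Set.mem_compl_iff, comp_mem_range]
    constructor
    · rintro (hx | hx)
      · obtain ⟨s, hs, rfl⟩ := List.mem_map.1 hx
        exact (isInner_iff γ).2 ((h.1.2 s).1 hs)
      · exact inner_of_not_mem_range γ hx
    · intro hx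
      by_cases hr : x ∈ Set.range γ
      · obtain ⟨s, rfl⟩ := hr
        exact Or.inl (List.mem_map.2 ⟨s, (h.1.2 s).2 ((isInner_iff γ).1 hx), rfl⟩)
      · exact Or.inr hr
  · rw [mem_filt, h.2.1.2]
    simp only [Set.mem_compl_iff]
    refine ⟨fun h => h.2, fun hy => ⟨?_, hy⟩⟩
    rintro ⟨s, rfl⟩
    exact hy ⟨γ s, rfl⟩
  · have h1 := length_pull_filt (inj β) e
    have h2 := h.2.2
    rw [List.length_append, List.length_map]
    omega

theorem faceFactor_factor {γ : S ⟶ S'} (β : S' ⟶ T) (y : T.Edge) (hy : y ∉ Set.range (γ ≫ β))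
    (hβ : y ∉ Set.range β) : γ ≫ faceFactor β y hβ = faceFactor (γ ≫ β) y hy := by
  apply mono_ext (faceHom β y hβ)
  rw [Category.assoc, faceFactor_comp]
  exact (faceFactor_comp (γ ≫ β) y hy).symm

theorem push_faceTerm {i j n : ℤ} (hij : j + 1 = i) {γ : S ⟶ S'} {β : S' ⟶ T} {d : List S.Edge}
    {e : List T.Edge} (h : Valid (γ ≫ β) d e n i) (y : T.Edge) (hy : y ∉ Set.range (γ ≫ β))
    (hβ : y ∉ Set.range β) (x : ((N.obj (op T)).X n : Type v)) :
    (-1 : R) ^ (d.length + e.idxOf y) • push j γ (faceTerm N j (γ ≫ β) d e y hy x) =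
      (-1 : R) ^ inversions (· ∈ Set.range β) e •
        (-1 : R) ^ ((d.map γ ++ pull β e).length +
          (filt (· ∉ Set.range β) e).idxOf y) •
        faceTerm N j β (d.map γ ++ pull β e) (filt (· ∉ Set.range β) e) y hβ
          x := by
  rw [faceTerm, LinearMap.comp_apply, push_gen γ (h.face hij hy), ← faceFactor_factor β y hy hβ,
    pushGen_fac, pushFac, LinearMap.smul_apply, faceTerm, LinearMap.comp_apply, smul_smul,
    smul_smul]
  have h1 : pull (faceFactor β y hβ) (pull (faceHom β y hβ) e) = pull β e := by
    rw [pull_comp (inj _) (inj _)]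
    exact congrArg (fun f : S' ⟶ T => pull f e) (faceFactor_comp β y hβ)
  have h2 : filt (· ∉ Set.range (faceFactor β y hβ)) (pull (faceHom β y hβ) e) =
      pull (faceHom β y hβ) (filt (· ∉ Set.range β) e) := by
    rw [← filt_pull (inj (faceHom β y hβ)) (fun y => y ∉ Set.range β)]
    exact filt_congr (fun z => not_congr (faceFactor_range β y hβ z)) _
  have h3 : inversions (· ∈ Set.range (faceFactor β y hβ)) (pull (faceHom β y hβ) e) =
      inversions (· ∈ Set.range β) (filt (· ≠ y) e) := by
    rw [filt_eq, ← map_pull_faceHom β e y hβ, inversions_map]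
    exact inversions_congr (faceFactor_range β y hβ) _
  have h4 : (filt (· ∈ Set.range β) e).length = (pull β e).length := by
    rw [← map_pull_filt (inj β), List.length_map]
  have h5 := inversions_filt_parity (· ∈ Set.range β) hβ e h.2.1.1 (h.mem hy)
  have h6 : (-1 : R) ^ (d.length + e.idxOf y) *
      (-1) ^ inversions (· ∈ Set.range (faceFactor β y hβ)) (pull (faceHom β y hβ) e) =
      (-1 : R) ^ inversions (· ∈ Set.range β) e * (-1 : R) ^ ((d.map γ ++ pull β e).length +
          (filt (· ∉ Set.range β) e).idxOf y) := by
    rw [h3, ← pow_add, ← pow_add, List.length_append, List.length_map, ← h4]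
    exact neg_one_pow_congr (by omega)
  refine congrArg₂ (· • ·) h6 ?_
  have h7 : (d.map γ ++ pull (faceFactor β y hβ) (pull (faceHom β y hβ) e)) =
    d.map γ ++ pull β e := by rw [h1]
  exact congrArg₂ (fun l l' => gen N j (faceFactor β y hβ) l l'
    (((N.map (faceHom β y hβ).op).f n).hom x)) h7 h2

theorem push_D {i j : ℤ} (hij : j + 1 = i) (γ : S ⟶ S') :
    (push (N := N) j γ) ∘ₗ D i j = D i j ∘ₗ push i γ := by
  apply mod_hom_ext
  intro T n α d e h x
  rw [LinearMap.comp_apply, LinearMap.comp_apply, D_gen h, push_gen γ h, map_add, dExt,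
    LinearMap.sum_apply, map_sum]
  by_cases hf : ∃ β : S' ⟶ T, γ ≫ β = α
  · obtain ⟨β, rfl⟩ := hf
    rw [pushGen_fac, pushFac, LinearMap.smul_apply, map_smul, D_gen h.push, smul_add]
    congr 1
    · rw [dExt, LinearMap.sum_apply, Finset.smul_sum]
      symm
      refine Fintype.sum_of_injective
        (fun y : {y : T.Edge // y ∉ Set.range β} =>
          (⟨y.1, fun ⟨s, hs⟩ => y.2 ⟨γ s, hs⟩⟩ : {y : T.Edge // y ∉ Set.range (γ ≫ β)}))
        (fun y z hyz => Subtype.ext (congrArg (fun w => w.1) hyz)) _ _ ?_ ?_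
      · rintro ⟨y, hy⟩ hr
        have hyβ : y ∈ Set.range β := by
          by_contra hc
          exact hr ⟨⟨y, hc⟩, rfl⟩
        rw [LinearMap.smul_apply, map_smul, faceTerm, LinearMap.comp_apply,
          push_gen γ (h.face hij hy), pushGen_not, LinearMap.zero_apply, smul_zero]
        rintro ⟨β', hβ'⟩
        have h1 : β' ≫ faceHom (γ ≫ β) y hy = β := by
          apply epi_ext γ
          rw [← Category.assoc, hβ', faceFactor_comp]
        obtain ⟨s, hs⟩ := hyβ
        rw [← h1] at hs
        exact faceHom_ne _ _ _ _ hs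
      · rintro ⟨y, hy⟩
        rw [LinearMap.smul_apply, LinearMap.smul_apply, map_smul]
        exact (push_faceTerm hij h y _ hy x).symm
    · rw [dInt, dInt, LinearMap.smul_apply, LinearMap.comp_apply, map_smul, push_gen γ (h.int hij),
        pushGen_fac, pushFac, LinearMap.smul_apply, LinearMap.smul_apply, LinearMap.comp_apply,
        smul_comm]
      congr 3
      rw [List.length_append, List.length_map, add_assoc, length_pull_filt (inj β)]
  · rw [pushGen_not hf, LinearMap.zero_apply, map_zero, dInt, LinearMap.smul_apply,
      LinearMap.comp_apply, map_smul, push_gen γ (h.int hij), pushGen_not hf, LinearMap.zero_apply,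
      smul_zero, add_zero]
    refine Finset.sum_eq_zero fun y _ => ?_
    rw [LinearMap.smul_apply, map_smul, faceTerm, LinearMap.comp_apply,
      push_gen γ (h.face hij y.2), pushGen_not, LinearMap.zero_apply, smul_zero]
    rintro ⟨β', hβ'⟩
    exact hf ⟨β' ≫ faceHom α y.1 y.2, by rw [← Category.assoc, hβ', faceFactor_comp]⟩

theorem push_id (m : ℤ) : push (N := N) m (𝟙 S) = LinearMap.id := by
  apply mod_hom_ext
  intro T n α d e h x
  have h0 : ∀ y ∈ e, y ∉ Set.range α := fun y hy => (h.2.1.2 y).1 hy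
  have h1 : pull α e = [] := by
    apply (List.map_eq_nil_iff (f := α)).1
    rw [map_pull_filt (inj α)]
    exact filt_eq_nil h0
  have h2 : filt (· ∉ Set.range α) e = e := filt_eq_self h0
  have h3 : d.map (𝟙 S : S ⟶ S) ++ pull α e = d := by
    rw [h1, List.append_nil]
    exact List.map_id d
  have h4 : pushGen N m (n := n) (𝟙 S) α d e = pushFac N m (𝟙 S) α d e := by
    rw [← pushGen_fac, Category.id_comp]
  rw [push_gen _ h, h4, pushFac, h2, h3, inversions_eq_zero h0, pow_zero, one_smul]
  rfl

theorem gen_unshuffle_filt {m n : ℤ} (α : S ⟶ T) (P : S.Edge → Prop) (l d : List S.Edge)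
    (e : List T.Edge) (x : ((N.obj (op T)).X n : Type v)) :
    gen N m α (d ++ l) e x = (-1 : R) ^ inversions P l •
      gen N m α (d ++ filt P l ++ filt (fun y => ¬ P y) l) e x := by
  rw [filt_eq, filt_eq]
  exact gen_unshuffle_left α P l d e x

theorem push_comp (m : ℤ) (γ : S ⟶ S') (γ' : S' ⟶ S'') :
    push (N := N) m (γ ≫ γ') = push m γ' ∘ₗ push m γ := by
  apply mod_hom_ext
  intro T n α d e h x
  rw [LinearMap.comp_apply, push_gen _ h, push_gen _ h]
  by_cases hf : ∃ β : S'' ⟶ T, (γ ≫ γ') ≫ β = α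
  · obtain ⟨β, rfl⟩ := hf
    rw [pushGen_fac]
    have h' : Valid (γ ≫ γ' ≫ β) d e n m := by rwa [← Category.assoc]
    have h1 : pushGen N m γ ((γ ≫ γ') ≫ β) d e x = pushFac N m γ (γ' ≫ β) d e x := by
      rw [Category.assoc, pushGen_fac]
    have hsub : ∀ y, y ∈ Set.range (γ' ≫ β) → y ∈ Set.range β := by
      rintro _ ⟨s, rfl⟩
      exact ⟨γ' s, rfl⟩
    rw [h1, pushFac, pushFac, LinearMap.smul_apply, LinearMap.smul_apply, map_smul,
      push_gen _ h'.push, pushGen_fac, pushFac, LinearMap.smul_apply, smul_smul, ← pow_add,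
      inversions_nested hsub]
    have h2 : filt (· ∉ Set.range β) (filt (· ∉ Set.range (γ' ≫ β)) e) =
        filt (· ∉ Set.range β) e := by
      rw [filt_filt]
      exact filt_congr (fun y => ⟨fun h => h.1, fun h => ⟨h, fun h' => h (hsub y h')⟩⟩) e
    have h3 : (pull (γ' ≫ β) e).map γ' = filt (· ∈ Set.range γ') (pull β e) := by
      rw [← map_pull_filt (inj γ'), pull_comp (inj γ') (inj β)]
      rfl
    have h4 : pull β (filt (· ∉ Set.range (γ' ≫ β)) e) = filt (· ∉ Set.range γ') (pull β e) := by
      rw [← filt_pull (inj β)]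
      exact filt_congr (fun y => not_congr comp_mem_range) _
    have h5 : inversions (· ∈ Set.range (γ' ≫ β)) (filt (· ∈ Set.range β) e) =
        inversions (· ∈ Set.range γ') (pull β e) := by
      rw [← map_pull_filt (inj β), inversions_map]
      exact inversions_congr (fun y => comp_mem_range) _
    have h6 := gen_unshuffle_filt (m := m) β (· ∈ Set.range γ') (pull β e) (d.map (γ ≫ γ'))
      (filt (· ∉ Set.range β) e) x
    rw [h2, h4, h5, List.map_append, List.map_map, h3, pow_add, mul_smul]
    exact congrArg _ h6
  · rw [pushGen_not hf, LinearMap.zero_apply]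
    by_cases hf' : ∃ β : S' ⟶ T, γ ≫ β = α
    · obtain ⟨β, rfl⟩ := hf'
      rw [pushGen_fac, pushFac, LinearMap.smul_apply, map_smul, push_gen _ h.push, pushGen_not,
        LinearMap.zero_apply, smul_zero]
      rintro ⟨β', rfl⟩
      exact hf ⟨β', Category.assoc ..⟩
    · rw [pushGen_not hf', LinearMap.zero_apply, map_zero]

end Bar
end

noncomputable section
namespace Bar
open Opposite RTree
open scoped Classical DirectSum

variable {S S' S'' T T' U U' : RTree}
universe v
variable {R : Type v} [CommRing R]

theorem smul_gen_congr {N : RTreeᵒᵖ ⥤ Ch R} {m n : ℤ} (α : S ⟶ T) (d : List S.Edge)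
    (e : List T.Edge) {k : ℕ} {x y : ((N.obj (op T)).X n : Type v)} (h : x = y) :
    (-1 : R) ^ k • gen N m α d e x = (-1 : R) ^ k • gen N m α d e y := by rw [h]

/-- The total complex of the double complex of coinvariants at the tree `S`. -/
def complex (N : RTreeᵒᵖ ⥤ Ch R) (S : RTree) : Ch R where
  X m := ModuleCat.of R (Mod N S m)
  d i j := if j + 1 = i then ModuleCat.ofHom (D i j) else 0
  shape i j h := if_neg h
  d_comp_d' i j k hi hj := by
    rw [if_pos (show j + 1 = i from hi), if_pos (show k + 1 = j from hj), ← ModuleCat.ofHom_comp,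
      D_D hi]
    rfl

theorem complex_d (N : RTreeᵒᵖ ⥤ Ch R) (S : RTree) {i j : ℤ} (h : j + 1 = i) :
    (complex N S).d i j = ModuleCat.ofHom (D i j) := if_pos h

/-- The total complex as a covariant functor of the tree. -/
def total (N : RTreeᵒᵖ ⥤ Ch R) : RTree ⥤ Ch R where
  obj S := complex N S
  map γ :=
    { f := fun m => ModuleCat.ofHom (push m γ)
      comm' := fun i j h => by
        rw [complex_d N _ h, complex_d N _ h]
        exact (congrArg ModuleCat.ofHom (push_D h γ)).symm }
  map_id S := by
    ext1 m
    change ModuleCat.ofHom (push m (𝟙 S)) = _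
    rw [push_id]
    rfl
  map_comp γ γ' := by
    ext1 m
    change ModuleCat.ofHom (push m (γ ≫ γ')) = _
    rw [push_comp]
    rfl

section map
variable {N N' : RTreeᵒᵖ ⥤ Ch R} (f : N ⟶ N')

theorem app_naturality (g : S ⟶ T) {n : ℤ} (x : ((N.obj (op T)).X n : Type v)) :
    ((f.app (op S)).f n).hom (((N.map g.op).f n).hom x) =
      ((N'.map g.op).f n).hom (((f.app (op T)).f n).hom x) := by
  have h := congrArg (fun k => (k.f n).hom x) (f.naturality g.op)
  exact h

/-- Functoriality of the coinvariants in the presheaf. -/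
def mapMod (S : RTree) (m : ℤ) : Mod N S m →ₗ[R] Mod N' S m :=
  lift m (fun {T n} α d e => gen N' m α d e ∘ₗ ((f.app (op T)).f n).hom)
    (fun α d e θ x _ => by
      rw [LinearMap.comp_apply, LinearMap.comp_apply, ← gen_iso, app_naturality])
    (fun α d₁ d₂ a b e x _ => gen_swap_left α d₁ d₂ a b e _)
    (fun α d e₁ e₂ a b x _ => gen_swap_right α d e₁ e₂ a b _)

theorem mapMod_gen {m n : ℤ} {α : S ⟶ T} {d : List S.Edge} {e : List T.Edge}
    (h : Valid α d e n m) (x : ((N.obj (op T)).X n : Type v)) :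
    mapMod f S m (gen N m α d e x) = gen N' m α d e (((f.app (op T)).f n).hom x) :=
  lift_gen _ _ _ _ h x

theorem mapMod_D {i j : ℤ} (hij : j + 1 = i) (S : RTree) :
    mapMod f S j ∘ₗ D i j = D i j ∘ₗ mapMod f S i := by
  apply mod_hom_ext
  intro T n α d e h x
  rw [LinearMap.comp_apply, LinearMap.comp_apply, D_gen h, mapMod_gen f h, D_gen h, map_add]
  congr 1
  · rw [dExt, dExt, LinearMap.sum_apply, LinearMap.sum_apply, map_sum]
    refine Finset.sum_congr rfl fun y _ => ?_
    rw [LinearMap.smul_apply, LinearMap.smul_apply, map_smul, faceTerm, faceTerm,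
      LinearMap.comp_apply, LinearMap.comp_apply, mapMod_gen f (h.face hij y.2), app_naturality]
  · rw [dInt, dInt, LinearMap.smul_apply, LinearMap.smul_apply, map_smul, LinearMap.comp_apply,
      LinearMap.comp_apply, mapMod_gen f (h.int hij)]
    have h1 := congrArg (fun k => k.hom x) ((f.app (op T)).comm n (n - 1))
    exact smul_gen_congr _ _ _ h1.symm

theorem mapMod_push (m : ℤ) (γ : S ⟶ S') :
    mapMod f S' m ∘ₗ push m γ = push m γ ∘ₗ mapMod f S m := by
  apply mod_hom_ext
  intro T n α d e h x
  rw [LinearMap.comp_apply, LinearMap.comp_apply, push_gen γ h, mapMod_gen f h, push_gen γ h]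
  by_cases hf : ∃ β : S' ⟶ T, γ ≫ β = α
  · obtain ⟨β, rfl⟩ := hf
    rw [pushGen_fac, pushGen_fac, pushFac, pushFac, LinearMap.smul_apply, LinearMap.smul_apply,
      map_smul, mapMod_gen f h.push]
  · rw [pushGen_not hf, pushGen_not hf]
    exact map_zero _

/-- Functoriality of the total complex in the presheaf. -/
def totalMap : total N ⟶ total N' where
  app S :=
    { f := fun m => ModuleCat.ofHom (mapMod f S m)
      comm' := fun i j h => by
        change _ ≫ (complex N' S).d i j = (complex N S).d i j ≫ _
        rw [complex_d N _ h, complex_d N' _ h]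
        exact (congrArg ModuleCat.ofHom (mapMod_D f h S)).symm }
  naturality S S' γ := by
    ext1 m
    change ModuleCat.ofHom (push m γ) ≫ ModuleCat.ofHom (mapMod f S' m) =
      ModuleCat.ofHom (mapMod f S m) ≫ ModuleCat.ofHom (push m γ)
    rw [← ModuleCat.ofHom_comp, ← ModuleCat.ofHom_comp, mapMod_push]

end map

end Bar

open Opposite RTree
variable {R : Type u} [CommRing R]

/-- The bar construction of a presheaf `M` of chain complexes on trees: the total complex for the
suspended presheaf `sM`. In degree `m` it is spanned by the classes `(α : S ⟶ T, d | e, s x)` with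
`m = q + p + |s x|`. -/
abbrev Bar (M : RTreeᵒᵖ ⥤ Ch R) : RTree ⥤ Ch R := Bar.total (M ⋙ Ch.susp)

/-- Functoriality of the bar construction in the presheaf. -/
def Bar.map {M M' : RTreeᵒᵖ ⥤ Ch R} (f : M ⟶ M') : Bar M ⟶ Bar M' :=
  Bar.totalMap (Functor.whiskerRight f Ch.susp)

/-- The map `x ↦ (α, d | e, s x)` from `M(T)_n` to `Bar(M)(S)_m`, for `m = q + p + n + 1`. -/
def Bar.elt (M : RTreeᵒᵖ ⥤ Ch R) {S T : RTree} (α : S ⟶ T) (d : List S.Edge) (e : List T.Edge)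
    (n m : ℤ) : (M.obj (op T)).X n ⟶ ((Bar M).obj S).X m :=
  Ch.suspMap (M.obj (op T)) n (n + 1) rfl ≫ ModuleCat.ofHom (Bar.gen (M ⋙ Ch.susp) m α d e)

/-- A linear ∞-preoperad structure on the presheaf `M`: maps `θ : M(S ∘_a Q) ⟶ M(S) ⊗ M(Q)`, natural
in `S` and `Q`, which satisfy the two associativity conditions, for two leaves on different levels
(grafting `P` on a leaf `b` of `Q`, and `Q` on a leaf `a` of `S`) and for two leaves on the same
level (grafting `Q` and `P` on distinct leaves `a` and `b` of `S`). -/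
structure Preoperad (M : RTreeᵒᵖ ⥤ Ch R) : Type (u + 1) where
  θ : ∀ (S Q : RTree) (a : S.Leaf), M.obj (op (graft S Q a)) ⟶ M.obj (op S) ⊗ M.obj (op Q)
  naturality : ∀ {S S' Q Q' : RTree} (β : S ⟶ S') (γ : Q ⟶ Q') (a : S.Leaf),
    M.map (graftMap β γ a).op ≫ θ S Q a =
      θ S' Q' (leafMap β a) ≫ (M.map β.op ⊗ₘ M.map γ.op)
  assoc_sequential : ∀ (S Q P : RTree) (a : S.Leaf) (b : Q.Leaf),
    M.map (seqHom P a b).op ≫ θ (graft S Q a) P (inrLeaf a b) ≫ (θ S Q a ▷ M.obj (op P)) ≫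
        (α_ _ _ _).hom =
      θ S (graft Q P b) a ≫ (M.obj (op S) ◁ θ Q P b)
  assoc_parallel : ∀ (S Q P : RTree) (a b : S.Leaf) (h : b ≠ a),
    M.map (parHom Q P a b h).op ≫ θ (graft S Q a) P (inlLeaf Q a b h) ≫
        (θ S Q a ▷ M.obj (op P)) ≫ (α_ _ _ _).hom ≫
          (M.obj (op S) ◁ Ch.swap (M.obj (op Q)) (M.obj (op P))) =
      θ (graft S P b) Q (inlLeaf P b a h.symm) ≫ (θ S P b ▷ M.obj (op Q)) ≫ (α_ _ _ _).hom

/-- A linear ∞-operad: the structure maps are quasi-isomorphisms. -/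
def Preoperad.IsOperad {M : RTreeᵒᵖ ⥤ Ch R} (θ : Preoperad M) : Prop :=
  ∀ (S Q : RTree) (a : S.Leaf), QuasiIso (θ.θ S Q a)

/-- A morphism of presheaves which is compatible with the structure maps. -/
def Preoperad.IsHom {M M' : RTreeᵒᵖ ⥤ Ch R} (θ : Preoperad M) (θ' : Preoperad M') (f : M ⟶ M') :
    Prop :=
  ∀ (S Q : RTree) (a : S.Leaf), θ.θ S Q a ≫ (f.app (op S) ⊗ₘ f.app (op Q)) =
    f.app (op (graft S Q a)) ≫ θ'.θ S Q a

/-- A linear ∞-precooperad structure on the covariant functor `Y`: maps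
`Δ : Y(S ∘_a Q) ⟶ Y(S) ⊗ Y(Q)`, natural in `S` and `Q` and coassociative. -/
structure Precooperad (Y : RTree ⥤ Ch R) : Type (u + 1) where
  Δ : ∀ (S Q : RTree) (a : S.Leaf), Y.obj (graft S Q a) ⟶ Y.obj S ⊗ Y.obj Q
  naturality : ∀ {S S' Q Q' : RTree} (β : S ⟶ S') (γ : Q ⟶ Q') (a : S.Leaf),
    Y.map (graftMap β γ a) ≫ Δ S' Q' (leafMap β a) = Δ S Q a ≫ (Y.map β ⊗ₘ Y.map γ)
  coassoc_sequential : ∀ (S Q P : RTree) (a : S.Leaf) (b : Q.Leaf),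
    Δ (graft S Q a) P (inrLeaf a b) ≫ (Δ S Q a ▷ Y.obj P) ≫ (α_ _ _ _).hom =
      Y.map (seqHom P a b) ≫ Δ S (graft Q P b) a ≫ (Y.obj S ◁ Δ Q P b)
  coassoc_parallel : ∀ (S Q P : RTree) (a b : S.Leaf) (h : b ≠ a),
    Δ (graft S Q a) P (inlLeaf Q a b h) ≫ (Δ S Q a ▷ Y.obj P) ≫ (α_ _ _ _).hom ≫
        (Y.obj S ◁ Ch.swap (Y.obj Q) (Y.obj P)) =
      Y.map (parHom Q P a b h) ≫ Δ (graft S P b) Q (inlLeaf P b a h.symm) ≫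
        (Δ S P b ▷ Y.obj Q) ≫ (α_ _ _ _).hom

/-- A linear ∞-cooperad: the structure maps are quasi-isomorphisms. -/
def Precooperad.IsCooperad {Y : RTree ⥤ Ch R} (Δ : Precooperad Y) : Prop :=
  ∀ (S Q : RTree) (a : S.Leaf), QuasiIso (Δ.Δ S Q a)

/-- A morphism of functors which is compatible with the structure maps. -/
def Precooperad.IsHom {Y Y' : RTree ⥤ Ch R} (Δ : Precooperad Y) (Δ' : Precooperad Y')
    (f : Y ⟶ Y') : Prop :=
  ∀ (S Q : RTree) (a : S.Leaf), Δ.Δ S Q a ≫ (f.app S ⊗ₘ f.app Q) =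
    f.app (graft S Q a) ≫ Δ'.Δ S Q a

/-- The map `x ↦ ∑ ± (α, dS | eS, s x₁) ⊗ (β, dQ | eQ, s x₂)` for `θ(x) = ∑ x₁ ⊗ x₂`, with
the Koszul sign which is the product of `(-1)^(1 + |dS| + |eS| + |dQ| + |eQ| + |eS| |dQ|)`, of
`(-1)^|x₁|` for `(s ⊗ s) θ s⁻¹`, and of `(-1)^(|s x₁| (|dQ| + |eQ|))` for moving `s x₁`
past `(β, dQ | eQ)`. -/
def Bar.degraft {M : RTreeᵒᵖ ⥤ Ch R} (θ : Preoperad M) {S Q T U : RTree} (a : S.Leaf)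
    (α : S ⟶ T) (β : Q ⟶ U) (dS : List S.Edge) (eS : List T.Edge) (dQ : List Q.Edge)
    (eQ : List U.Edge) (n m : ℤ)
    (hm : (1 + dS.length + dQ.length : ℤ) + (eS.length + eQ.length) + (n + 1) = m) :
    (M.obj (op (graft T U (leafMap α a)))).X n ⟶ ((Bar M).obj S ⊗ (Bar M).obj Q).X m :=
  (θ.θ T U (leafMap α a)).f n ≫ Ch.desc (fun i j (h : i + j = n) =>
    (1 + dS.length + eS.length + dQ.length + eQ.length + eS.length * dQ.length +
        ((i + 1) * (dQ.length + eQ.length) + i) : ℤ).negOnePow •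
      ((Bar.elt M α dS eS i (dS.length + eS.length + (i + 1)) ⊗ₘ
          Bar.elt M β dQ eQ j (dQ.length + eQ.length + (j + 1))) ≫
        Ch.ι ((Bar M).obj S) ((Bar M).obj Q) _ _ m (by lia)))

end

/-! Coinvariants are removed first. A morphism of trees is determined by its values on leaves, so an
isomorphism between two morphisms out of `S` is unique. After one representative `α i : S ⟶ T i` of
each isomorphism class is chosen, together with enumerations of its missed edges and of the inner
edges of `S`, the graded module of the bar construction at `S` becomes a finite direct sum of
shifted copies of the `M(T i)` (`proj_gen_self`, `proj_gen_ne`, `sum_gen_proj`).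

A morphism out of `S ∘_a Q` sends `a` to an inner edge of its target. Cutting the target there shows
that the morphism is, up to isomorphism, `α ∘_a β` (`exists_graftMap`), and the isomorphism classes
of `α` and `β` are determined by it (`graftMap_factor`). Representatives for `S ∘_a Q` are therefore
pairs of representatives, and the formula for Δ on these pairs defines a map. The formula then holds
for all `α`, `β` and all enumerations (`elt_comulDeg`): θ is natural along isomorphisms, and a
permutation of one of the four lists produces the same sign on both sides.

The algebraic identities are checked on generators. An edge missed by `α ∘ β` is missed either by
`α` or by `β`, so the external differential of a generator splits as in the Leibniz rule, and
naturality of θ along faces makes Δ a chain map (`eltTensor_d`, `comulDeg_d`). Naturality in the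
trees is transparent for enumerations adapted to a factorisation (`elt_graft_push`,
`eltTensor_push`). Coassociativity reduces to the associativity of θ and to the signs for reordering
the blocks of the enumerations (`eltTensorLeft_associator`, `eltTensorLeft_swap`). Most of the
Koszul sign comparisons are congruences modulo 2 between polynomials in lengths and degrees;
`negOnePow_eq_of_zmod` moves them to `ZMod 2`.

For the quasi-isomorphism, summands are ranked by the number of missed edges. The external
differential lowers the rank and the internal one preserves it, so both sides of Δ are triangular,
with diagonal `±` the differential of `M(T ∘ U)`, respectively of `M(T) ⊗ M(U)`. The component of Δ
at a pair of representatives is θ for the two targets (`comulDeg_proj`), a quasi-isomorphism by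
assumption. Finitely many ranks occur, so descending induction on the rank in the mapping cone
concludes (`Ch.Splitting.quasiIso`). No flatness is needed, because the tensor product of the two
bar constructions is decomposed before homology is taken. -/

theorem negOnePow_eq_of_zmod {a b : ℤ} (h : (a : ZMod 2) = b) : a.negOnePow = b.negOnePow := by
  rw [Int.negOnePow_eq_iff, ← ZMod.intCast_eq_zero_iff_even, Int.cast_sub, h, sub_self]

/-! ### Elements of tensor products of chain complexes -/

noncomputable section
namespace Ch
variable {R : Type u} [CommRing R] {K L P K' L' P' : Ch R}

/-- The element `x ⊗ y` of the tensor product of two chain complexes. -/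
def tmul {i j : ℤ} (n : ℤ) (h : i + j = n) (x : K.X i) (y : L.X j) : ((K ⊗ L).X n : Type u) :=
  (ι K L i j n h).hom (x ⊗ₜ[R] y)

section tmul
variable {i j n : ℤ} (h : i + j = n)

theorem tmul_add (x : K.X i) (y y' : L.X j) :
    tmul n h x (y + y') = tmul n h x y + tmul n h x y' := by
  rw [tmul, TensorProduct.tmul_add, map_add]; rfl

theorem add_tmul (x x' : K.X i) (y : L.X j) :
    tmul n h (x + x') y = tmul n h x y + tmul n h x' y := by
  rw [tmul, TensorProduct.add_tmul, map_add]; rfl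

theorem tmul_smul (r : R) (x : K.X i) (y : L.X j) :
    tmul n h x (r • y) = r • tmul n h x y := by
  rw [tmul, TensorProduct.tmul_smul, map_smul]; rfl

theorem smul_tmul (r : R) (x : K.X i) (y : L.X j) :
    tmul n h (r • x) y = r • tmul n h x y := by
  rw [tmul, ← TensorProduct.smul_tmul', map_smul]; rfl

/-- The tensor product of elements as a bilinear map. -/
def tmulₗ (K L : Ch R) : K.X i →ₗ[R] L.X j →ₗ[R] (K ⊗ L).X n :=
  LinearMap.mk₂ R (tmul n h) (add_tmul h) (smul_tmul h) (tmul_add h) (tmul_smul h)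

theorem tmul_zero (x : K.X i) : tmul n h x (0 : L.X j) = 0 := (tmulₗ h K L x).map_zero
theorem zero_tmul (y : L.X j) : tmul n h (0 : K.X i) y = 0 := (tmulₗ h K L).map_zero₂ y

theorem tmul_units_smul (r : ℤˣ) (x : K.X i) (y : L.X j) :
    tmul n h x (r • y) = r • tmul n h x y := by
  obtain rfl | rfl := Int.units_eq_one_or r
  · simp
  · rw [Units.neg_smul, Units.neg_smul, one_smul, one_smul]
    exact (tmulₗ h K L x).map_neg y

theorem units_smul_tmul (r : ℤˣ) (x : K.X i) (y : L.X j) :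
    tmul n h (r • x) y = r • tmul n h x y := by
  obtain rfl | rfl := Int.units_eq_one_or r
  · simp
  · rw [Units.neg_smul, Units.neg_smul, one_smul, one_smul]
    exact (tmulₗ h K L).map_neg₂ x y

theorem tmul_sum {I : Type*} (s : Finset I) (x : K.X i) (y : I → L.X j) :
    tmul n h x (∑ k ∈ s, y k) = ∑ k ∈ s, tmul n h x (y k) := map_sum (tmulₗ h K L x) y s

theorem sum_tmul {I : Type*} (s : Finset I) (x : I → K.X i) (y : L.X j) :
    tmul n h (∑ k ∈ s, x k) y = ∑ k ∈ s, tmul n h (x k) y :=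
  (tmulₗ h K L).map_sum₂ s x y

end tmul

theorem hom_ext_tmul {n : ℤ} {V : ModuleCat.{u} R} {f g : (K ⊗ L).X n ⟶ V}
    (h : ∀ (i j : ℤ) (h : i + j = n) (x : K.X i) (y : L.X j),
      f.hom (tmul n h x y) = g.hom (tmul n h x y)) : f = g := by
  apply tensor_hom_ext
  intro i j hij
  ext1
  exact TensorProduct.ext' (h i j hij)

theorem linear_ext_tmul {n : ℤ} {V : Type u} [AddCommGroup V] [Module R V]
    {f g : ((K ⊗ L).X n : Type u) →ₗ[R] V}
    (h : ∀ (i j : ℤ) (h : i + j = n) (x : K.X i) (y : L.X j),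
      f (tmul n h x y) = g (tmul n h x y)) : f = g :=
  congrArg ModuleCat.Hom.hom
    (hom_ext_tmul (f := ModuleCat.ofHom f) (g := ModuleCat.ofHom g) h)

/-- For fixed `z` both sides are linear in the element of `K ⊗ L`, which may therefore be taken of
the form `x ⊗ y`. -/
theorem hom_ext_tmul₁₂ {n : ℤ} {V : ModuleCat.{u} R} {f g : ((K ⊗ L) ⊗ P).X n ⟶ V}
    (h : ∀ (i j ij k : ℤ) (hij : i + j = ij) (h : ij + k = n) (x : K.X i) (y : L.X j) (z : P.X k),
      f.hom (tmul n h (tmul ij hij x y) z) = g.hom (tmul n h (tmul ij hij x y) z)) : f = g := by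
  apply hom_ext_tmul
  intro a k hn u z
  have := linear_ext_tmul (f := f.hom ∘ₗ (tmulₗ hn (K ⊗ L) P).flip z)
    (g := g.hom ∘ₗ (tmulₗ hn (K ⊗ L) P).flip z) (fun i j hij x y => h i j a k hij hn x y z)
  exact LinearMap.congr_fun this u

theorem desc_tmul {n : ℤ} {V : ModuleCat.{u} R}
    (f : ∀ i j : ℤ, i + j = n → (K.X i ⊗ L.X j ⟶ V)) {i j : ℤ} (h : i + j = n)
    (x : K.X i) (y : L.X j) : (desc f).hom (tmul n h x y) = (f i j h).hom (x ⊗ₜ[R] y) :=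
  congrArg (fun k => k.hom (x ⊗ₜ[R] y)) (ι_desc f i j h)

theorem units_smul_hom_apply {V W : ModuleCat.{u} R} (r : ℤˣ) (f : V ⟶ W) (x : V) :
    (r • f).hom x = r • f.hom x := by
  obtain rfl | rfl := Int.units_eq_one_or r
  · simp
  · rw [Units.neg_smul, Units.neg_smul, one_smul, one_smul]
    rfl

theorem d_tmul {i j n : ℤ} (h : i + j = n) {i' j' m : ℤ} (hi : i' + 1 = i) (hj : j' + 1 = j)
    (hm : m + 1 = n) (x : K.X i) (y : L.X j) :
    ((K ⊗ L).d n m).hom (tmul n h x y) =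
      tmul m (by lia) ((K.d i i').hom x) y + i.negOnePow • tmul m (by lia) x ((L.d j j').hom y) := by
  have := congrArg (fun k => k.hom (x ⊗ₜ[R] y)) (ι_d K L i j i' j' n m h hi hj hm)
  refine this.trans ?_
  change ((K.d i i' ▷ L.X j) ≫ ι K L i' j m (by lia)).hom (x ⊗ₜ[R] y) +
    (i.negOnePow • ((K.X i ◁ L.d j j') ≫ ι K L i j' m (by lia))).hom (x ⊗ₜ[R] y) = _
  rw [units_smul_hom_apply]
  rfl

theorem map_tmul (f : K ⟶ K') (g : L ⟶ L') {i j n : ℤ} (h : i + j = n) (x : K.X i) (y : L.X j) :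
    ((f ⊗ₘ g).f n).hom (tmul n h x y) = tmul n h ((f.f i).hom x) ((g.f j).hom y) := by
  have := HomologicalComplex.ι_mapBifunctorMap f g (curriedTensor (ModuleCat.{u} R))
    (ComplexShape.down ℤ) i j n h
  have := congrArg (fun k => k.hom (x ⊗ₜ[R] y)) this
  exact this

theorem whiskerRight_tmul (f : K ⟶ K') (L : Ch R) {i j n : ℤ} (h : i + j = n) (x : K.X i)
    (y : L.X j) : ((f ▷ L).f n).hom (tmul n h x y) = tmul n h ((f.f i).hom x) y := by
  rw [← tensorHom_id, map_tmul]
  rfl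

theorem whiskerLeft_tmul (K : Ch R) (g : L ⟶ L') {i j n : ℤ} (h : i + j = n) (x : K.X i)
    (y : L.X j) : ((K ◁ g).f n).hom (tmul n h x y) = tmul n h x ((g.f j).hom y) := by
  rw [← id_tensorHom, map_tmul]
  rfl

/-- No sign appears: on triple summands the associator is the associator of modules. Only `swap`
introduces Koszul signs. -/
theorem associator_tmul {i j k ij jk n : ℤ} (hij : i + j = ij) (h : ij + k = n) (hjk : j + k = jk)
    (x : K.X i) (y : L.X j) (z : P.X k) :
    ((α_ K L P).hom.f n).hom (tmul n h (tmul ij hij x y) z) =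
      tmul n (by lia) x (tmul jk hjk y z) := by
  subst hij hjk
  have h1 := HomologicalComplex.ι_mapBifunctorAssociatorX_hom
    (curriedAssociatorNatIso (ModuleCat.{u} R)) K L P (ComplexShape.down ℤ) (ComplexShape.down ℤ)
    (ComplexShape.down ℤ) i j k n h
  have h2 := congrArg (fun f => f.hom ((x ⊗ₜ[R] y) ⊗ₜ[R] z)) h1
  refine Eq.trans ?_ (h2.trans ?_)
  · rw [HomologicalComplex.mapBifunctor₁₂.ι_eq _ _ _ _ _ _ _ i j k (i + j) n rfl h]
    rfl
  · rw [HomologicalComplex.mapBifunctor₂₃.ι_eq _ _ _ _ _ _ _ _ i j k (j + k) n rfl (by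
      change i + (j + k) = n
      lia)]
    rfl

theorem swap_tmul {i j n : ℤ} (h : i + j = n) (x : K.X i) (y : L.X j) :
    ((swap K L).f n).hom (tmul n h x y) =
      (i * j).negOnePow • tmul n (by lia) y x := by
  refine (desc_tmul _ h x y).trans ?_
  rw [units_smul_hom_apply]
  rfl

/-- The map `x ⊗ y ↦ σ(|x|, |y|) • u x ⊗ v y` for families of maps `u` of degree `s` and `v` of
degree `t`, and a sign `σ`. -/
def gtensor (σ : ℤ → ℤ → ℤˣ) (u : ∀ i j, K.X i ⟶ K'.X j) (v : ∀ i j, L.X i ⟶ L'.X j) (s t : ℤ)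
    {n m : ℤ} (h : s + t + n = m) : (K ⊗ L).X n ⟶ (K' ⊗ L').X m :=
  desc fun i j hij => σ i j • ((u i (s + i) ⊗ₘ v j (t + j)) ≫ ι K' L' (s + i) (t + j) m (by lia))

/-- The target degrees `a`, `b` are free variables with equations, so that the formula applies
directly in the degrees in which generators of the bar construction are written. -/
theorem gtensor_tmul (σ : ℤ → ℤ → ℤˣ) (u : ∀ i j, K.X i ⟶ K'.X j) (v : ∀ i j, L.X i ⟶ L'.X j)
    (s t : ℤ) {n m : ℤ} (h : s + t + n = m) {i j a b : ℤ} (hij : i + j = n) (ha : s + i = a)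
    (hb : t + j = b) (x : K.X i) (y : L.X j) :
    (gtensor σ u v s t h).hom (tmul n hij x y) =
      σ i j • tmul m (by lia) ((u i a).hom x) ((v j b).hom y) := by
  subst ha hb
  refine (desc_tmul _ hij x y).trans ?_
  rw [units_smul_hom_apply]
  rfl

end Ch
end

/-! ### Morphisms out of a tree are classified by sets of leaves -/

namespace RTree
variable {S T T' : RTree}

/-- The leaves of `S` whose images under `f` lie above the edge `y`. -/
def leafSet (f : S ⟶ T) (y : T.Edge) : Set S.Edge := {l | S.IsLeaf l ∧ f l ≤ y}

/-- Two edges with a common leaf above them are comparable (an edge lies above `y` when it is `≤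
y`). If the comparison goes the wrong way, the inclusion forces both edges to have the same leaves,
and then they are equal by `eq_of_leaves`. -/
theorem leafSet_subset {f : S ⟶ T} {y z : T.Edge} : leafSet f y ⊆ leafSet f z ↔ y ≤ z := by
  refine ⟨fun h => ?_, fun h l hl => ⟨hl.1, hl.2.trans h⟩⟩
  obtain ⟨l, hl, hly⟩ := exists_leaf_le y
  obtain ⟨k, hk, rfl⟩ := f.leaf_surj l hl
  rcases T.chain hly (h ⟨hk, hly⟩).2 with h1 | h1
  · exact h1
  · refine (eq_of_leaves fun m hm => ?_).le
    obtain ⟨j, hj, rfl⟩ := f.leaf_surj m hm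
    exact ⟨fun h2 => (h ⟨hj, h2⟩).2, fun h2 => h2.trans h1⟩

theorem leafSet_apply (f : S ⟶ T) (x : S.Edge) : leafSet f (f x) = {l | S.IsLeaf l ∧ l ≤ x} := by
  ext l
  exact and_congr_right fun _ => le_iff f

/-- An edge of `T` goes to the edge of `T'` with the same set of leaves. Since inclusion of leaf
sets is the order of the edges, this is an order embedding. -/
theorem exists_hom_of_leafSet {f : S ⟶ T} {g : S ⟶ T'}
    (h : Set.range (leafSet f) ⊆ Set.range (leafSet g)) : ∃ k : T ⟶ T', f ≫ k = g := by
  choose k hk using fun y => h ⟨y, rfl⟩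
  have hle : ∀ y z, k y ≤ k z ↔ y ≤ z := fun y z => by
    rw [← leafSet_subset (f := g), hk, hk, leafSet_subset]
  have hf : ∀ x, k (f x) = g x := fun x => by
    have : leafSet g (k (f x)) = leafSet g (g x) := by rw [hk, leafSet_apply, leafSet_apply]
    exact le_antisymm (leafSet_subset.1 this.le) (leafSet_subset.1 this.ge)
  refine ⟨⟨OrderEmbedding.ofMapLEIff k hle, ?_, ?_, ?_⟩, hom_ext hf⟩
  · refine (congrArg k f.map_root.symm).trans ((hf _).trans g.map_root)
  · intro y hy
    obtain ⟨x, hx, rfl⟩ := f.leaf_surj y hy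
    have h1 := g.map_leaf x hx
    rw [← show k (f x) = g x from hf x] at h1
    exact h1
  · intro y hy
    obtain ⟨x, hx, rfl⟩ := g.leaf_surj y hy
    exact ⟨f x, f.map_leaf x hx, hf x⟩

theorem exists_iso_of_leafSet {f : S ⟶ T} {g : S ⟶ T'}
    (h : Set.range (leafSet f) = Set.range (leafSet g)) : ∃ k : T ≅ T', f ≫ k.hom = g := by
  obtain ⟨k, hk⟩ := exists_hom_of_leafSet h.le
  obtain ⟨l, hl⟩ := exists_hom_of_leafSet h.ge
  exact ⟨⟨k, l, epi_ext f (by rw [← Category.assoc, hk, hl, Category.comp_id]),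
    epi_ext g (by rw [← Category.assoc, hl, hk, Category.comp_id])⟩, hk⟩

theorem range_leafSet_iso (f : S ⟶ T) (k : T ≅ T') :
    Set.range (leafSet (f ≫ k.hom)) = Set.range (leafSet f) := by
  have h : ∀ y, leafSet (f ≫ k.hom) (k.hom y) = leafSet f y := fun y => by
    ext l
    exact and_congr_right fun _ => le_iff k.hom
  ext s
  constructor
  · rintro ⟨y, rfl⟩
    exact ⟨k.inv y, by rw [← h, range_iso]⟩
  · rintro ⟨y, rfl⟩
    exact ⟨k.hom y, h y⟩

end RTree

/-! ### Signs of permutations of lists of edges -/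

/-- The number of inversions of a list of natural numbers. -/
def listInv : List ℕ → ℕ
  | [] => 0
  | x :: l => l.countP (fun y => decide (y < x)) + listInv l

/-- The pair `(a, b)` is an inversion in exactly one of the two orders, and every other pair keeps
its relative order. -/
theorem listInv_swap {a b : ℕ} (h : a ≠ b) (l₁ l₂ : List ℕ) :
    (listInv (l₁ ++ a :: b :: l₂) + listInv (l₁ ++ b :: a :: l₂)) % 2 = 1 := by
  induction l₁ with
  | nil =>
    simp only [List.nil_append, listInv, List.countP_cons]
    rcases h.lt_or_gt with h | h
    · simp only [h, h.not_gt, decide_true, decide_false]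
      simp
      omega
    · simp only [h, h.not_gt, decide_true, decide_false]
      simp
      omega
  | cons c l ih =>
    have : (l ++ a :: b :: l₂).countP (fun y => decide (y < c)) =
        (l ++ b :: a :: l₂).countP (fun y => decide (y < c)) :=
      (List.Perm.append_left l (List.Perm.swap b a l₂)).countP_eq _
    simp only [List.cons_append, listInv, this]
    omega

/-- The position of an edge in the chosen labelling of the edges. -/
def RTree.edgeIndex {T : RTree} (x : T.Edge) : ℕ := Fin.val (n := T.card) x

theorem RTree.edgeIndex_injective {T : RTree} : Function.Injective (edgeIndex (T := T)) :=
  Fin.val_injective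

open RTree in
/-- The sign of a list of edges: the parity of its number of inversions. -/
def edgeSign {T : RTree} (l : List T.Edge) : ℤˣ := (-1) ^ listInv (l.map edgeIndex)

open RTree in
theorem edgeSign_swap {T : RTree} {a b : T.Edge} (h : a ≠ b) (l₁ l₂ : List T.Edge) :
    edgeSign (l₁ ++ a :: b :: l₂) = - edgeSign (l₁ ++ b :: a :: l₂) := by
  have h1 := listInv_swap (edgeIndex_injective.ne h) (l₁.map edgeIndex) (l₂.map edgeIndex)
  rw [edgeSign, edgeSign, List.map_append, List.map_append, List.map_cons, List.map_cons,
    List.map_cons, List.map_cons]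
  rcases Nat.even_or_odd (listInv (l₁.map edgeIndex ++
    edgeIndex b :: edgeIndex a :: l₂.map edgeIndex)) with h2 | h2
  · rw [h2.neg_one_pow, Odd.neg_one_pow]
    rw [Nat.even_iff] at h2
    rw [Nat.odd_iff]
    omega
  · rw [h2.neg_one_pow, Even.neg_one_pow, neg_neg]
    rw [Nat.odd_iff] at h2
    rw [Nat.even_iff]
    omega

theorem units_mul_self (s : ℤˣ) : s * s = 1 := Int.units_mul_self s

/-- A function of lists which changes its sign under transpositions of adjacent entries. -/
def Alternating {X V : Type*} [AddCommGroup V] (F : List X → V) : Prop :=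
  ∀ l₁ l₂ a b, F (l₁ ++ a :: b :: l₂) = - F (l₁ ++ b :: a :: l₂)

/-- Serves to permute one block of a list such as `(a, d_S, d_Q)` while the blocks `p` and `r`
around it stay fixed. -/
theorem Alternating.comp {X Y V : Type*} [AddCommGroup V] {F : List Y → V} (hF : Alternating F)
    (f : X → Y) (p r : List Y) : Alternating fun l => F (p ++ (l.map f ++ r)) := by
  intro l₁ l₂ a b
  have := hF (p ++ l₁.map f) (l₂.map f ++ r) (f a) (f b)
  simpa using this

/-- Induction on the permutation, with an arbitrary prefix `l₀` so that a common first entry can be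
absorbed into it. The entries must be distinct: exchanging equal neighbours negates the value of `F`
but does not change `edgeSign`. -/
theorem Alternating.perm {T : RTree} {V : Type*} [AddCommGroup V] {F : List T.Edge → V}
    (hF : Alternating F)
    {l l' : List T.Edge} (h : l.Perm l') (hl : l.Nodup) :
    F l = (edgeSign l * edgeSign l') • F l' := by
  have key : ∀ l₀ : List T.Edge, (l₀ ++ l).Nodup →
      F (l₀ ++ l) = (edgeSign (l₀ ++ l) * edgeSign (l₀ ++ l')) • F (l₀ ++ l') := by
    clear hl
    induction h with
    | nil => intro l₀ _; rw [units_mul_self, one_smul]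
    | cons x _ ih =>
      intro l₀ h0
      have := ih (l₀ ++ [x]) (by simpa using h0)
      simpa using this
    | swap x y l =>
      intro l₀ h0
      have hxy : y ≠ x := by
        rintro rfl
        exact (List.nodup_cons.1 (List.nodup_append.1 h0).2.1).1 List.mem_cons_self
      rw [hF, edgeSign_swap hxy, neg_mul, units_mul_self, Units.neg_smul, one_smul]
    | trans h1 h2 ih1 ih2 =>
      intro l₀ h0
      rw [ih1 l₀ h0, ih2 l₀ ((h1.append_left l₀).nodup_iff.1 h0), smul_smul]
      congr 1
      rw [mul_assoc, ← mul_assoc (edgeSign _) (edgeSign _) (edgeSign _), units_mul_self, one_mul]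
  exact key [] hl

/-! ### The bar construction as a direct sum over isomorphism classes -/

noncomputable section
namespace Bar
open Opposite RTree
open scoped Classical

variable {S T T' : RTree}

theorem IsEnum.perm {X : Type} {l l' : List X} {s : Set X} (h : IsEnum l s) (h' : IsEnum l' s) :
    l.Perm l' :=
  (List.perm_ext_iff_of_nodup h.1 h'.1).2 fun x => (h.2 x).trans (h'.2 x).symm

theorem exists_isEnum {X : Type} [Fintype X] (s : Set X) : ∃ l : List X, IsEnum l s :=
  ⟨(Finset.univ.filter (· ∈ s)).toList, Finset.nodup_toList _, fun x => by simp⟩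

/-- A complete system of representatives for the isomorphism classes of morphisms `S ⟶ T`, with
an enumeration of the edges of `T` which are not in the image. -/
structure Reps (S : RTree) : Type 1 where
  I : Type
  fin : Fintype I
  T : I → RTree
  α : ∀ i, S ⟶ T i
  e : ∀ i, List (T i).Edge
  enum : ∀ i, IsEnum (e i) (Set.range (α i))ᶜ
  exists_iso : ∀ {X : RTree} (f : S ⟶ X), ∃ i, ∃ k : T i ≅ X, α i ≫ k.hom = f
  unique : ∀ (i j : I) (k : T i ≅ T j), α i ≫ k.hom = α j → i = j

attribute [instance] Reps.fin

/-- Representatives for the isomorphism classes of morphisms out of `S`, chosen through the sets of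
leaves above the edges. -/
def Reps.canonical (S : RTree) : Reps S where
  I := {C : Set (Set S.Edge) // ∃ (T : RTree) (f : S ⟶ T), Set.range (leafSet f) = C}
  -- Finite, being a subtype of the sets of sets of edges of the finite tree `S`.
  fin := Fintype.ofFinite _
  T i := i.2.choose
  α i := i.2.choose_spec.choose
  e i := (exists_isEnum (Set.range i.2.choose_spec.choose)ᶜ).choose
  enum i := (exists_isEnum (Set.range i.2.choose_spec.choose)ᶜ).choose_spec
  exists_iso {X} f := by
    let i : {C : Set (Set S.Edge) // ∃ (T : RTree) (f : S ⟶ T), Set.range (leafSet f) = C} :=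
      ⟨Set.range (leafSet f), X, f, rfl⟩
    exact ⟨i, exists_iso_of_leafSet i.2.choose_spec.choose_spec⟩
  unique i j k h := by
    apply Subtype.ext
    rw [← i.2.choose_spec.choose_spec, ← j.2.choose_spec.choose_spec, ← h, range_leafSet_iso]

universe v
variable {R : Type v} [CommRing R] {N : RTreeᵒᵖ ⥤ Ch R}

theorem map_units_smul' {V W : Type*} [AddCommGroup V] [AddCommGroup W] {F : Type*} [FunLike F V W]
    [AddMonoidHomClass F V W] (f : F) (s : ℤˣ) (x : V) : f (s • x) = s • f x := by
  obtain rfl | rfl := Int.units_eq_one_or s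
  · simp
  · simp [Units.neg_smul]

theorem neg_one_pow_smul {V : Type*} [AddCommGroup V] [Module R V] (k : ℕ) (x : V) :
    (-1 : R) ^ k • x = (k : ℤ).negOnePow • x := by
  rcases Nat.even_or_odd k with h | h
  · rw [h.neg_one_pow, Int.negOnePow_even _ (by exact_mod_cast h), one_smul, one_smul]
  · rw [h.neg_one_pow, Int.negOnePow_odd _ (by exact_mod_cast h), neg_smul, Units.neg_smul,
      one_smul, one_smul]

theorem gen_perm {m n : ℤ} (α : S ⟶ T) {d d' : List S.Edge} {e e' : List T.Edge} (hd : d.Perm d')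
    (hd1 : d.Nodup) (he : e.Perm e') (he1 : e.Nodup) (x : ((N.obj (op T)).X n : Type v)) :
    gen N m α d e x =
      ((edgeSign d * edgeSign d') * (edgeSign e * edgeSign e')) • gen N m α d' e' x := by
  have h1 : Alternating fun d => gen N m α d e x := fun _ _ _ _ => gen_swap_left _ _ _ _ _ _ _
  have h2 : Alternating fun e => gen N m α d' e x := fun _ _ _ _ => gen_swap_right _ _ _ _ _ _ _
  rw [h1.perm hd hd1, h2.perm he he1, smul_smul]

/-- The identification of the modules of a complex in equal degrees (zero in different degrees). -/
def degCast (K : Ch R) (n n' : ℤ) : (K.X n : Type v) →ₗ[R] K.X n' :=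
  if h : n = n' then (K.XIsoOfEq h).hom.hom else 0

theorem degCast_self (K : Ch R) (n : ℤ) (x : K.X n) : degCast K n n x = x := by
  rw [degCast, dif_pos rfl]
  rfl

variable (N) in
/-- The value on `(α, d | e, x)` of the projection to the summand of the representative `α i`. -/
def projGen (P : Reps S) (d₀ : List S.Edge) (i : P.I) (n' : ℤ) {n : ℤ} (α : S ⟶ T)
    (d : List S.Edge) (e : List T.Edge) :
    ((N.obj (op T)).X n : Type v) →ₗ[R] (N.obj (op (P.T i))).X n' :=
  if h : ∃ k : P.T i ≅ T, P.α i ≫ k.hom = α then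
    ((edgeSign d * edgeSign d₀) * (edgeSign (e.map h.choose.inv) * edgeSign (P.e i))) •
      (degCast _ n n' ∘ₗ ((N.map h.choose.hom.op).f n).hom)
  else 0

/-- The isomorphism chosen in `projGen` is the only possible one, because morphisms of trees are
epimorphisms (`epi_ext`). -/
theorem projGen_fac (P : Reps S) (d₀ : List S.Edge) (i : P.I) (n' : ℤ) {n : ℤ}
    (d : List S.Edge) (e : List T.Edge) (k : P.T i ≅ T) (x : ((N.obj (op T)).X n : Type v)) :
    projGen N P d₀ i n' (P.α i ≫ k.hom) d e x =
    ((edgeSign d * edgeSign d₀) * (edgeSign (e.map k.inv) * edgeSign (P.e i))) •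
      (degCast _ n n' (((N.map k.hom.op).f n).hom x)) := by
  have h : ∃ k' : P.T i ≅ T, P.α i ≫ k'.hom = P.α i ≫ k.hom := ⟨k, rfl⟩
  have h1 : h.choose = k := Iso.ext (epi_ext _ h.choose_spec)
  rw [projGen, dif_pos h, h1]
  rfl

theorem projGen_not {P : Reps S} {d₀ : List S.Edge} {i : P.I} {n' : ℤ} {n : ℤ} {α : S ⟶ T}
    {d : List S.Edge} {e : List T.Edge} (h : ¬ ∃ k : P.T i ≅ T, P.α i ≫ k.hom = α) :
    projGen N P d₀ i n' (n := n) α d e = 0 := dif_neg h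

theorem ne_of_valid_left {m n : ℤ} {α : S ⟶ T} {d₁ d₂ : List S.Edge} {a b : S.Edge}
    {e : List T.Edge} (h : Valid α (d₁ ++ a :: b :: d₂) e n m) : a ≠ b := by
  rintro rfl
  exact (List.nodup_cons.1 (List.nodup_append.1 h.1.1).2.1).1 List.mem_cons_self

theorem ne_of_valid_right {m n : ℤ} {α : S ⟶ T} {d : List S.Edge} {a b : T.Edge}
    {e₁ e₂ : List T.Edge} (h : Valid α d (e₁ ++ a :: b :: e₂) n m) : a ≠ b := by
  rintro rfl
  exact (List.nodup_cons.1 (List.nodup_append.1 h.2.1.1).2.1).1 List.mem_cons_self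

/-- The projection to the summand of the representative `α i`. -/
def proj (P : Reps S) (d₀ : List S.Edge) (i : P.I) (m n' : ℤ) :
    Mod N S m →ₗ[R] (N.obj (op (P.T i))).X n' :=
  lift m (fun α d e => projGen N P d₀ i n' α d e)
    (by
      intro T T' n α d e θ x _
      by_cases h : ∃ k : P.T i ≅ T, P.α i ≫ k.hom = α
      · obtain ⟨k, rfl⟩ := h
        have h1 : (P.α i ≫ k.hom) ≫ θ.hom = P.α i ≫ (k ≪≫ θ).hom := Category.assoc ..
        rw [h1, projGen_fac, projGen_fac, map_comp_apply', List.map_map]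
        congr 5
        funext y
        exact congrArg k.inv (iso_range θ y).symm
      · rw [projGen_not h, projGen_not]
        · rfl
        · rintro ⟨k, hk⟩
          exact h ⟨k ≪≫ θ.symm, by simp [reassoc_of% hk]⟩)
    (by
      intro T n α d₁ d₂ a b e x hv
      by_cases h : ∃ k : P.T i ≅ T, P.α i ≫ k.hom = α
      · obtain ⟨k, rfl⟩ := h
        rw [projGen_fac, projGen_fac, edgeSign_swap (ne_of_valid_left hv), neg_mul, neg_mul,
          Units.neg_smul]
      · rw [projGen_not h, projGen_not h]
        simp)
    (by
      intro T n α d e₁ e₂ a b x hv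
      by_cases h : ∃ k : P.T i ≅ T, P.α i ≫ k.hom = α
      · obtain ⟨k, rfl⟩ := h
        rw [projGen_fac, projGen_fac, List.map_append, List.map_append, List.map_cons,
          List.map_cons, List.map_cons, List.map_cons,
          edgeSign_swap ((inj k.inv).ne (ne_of_valid_right hv)), neg_mul, mul_neg,
          Units.neg_smul]
      · rw [projGen_not h, projGen_not h]
        simp)

theorem Reps.valid (P : Reps S) {d₀ : List S.Edge} (hd : IsEnum d₀ {x | S.IsInner x}) (i : P.I)
    {n m : ℤ} (hm : (d₀.length : ℤ) + (P.e i).length + n = m) : Valid (P.α i) d₀ (P.e i) n m :=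
  ⟨hd, P.enum i, hm⟩

/-- The isomorphism of the representative with itself is the identity, and each permutation sign
occurs squared. -/
theorem proj_gen_self (P : Reps S) {d₀ : List S.Edge} (hd : IsEnum d₀ {x | S.IsInner x}) (i : P.I)
    {n m : ℤ} (hm : (d₀.length : ℤ) + (P.e i).length + n = m)
    (x : ((N.obj (op (P.T i))).X n : Type v)) :
    proj P d₀ i m n (gen N m (P.α i) d₀ (P.e i) x) = x := by
  have h1 : gen N m (P.α i) d₀ (P.e i) x = gen N m (P.α i ≫ 𝟙 _) d₀ (P.e i) x := by
    rw [Category.comp_id]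
  rw [h1]
  have hv := P.valid hd i hm
  rw [← Category.comp_id (P.α i)] at hv
  refine (lift_gen _ _ _ _ hv x).trans ((projGen_fac P d₀ i n d₀ (P.e i) (Iso.refl _) x).trans ?_)
  have h2 : (P.e i).map (Iso.refl (P.T i)).inv = P.e i := List.map_id _
  rw [h2, units_mul_self, units_mul_self, one_mul, one_smul, degCast_self]
  have h3 := N.map_id (op (P.T i))
  exact congrArg (fun f => (f.f n).hom x) h3

theorem proj_gen_ne (P : Reps S) {d₀ : List S.Edge} (hd : IsEnum d₀ {x | S.IsInner x}) {i j : P.I}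
    (hij : i ≠ j) {n n' m : ℤ} (x : ((N.obj (op (P.T j))).X n : Type v)) :
    proj P d₀ i m n' (gen N m (P.α j) d₀ (P.e j) x) = 0 := by
  by_cases hm : (d₀.length : ℤ) + (P.e j).length + n = m
  · refine (lift_gen _ _ _ _ (P.valid hd j hm) x).trans ?_
    rw [projGen_not]
    · rfl
    · rintro ⟨k, hk⟩
      exact hij (P.unique _ _ k hk)
  · rw [gen_of_not (fun h => hm h.2.2), map_zero]

/-- Any generator is carried to its representative by an isomorphism and by permutations of its two
lists, and `projGen` records exactly the resulting sign and pullback. The degree `m - |d₀| - |e i|`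
is the only one in which the representative is admissible in total degree `m`. With `proj_gen_self`
and `proj_gen_ne` this gives the direct sum decomposition. -/
theorem sum_gen_proj (P : Reps S) {d₀ : List S.Edge} (hd : IsEnum d₀ {x | S.IsInner x}) {m : ℤ}
    (z : Mod N S m) :
    ∑ i, gen N m (P.α i) d₀ (P.e i) (proj P d₀ i m (m - d₀.length - (P.e i).length) z) = z := by
  suffices h : ∑ i, gen N m (P.α i) d₀ (P.e i) ∘ₗ proj P d₀ i m (m - d₀.length - (P.e i).length) =
      LinearMap.id by
    have := LinearMap.congr_fun h z
    simpa using this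
  apply mod_hom_ext
  intro T n α d e hv x
  obtain ⟨i, k, rfl⟩ := P.exists_iso α
  rw [LinearMap.sum_apply, Finset.sum_eq_single i]
  · have h1 : proj P d₀ i m (m - d₀.length - (P.e i).length) (gen N m (P.α i ≫ k.hom) d e x) =
      _ := (lift_gen _ _ _ _ hv x).trans (projGen_fac P d₀ i _ d e k x)
    have he : (e.map k.inv).map k.hom = e := by
      rw [List.map_map]
      exact (List.map_congr_left fun y _ => range_iso k y).trans (List.map_id _)
    have he2 : IsEnum (e.map k.inv) (Set.range (P.α i))ᶜ := by
      have := hv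
      rw [← he, valid_iso] at this
      exact this.2.1
    have hl := he2.perm (P.enum i)
    have hd2 := hv.1.perm hd
    have hn : m - d₀.length - (P.e i).length = n := by
      have h2 := hl.length_eq
      rw [List.length_map] at h2
      have h3 := hd2.length_eq
      have := hv.2.2
      omega
    rw [LinearMap.comp_apply, h1, map_units_smul', LinearMap.id_apply]
    conv_rhs => rw [← he, ← gen_iso, gen_perm (P.α i) hd2 hv.1.1 hl he2.1]
    rw [hn, degCast_self]
  · intro j _ hj
    rw [LinearMap.comp_apply]
    have h1 : proj P d₀ j m (m - d₀.length - (P.e j).length) (gen N m (P.α i ≫ k.hom) d e x) =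
      _ := lift_gen _ _ _ _ hv x
    rw [h1, projGen_not, LinearMap.zero_apply, map_zero]
    rintro ⟨l, hl⟩
    exact hj (P.unique _ _ (l ≪≫ k.symm) (by simp [reassoc_of% hl]))
  · intro h
    exact absurd (Finset.mem_univ i) h

end Bar
end

/-! ### Cutting a tree at an inner edge; morphisms out of a grafting -/

namespace RTree
variable {S S' S'' T T' U U' Q Q' Q'' X : RTree}

/-- The upper part of `X` after a cut at `y`. It is closed under going up, so the inputs of its
vertices are the same as in `X`. -/
theorem isReducedTree_Iic (X : RTree) (y : X.Edge) (hy : ¬ X.IsLeaf y) :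
    IsReducedTree {x : X.Edge // x ≤ y} where
  exists_root := ⟨⟨y, le_rfl⟩, fun x => x.2⟩
  exists_vertex := ⟨⟨y, le_rfl⟩, fun h => hy fun b hb => h (b := ⟨b, hb⟩) hb⟩
  chain x u v h h' := X.chain h h'
  branching := by
    rintro ⟨v, hv⟩ hm
    obtain ⟨x, z, hx, hz, hne⟩ := X.isReducedTree.branching v (fun h => hm fun b hb => h hb)
    exact ⟨⟨x, hx.le.trans hv⟩, ⟨z, hz.le.trans hv⟩, ⟨hx.lt, fun c h1 h2 => hx.2 (c := c.1) h1 h2⟩,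
      ⟨hz.lt, fun c h1 h2 => hz.2 (c := c.1) h1 h2⟩, fun h => hne (congrArg Subtype.val h)⟩

/-- The lower part of `X` after a cut at `y`, with `y` as a new leaf. It still has a vertex because
`y` is not the root. -/
theorem isReducedTree_not_lt (X : RTree) (y : X.Edge) (hy : y ≠ X.root) :
    IsReducedTree {x : X.Edge // ¬ x < y} where
  exists_root := ⟨⟨X.root, fun h => h.not_ge (X.le_root y)⟩, fun x => X.le_root x.1⟩
  exists_vertex := ⟨⟨X.root, fun h => h.not_ge (X.le_root y)⟩, fun h =>
    hy (eq_root_of_le (h (b := ⟨y, lt_irrefl y⟩) (X.le_root y)))⟩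
  chain x u v h h' := X.chain h h'
  branching := by
    rintro ⟨v, hv⟩ hm
    obtain ⟨x, z, hx, hz, hne⟩ := X.isReducedTree.branching v (fun h => hm fun b hb => h hb)
    -- An input `x` of `v` strictly above `y` would make `v` and `y` comparable. Then `y < v`
    -- contradicts the covering, `v < y` is excluded, and `v = y` is minimal in the lower part.
    have key : ∀ x, x ⋖ v → ¬ x < y := by
      intro x hx hxy
      have hvy : v ≠ y := by
        rintro rfl
        apply hm
        rintro ⟨b, hb⟩ (hbv : b ≤ v)
        exact (hbv.eq_or_lt.resolve_right hb).ge
      rcases X.chain hxy.le hx.le with h | h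
      · exact hx.2 hxy (h.lt_of_ne hvy.symm)
      · exact hv (h.lt_of_ne hvy)
    exact ⟨⟨x, key x hx⟩, ⟨z, key z hz⟩, ⟨hx.lt, fun c h1 h2 => hx.2 (c := c.1) h1 h2⟩,
      ⟨hz.lt, fun c h1 h2 => hz.2 (c := c.1) h1 h2⟩, fun h => hne (congrArg Subtype.val h)⟩

theorem exists_iso_of_surjective (f : S ⟶ T) (hf : Function.Surjective f) :
    ∃ k : S ≅ T, k.hom = f := by
  obtain ⟨k, hk⟩ := exists_iso f (𝟙 T) (hf.range_eq.trans
    (Function.Surjective.range_eq (f := (𝟙 T : T ⟶ T)) fun y => ⟨y, rfl⟩).symm)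
  exact ⟨k, by rw [← hk, Category.comp_id]⟩

open scoped Classical in
/-- Every tree is obtained by grafting at any of its inner edges. -/
theorem exists_graft_iso (X : RTree) (y : X.Edge) (hy : X.IsInner y) :
    ∃ (T U : RTree) (b : T.Leaf) (φ : graft T U b ≅ X), φ.hom (inl U b b.1) = y := by
  let hT := isReducedTree_not_lt X y hy.2
  let hU := isReducedTree_Iic X y hy.1
  let f : (ofPoset _ hT).Edge → X.Edge := fun t => (edgeIso _ hT t).1
  let g : (ofPoset _ hU).Edge → X.Edge := fun t => (edgeIso _ hU t).1
  have hff : ∀ s s', f s ≤ f s' ↔ s ≤ s' := fun s s' => (edgeIso _ hT).le_iff_le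
  have hgg : ∀ s s', g s ≤ g s' ↔ s ≤ s' := fun s s' => (edgeIso _ hU).le_iff_le
  have hfs : ∀ x, ¬ x < y → ∃ s, f s = x := fun x hx => ⟨(edgeIso _ hT).symm ⟨x, hx⟩,
    congrArg Subtype.val ((edgeIso _ hT).apply_symm_apply _)⟩
  have hgs : ∀ x, x ≤ y → ∃ s, g s = x := fun x hx => ⟨(edgeIso _ hU).symm ⟨x, hx⟩,
    congrArg Subtype.val ((edgeIso _ hU).apply_symm_apply _)⟩
  have hfn : ∀ s, ¬ f s < y := fun s => (edgeIso _ hT s).2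
  have hgl : ∀ s, g s ≤ y := fun s => (edgeIso _ hU s).2
  obtain ⟨b, hb⟩ := hfs y (lt_irrefl y)
  obtain ⟨r, hr⟩ := hgs y le_rfl
  have hr' : r = (ofPoset _ hU).root := by
    refine eq_root_of_le ((hgg _ _).1 ?_)
    rw [hr]
    exact hgl _
  have hbl : (ofPoset _ hT).IsLeaf b := fun c hc => by
    rw [← hff, hb] at hc ⊢
    exact (hc.eq_or_lt.resolve_right (hfn c)).ge
  have hgi : Function.Injective g := fun s s' h => le_antisymm ((hgg _ _).1 h.le) ((hgg _ _).1 h.ge)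
  have hfi : Function.Injective f := fun s s' h => le_antisymm ((hff _ _).1 h.le) ((hff _ _).1 h.ge)
  -- The two inclusions agree where the parts are glued: the leaf `b` and the root of the upper part
  -- both go to `y`.
  let φ : graft (ofPoset _ hT) (ofPoset _ hU) ⟨b, hbl⟩ ⟶ X := graftDesc f g hff hgg
    (fun u s => by
      rw [← hff, hb]
      refine ⟨fun h => ?_, fun h => (hgl u).trans h⟩
      rcases X.chain h (hgl u) with h1 | h1
      · exact (h1.eq_or_lt.resolve_right (hfn s)).ge
      · exact h1)
    (fun s u => by
      constructor
      · intro h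
        have h1 := (h.trans (hgl u)).eq_or_lt.resolve_right (hfn s)
        refine ⟨hfi (h1.trans hb.symm), ?_⟩
        rw [← hr']
        exact hgi (hr ▸ le_antisymm (hgl u) (h1 ▸ h))
      · rintro ⟨rfl, rfl⟩
        rw [hb, ← hr', hr])
    (by
      obtain ⟨s, hs⟩ := hfs X.root (fun h => h.not_ge (X.le_root y))
      refine eq_root_of_le ?_
      rw [← hs]
      exact (hff _ _).2 (le_root _ _))
    (fun s hs hsb x hx => by
      by_cases hxy : x < y
      · rcases X.chain hx hxy.le with h | h
        · exact absurd (hfi ((h.eq_or_lt.resolve_right (hfn s)).trans hb.symm)) hsb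
        · rw [← hb] at h
          exact absurd (le_antisymm ((hff _ _).1 h) (hs ((hff _ _).1 h))).symm hsb
      · obtain ⟨x, rfl⟩ := hfs x hxy
        exact (hff _ _).2 (hs ((hff _ _).1 hx)))
    (fun u hu x hx => by
      obtain ⟨x, rfl⟩ := hgs x (hx.trans (hgl u))
      exact (hgg _ _).2 (hu ((hgg _ _).1 hx)))
    (fun x _ => by
      by_cases hxy : x < y
      · exact Or.inr (hgs x hxy.le)
      · exact Or.inl (hfs x hxy))
  have h1 : ∀ s, φ (inl _ _ s) = f s := fun s => graftElim_inl _ _ _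
  have h2 : ∀ s, φ (inr _ s) = g s := fun s => graftElim_inr f g
    (show f b = g (ofPoset _ hU).root by rw [← hr', hr, hb]) _
  obtain ⟨k, hk⟩ := exists_iso_of_surjective φ fun x => by
    by_cases hxy : x < y
    · obtain ⟨u, hu⟩ := hgs x hxy.le
      exact ⟨_, (h2 u).trans hu⟩
    · obtain ⟨s, hs⟩ := hfs x hxy
      exact ⟨_, (h1 s).trans hs⟩
  exact ⟨_, _, _, k, by rw [hk, h1, hb]⟩

theorem graftMap_inl (α : S ⟶ S') (β : Q ⟶ Q') (a : S.Leaf) (s : S.Edge) :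
    graftMap α β a (inl Q a s) = inl Q' (leafMap α a) (α s) := graftElim_inl _ _ _

theorem graftMap_inr (α : S ⟶ S') (β : Q ⟶ Q') (a : S.Leaf) (r : Q.Edge) :
    graftMap α β a (inr a r) = inr (leafMap α a) (β r) :=
  graftElim_inr _ _ (by
    rw [show β Q.root = Q'.root from β.map_root, inr_root]
    rfl) _

theorem graft_hom_ext {a : S.Leaf} {f g : graft S Q a ⟶ X}
    (h₁ : ∀ s, f (inl Q a s) = g (inl Q a s)) (h₂ : ∀ r, f (inr a r) = g (inr a r)) : f = g := by
  apply hom_ext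
  intro x
  rcases graft_cases x with ⟨s, rfl⟩ | ⟨r, -, rfl⟩
  · exact h₁ s
  · exact h₂ r

theorem graftMap_comp (α : S ⟶ S') (β : Q ⟶ Q') (α' : S' ⟶ S'') (β' : Q' ⟶ Q'') (a : S.Leaf) :
    graftMap α β a ≫ graftMap α' β' (leafMap α a) = graftMap (α ≫ α') (β ≫ β') a := by
  apply graft_hom_ext
  · intro s
    rw [comp_apply, graftMap_inl, graftMap_inl]
    exact (graftMap_inl (α ≫ α') (β ≫ β') a s).symm
  · intro r
    rw [comp_apply, graftMap_inr, graftMap_inr]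
    exact (graftMap_inr (α ≫ α') (β ≫ β') a r).symm

theorem exists_graftIso (α : S ⟶ T) (k : T ≅ T') (β : Q ⟶ U) (l : U ≅ U') (a : S.Leaf) :
    ∃ K : graft T U (leafMap α a) ≅ graft T' U' (leafMap (α ≫ k.hom) a),
      graftMap α β a ≫ K.hom = graftMap (α ≫ k.hom) (β ≫ l.hom) a ∧
      K.hom = graftMap k.hom l.hom (leafMap α a) := by
  obtain ⟨K, hK⟩ := exists_iso_of_surjective (graftMap k.hom l.hom (leafMap α a)) fun x => by
    rcases graft_cases x with ⟨s, rfl⟩ | ⟨r, -, rfl⟩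
    · exact ⟨inl _ _ (k.inv s), by rw [graftMap_inl, range_iso]⟩
    · exact ⟨inr _ (l.inv r), by rw [graftMap_inr, range_iso]⟩
  exact ⟨K, hK ▸ graftMap_comp α β k.hom l.hom a, hK⟩

theorem isInner_inl_leaf (a : S.Leaf) : (graft S Q a).IsInner (inl Q a a.1) := by
  refine ⟨fun h => (isLeaf_inl.1 h).2 rfl, fun h => ?_⟩
  rw [← inl_root] at h
  exact S.root_not_isLeaf (inl_injective h ▸ a.2)

/-- An order embedding that matches the grafting edges respects the parts below and above them; what
remains is that the two restrictions preserve roots and leaves. -/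
theorem exists_restrict {a : S.Leaf} {b : T.Leaf} (f : graft S Q a ⟶ graft T U b)
    (hf : f (inl Q a a.1) = inl U b b.1) : ∃ (α : S ⟶ T) (β : Q ⟶ U), leafMap α a = b ∧
      (∀ s, f (inl Q a s) = inl U b (α s)) ∧ ∀ r, f (inr a r) = inr b (β r) := by
  have h1 : ∀ s, ∃ t, f (inl Q a s) = inl U b t := by
    intro s
    rcases graft_cases (f (inl Q a s)) with h | ⟨r, hr, h⟩
    · exact h
    · exfalso
      -- If the image of `s` were strictly above `b`, then `s` would lie above `a`, so `s = a`,
      -- whose image is `b` itself.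
      have h2 : f (inl Q a s) ≤ f (inl Q a a.1) := by
        rw [h, hf]
        exact inr_le_inl.2 le_rfl
      have h3 := inl_le_inl.1 ((le_iff f).1 h2)
      obtain rfl : s = a.1 := le_antisymm h3 (a.2 h3)
      exact hr (inl_le_inr.1 (hf.symm.trans h).le).2
  have h2 : ∀ r, ∃ u, f (inr a r) = inr b u := by
    intro r
    rcases graft_cases (f (inr a r)) with ⟨t, h⟩ | ⟨u, -, h⟩
    -- The image lies above `b` and belongs to `T`, where `b` is a leaf. Hence it is `b`, that is,
    -- the root of `U`.
    · have h3 : f (inr a r) ≤ f (inl Q a a.1) := (le_iff f).2 (inr_le_inl.2 le_rfl)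
      rw [h, hf, inl_le_inl] at h3
      refine ⟨U.root, ?_⟩
      rw [h, inr_root, le_antisymm h3 (b.2 h3)]
    · exact ⟨u, h⟩
  choose α hα using h1
  choose β hβ using h2
  have hab : α a.1 = b.1 := inl_injective ((hα a.1).symm.trans hf)
  refine ⟨⟨OrderEmbedding.ofMapLEIff α fun x y => ?_, ?_, ?_, ?_⟩,
    ⟨OrderEmbedding.ofMapLEIff β fun x y => ?_, ?_, ?_, ?_⟩, Subtype.ext hab, hα, hβ⟩
  · rw [← inl_le_inl (R := U) (a := b), ← hα, ← hα, le_iff f, inl_le_inl]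
  · apply inl_injective (R := U) (a := b)
    exact (hα _).symm.trans (by
      rw [inl_root, inl_root]
      exact f.map_root)
  · intro x hx
    change T.IsLeaf (α x)
    by_cases hxa : x = a.1
    · rw [hxa, hab]
      exact b.2
    · have := f.map_leaf _ (isLeaf_inl.2 ⟨hx, hxa⟩)
      rw [show f.toEmb (inl Q a x) = _ from hα x] at this
      exact (isLeaf_inl.1 this).1
  · intro t ht
    -- The leaf `b` of `T` is not a leaf of the grafting, so surjectivity of `f` on leaves does not
    -- reach it; its preimage is `a`.
    by_cases htb : t = b.1
    · exact ⟨a.1, a.2, hab.trans htb.symm⟩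
    · obtain ⟨x, hx, hxt⟩ := f.leaf_surj _ (isLeaf_inl.2 ⟨ht, htb⟩)
      replace hxt : f x = inl U b t := hxt
      rcases graft_cases x with ⟨s, rfl⟩ | ⟨r, -, rfl⟩
      · exact ⟨s, (isLeaf_inl.1 hx).1, inl_injective ((hα s).symm.trans hxt)⟩
      · rw [hβ] at hxt
        exact absurd (inl_le_inr.1 hxt.ge).1 htb
  · rw [← inr_le_inr (R := U) (a := b), ← hβ, ← hβ, le_iff f, inr_le_inr]
  · apply inr_injective (R := U) (a := b)
    refine (hβ _).symm.trans ?_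
    rw [inr_root, inr_root, hf]
  · intro x hx
    have := f.map_leaf _ (isLeaf_inr.2 hx)
    rw [show f.toEmb (inr a x) = _ from hβ x] at this
    exact isLeaf_inr.1 this
  · intro u hu
    obtain ⟨x, hx, hxt⟩ := f.leaf_surj _ (isLeaf_inr.2 hu : (graft T U b).IsLeaf (inr b u))
    replace hxt : f x = inr b u := hxt
    rcases graft_cases x with ⟨s, rfl⟩ | ⟨r, -, rfl⟩
    · rw [hα] at hxt
      have h3 := (inl_le_inr.1 hxt.le).1
      rw [← hab] at h3
      have h4 : s = a.1 := (show Function.Injective α from fun x y hxy =>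
        inl_injective (inj f ((hα x).trans (hxy ▸ (hα y).symm)))) h3
      exact absurd h4 (isLeaf_inl.1 hx).2
    · exact ⟨r, isLeaf_inr.1 hx, inr_injective ((hβ r).symm.trans hxt)⟩

/-- The edge `a` is inner in the grafting and so is its image in `X`. Cutting `X` at this image, `f`
restricts to the two parts. -/
theorem exists_graftMap {a : S.Leaf} (f : graft S Q a ⟶ X) :
    ∃ (T U : RTree) (α : S ⟶ T) (β : Q ⟶ U) (φ : graft T U (leafMap α a) ≅ X),
      graftMap α β a ≫ φ.hom = f := by
  obtain ⟨T, U, b, φ, hφ⟩ := exists_graft_iso X (f (inl Q a a.1))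
    ((Bar.isInner_iff f).2 (isInner_inl_leaf a))
  obtain ⟨α, β, rfl, h1, h2⟩ := exists_restrict (f ≫ φ.inv) (b := b) (by
    rw [comp_apply, ← hφ, iso_range])
  refine ⟨T, U, α, β, φ, ?_⟩
  rw [← φ.eq_comp_inv]
  apply graft_hom_ext
  · intro s
    rw [h1, graftMap_inl]
  · intro s
    rw [h2, graftMap_inr]

/-- The factor `f` preserves the grafting edge because both graft maps do, and its restrictions are
the factorisations. This gives the uniqueness of pairs of representatives. It also shows that the
map induced by `graftMap γ γ' a` kills a generator at `graftMap α β a` unless both `α` and `β`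
factor. -/
theorem graftMap_factor {α : S ⟶ T} {β : Q ⟶ U} {γ : S ⟶ S'} {γ' : Q ⟶ Q'} {a : S.Leaf}
    {f : graft S' Q' (leafMap γ a) ⟶ graft T U (leafMap α a)}
    (h : graftMap γ γ' a ≫ f = graftMap α β a) :
    (∃ α', γ ≫ α' = α) ∧ ∃ β', γ' ≫ β' = β := by
  have h1 : ∀ x, f (graftMap γ γ' a x) = graftMap α β a x := fun x =>
    congrArg (fun k : graft S Q a ⟶ graft T U (leafMap α a) => k x) h
  obtain ⟨α', β', -, h3, h4⟩ := exists_restrict f (by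
    have := h1 (inl Q a a.1)
    rw [graftMap_inl, graftMap_inl] at this
    exact this)
  refine ⟨⟨α', hom_ext fun s => ?_⟩, ⟨β', hom_ext fun s => ?_⟩⟩
  · have := h1 (inl Q a s)
    rw [graftMap_inl, graftMap_inl, h3] at this
    exact inl_injective this
  · have := h1 (inr a s)
    rw [graftMap_inr, graftMap_inr, h4] at this
    exact inr_injective this

theorem inl_mem_range {α : S ⟶ T} {β : Q ⟶ U} {a : S.Leaf} {t : T.Edge} :
    inl U (leafMap α a) t ∈ Set.range (graftMap α β a) ↔ t ∈ Set.range α := by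
  constructor
  · rintro ⟨x, hx⟩
    rcases graft_cases x with ⟨s, rfl⟩ | ⟨r, hr, rfl⟩
    · rw [graftMap_inl] at hx
      exact ⟨s, inl_injective hx⟩
    · rw [graftMap_inr] at hx
      exact absurd ((root_iff β).1 (inl_le_inr.1 hx.ge).2) hr
  · rintro ⟨s, rfl⟩
    exact ⟨inl Q a s, graftMap_inl _ _ _ _⟩

theorem inr_mem_range {α : S ⟶ T} {β : Q ⟶ U} {a : S.Leaf} {t : U.Edge} :
    inr (leafMap α a) t ∈ Set.range (graftMap α β a) ↔ t ∈ Set.range β := by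
  constructor
  · rintro ⟨x, hx⟩
    rcases graft_cases x with ⟨s, rfl⟩ | ⟨r, hr, rfl⟩
    · rw [graftMap_inl] at hx
      exact ⟨Q.root, β.map_root.trans (inl_le_inr.1 hx.le).2.symm⟩
    · rw [graftMap_inr] at hx
      exact ⟨r, inr_injective hx⟩
  · rintro ⟨s, rfl⟩
    exact ⟨inr a s, graftMap_inr _ _ _ _⟩

theorem inl_ne_inr' {a : S.Leaf} {s : S.Edge} {r : Q.Edge} (h : r ≠ Q.root) :
    inl Q a s ≠ inr a r := fun h' => h (inl_le_inr.1 h'.le).2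

theorem isInner_inl {a : S.Leaf} {s : S.Edge} :
    (graft S Q a).IsInner (inl Q a s) ↔ s = a.1 ∨ S.IsInner s := by
  constructor
  · rintro ⟨h1, h2⟩
    by_cases h : s = a.1
    · exact Or.inl h
    · refine Or.inr ⟨fun h3 => h1 (isLeaf_inl.2 ⟨h3, h⟩), fun h3 => h2 ?_⟩
      rw [h3, inl_root]
  · rintro (rfl | h)
    · exact isInner_inl_leaf a
    · refine ⟨fun h1 => h.1 (isLeaf_inl.1 h1).1, fun h1 => h.2 ?_⟩
      rw [← inl_root] at h1
      exact inl_injective h1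

theorem isInner_inr {a : S.Leaf} {r : Q.Edge} (hr : r ≠ Q.root) :
    (graft S Q a).IsInner (inr a r) ↔ Q.IsInner r := by
  rw [IsInner, isLeaf_inr, IsInner]
  refine and_congr_right fun _ => iff_of_true (fun h => ?_) hr
  rw [← inl_root] at h
  exact hr (inl_le_inr.1 h.ge).2

end RTree

/-! ### Enumerations and representatives for a grafting -/

namespace Bar
open RTree
variable {S T U Q : RTree}

/-- The only edge common to the two parts of the target is the grafting edge, which is the image of
the root of `Q` and hence does not occur in `e'`. The two blocks are therefore disjoint. -/
theorem isEnum_append_graft {α : S ⟶ T} {β : Q ⟶ U} {a : S.Leaf} {e : List T.Edge}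
    {e' : List U.Edge} (he : IsEnum e (Set.range α)ᶜ) (he' : IsEnum e' (Set.range β)ᶜ) :
    IsEnum (e.map (inl U (leafMap α a)) ++ e'.map (inr (leafMap α a)))
      (Set.range (graftMap α β a))ᶜ := by
  constructor
  · rw [List.nodup_append]
    refine ⟨he.1.map inl_injective, he'.1.map inr_injective, ?_⟩
    intro x hx y hy
    obtain ⟨s, hs, rfl⟩ := List.mem_map.1 hx
    obtain ⟨r, hr, rfl⟩ := List.mem_map.1 hy
    refine inl_ne_inr' ?_
    rintro rfl
    exact (he'.2 _).1 hr ⟨Q.root, β.map_root⟩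
  · intro x
    rw [List.mem_append]
    rcases graft_cases x with ⟨s, rfl⟩ | ⟨r, hr, rfl⟩
    · rw [List.mem_map_of_injective inl_injective, Set.mem_compl_iff, inl_mem_range, he.2]
      refine ⟨fun h => h.resolve_right fun h1 => ?_, Or.inl⟩
      obtain ⟨r, hr, h2⟩ := List.mem_map.1 h1
      exact (he'.2 _).1 hr ⟨Q.root, β.map_root.trans (inl_le_inr.1 h2.ge).2.symm⟩
    · rw [List.mem_map_of_injective inr_injective, Set.mem_compl_iff, inr_mem_range, he'.2]
      refine ⟨fun h => h.resolve_left fun h1 => ?_, Or.inr⟩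
      obtain ⟨s, hs, h2⟩ := List.mem_map.1 h1
      exact hr (inl_le_inr.1 h2.le).2

/-- Grafting turns the leaf `a`, identified with the root of `Q`, into one new inner edge. It is
inner neither in `S` nor in `Q`, so the three blocks are disjoint. -/
theorem isEnum_cons_graft {a : S.Leaf} {d : List S.Edge} {d' : List Q.Edge}
    (hd : IsEnum d {x | S.IsInner x}) (hd' : IsEnum d' {x | Q.IsInner x}) :
    IsEnum (inl Q a a.1 :: (d.map (inl Q a) ++ d'.map (inr a)))
      {x | (graft S Q a).IsInner x} := by
  have h1 : ∀ s ∈ d, s ≠ a.1 := fun s hs h => ((hd.2 s).1 hs).1 (h ▸ a.2)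
  have h2 : ∀ s ∈ d', s ≠ Q.root := fun s hs => ((hd'.2 s).1 hs).2
  constructor
  · rw [List.nodup_cons, List.nodup_append, List.mem_append]
    refine ⟨?_, hd.1.map inl_injective, hd'.1.map inr_injective, ?_⟩
    · rintro (h | h)
      · exact h1 _ ((List.mem_map_of_injective inl_injective).1 h) rfl
      · obtain ⟨r, hr, h⟩ := List.mem_map.1 h
        exact inl_ne_inr' (h2 r hr) h.symm
    · intro x hx y hy
      obtain ⟨s, hs, rfl⟩ := List.mem_map.1 hx
      obtain ⟨r, hr, rfl⟩ := List.mem_map.1 hy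
      exact inl_ne_inr' (h2 r hr)
  · intro x
    rw [List.mem_cons, List.mem_append]
    rcases graft_cases x with ⟨s, rfl⟩ | ⟨r, hr, rfl⟩
    · rw [List.mem_map_of_injective inl_injective, inl_injective.eq_iff, hd.2, Set.mem_ofPred_eq,
        Set.mem_ofPred_eq, isInner_inl]
      refine or_congr_right ⟨fun h => h.resolve_right fun h3 => ?_, Or.inl⟩
      obtain ⟨r, hr, h⟩ := List.mem_map.1 h3
      exact inl_ne_inr' (h2 r hr) h.symm
    · rw [List.mem_map_of_injective inr_injective, hd'.2, Set.mem_ofPred_eq, Set.mem_ofPred_eq,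
        isInner_inr hr]
      refine ⟨fun h => ?_, fun h => Or.inr (Or.inr h)⟩
      rcases h with h | h | h
      · exact absurd h.symm (inl_ne_inr' hr)
      · obtain ⟨s, -, h⟩ := List.mem_map.1 h
        exact absurd h (inl_ne_inr' hr)
      · exact h

/-- Representatives for the morphisms out of a grafting. -/
noncomputable def Reps.graft (P : Reps S) (P' : Reps Q) (a : S.Leaf) : Reps (RTree.graft S Q a) where
  I := P.I × P'.I
  fin := inferInstance
  T i := RTree.graft (P.T i.1) (P'.T i.2) (leafMap (P.α i.1) a)
  α i := graftMap (P.α i.1) (P'.α i.2) a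
  e i := (P.e i.1).map (inl _ _) ++ (P'.e i.2).map (inr _)
  enum i := isEnum_append_graft (P.enum i.1) (P'.enum i.2)
  exists_iso {X} f := by
    obtain ⟨T, U, α, β, φ, rfl⟩ := exists_graftMap f
    obtain ⟨i, k, rfl⟩ := P.exists_iso α
    obtain ⟨j, l, rfl⟩ := P'.exists_iso β
    obtain ⟨K, hK, -⟩ := exists_graftIso (P.α i) k (P'.α j) l a
    exact ⟨(i, j), K ≪≫ φ, by rw [Iso.trans_hom, reassoc_of% hK]⟩
  unique := by
    rintro ⟨i, j⟩ ⟨i', j'⟩ k hk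
    have hk' : graftMap (P.α i') (P'.α j') a ≫ k.inv = graftMap (P.α i) (P'.α j) a := by
      rw [k.comp_inv_eq]
      exact hk.symm
    -- The isomorphism `k` and its inverse both restrict, and the restrictions are mutually inverse
    -- because morphisms of trees are epimorphisms.
    obtain ⟨⟨α, hα⟩, ⟨β, hβ⟩⟩ := graftMap_factor hk
    obtain ⟨⟨α', hα'⟩, ⟨β', hβ'⟩⟩ := graftMap_factor hk'
    refine Prod.ext (P.unique i i' ⟨α, α', epi_ext (P.α i) ?_, epi_ext (P.α i') ?_⟩ hα)
      (P'.unique j j' ⟨β, β', epi_ext (P'.α j) ?_, epi_ext (P'.α j') ?_⟩ hβ)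
    · rw [reassoc_of% hα, hα', Category.comp_id]
    · rw [reassoc_of% hα', hα, Category.comp_id]
    · rw [reassoc_of% hβ, hβ', Category.comp_id]
    · rw [reassoc_of% hβ', hβ, Category.comp_id]

end Bar

/-! ### Generators of the bar construction and the formula for Δ -/

noncomputable section
namespace Ch
variable {R : Type u} [CommRing R] {K L : Ch R}

theorem suspMap_naturality (f : K ⟶ L) (k n : ℤ) (h : k + 1 = n) (x : K.X k) :
    (suspMap L k n h).hom ((f.f k).hom x) = ((susp.map f).f n).hom ((suspMap K k n h).hom x) := by
  obtain rfl : k = n - 1 := by lia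
  rfl

theorem suspMap_d (k k' n n' : ℤ) (h : k + 1 = n) (h' : k' + 1 = n') (x : K.X k) :
    ((susp.obj K).d n n').hom ((suspMap K k n h).hom x) =
      - (suspMap K k' n' h').hom ((K.d k k').hom x) := by
  obtain rfl : k = n - 1 := by lia
  obtain rfl : k' = n' - 1 := by lia
  rfl

/-- The inverse of `suspMap`. -/
def desuspMap (K : Ch R) (k n : ℤ) (h : k + 1 = n) : (susp.obj K).X n ⟶ K.X k :=
  (K.XIsoOfEq (show n - 1 = k by lia)).hom

theorem desuspMap_suspMap (k n : ℤ) (h : k + 1 = n) (x : K.X k) :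
    (desuspMap K k n h).hom ((suspMap K k n h).hom x) = x := by
  obtain rfl : k = n - 1 := by lia
  rfl

theorem suspMap_desuspMap (k n : ℤ) (h : k + 1 = n) (x : (susp.obj K).X n) :
    (suspMap K k n h).hom ((desuspMap K k n h).hom x) = x := by
  obtain rfl : k = n - 1 := by lia
  rfl

end Ch

namespace Bar
open Opposite RTree
variable {R : Type u} [CommRing R] {M : RTreeᵒᵖ ⥤ Ch R}
variable {S S' T T' U U' Q Q' : RTree}

/-- The sign of the permutation between two enumerations of the same set of edges. -/
def permSign (l l' : List T.Edge) : ℤˣ := edgeSign l * edgeSign l'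

theorem elt_apply (α : S ⟶ T) (d : List S.Edge) (e : List T.Edge) (n m : ℤ)
    (x : (M.obj (op T)).X n) : (Bar.elt M α d e n m).hom x =
      gen (M ⋙ Ch.susp) m α d e ((Ch.suspMap (M.obj (op T)) n (n + 1) rfl).hom x) := rfl

theorem elt_iso (α : S ⟶ T) (d : List S.Edge) (e : List T.Edge) (k : T ≅ T') (n m : ℤ)
    (x : (M.obj (op T')).X n) :
    (Bar.elt M α d e n m).hom (((M.map k.hom.op).f n).hom x) =
      (Bar.elt M (α ≫ k.hom) d (e.map k.hom) n m).hom x := by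
  rw [elt_apply, elt_apply, Ch.suspMap_naturality]
  exact gen_iso (N := M ⋙ Ch.susp) α d e k _

theorem elt_of_not {α : S ⟶ T} {d : List S.Edge} {e : List T.Edge} {n m : ℤ}
    (h : ¬ Valid α d e (n + 1) m) : Bar.elt M α d e n m = 0 := by
  ext x
  rw [elt_apply, gen_of_not h]
  rfl

theorem elt_perm (α : S ⟶ T) {d d' : List S.Edge} {e e' : List T.Edge} (hd : d.Perm d')
    (hd1 : d.Nodup) (he : e.Perm e') (he1 : e.Nodup) (n m : ℤ) (x : (M.obj (op T)).X n) :
    (Bar.elt M α d e n m).hom x =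
      (permSign d d' * permSign e e') • (Bar.elt M α d' e' n m).hom x :=
  gen_perm α hd hd1 he he1 _

theorem elt_alternating_left (α : S ⟶ T) (e : List T.Edge) (n m : ℤ) (x : (M.obj (op T)).X n) :
    Alternating fun d => (Bar.elt M α d e n m).hom x :=
  fun _ _ _ _ => gen_swap_left _ _ _ _ _ _ _

theorem elt_alternating_right (α : S ⟶ T) (d : List S.Edge) (n m : ℤ) (x : (M.obj (op T)).X n) :
    Alternating fun e => (Bar.elt M α d e n m).hom x :=
  fun _ _ _ _ => gen_swap_right _ _ _ _ _ _ _

/-- The list `(a, dS, dQ)` of edges of `S ∘_a Q`. -/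
abbrev graftInner (a : S.Leaf) (d : List S.Edge) (d' : List Q.Edge) : List (graft S Q a).Edge :=
  inl Q a a.1 :: (d.map (inl Q a) ++ d'.map (inr a))

/-- The list `(eS, eQ)` of edges of `S ∘_a Q`. -/
abbrev graftEnum (a : S.Leaf) (e : List S.Edge) (e' : List Q.Edge) : List (graft S Q a).Edge :=
  e.map (inl Q a) ++ e'.map (inr a)

/-- The four blocks are permuted one at a time. The signs are computed in the trees `S`, `T`, `Q`,
`U` separately, which makes the total sign equal to that of `eltTensor_perm`. -/
theorem elt_graft_perm {a : S.Leaf} {b : T.Leaf} (f : graft S Q a ⟶ graft T U b)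
    {d d' : List S.Edge} {e e' : List T.Edge} {c c' : List Q.Edge} {g g' : List U.Edge}
    (hd : d.Perm d') (hd1 : d.Nodup) (he : e.Perm e') (he1 : e.Nodup)
    (hc : c.Perm c') (hc1 : c.Nodup) (hg : g.Perm g') (hg1 : g.Nodup) (n m : ℤ)
    (x : (M.obj (op (graft T U b))).X n) :
    (Bar.elt M f (graftInner a d c) (graftEnum b e g) n m).hom x =
      ((permSign d d' * permSign e e') * (permSign c c' * permSign g g')) •
        (Bar.elt M f (graftInner a d' c') (graftEnum b e' g') n m).hom x := by
  have h1 := ((elt_alternating_left f (graftEnum b e g) n m x).comp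
    (inl Q a) [inl Q a a.1] (c.map (inr a))).perm hd hd1
  have h2 := ((elt_alternating_left f (graftEnum b e g) n m x).comp
    (inr a) (inl Q a a.1 :: d'.map (inl Q a)) []).perm hc hc1
  have h3 := ((elt_alternating_right f (graftInner a d' c') n m x).comp
    (inl U b) [] (g.map (inr b))).perm he he1
  have h4 := ((elt_alternating_right f (graftInner a d' c') n m x).comp
    (inr b) (e'.map (inl U b)) []).perm hg hg1
  simp only [List.append_nil, List.cons_append, List.nil_append] at h1 h2 h3 h4
  rw [h1, h2, h3, h4, smul_smul, smul_smul, smul_smul]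
  congr 1
  simp only [permSign]
  ac_rfl

/-- The projection to the summand of the representative `α i`. -/
def eltProj (M : RTreeᵒᵖ ⥤ Ch R) (P : Reps S) (d₀ : List S.Edge) (i : P.I) (m n : ℤ) :
    ((Bar M).obj S).X m ⟶ (M.obj (op (P.T i))).X n :=
  ModuleCat.ofHom (proj (N := M ⋙ Ch.susp) P d₀ i m (n + 1)) ≫
    Ch.desuspMap (M.obj (op (P.T i))) n (n + 1) rfl

section reps
variable (P : Reps S) {d₀ : List S.Edge} (hd : IsEnum d₀ {x | S.IsInner x})
include hd

theorem elt_eltProj_self (i : P.I) {n m : ℤ}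
    (hm : (d₀.length : ℤ) + (P.e i).length + (n + 1) = m) :
    Bar.elt M (P.α i) d₀ (P.e i) n m ≫ eltProj M P d₀ i m n = 𝟙 _ := by
  ext x
  change (Ch.desuspMap _ n (n + 1) rfl).hom (proj (N := M ⋙ Ch.susp) P d₀ i m (n + 1)
    (gen (M ⋙ Ch.susp) m (P.α i) d₀ (P.e i) _)) = x
  rw [proj_gen_self P hd i hm]
  exact Ch.desuspMap_suspMap _ _ _ _

theorem elt_eltProj_ne {i j : P.I} (hij : i ≠ j) (n n' m : ℤ) :
    Bar.elt M (P.α j) d₀ (P.e j) n m ≫ eltProj M P d₀ i m n' = 0 := by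
  ext x
  change (Ch.desuspMap _ n' (n' + 1) rfl).hom (proj (N := M ⋙ Ch.susp) P d₀ i m (n' + 1)
    (gen (M ⋙ Ch.susp) m (P.α j) d₀ (P.e j) _)) = 0
  rw [proj_gen_ne P hd hij, map_zero]

theorem sum_eltProj_elt (m : ℤ) (n : P.I → ℤ)
    (hn : ∀ i, (d₀.length : ℤ) + (P.e i).length + (n i + 1) = m) :
    ∑ i, eltProj M P d₀ i m (n i) ≫ Bar.elt M (P.α i) d₀ (P.e i) (n i) m = 𝟙 _ := by
  ext z
  have h := sum_gen_proj (N := M ⋙ Ch.susp) P hd z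
  rw [ModuleCat.hom_sum, LinearMap.sum_apply]
  refine Eq.trans (Finset.sum_congr rfl fun i _ => ?_) h
  obtain ⟨k, hk⟩ : ∃ k, k = n i + 1 := ⟨_, rfl⟩
  have h1 : m - d₀.length - (P.e i).length = n i + 1 := by
    have := hn i
    lia
  rw [h1]
  exact congrArg (gen (M ⋙ Ch.susp) m (P.α i) d₀ (P.e i))
    (Ch.suspMap_desuspMap (n i) (n i + 1) rfl (proj (N := M ⋙ Ch.susp) P d₀ i m (n i + 1) z))

/-- By `sum_eltProj_elt` the generators at the representatives are jointly epimorphic. One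
enumeration for each representative suffices. -/
theorem bar_hom_ext {m : ℤ} {V : ModuleCat.{u} R} {f g : ((Bar M).obj S).X m ⟶ V}
    (h : ∀ (i : P.I) (n : ℤ), (d₀.length : ℤ) + (P.e i).length + (n + 1) = m →
      Bar.elt M (P.α i) d₀ (P.e i) n m ≫ f = Bar.elt M (P.α i) d₀ (P.e i) n m ≫ g) : f = g := by
  rw [← Category.id_comp f, ← Category.id_comp g, ← sum_eltProj_elt (M := M) P hd m
    (fun i => m - d₀.length - (P.e i).length - 1) (fun i => by lia), Preadditive.sum_comp,
    Preadditive.sum_comp]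
  refine Finset.sum_congr rfl fun i _ => ?_
  rw [Category.assoc, Category.assoc, h i _ (by lia)]

end reps

/-- The Koszul sign of the structure maps of the bar construction. -/
def graftSign (q p q' p' : ℕ) (i _j : ℤ) : ℤˣ :=
  (1 + q + p + q' + p' + p * q' + ((i + 1) * (q' + p') + i) : ℤ).negOnePow

/-- The map `x₁ ⊗ x₂ ↦ ± (α, d | e, s x₁) ⊗ (β, d' | e', s x₂)`. -/
def eltTensor (M : RTreeᵒᵖ ⥤ Ch R) (α : S ⟶ T) (β : Q ⟶ U) (d : List S.Edge) (e : List T.Edge)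
    (d' : List Q.Edge) (e' : List U.Edge) (n m : ℤ)
    (hm : (1 + d.length + d'.length : ℤ) + (e.length + e'.length) + (n + 1) = m) :
    (M.obj (op T) ⊗ M.obj (op U)).X n ⟶ ((Bar M).obj S ⊗ (Bar M).obj Q).X m :=
  Ch.gtensor (graftSign d.length e.length d'.length e'.length)
    (Bar.elt M α d e) (Bar.elt M β d' e') (d.length + e.length + 1) (d'.length + e'.length + 1)
    (by lia)

theorem eltTensor_tmul (α : S ⟶ T) (β : Q ⟶ U) (d : List S.Edge) (e : List T.Edge)
    (d' : List Q.Edge) (e' : List U.Edge) (n m : ℤ)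
    (hm : (1 + d.length + d'.length : ℤ) + (e.length + e'.length) + (n + 1) = m)
    {i j k l : ℤ} (hij : i + j = n) (hk : (d.length : ℤ) + e.length + (i + 1) = k)
    (hl : (d'.length : ℤ) + e'.length + (j + 1) = l)
    (x : (M.obj (op T)).X i) (y : (M.obj (op U)).X j) :
    (eltTensor M α β d e d' e' n m hm).hom (Ch.tmul n hij x y) =
      graftSign d.length e.length d'.length e'.length i j •
        Ch.tmul m (by lia) ((Bar.elt M α d e i k).hom x) ((Bar.elt M β d' e' j l).hom y) :=
  Ch.gtensor_tmul _ _ _ _ _ _ hij (by lia) (by lia) x y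

theorem degraft_eq (θ : Preoperad M) (a : S.Leaf) (α : S ⟶ T) (β : Q ⟶ U) (d : List S.Edge)
    (e : List T.Edge) (d' : List Q.Edge) (e' : List U.Edge) (n m : ℤ)
    (hm : (1 + d.length + d'.length : ℤ) + (e.length + e'.length) + (n + 1) = m) :
    Bar.degraft θ a α β d e d' e' n m hm =
      (θ.θ T U (leafMap α a)).f n ≫ eltTensor M α β d e d' e' n m hm := by
  rw [Bar.degraft]
  congr 1
  apply Ch.hom_ext_tmul
  intro i j hij x y
  rw [eltTensor_tmul α β d e d' e' n m hm hij rfl rfl]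
  refine (Ch.desc_tmul _ hij x y).trans ?_
  rw [Ch.units_smul_hom_apply]
  rfl

theorem naturality_apply (θ : Preoperad M) (α : S ⟶ S') (β : Q ⟶ Q') (a : S.Leaf) (n : ℤ)
    (x : (M.obj (op (graft S' Q' (leafMap α a)))).X n) :
    ((θ.θ S Q a).f n).hom (((M.map (graftMap α β a).op).f n).hom x) =
      ((M.map α.op ⊗ₘ M.map β.op).f n).hom (((θ.θ S' Q' (leafMap α a)).f n).hom x) := by
  have := congrArg (fun k => (k.f n).hom x) (θ.naturality α β a)
  exact this

theorem map_map_inv (k : T ≅ T') (e : List T'.Edge) : (e.map k.inv).map k.hom = e := by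
  rw [List.map_map]
  exact (List.map_congr_left fun y _ => range_iso k y).trans (List.map_id _)

theorem eltTensor_iso (α : S ⟶ T) (β : Q ⟶ U) (d : List S.Edge) (e : List T.Edge)
    (d' : List Q.Edge) (e' : List U.Edge) (k : T ≅ T') (l : U ≅ U') (n m : ℤ) (hm) (hm')
    (z : (M.obj (op T') ⊗ M.obj (op U')).X n) :
    (eltTensor M α β d e d' e' n m hm).hom (((M.map k.hom.op ⊗ₘ M.map l.hom.op).f n).hom z) =
      (eltTensor M (α ≫ k.hom) (β ≫ l.hom) d (e.map k.hom) d' (e'.map l.hom) n m hm').hom z := by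
  suffices h : ((M.map k.hom.op ⊗ₘ M.map l.hom.op).f n) ≫ eltTensor M α β d e d' e' n m hm =
      eltTensor M (α ≫ k.hom) (β ≫ l.hom) d (e.map k.hom) d' (e'.map l.hom) n m hm' from
    congrArg (fun f => f.hom z) h
  apply Ch.hom_ext_tmul
  intro i j hij x y
  rw [ModuleCat.comp_apply, Ch.map_tmul, eltTensor_tmul _ _ _ _ _ _ _ _ _ hij rfl rfl,
    eltTensor_tmul _ _ _ _ _ _ _ _ _ hij (by rw [List.length_map]) (by rw [List.length_map]),
    elt_iso, elt_iso]
  refine congrArg₂ (· • ·) ?_ rfl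
  rw [List.length_map, List.length_map]

/-- A permutation leaves the lengths of the lists unchanged, hence also the Koszul sign, and the
permutation signs of the two tensor factors multiply. -/
theorem eltTensor_perm (α : S ⟶ T) (β : Q ⟶ U) {d d' : List S.Edge} {e e' : List T.Edge}
    {c c' : List Q.Edge} {g g' : List U.Edge}
    (hd : d.Perm d') (hd1 : d.Nodup) (he : e.Perm e') (he1 : e.Nodup)
    (hc : c.Perm c') (hc1 : c.Nodup) (hg : g.Perm g') (hg1 : g.Nodup) (n m : ℤ) (hm) (hm') :
    eltTensor M α β d e c g n m hm =
      ((permSign d d' * permSign e e') * (permSign c c' * permSign g g')) •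
        eltTensor M α β d' e' c' g' n m hm' := by
  apply Ch.hom_ext_tmul
  intro i j hij x y
  rw [Ch.units_smul_hom_apply, eltTensor_tmul _ _ _ _ _ _ _ _ _ hij (k := d'.length + e'.length + (i + 1))
      (l := c'.length + g'.length + (j + 1)) (by rw [hd.length_eq, he.length_eq])
      (by rw [hc.length_eq, hg.length_eq]),
    eltTensor_tmul _ _ _ _ _ _ _ _ _ hij rfl rfl, elt_perm α hd hd1 he he1, elt_perm β hc hc1 hg hg1,
    Ch.units_smul_tmul, Ch.tmul_units_smul, smul_smul, smul_smul, smul_smul]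
  refine congrArg₂ (· • ·) ?_ rfl
  rw [hd.length_eq, he.length_eq, hc.length_eq, hg.length_eq]
  ac_rfl

theorem isEnum_map_inv {α : S ⟶ T} (k : T ≅ T') {e : List T'.Edge}
    (he : IsEnum e (Set.range (α ≫ k.hom))ᶜ) : IsEnum (e.map k.inv) (Set.range α)ᶜ := by
  rw [← map_map_inv k e] at he
  exact (isEnum_map (iso_bijective k) fun x => not_congr (range_iso_comp α k x).symm).1 he

/-- The structure map in degree `m`, defined through representatives. -/
def comulDeg (θ : Preoperad M) (P : Reps S) (P' : Reps Q) (d : List S.Edge) (d' : List Q.Edge)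
    (a : S.Leaf) (m : ℤ) :
    ((Bar M).obj (graft S Q a)).X m ⟶ ((Bar M).obj S ⊗ (Bar M).obj Q).X m :=
  ∑ i : P.I × P'.I, eltProj M (P.graft P' a) (graftInner a d d') i m
      -- This is the degree `n` of `x`, solved from `m = (1 + |d| + |d'|) + (|e| + |e'|) + (n + 1)`.
      (m - 1 - (1 + d.length + d'.length) - ((P.e i.1).length + (P'.e i.2).length)) ≫
    (θ.θ (P.T i.1) (P'.T i.2) (leafMap (P.α i.1) a)).f _ ≫
      eltTensor M (P.α i.1) (P'.α i.2) d (P.e i.1) d' (P'.e i.2) _ m (by lia)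

section formula
variable (θ : Preoperad M) (P : Reps S) (P' : Reps Q) {d : List S.Edge} {d' : List Q.Edge}
  (hd : IsEnum d {x | S.IsInner x}) (hd' : IsEnum d' {x | Q.IsInner x})

include hd hd'
-- Only the projection to the summand `(i, j)` is nonzero on this generator.
theorem elt_comulDeg_reps (a : S.Leaf) (i : P.I) (j : P'.I) (n m : ℤ)
    (hm : (1 + d.length + d'.length : ℤ) + ((P.e i).length + (P'.e j).length) + (n + 1) = m) :
    Bar.elt M (graftMap (P.α i) (P'.α j) a) (graftInner a d d')
        (graftEnum (leafMap (P.α i) a) (P.e i) (P'.e j)) n m ≫ comulDeg θ P P' d d' a m =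
      (θ.θ (P.T i) (P'.T j) (leafMap (P.α i) a)).f n ≫
        eltTensor M (P.α i) (P'.α j) d (P.e i) d' (P'.e j) n m hm := by
  have hd2 := isEnum_cons_graft (a := a) hd hd'
  rw [comulDeg, Preadditive.comp_sum]
  rw [Finset.sum_eq_single_of_mem (i, j) (Finset.mem_univ _)]
  · obtain rfl : n = m - 1 - (1 + d.length + d'.length) - ((P.e i).length + (P'.e j).length) := by
      lia
    have h := elt_eltProj_self (M := M) (P.graft P' a) hd2 (i, j)
      (n := m - 1 - (1 + d.length + d'.length) - ((P.e i).length + (P'.e j).length)) (m := m) (by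
        change ((inl Q a a.1 :: (d.map (inl Q a) ++ d'.map (inr a))).length : ℤ) +
          ((P.e i).map (inl _ _) ++ (P'.e j).map (inr _)).length + _ = m
        simp only [List.length_cons, List.length_append, List.length_map]
        push_cast
        lia)
    exact (reassoc_of% h) _
  · intro k _ hk
    have h := elt_eltProj_ne (M := M) (P.graft P' a) hd2 (i := k) (j := (i, j)) hk n
      (m - 1 - (1 + d.length + d'.length) - ((P.e k.1).length + (P'.e k.2).length)) m
    exact ((reassoc_of% h) _).trans Limits.zero_comp

/-- Independence of all choices. An isomorphism `K` of graftings and four permutations carry the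
generator to the one at a pair of representatives. On the other side, naturality of θ along `K`
moves the pullback into the two tensor factors, and `elt_graft_perm` and `eltTensor_perm` contribute
the same sign. -/
theorem elt_comulDeg {a : S.Leaf} (α : S ⟶ T) (β : Q ⟶ U) {c : List S.Edge} {e : List T.Edge}
    {c' : List Q.Edge} {e' : List U.Edge} (hc : IsEnum c {x | S.IsInner x})
    (he : IsEnum e (Set.range α)ᶜ) (hc' : IsEnum c' {x | Q.IsInner x})
    (he' : IsEnum e' (Set.range β)ᶜ) (n m : ℤ)
    (hm : (1 + c.length + c'.length : ℤ) + (e.length + e'.length) + (n + 1) = m) :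
    Bar.elt M (graftMap α β a) (graftInner a c c') (graftEnum (leafMap α a) e e') n m ≫
        comulDeg θ P P' d d' a m =
      (θ.θ T U (leafMap α a)).f n ≫ eltTensor M α β c e c' e' n m hm := by
  obtain ⟨i, k, rfl⟩ := P.exists_iso α
  obtain ⟨j, l, rfl⟩ := P'.exists_iso β
  obtain ⟨K, hK1, hK2⟩ := exists_graftIso (P.α i) k (P'.α j) l a
  have he2 := isEnum_map_inv k he
  have he2' := isEnum_map_inv l he'
  have p1 := hc.perm hd
  have p2 := hc'.perm hd'
  have p3 := he2.perm (P.enum i)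
  have p4 := he2'.perm (P'.enum j)
  ext x
  have h1 : graftEnum (leafMap (P.α i ≫ k.hom) a) e e' =
      (graftEnum (leafMap (P.α i) a) (e.map k.inv) (e'.map l.inv)).map K.hom := by
    have h2 : ∀ s, K.hom (inl _ _ s) = inl _ _ (k.hom s) := fun s => by
      rw [hK2]; exact graftMap_inl _ _ _ _
    have h3 : ∀ s, K.hom (inr _ s) = inr _ (l.hom s) := fun s => by
      rw [hK2]; exact graftMap_inr _ _ _ _
    rw [List.map_append, List.map_map, List.map_map, List.map_map, List.map_map]
    refine congrArg₂ (· ++ ·) (List.map_congr_left fun y _ => ?_)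
      (List.map_congr_left fun y _ => ?_)
    · exact ((h2 _).trans (congrArg _ (range_iso k y))).symm
    · exact ((h3 _).trans (congrArg _ (range_iso l y))).symm
  have hl1 : c.length = d.length := p1.length_eq
  have hl2 : c'.length = d'.length := p2.length_eq
  have hl3 : e.length = (P.e i).length := by rw [← p3.length_eq, List.length_map]
  have hl4 : e'.length = (P'.e j).length := by rw [← p4.length_eq, List.length_map]
  have hm0 : (1 + d.length + d'.length : ℤ) + ((P.e i).length + (P'.e j).length) + (n + 1) = m := by
    rw [← hl1, ← hl2, ← hl3, ← hl4]
    exact hm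
  have h4 := congrArg (fun f => f.hom (((M.map K.hom.op).f n).hom x))
    (elt_comulDeg_reps θ P P' hd hd' a i j n m hm0)
  have h5 := naturality_apply θ k.hom l.hom (leafMap (P.α i) a) n x
  rw [← hK2] at h5
  rw [ModuleCat.comp_apply, ← hK1, h1, ← elt_iso, elt_graft_perm _ p1 hc.1 p3 he2.1 p2 hc'.1 p4 he2'.1,
    map_units_smul']
  refine (congrArg _ h4).trans ?_
  have h6 : ((θ.θ (P.T i) (P'.T j) (leafMap (P.α i) a)).f n).hom (((M.map K.hom.op).f n).hom x) =
    _ := h5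
  have hm1 : (1 + c.length + c'.length : ℤ) +
      ((e.map k.inv).length + (e'.map l.inv).length) + (n + 1) = m := by
    rw [List.length_map, List.length_map]
    exact hm
  have h7 := eltTensor_iso (M := M) (P.α i) (P'.α j) c (e.map k.inv) c' (e'.map l.inv) k l n m hm1
    (by rw [map_map_inv, map_map_inv]; exact hm)
    (((θ.θ T U (leafMap (P.α i ≫ k.hom) a)).f n).hom x)
  have h8 := eltTensor_perm (M := M) (P.α i) (P'.α j) p1 hc.1 p3 he2.1 p2 hc'.1 p4 he2'.1 n m hm1
    hm0
  rw [h8, Ch.units_smul_hom_apply] at h7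
  refine (congrArg _ (congrArg _ h6)).trans (h7.trans ?_)
  congr 2
  simp only [map_map_inv]

end formula

end Bar
end

/-! ### Δ commutes with the differentials -/

noncomputable section
namespace Bar
open Opposite RTree
open scoped Classical
variable {R : Type u} [CommRing R] {M : RTreeᵒᵖ ⥤ Ch R}
variable {S S' T T' U U' Q Q' : RTree}

theorem gen_d_congr {N : RTreeᵒᵖ ⥤ Ch R} (α : S ⟶ T) (d : List S.Edge) (e : List T.Edge) (m : ℤ)
    {n k k' : ℤ} (h : k = k') (z : (N.obj (op T)).X n) :
    gen N m α d e (((N.obj (op T)).d n k).hom z) =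
      gen N m α d e (((N.obj (op T)).d n k').hom z) := by
  subst h
  rfl

/-- The extra 1 in the sign of the internal term comes from `∂ (s x) = - s (∂ x)`. -/
theorem elt_d {α : S ⟶ T} {d : List S.Edge} {e : List T.Edge} {n n' i j : ℤ}
    (h : Valid α d e (n + 1) i) (hij : j + 1 = i) (hn : n' + 1 = n) (x : (M.obj (op T)).X n) :
    (((Bar M).obj S).d i j).hom ((Bar.elt M α d e n i).hom x) =
      ∑ y : {y : T.Edge // y ∉ Set.range α}, ((d.length + e.idxOf y.1 : ℕ) : ℤ).negOnePow •
        (Bar.elt M (faceFactor α y.1 y.2) d (pull (faceHom α y.1 y.2) e) n j).hom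
          (((M.map (faceHom α y.1 y.2).op).f n).hom x) +
      ((d.length + e.length : ℕ) + 1 : ℤ).negOnePow • (Bar.elt M α d e n' j).hom
        (((M.obj (op T)).d n n').hom x) := by
  have h1 : ((Bar M).obj S).d i j = ModuleCat.ofHom (D i j) := complex_d _ S hij
  rw [h1]
  refine (D_gen h _).trans (congrArg₂ (· + ·) ?_ ?_)
  · rw [dExt, LinearMap.sum_apply]
    refine Finset.sum_congr rfl fun y _ => ?_
    rw [LinearMap.smul_apply, neg_one_pow_smul, elt_apply, Ch.suspMap_naturality]
    rfl
  · rw [dInt, LinearMap.smul_apply, neg_one_pow_smul, LinearMap.comp_apply,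
      gen_d_congr (N := M ⋙ Ch.susp) α d e j (show n + 1 - 1 = n' + 1 by lia)]
    have h2 := Ch.suspMap_d (K := M.obj (op T)) n n' (n + 1) (n' + 1) rfl rfl x
    refine (congrArg (fun z => _ • gen (M ⋙ Ch.susp) j α d e z) h2).trans ?_
    rw [map_neg, Int.negOnePow_succ, Units.neg_smul, smul_neg]
    rfl

/-- The Leibniz rule, with signs arranged as in the differential of the corresponding generator over
`S ∘_a Q`. There `1 + |d| + |d'|` inner edges come first, and the missed edges of `U` are listed
after those of `T`. -/
theorem eltTensor_d {α : S ⟶ T} {β : Q ⟶ U} {d : List S.Edge} {e : List T.Edge}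
    {d' : List Q.Edge} {e' : List U.Edge} (hd : IsEnum d {x | S.IsInner x})
    (he : IsEnum e (Set.range α)ᶜ) (hd' : IsEnum d' {x | Q.IsInner x})
    (he' : IsEnum e' (Set.range β)ᶜ) {n n' m m' : ℤ}
    (hm : (1 + d.length + d'.length : ℤ) + (e.length + e'.length) + (n + 1) = m)
    (hmm : m' + 1 = m) (hn : n' + 1 = n) (z : (M.obj (op T) ⊗ M.obj (op U)).X n) :
    (((Bar M).obj S ⊗ (Bar M).obj Q).d m m').hom ((eltTensor M α β d e d' e' n m hm).hom z) =
      ∑ y : {y : T.Edge // y ∉ Set.range α},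
        (1 + d.length + d'.length + e.idxOf y.1 : ℤ).negOnePow •
          (eltTensor M (faceFactor α y.1 y.2) β d (pull (faceHom α y.1 y.2) e) d' e' n m' (by
            have := IsEnum.length_pull (inj _) (range_faceHom α y.1 y.2) he.1 ((he.2 _).2 y.2)
            lia)).hom (((M.map (faceHom α y.1 y.2).op ▷ M.obj (op U)).f n).hom z) +
      ∑ y : {y : U.Edge // y ∉ Set.range β},
        (1 + d.length + d'.length + e.length + e'.idxOf y.1 : ℤ).negOnePow •
          (eltTensor M α (faceFactor β y.1 y.2) d e d' (pull (faceHom β y.1 y.2) e') n m' (by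
            have := IsEnum.length_pull (inj _) (range_faceHom β y.1 y.2) he'.1 ((he'.2 _).2 y.2)
            lia)).hom (((M.obj (op T) ◁ M.map (faceHom β y.1 y.2).op).f n).hom z) +
      (d.length + d'.length + e.length + e'.length : ℤ).negOnePow •
        (eltTensor M α β d e d' e' n' m' (by lia)).hom
          (((M.obj (op T) ⊗ M.obj (op U)).d n n').hom z) := by
  have hE : ∀ y : {y : T.Edge // y ∉ Set.range α},
      (pull (faceHom α y.1 y.2) e).length + 1 = e.length := fun y =>
    IsEnum.length_pull (inj _) (range_faceHom α y.1 y.2) he.1 ((he.2 _).2 y.2)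
  have hE' : ∀ y : {y : U.Edge // y ∉ Set.range β},
      (pull (faceHom β y.1 y.2) e').length + 1 = e'.length := fun y =>
    IsEnum.length_pull (inj _) (range_faceHom β y.1 y.2) he'.1 ((he'.2 _).2 y.2)
  revert z
  -- As an equality of morphisms the claim can be tested on pure tensors.
  suffices h : (eltTensor M α β d e d' e' n m hm) ≫ ((Bar M).obj S ⊗ (Bar M).obj Q).d m m' =
      ∑ y : {y : T.Edge // y ∉ Set.range α},
        (1 + d.length + d'.length + e.idxOf y.1 : ℤ).negOnePow •
          (((M.map (faceHom α y.1 y.2).op ▷ M.obj (op U)).f n) ≫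
            eltTensor M (faceFactor α y.1 y.2) β d (pull (faceHom α y.1 y.2) e) d' e' n m' (by
              have := hE y
              lia)) +
      ∑ y : {y : U.Edge // y ∉ Set.range β},
        (1 + d.length + d'.length + e.length + e'.idxOf y.1 : ℤ).negOnePow •
          (((M.obj (op T) ◁ M.map (faceHom β y.1 y.2).op).f n) ≫
            eltTensor M α (faceFactor β y.1 y.2) d e d' (pull (faceHom β y.1 y.2) e') n m' (by
              have := hE' y
              lia)) +
      (d.length + d'.length + e.length + e'.length : ℤ).negOnePow •
        ((M.obj (op T) ⊗ M.obj (op U)).d n n' ≫ eltTensor M α β d e d' e' n' m' (by lia)) by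
    intro z
    have h1 := congrArg (fun f => f.hom z) h
    refine h1.trans ?_
    simp only [ModuleCat.hom_add, ModuleCat.hom_sum, LinearMap.add_apply, LinearMap.sum_apply,
      Ch.units_smul_hom_apply]
    rfl
  apply Ch.hom_ext_tmul
  intro i j hij x y
  simp only [ModuleCat.hom_add, ModuleCat.hom_sum, LinearMap.add_apply, LinearMap.sum_apply,
      Ch.units_smul_hom_apply, ModuleCat.comp_apply]
  obtain ⟨k, hk⟩ : ∃ k : ℤ, (d.length : ℤ) + e.length + (i + 1) = k := ⟨_, rfl⟩
  obtain ⟨l, hl⟩ : ∃ l : ℤ, (d'.length : ℤ) + e'.length + (j + 1) = l := ⟨_, rfl⟩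
  rw [eltTensor_tmul α β d e d' e' n m hm hij hk hl, map_units_smul',
    Ch.d_tmul (i' := k - 1) (j' := l - 1) _ (by lia) (by lia) hmm,
    elt_d (n' := i - 1) ⟨hd, he, hk⟩ (by lia) (by lia),
    elt_d (n' := j - 1) ⟨hd', he', hl⟩ (by lia) (by lia), Ch.add_tmul, Ch.tmul_add,
    Ch.sum_tmul, Ch.tmul_sum, Ch.d_tmul (i' := i - 1) (j' := j - 1) _ (by lia) (by lia) hn]
  simp only [Ch.units_smul_tmul, Ch.tmul_units_smul, Ch.whiskerLeft_tmul, Ch.whiskerRight_tmul,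
    smul_add, Finset.smul_sum, map_add, map_units_smul', smul_smul]
  rw [eltTensor_tmul α β d e d' e' n' m' _ (by lia : i - 1 + j = n') (k := k - 1) (l := l) (by lia) hl,
    eltTensor_tmul α β d e d' e' n' m' _ (by lia : i + (j - 1) = n') (k := k) (l := l - 1) hk
      (by lia), smul_smul, smul_smul]
  have e1 : ∀ w : {y : T.Edge // y ∉ Set.range α}, _ := fun w =>
    eltTensor_tmul (M := M) (faceFactor α w.1 w.2) β d (pull (faceHom α w.1 w.2) e) d' e' n m'
      (by have := hE w; lia) hij (k := k - 1) (l := l) (by have := hE w; lia) hl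
      (((M.map (faceHom α w.1 w.2).op).f i).hom x) y
  have e2 : ∀ w : {y : U.Edge // y ∉ Set.range β}, _ := fun w =>
    eltTensor_tmul (M := M) α (faceFactor β w.1 w.2) d e d' (pull (faceHom β w.1 w.2) e') n m'
      (by have := hE' w; lia) hij (k := k) (l := l - 1) hk (by have := hE' w; lia)
      x (((M.map (faceHom β w.1 w.2).op).f j).hom y)
  rw [Finset.sum_congr rfl fun w _ => congrArg _ (e1 w),
    Finset.sum_congr rfl fun w _ => congrArg _ (e2 w)]
  simp only [smul_smul]
  -- The left side is (external + internal) for the first factor plus the same for the second. It is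
  -- regrouped into external and internal terms, leaving four comparisons of signs.
  rw [add_add_add_comm]
  refine congrArg₂ (· + ·) (congrArg₂ (· + ·) ?_ ?_) (congrArg₂ (· + ·) ?_ ?_)
  · refine Finset.sum_congr rfl fun w _ => congrArg (· • _) ?_
    rw [graftSign, graftSign, ← Int.negOnePow_add, ← Int.negOnePow_add]
    apply negOnePow_eq_of_zmod
    -- A face has one missed edge less, so all lengths are expressed through that of the face.
    rw [← hE w]
    push_cast
    grind
  · refine Finset.sum_congr rfl fun w _ => congrArg (· • _) ?_
    rw [graftSign, graftSign, ← Int.negOnePow_add, ← Int.negOnePow_add, ← Int.negOnePow_add]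
    apply negOnePow_eq_of_zmod
    rw [← hE' w, ← hk]
    push_cast
    grind
  · refine congrArg (· • _) ?_
    rw [graftSign, graftSign, ← Int.negOnePow_add, ← Int.negOnePow_add]
    apply negOnePow_eq_of_zmod
    push_cast
    grind
  · refine congrArg (· • _) ?_
    rw [graftSign, graftSign, ← Int.negOnePow_add, ← Int.negOnePow_add, ← Int.negOnePow_add,
      ← Int.negOnePow_add]
    apply negOnePow_eq_of_zmod
    rw [← hk]
    push_cast
    grind

/-- Compares two models of one face, such as `∂_t (T ∘ U)` and `(∂_t T) ∘ U`: morphisms to `T` with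
equal ranges are isomorphic over `T`. -/
theorem elt_face_eq (αU : S ⟶ U) (αU' : S ⟶ U') (β : U ⟶ T) (β' : U' ⟶ T)
    (d : List S.Edge) (e : List U.Edge) (e' : List U'.Edge) (n m : ℤ)
    (hr : Set.range β = Set.range β') (hα : αU ≫ β = αU' ≫ β') (he : e.map β = e'.map β')
    (x : (M.obj (op T)).X n) :
    (Bar.elt M αU d e n m).hom (((M.map β.op).f n).hom x) =
      (Bar.elt M αU' d e' n m).hom (((M.map β'.op).f n).hom x) := by
  rw [elt_apply, elt_apply, Ch.suspMap_naturality, Ch.suspMap_naturality]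
  exact gen_face_eq (N := M ⋙ Ch.susp) αU αU' β β' d e e' hr hα he _

theorem map_id_op : M.map (𝟙 T : T ⟶ T).op = 𝟙 (M.obj (op T)) := M.map_id (op T)

theorem exists_range_graftMap {α : S ⟶ T} {β : Q ⟶ U} {a : S.Leaf}
    {w : (graft T U (leafMap α a)).Edge} (hw : w ∉ Set.range (graftMap α β a)) :
    (∃ t, t ∉ Set.range α ∧ w = inl U (leafMap α a) t) ∨
      ∃ u, u ∉ Set.range β ∧ w = inr (leafMap α a) u := by
  rcases graft_cases w with ⟨t, rfl⟩ | ⟨u, -, rfl⟩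
  · exact Or.inl ⟨t, fun h => hw (inl_mem_range.2 h), rfl⟩
  · exact Or.inr ⟨u, fun h => hw (inr_mem_range.2 h), rfl⟩

theorem ne_root_of_not_mem_range {β : Q ⟶ U} {u : U.Edge} (h : u ∉ Set.range β) : u ≠ U.root :=
  (inner_of_not_mem_range β h).2

theorem range_graftMap_left {f : T ⟶ T'} {t : T'.Edge} (hf : Set.range f = {t}ᶜ) (b : T.Leaf) :
    Set.range (graftMap f (𝟙 U) b) = {inl U (leafMap f b) t}ᶜ := by
  ext w
  rcases graft_cases w with ⟨s, rfl⟩ | ⟨u, hu, rfl⟩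
  · rw [inl_mem_range, hf]
    exact (not_congr inl_injective.eq_iff).symm
  · rw [inr_mem_range]
    exact iff_of_true ⟨u, rfl⟩ (inl_ne_inr' hu).symm

theorem range_graftMap_right {f : U ⟶ U'} {u : U'.Edge} (hf : Set.range f = {u}ᶜ) (b : T.Leaf) :
    Set.range (graftMap (𝟙 T) f b) = {inr b u}ᶜ := by
  have hu : u ≠ U'.root := fun h => by
    have h1 : u ∈ Set.range f := ⟨U.root, f.map_root.trans h.symm⟩
    rw [hf] at h1
    exact h1 rfl
  ext w
  rcases graft_cases w with ⟨s, rfl⟩ | ⟨r, -, rfl⟩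
  · exact iff_of_true ⟨inl U b s, graftMap_inl _ _ _ _⟩ (inl_ne_inr' hu)
  · refine (inr_mem_range (α := 𝟙 T)).trans ?_
    rw [hf]
    exact (not_congr inr_injective.eq_iff).symm

theorem map_graftEnum_pull_left {f : T ⟶ T'} {t : T'.Edge} (hf : Set.range f = {t}ᶜ) (b : T.Leaf)
    (e : List T'.Edge) {e' : List U.Edge} (he' : ∀ r ∈ e', r ≠ U.root) :
    filt (· ∈ ({inl U (leafMap f b) t}ᶜ : Set _)) (graftEnum (leafMap f b) e e') =
      (graftEnum b (pull f e) e').map (graftMap f (𝟙 U) b) := by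
  rw [filt_append, filt_map, filt_map, List.map_append, List.map_map, List.map_map]
  refine congrArg₂ (· ++ ·) ?_ ?_
  · rw [filt_congr (P := fun x => inl U (leafMap f b) x ∈ ({inl U (leafMap f b) t}ᶜ : Set _))
      (Q := (· ∈ Set.range f)) (fun s => by
        rw [hf]
        exact not_congr inl_injective.eq_iff), ← map_pull_filt (inj f), List.map_map]
    exact List.map_congr_left fun s _ => (graftMap_inl _ _ _ _).symm
  · rw [filt_eq_self (P := fun x => inr (leafMap f b) x ∈ ({inl U (leafMap f b) t}ᶜ : Set _))
      fun r hr => (inl_ne_inr' (he' r hr)).symm]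
    exact List.map_congr_left fun s _ => (graftMap_inr f (𝟙 U) b s).symm

theorem map_graftEnum_pull_right {f : U ⟶ U'} {u : U'.Edge} (hf : Set.range f = {u}ᶜ)
    (hu : u ≠ U'.root) (b : T.Leaf) (e : List T.Edge) (e' : List U'.Edge) :
    filt (· ∈ ({inr b u}ᶜ : Set (graft T U' b).Edge)) (graftEnum b e e') =
      (graftEnum b e (pull f e')).map (graftMap (𝟙 T) f b) := by
  rw [filt_append, filt_map, filt_map, List.map_append, List.map_map, List.map_map]
  refine congrArg₂ (· ++ ·) ?_ ?_
  · rw [filt_eq_self (P := fun x => inl U' b x ∈ ({inr b u}ᶜ : Set _))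
      fun r hr => inl_ne_inr' hu]
    exact List.map_congr_left fun s _ => (graftMap_inl (𝟙 T) f b s).symm
  · rw [filt_congr (P := fun x => inr b x ∈ ({inr b u}ᶜ : Set _))
      (Q := (· ∈ Set.range f)) (fun s => by
        rw [hf]
        exact not_congr inr_injective.eq_iff), ← map_pull_filt (inj f), List.map_map]
    exact List.map_congr_left fun s _ => (graftMap_inr (𝟙 T) f b s).symm

section chain
variable (θ : Preoperad M) (P : Reps S) (P' : Reps Q) {d : List S.Edge} {d' : List Q.Edge}
  (hd : IsEnum d {x | S.IsInner x}) (hd' : IsEnum d' {x | Q.IsInner x}) {a : S.Leaf}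

theorem IsEnum.pull {f : U ⟶ T} {γ : S ⟶ U} {e : List T.Edge} (he : IsEnum e (Set.range (γ ≫ f))ᶜ) :
    IsEnum (Bar.pull f e) (Set.range γ)ᶜ :=
  ⟨nodup_pull (inj f) he.1, fun y => by
    rw [mem_pull (inj f), he.2]
    exact not_congr comp_mem_range⟩

include hd hd'
-- Contracting an edge `t` of `T` in `T ∘ U` amounts to grafting `U` on `∂_t T`. The formula for Δ
-- applies to this model of the face, and naturality of θ along `f ∘ 𝟙` moves the pullback to the
-- first tensor factor.
theorem comulDeg_face_inl {α : S ⟶ T} {β : Q ⟶ U} {t : T.Edge}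
    (h : inl U (leafMap α a) t ∉ Set.range (graftMap α β a)) (γ : S ⟶ T') (f : T' ⟶ T)
    (hγ : γ ≫ f = α) (hf : Set.range f = {t}ᶜ) {e : List T.Edge} {e' : List U.Edge}
    (he : IsEnum e (Set.range α)ᶜ) (he' : IsEnum e' (Set.range β)ᶜ) {n m : ℤ}
    (hm : (1 + d.length + d'.length : ℤ) + ((pull f e).length + e'.length) + (n + 1) = m)
    (x : (M.obj (op (graft T U (leafMap α a)))).X n) :
    (comulDeg θ P P' d d' a m).hom ((Bar.elt M (faceFactor (graftMap α β a) _ h)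
      (graftInner a d d') (pull (faceHom (graftMap α β a) _ h) (graftEnum (leafMap α a) e e'))
        n m).hom (((M.map (faceHom (graftMap α β a) _ h).op).f n).hom x)) =
    (eltTensor M γ β d (pull f e) d' e' n m hm).hom
      (((M.map f.op ▷ M.obj (op U)).f n).hom (((θ.θ T U (leafMap α a)).f n).hom x)) := by
  subst hγ
  have hr := (range_faceHom _ _ h).trans (range_graftMap_left (U := U) hf (leafMap γ a)).symm
  have h1 := elt_face_eq (M := M) (faceFactor (graftMap (γ ≫ f) β a) _ h) (graftMap γ β a)
    (faceHom (graftMap (γ ≫ f) β a) _ h) (graftMap f (𝟙 U) (leafMap γ a)) (graftInner a d d')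
    (pull (faceHom (graftMap (γ ≫ f) β a) _ h) (graftEnum (leafMap (γ ≫ f) a) e e'))
    (graftEnum (leafMap γ a) (pull f e) e') n m hr
    ((faceFactor_comp _ _ _).trans (by
      have := (graftMap_comp γ β f (𝟙 U) a).symm
      rw [Category.comp_id] at this
      exact this)) (by
      rw [map_pull_filt (inj _), range_faceHom]
      exact map_graftEnum_pull_left hf (leafMap γ a) e fun r hr =>
        ne_root_of_not_mem_range ((he'.2 r).1 hr)) x
  rw [h1]
  have h2 := elt_comulDeg θ P P' hd hd' (a := a) γ β hd he.pull hd' he' n m hm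
  refine (congrArg (fun k => k.hom (((M.map (graftMap f (𝟙 U) (leafMap γ a)).op).f n).hom x))
    h2).trans ?_
  have h3 := naturality_apply θ f (𝟙 U) (leafMap γ a) n x
  rw [map_id_op, tensorHom_id] at h3
  exact congrArg _ h3

/-- The mirror case: the contracted edge belongs to `U`, and the pullback ends up on the second
tensor factor. -/
theorem comulDeg_face_inr {α : S ⟶ T} {β : Q ⟶ U} {t : U.Edge}
    (h : inr (leafMap α a) t ∉ Set.range (graftMap α β a)) (γ : Q ⟶ U') (f : U' ⟶ U)
    (hγ : γ ≫ f = β) (hf : Set.range f = {t}ᶜ) {e : List T.Edge} {e' : List U.Edge}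
    (he : IsEnum e (Set.range α)ᶜ) (he' : IsEnum e' (Set.range β)ᶜ) {n m : ℤ}
    (hm : (1 + d.length + d'.length : ℤ) + (e.length + (pull f e').length) + (n + 1) = m)
    (x : (M.obj (op (graft T U (leafMap α a)))).X n) :
    (comulDeg θ P P' d d' a m).hom ((Bar.elt M (faceFactor (graftMap α β a) _ h)
      (graftInner a d d') (pull (faceHom (graftMap α β a) _ h) (graftEnum (leafMap α a) e e'))
        n m).hom (((M.map (faceHom (graftMap α β a) _ h).op).f n).hom x)) =
    (eltTensor M α γ d e d' (pull f e') n m hm).hom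
      (((M.obj (op T) ◁ M.map f.op).f n).hom (((θ.θ T U (leafMap α a)).f n).hom x)) := by
  subst hγ
  have hr := (range_faceHom _ _ h).trans (range_graftMap_right hf (leafMap α a)).symm
  have ht : t ≠ U.root := fun h => by
    have h1 : t ∈ Set.range f := ⟨U'.root, f.map_root.trans h.symm⟩
    rw [hf] at h1
    exact h1 rfl
  have h1 := elt_face_eq (M := M) (faceFactor (graftMap α (γ ≫ f) a) _ h) (graftMap α γ a)
    (faceHom (graftMap α (γ ≫ f) a) _ h) (graftMap (𝟙 T) f (leafMap α a)) (graftInner a d d')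
    (pull (faceHom (graftMap α (γ ≫ f) a) _ h) (graftEnum (leafMap α a) e e'))
    (graftEnum (leafMap α a) e (pull f e')) n m hr
    ((faceFactor_comp _ _ _).trans (graftMap_comp α γ (𝟙 T) f a).symm) (by
      rw [map_pull_filt (inj _), range_faceHom]
      exact map_graftEnum_pull_right hf ht _ e e') x
  rw [h1]
  have h2 := elt_comulDeg θ P P' hd hd' (a := a) α γ hd he hd' he'.pull n m hm
  refine (congrArg (fun k => k.hom (((M.map (graftMap (𝟙 T) f (leafMap α a)).op).f n).hom x))
    h2).trans ?_
  have h3 := naturality_apply θ (𝟙 T) f (leafMap α a) n x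
  rw [map_id_op, id_tensorHom] at h3
  exact congrArg _ h3

/-- On a generator both sides are sums over the edges missed by `α` and by `β`, plus one internal
term. The external terms match by naturality of θ along faces, the internal one because θ is a chain
map. -/
theorem comulDeg_d {m m' : ℤ} (hmm : m' + 1 = m) :
    comulDeg θ P P' d d' a m ≫ ((Bar M).obj S ⊗ (Bar M).obj Q).d m m' =
      ((Bar M).obj (graft S Q a)).d m m' ≫ comulDeg θ P P' d d' a m' := by
  have hD := isEnum_cons_graft (a := a) hd hd'
  apply bar_hom_ext (M := M) (P.graft P' a) hD
  rintro ⟨i, j⟩ n hm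
  change Bar.elt M (graftMap (P.α i) (P'.α j) a) (graftInner a d d')
    (graftEnum (leafMap (P.α i) a) (P.e i) (P'.e j)) n m ≫ _ =
    Bar.elt M (graftMap (P.α i) (P'.α j) a) (graftInner a d d')
      (graftEnum (leafMap (P.α i) a) (P.e i) (P'.e j)) n m ≫ _
  have hm1 : (1 + d.length + d'.length : ℤ) + ((P.e i).length + (P'.e j).length) + (n + 1) = m := by
    rw [← hm]
    change _ = ((graftInner a d d').length : ℤ) +
      (graftEnum (leafMap (P.α i) a) (P.e i) (P'.e j)).length + _
    simp only [List.length_cons, List.length_append, List.length_map]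
    push_cast
    lia
  rw [← Category.assoc, elt_comulDeg θ P P' hd hd' _ _ hd (P.enum i) hd' (P'.enum j) n m hm1]
  ext x
  have hv : Valid (graftMap (P.α i) (P'.α j) a) (graftInner a d d')
    (graftEnum (leafMap (P.α i) a) (P.e i) (P'.e j)) (n + 1) m :=
    ⟨hD, isEnum_append_graft (P.enum i) (P'.enum j), hm⟩
  rw [ModuleCat.comp_apply, ModuleCat.comp_apply,
    eltTensor_d hd (P.enum i) hd' (P'.enum j) hm1 hmm (sub_add_cancel n 1), ModuleCat.comp_apply,
    ModuleCat.comp_apply, elt_d hv hmm (sub_add_cancel n 1), map_add, map_sum]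
  refine congrArg₂ (· + ·) ?_ ?_
  -- The edges missed by a graft map are the disjoint union of those missed by its two parts.
  · let φ : {t : (P.T i).Edge // t ∉ Set.range (P.α i)} ⊕
        {u : (P'.T j).Edge // u ∉ Set.range (P'.α j)} →
        {w // w ∉ Set.range (graftMap (P.α i) (P'.α j) a)} :=
      Sum.elim (fun t => ⟨inl _ _ t.1, fun h => t.2 (inl_mem_range.1 h)⟩)
        (fun u => ⟨inr _ u.1, fun h => u.2 (inr_mem_range.1 h)⟩)
    have hφ : Function.Bijective φ := by
      constructor
      · rintro (t | t) (u | u) h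
        · exact congrArg Sum.inl (Subtype.ext (inl_injective (congrArg Subtype.val h)))
        · exact absurd (congrArg Subtype.val h) (inl_ne_inr' (ne_root_of_not_mem_range u.2))
        · exact absurd (congrArg Subtype.val h).symm (inl_ne_inr' (ne_root_of_not_mem_range t.2))
        · exact congrArg Sum.inr (Subtype.ext (inr_injective (congrArg Subtype.val h)))
      · rintro ⟨w, hw⟩
        rcases exists_range_graftMap hw with ⟨t, ht, rfl⟩ | ⟨u, hu, rfl⟩
        · exact ⟨Sum.inl ⟨t, ht⟩, rfl⟩
        · exact ⟨Sum.inr ⟨u, hu⟩, rfl⟩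
    rw [← Fintype.sum_bijective φ hφ _ _ (fun _ => rfl), Fintype.sum_sum_type]
    refine congrArg₂ (· + ·) (Finset.sum_congr rfl fun w _ => ?_)
      (Finset.sum_congr rfl fun w _ => ?_)
    · have h1 := comulDeg_face_inl θ P P' hd hd' (φ (Sum.inl w)).2 (faceFactor _ w.1 w.2)
        (faceHom _ w.1 w.2) (faceFactor_comp _ _ _) (range_faceHom _ _ _) (P.enum i) (P'.enum j)
        (n := n) (m := m') (by
          have := IsEnum.length_pull (inj _) (range_faceHom _ w.1 w.2) (P.enum i).1
            (((P.enum i).2 _).2 w.2)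
          lia) x
      rw [map_units_smul']
      refine Eq.trans ?_ (congrArg _ h1.symm)
      refine congrArg (Int.negOnePow · • _) ?_
      have h3 : (graftEnum (leafMap (P.α i) a) (P.e i) (P'.e j)).idxOf
          (inl (P'.T j) (leafMap (P.α i) a) w.1) = (P.e i).idxOf w.1 := by
        rw [List.idxOf_append_of_mem, idxOf_map inl_injective]
        exact List.mem_map_of_mem (((P.enum i).2 _).2 w.2)
      have h4 : (graftEnum (leafMap (P.α i) a) (P.e i) (P'.e j)).idxOf (φ (Sum.inl w)).1 =
        (P.e i).idxOf w.1 := h3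
      rw [h4]
      simp only [List.length_cons, List.length_append, List.length_map]
      push_cast
      ring
    · have h1 := comulDeg_face_inr θ P P' hd hd' (φ (Sum.inr w)).2 (faceFactor _ w.1 w.2)
        (faceHom _ w.1 w.2) (faceFactor_comp _ _ _) (range_faceHom _ _ _) (P.enum i) (P'.enum j)
        (n := n) (m := m') (by
          have := IsEnum.length_pull (inj _) (range_faceHom _ w.1 w.2) (P'.enum j).1
            (((P'.enum j).2 _).2 w.2)
          lia) x
      rw [map_units_smul']
      refine Eq.trans ?_ (congrArg _ h1.symm)
      refine congrArg (Int.negOnePow · • _) ?_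
      -- In the joint enumeration all missed edges of the lower tree precede `w`, which shifts its
      -- position by their number.
      have h3 : (graftEnum (leafMap (P.α i) a) (P.e i) (P'.e j)).idxOf
          (inr (leafMap (P.α i) a) w.1) = (P.e i).length + (P'.e j).idxOf w.1 := by
        rw [List.idxOf_append_of_notMem, idxOf_map inr_injective, List.length_map]
        intro h
        obtain ⟨s, -, h⟩ := List.mem_map.1 h
        exact inl_ne_inr' (ne_root_of_not_mem_range w.2) h
      have h4 : (graftEnum (leafMap (P.α i) a) (P.e i) (P'.e j)).idxOf (φ (Sum.inr w)).1 =
        (P.e i).length + (P'.e j).idxOf w.1 := h3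
      rw [h4]
      simp only [List.length_cons, List.length_append, List.length_map]
      push_cast
      ring
  · have h1 := congrArg (fun f => f.hom (((M.obj (op _)).d n (n - 1)).hom x))
      (elt_comulDeg θ P P' hd hd' (a := a) (P.α i) (P'.α j) hd (P.enum i) hd' (P'.enum j) (n - 1) m'
        (by lia))
    rw [map_units_smul']
    refine Eq.trans ?_ (congrArg _ h1.symm)
    have h2 := congrArg (fun f => f.hom x)
      ((θ.θ (P.T i) (P'.T j) (leafMap (P.α i) a)).comm n (n - 1))
    refine congrArg₂ (· • ·) ?_ (congrArg _ h2)
    -- The 1 counting the grafting edge and the 1 from the suspension cancel modulo 2.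
    apply negOnePow_eq_of_zmod
    simp only [List.length_cons, List.length_append, List.length_map]
    push_cast
    grind

end chain

end Bar
end

/-! ### Moving blocks in alternating functions -/

theorem Alternating.cons_append {X V : Type*} [AddCommGroup V] {F : List X → V}
    (hF : Alternating F) (p : List X) (x : X) (l r : List X) :
    F (p ++ x :: (l ++ r)) = (l.length : ℤ).negOnePow • F (p ++ (l ++ x :: r)) := by
  induction l generalizing p with
  | nil => simp
  | cons y l ih =>
    have h := ih (p ++ [y])
    simp only [List.append_assoc, List.cons_append, List.nil_append] at h
    rw [List.cons_append, hF, h, List.cons_append, List.length_cons, Nat.cast_add, Nat.cast_one,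
      Int.negOnePow_succ, Units.neg_smul]

theorem Alternating.append_append {X V : Type*} [AddCommGroup V] {F : List X → V}
    (hF : Alternating F) (p l l' r : List X) :
    F (p ++ (l ++ (l' ++ r))) =
      (l.length * l'.length : ℤ).negOnePow • F (p ++ (l' ++ (l ++ r))) := by
  induction l generalizing p with
  | nil => simp
  | cons y l ih =>
    have h := ih (p ++ [y])
    simp only [List.append_assoc, List.cons_append, List.nil_append] at h
    rw [List.cons_append, h, hF.cons_append, smul_smul, ← Int.negOnePow_add, List.cons_append,
      List.length_cons]
    refine congrArg₂ (· • ·) (congrArg _ ?_) rfl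
    push_cast
    ring

/-! ### Naturality of Δ in the trees and in the ∞-operad -/

noncomputable section
namespace Bar
open Opposite RTree
open scoped Classical
variable {R : Type u} [CommRing R] {M : RTreeᵒᵖ ⥤ Ch R}
variable {S S' T T' U U' Q Q' : RTree}

/-- An enumeration of the inner edges of a tree. -/
def innerEnum (S : RTree) : List S.Edge := (exists_isEnum {x | S.IsInner x}).choose

theorem isEnum_innerEnum (S : RTree) : IsEnum (innerEnum S) {x | S.IsInner x} :=
  (exists_isEnum {x | S.IsInner x}).choose_spec

theorem length_graftInner (a : S.Leaf) (d : List S.Edge) (d' : List Q.Edge) :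
    ((graftInner a d d').length : ℤ) = 1 + d.length + d'.length := by
  simp only [List.length_cons, List.length_append, List.length_map]
  push_cast
  ring

theorem length_graftEnum (a : S.Leaf) (d : List S.Edge) (d' : List Q.Edge) :
    ((graftEnum a d d').length : ℤ) = d.length + d'.length := by
  simp only [List.length_append, List.length_map]
  push_cast
  ring

/-- Other enumerations change a generator only by a sign, so for each pair `(α, β)` a single choice
suffices. The choice may depend on `α` and `β`, which permits enumerations adapted to a
factorisation. -/
theorem bar_graft_ext {a : S.Leaf} {d : List S.Edge} {d' : List Q.Edge}
    (hd : IsEnum d {x | S.IsInner x}) (hd' : IsEnum d' {x | Q.IsInner x}) {m : ℤ}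
    {V : ModuleCat.{u} R} {f g : ((Bar M).obj (graft S Q a)).X m ⟶ V}
    (h : ∀ {T U : RTree} (α : S ⟶ T) (β : Q ⟶ U), ∃ (e : List T.Edge) (e' : List U.Edge),
      IsEnum e (Set.range α)ᶜ ∧ IsEnum e' (Set.range β)ᶜ ∧
      ∀ (n : ℤ), (1 + d.length + d'.length : ℤ) + (e.length + e'.length) + (n + 1) = m →
        ∀ x : (M.obj (op (graft T U (leafMap α a)))).X n,
        f.hom ((Bar.elt M (graftMap α β a) (graftInner a d d')
          (graftEnum (leafMap α a) e e') n m).hom x) =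
        g.hom ((Bar.elt M (graftMap α β a) (graftInner a d d')
          (graftEnum (leafMap α a) e e') n m).hom x)) : f = g := by
  apply bar_hom_ext (M := M) ((Reps.canonical S).graft (Reps.canonical Q) a)
    (isEnum_cons_graft (a := a) hd hd')
  rintro ⟨i, j⟩ n hm
  ext x
  obtain ⟨e, e', he, he', h1⟩ := h ((Reps.canonical S).α i) ((Reps.canonical Q).α j)
  have p1 := ((Reps.canonical S).enum i).perm he
  have p2 := ((Reps.canonical Q).enum j).perm he'
  have h2 := elt_graft_perm (M := M) (graftMap ((Reps.canonical S).α i) ((Reps.canonical Q).α j) a)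
    (List.Perm.refl d) hd.1 p1 ((Reps.canonical S).enum i).1 (List.Perm.refl d') hd'.1 p2
    ((Reps.canonical Q).enum j).1 n m x
  rw [ModuleCat.comp_apply, ModuleCat.comp_apply]
  have hm' : (1 + d.length + d'.length : ℤ) + (e.length + e'.length) + (n + 1) = m := by
    rw [← hm, ← p1.length_eq, ← p2.length_eq, ← length_graftInner a]
    refine congrArg (_ + · + _) ?_
    exact (length_graftEnum (leafMap ((Reps.canonical S).α i) a) _ _).symm
  refine (congrArg f.hom h2).trans (Eq.trans ?_ (congrArg g.hom h2).symm)
  rw [map_units_smul', map_units_smul']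
  exact congrArg _ (h1 n hm' x)

/-- The structure maps of the bar construction. -/
def comul (θ : Preoperad M) (S Q : RTree) (a : S.Leaf) :
    (Bar M).obj (graft S Q a) ⟶ (Bar M).obj S ⊗ (Bar M).obj Q where
  f m := comulDeg θ (Reps.canonical S) (Reps.canonical Q) (innerEnum S) (innerEnum Q) a m
  comm' _ _ h := comulDeg_d θ _ _ (isEnum_innerEnum S) (isEnum_innerEnum Q) h

theorem elt_comul (θ : Preoperad M) {a : S.Leaf} (α : S ⟶ T) (β : Q ⟶ U) {d : List S.Edge}
    {e : List T.Edge} {d' : List Q.Edge} {e' : List U.Edge} (hd : IsEnum d {x | S.IsInner x})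
    (he : IsEnum e (Set.range α)ᶜ) (hd' : IsEnum d' {x | Q.IsInner x})
    (he' : IsEnum e' (Set.range β)ᶜ) {n m : ℤ}
    (hm : (1 + d.length + d'.length : ℤ) + (e.length + e'.length) + (n + 1) = m)
    (x : (M.obj (op (graft T U (leafMap α a)))).X n) :
    ((comul θ S Q a).f m).hom ((Bar.elt M (graftMap α β a) (graftInner a d d')
      (graftEnum (leafMap α a) e e') n m).hom x) =
      (eltTensor M α β d e d' e' n m hm).hom (((θ.θ T U (leafMap α a)).f n).hom x) :=
  congrArg (fun f => f.hom x) (elt_comulDeg θ (Reps.canonical S) (Reps.canonical Q)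
    (isEnum_innerEnum S) (isEnum_innerEnum Q) α β hd he hd' he' n m hm)

theorem elt_push_not {γ : S ⟶ S'} {α : S ⟶ T} (h : ¬ ∃ β : S' ⟶ T, γ ≫ β = α)
    (d : List S.Edge) (e : List T.Edge) (n m : ℤ) (x : (M.obj (op T)).X n) :
    (((Bar M).map γ).f m).hom ((Bar.elt M α d e n m).hom x) = 0 := by
  by_cases hv : Valid α d e (n + 1) m
  · refine (push_gen γ hv _).trans ?_
    rw [pushGen_not h]
    rfl
  · rw [elt_of_not hv]
    exact map_zero _

theorem isEnum_push {γ : S ⟶ S'} {β : S' ⟶ T} {p : List S'.Edge} {r : List T.Edge}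
    (hp : IsEnum p (Set.range γ)ᶜ) (hr : IsEnum r (Set.range β)ᶜ) :
    IsEnum (p.map β ++ r) (Set.range (γ ≫ β))ᶜ := by
  refine ⟨List.nodup_append.2 ⟨hp.1.map (inj β), hr.1, ?_⟩, fun x => ?_⟩
  · rintro _ hx y hy rfl
    obtain ⟨z, -, rfl⟩ := List.mem_map.1 hx
    exact (hr.2 _).1 hy ⟨z, rfl⟩
  · rw [List.mem_append, hr.2]
    by_cases hx : x ∈ Set.range β
    · obtain ⟨z, rfl⟩ := hx
      rw [List.mem_map_of_injective (inj β), hp.2, Set.mem_compl_iff, Set.mem_compl_iff,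
        Set.mem_compl_iff, comp_mem_range]
      exact or_iff_left fun h => h ⟨z, rfl⟩
    · refine iff_of_true (Or.inr hx) ?_
      rintro ⟨s, rfl⟩
      exact hx ⟨γ s, rfl⟩

theorem isEnum_map_append {γ : S ⟶ S'} {d : List S.Edge} {p : List S'.Edge}
    (hd : IsEnum d {x | S.IsInner x}) (hp : IsEnum p (Set.range γ)ᶜ) :
    IsEnum (d.map γ ++ p) {x | S'.IsInner x} := by
  refine ⟨List.nodup_append.2 ⟨hd.1.map (inj γ), hp.1, ?_⟩, fun x => ?_⟩
  · rintro _ hx y hy rfl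
    obtain ⟨z, -, rfl⟩ := List.mem_map.1 hx
    exact (hp.2 _).1 hy ⟨z, rfl⟩
  · rw [List.mem_append, hp.2]
    by_cases hx : x ∈ Set.range γ
    · obtain ⟨z, rfl⟩ := hx
      rw [List.mem_map_of_injective (inj γ), hd.2]
      exact (or_iff_left fun h => h ⟨z, rfl⟩).trans (isInner_iff γ).symm
    · exact iff_of_true (Or.inr hx) (inner_of_not_mem_range γ hx)

/-- In the list `(β p, r)` the edges in the image of `β` already stand in front, so the permutation
in the definition of the induced map is trivial and no sign occurs. -/
theorem elt_push {γ : S ⟶ S'} {β : S' ⟶ T} {d : List S.Edge} {p : List S'.Edge} {r : List T.Edge}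
    (hd : IsEnum d {x | S.IsInner x}) (hp : IsEnum p (Set.range γ)ᶜ)
    (hr : IsEnum r (Set.range β)ᶜ) {n m : ℤ} (x : (M.obj (op T)).X n) :
    (((Bar M).map γ).f m).hom ((Bar.elt M (γ ≫ β) d (p.map β ++ r) n m).hom x) =
      (Bar.elt M β (d.map γ ++ p) r n m).hom x := by
  have h0 : ∀ y ∈ r, y ∉ Set.range β := fun y hy => (hr.2 y).1 hy
  have h1 : inversions (· ∈ Set.range β) (p.map β ++ r) = 0 := by
    clear hp
    induction p with
    | nil => exact inversions_eq_zero h0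
    | cons y p ih => exact (inversions_cons_pos (P := (· ∈ Set.range β)) ⟨y, rfl⟩ _).trans ih
  have h2 : pull β (p.map β ++ r) = p := by
    apply (inj β).list_map
    rw [map_pull_filt (inj β), filt_append, filt_eq_nil h0, List.append_nil, filt_eq_self]
    intro y hy
    obtain ⟨z, -, rfl⟩ := List.mem_map.1 hy
    exact ⟨z, rfl⟩
  have h3 : filt (· ∉ Set.range β) (p.map β ++ r) = r := by
    rw [filt_append, filt_eq_self h0, filt_eq_nil, List.nil_append]
    intro y hy h
    obtain ⟨z, -, rfl⟩ := List.mem_map.1 hy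
    exact h ⟨z, rfl⟩
  by_cases hv : Valid (γ ≫ β) d (p.map β ++ r) (n + 1) m
  · refine (push_gen γ hv _).trans ?_
    rw [pushGen_fac, pushFac, h1, h2, h3, pow_zero, one_smul]
    rfl
  · rw [elt_of_not hv, elt_of_not]
    · exact map_zero _
    · rintro ⟨-, -, h⟩
      refine hv ⟨hd, isEnum_push hp hr, ?_⟩
      rw [← h]
      simp only [List.length_append, List.length_map]
      push_cast
      ring

section naturality
variable (γ : S ⟶ S') (γ' : Q ⟶ Q') {a : S.Leaf} {d : List S.Edge} {d' : List Q.Edge}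
  {p : List S'.Edge} {p' : List Q'.Edge}

/-- Two reorderings produce the sign. The missed edges have to be listed as `(p, p', r, r')`, which
moves `r` past `p'`. After the push, the inner edges come as `(a, d, d', p, p')`, and `p` has to be
moved past `d'`. -/
theorem elt_graft_push {β : S' ⟶ T} {β' : Q' ⟶ U} {r : List T.Edge} {r' : List U.Edge}
    (hd : IsEnum d {x | S.IsInner x}) (hd' : IsEnum d' {x | Q.IsInner x})
    (hp : IsEnum p (Set.range γ)ᶜ) (hp' : IsEnum p' (Set.range γ')ᶜ)
    (hr : IsEnum r (Set.range β)ᶜ) (hr' : IsEnum r' (Set.range β')ᶜ) {n m : ℤ}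
    (x : (M.obj (op (graft T U (leafMap (γ ≫ β) a)))).X n) :
    (((Bar M).map (graftMap γ γ' a)).f m).hom
      ((Bar.elt M (graftMap (γ ≫ β) (γ' ≫ β') a) (graftInner a d d')
        (graftEnum (leafMap (γ ≫ β) a) (p.map β ++ r) (p'.map β' ++ r')) n m).hom x) =
    (p.length * d'.length + r.length * p'.length : ℤ).negOnePow •
      (Bar.elt M (graftMap β β' (leafMap γ a)) (graftInner (leafMap γ a) (d.map γ ++ p)
        (d'.map γ' ++ p')) (graftEnum (leafMap β (leafMap γ a)) r r') n m).hom x := by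
  have hg : graftMap γ γ' a ≫ graftMap β β' (leafMap γ a) = graftMap (γ ≫ β) (γ' ≫ β') a :=
    graftMap_comp γ γ' β β' a
  have h1 := (elt_alternating_right (M := M) (graftMap (γ ≫ β) (γ' ≫ β') a) (graftInner a d d')
    n m x).append_append ((p.map β).map (inl U (leafMap (γ ≫ β) a)))
      (r.map (inl U (leafMap (γ ≫ β) a))) ((p'.map β').map (inr (leafMap (γ ≫ β) a)))
      (r'.map (inr (leafMap (γ ≫ β) a)))
  have h2 := elt_push (M := M) (γ := graftMap γ γ' a) (β := graftMap β β' (leafMap γ a))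
    (isEnum_cons_graft (a := a) hd hd') (isEnum_append_graft (a := a) hp hp')
    (isEnum_append_graft (a := leafMap γ a) hr hr') (n := n) (m := m) x
  have h3 := (elt_alternating_left (M := M) (graftMap β β' (leafMap γ a))
    (graftEnum (leafMap β (leafMap γ a)) r r') n m x).append_append
      (inl Q' (leafMap γ a) (leafMap γ a).1 :: (d.map γ).map (inl Q' (leafMap γ a)))
      ((d'.map γ').map (inr (leafMap γ a))) (p.map (inl Q' (leafMap γ a)))
      (p'.map (inr (leafMap γ a)))
  have e1 : graftEnum (leafMap (γ ≫ β) a) (p.map β ++ r) (p'.map β' ++ r') =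
      (p.map β).map (inl U (leafMap (γ ≫ β) a)) ++ (r.map (inl U (leafMap (γ ≫ β) a)) ++
        ((p'.map β').map (inr (leafMap (γ ≫ β) a)) ++ r'.map (inr (leafMap (γ ≫ β) a)))) :=
    (congrArg₂ (· ++ ·) List.map_append List.map_append).trans (List.append_assoc ..)
  have e2 : (p.map β).map (inl U (leafMap (γ ≫ β) a)) ++
      ((p'.map β').map (inr (leafMap (γ ≫ β) a)) ++ (r.map (inl U (leafMap (γ ≫ β) a)) ++
        r'.map (inr (leafMap (γ ≫ β) a)))) =
      (graftEnum (leafMap γ a) p p').map (graftMap β β' (leafMap γ a)) ++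
        graftEnum (leafMap β (leafMap γ a)) r r' := by
    rw [List.map_append, List.map_map, List.map_map, List.map_map, List.map_map,
      List.append_assoc]
    refine congrArg₂ (· ++ ·) (List.map_congr_left fun y _ => ?_)
      (congrArg₂ (· ++ ·) (List.map_congr_left fun y _ => ?_) rfl)
    · exact (graftMap_inl β β' (leafMap γ a) y).symm
    · exact (graftMap_inr β β' (leafMap γ a) y).symm
  have e3 : (graftInner a d d').map (graftMap γ γ' a) ++ graftEnum (leafMap γ a) p p' =
      (inl Q' (leafMap γ a) (leafMap γ a).1 :: (d.map γ).map (inl Q' (leafMap γ a))) ++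
      ((d'.map γ').map (inr (leafMap γ a)) ++ (p.map (inl Q' (leafMap γ a)) ++
      (p'.map (inr (leafMap γ a))))) := by
    rw [List.map_cons, List.map_append, List.map_map, List.map_map, List.map_map, List.map_map,
      graftMap_inl]
    simp only [List.cons_append, List.append_assoc]
    refine congrArg₂ List.cons rfl (congrArg₂ (· ++ ·) (List.map_congr_left fun y _ => ?_)
      (congrArg₂ (· ++ ·) (List.map_congr_left fun y _ => ?_) rfl))
    · exact graftMap_inl γ γ' a y
    · exact graftMap_inr γ γ' a y
  have e4 : (inl Q' (leafMap γ a) (leafMap γ a).1 :: (d.map γ).map (inl Q' (leafMap γ a))) ++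
      (p.map (inl Q' (leafMap γ a)) ++ ((d'.map γ').map (inr (leafMap γ a)) ++
      (p'.map (inr (leafMap γ a))))) =
      graftInner (leafMap γ a) (d.map γ ++ p) (d'.map γ' ++ p') := by
    simp only [graftInner, List.map_append, List.cons_append, List.append_assoc]
  rw [e1, h1, map_units_smul', e2]
  rw [e3] at h2
  rw [e4] at h3
  have h4 : (((Bar M).map (graftMap γ γ' a)).f m).hom
      ((Bar.elt M (graftMap (γ ≫ β) (γ' ≫ β') a) (graftInner a d d')
        ((graftEnum (leafMap γ a) p p').map (graftMap β β' (leafMap γ a)) ++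
        graftEnum (leafMap β (leafMap γ a)) r r') n m).hom x) = _ :=
    (congrArg (fun k => (((Bar M).map (graftMap γ γ' a)).f m).hom
      ((Bar.elt M k (graftInner a d d')
        ((graftEnum (leafMap γ a) p p').map (graftMap β β' (leafMap γ a)) ++
        graftEnum (leafMap β (leafMap γ a)) r r') n m).hom x)) hg.symm).trans h2
  refine (congrArg _ (h4.trans h3)).trans ?_
  rw [smul_smul, ← Int.negOnePow_add]
  refine congrArg₂ (· • ·) (congrArg _ ?_) rfl
  simp only [List.length_map]
  ring

/-- Of the Koszul sign only the summand `|e_S| |d_Q|` changes: `(|p| + |r|) |d'|` becomes `|r| (|d'|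
+ |p'|)`. The difference is the sign of `elt_graft_push`. -/
theorem eltTensor_push {β : S' ⟶ T} {β' : Q' ⟶ U} {r : List T.Edge} {r' : List U.Edge}
    (hd : IsEnum d {x | S.IsInner x}) (hd' : IsEnum d' {x | Q.IsInner x})
    (hp : IsEnum p (Set.range γ)ᶜ) (hp' : IsEnum p' (Set.range γ')ᶜ)
    (hr : IsEnum r (Set.range β)ᶜ) (hr' : IsEnum r' (Set.range β')ᶜ) {n m : ℤ} (hm) (hm')
    (z : (M.obj (op T) ⊗ M.obj (op U)).X n) :
    (((Bar M).map γ ⊗ₘ (Bar M).map γ').f m).hom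
      ((eltTensor M (γ ≫ β) (γ' ≫ β') d (p.map β ++ r) d' (p'.map β' ++ r') n m hm).hom z) =
    (p.length * d'.length + r.length * p'.length : ℤ).negOnePow •
      (eltTensor M β β' (d.map γ ++ p) r (d'.map γ' ++ p') r' n m hm').hom z := by
  suffices h : eltTensor M (γ ≫ β) (γ' ≫ β') d (p.map β ++ r) d' (p'.map β' ++ r') n m hm ≫
      ((Bar M).map γ ⊗ₘ (Bar M).map γ').f m =
    (p.length * d'.length + r.length * p'.length : ℤ).negOnePow •
      eltTensor M β β' (d.map γ ++ p) r (d'.map γ' ++ p') r' n m hm' by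
    have h1 := congrArg (fun f => f.hom z) h
    rwa [ModuleCat.comp_apply, Ch.units_smul_hom_apply] at h1
  apply Ch.hom_ext_tmul
  intro i j hij x y
  rw [ModuleCat.comp_apply, Ch.units_smul_hom_apply, eltTensor_tmul _ _ _ _ _ _ _ _ _ hij rfl rfl,
    eltTensor_tmul _ _ _ _ _ _ _ _ _ hij (k := d.length + (p.map β ++ r).length + (i + 1))
      (l := d'.length + (p'.map β' ++ r').length + (j + 1))
      (by simp only [List.length_append, List.length_map]; push_cast; ring)
      (by simp only [List.length_append, List.length_map]; push_cast; ring),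
    map_units_smul', Ch.map_tmul, elt_push hd hp hr, elt_push hd' hp' hr', smul_smul]
  refine congrArg₂ (· • ·) ?_ rfl
  rw [graftSign, graftSign, ← Int.negOnePow_add]
  apply negOnePow_eq_of_zmod
  simp only [List.length_append, List.length_map]
  push_cast
  grind

theorem eltTensor_push_not {α : S ⟶ T} {α' : Q ⟶ U} (e : List T.Edge) (e' : List U.Edge)
    (h : ¬ ((∃ β, γ ≫ β = α) ∧ ∃ β', γ' ≫ β' = α')) {n m : ℤ} (hm)
    (z : (M.obj (op T) ⊗ M.obj (op U)).X n) :
    (((Bar M).map γ ⊗ₘ (Bar M).map γ').f m).hom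
      ((eltTensor M α α' d e d' e' n m hm).hom z) = 0 := by
  suffices h : eltTensor M α α' d e d' e' n m hm ≫ ((Bar M).map γ ⊗ₘ (Bar M).map γ').f m = 0 from
    congrArg (fun f => f.hom z) h
  apply Ch.hom_ext_tmul
  intro i j hij x y
  rw [ModuleCat.comp_apply, eltTensor_tmul _ _ _ _ _ _ _ _ _ hij rfl rfl, map_units_smul',
    Ch.map_tmul]
  refine Eq.trans (b := graftSign d.length e.length d'.length e'.length i j •
    (0 : ((Bar M).obj S' ⊗ (Bar M).obj Q').X m)) (congrArg _ ?_) (smul_zero _)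
  rw [not_and_or] at h
  rcases h with h | h
  · rw [elt_push_not h, Ch.zero_tmul]
  · rw [elt_push_not h, Ch.tmul_zero]

theorem comul_naturality (θ : Preoperad M) (a : S.Leaf) :
    (Bar M).map (graftMap γ γ' a) ≫ comul θ S' Q' (leafMap γ a) =
      comul θ S Q a ≫ ((Bar M).map γ ⊗ₘ (Bar M).map γ') := by
  ext1 m
  have hd := isEnum_innerEnum S
  have hd' := isEnum_innerEnum Q
  apply bar_graft_ext hd hd'
  intro T U α α'
  -- If both morphisms factor, the enumerations are composed from those of the factors. Otherwise
  -- both sides vanish, the left one by `graftMap_factor`.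
  by_cases h : (∃ β, γ ≫ β = α) ∧ ∃ β', γ' ≫ β' = α'
  · obtain ⟨⟨β, rfl⟩, ⟨β', rfl⟩⟩ := h
    obtain ⟨p, hp⟩ := exists_isEnum (Set.range γ)ᶜ
    obtain ⟨p', hp'⟩ := exists_isEnum (Set.range γ')ᶜ
    obtain ⟨r, hr⟩ := exists_isEnum (Set.range β)ᶜ
    obtain ⟨r', hr'⟩ := exists_isEnum (Set.range β')ᶜ
    refine ⟨p.map β ++ r, p'.map β' ++ r', isEnum_push hp hr, isEnum_push hp' hr',
      fun n hm x => ?_⟩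
    have hm' : (1 + ((innerEnum S).map γ ++ p).length + ((innerEnum Q).map γ' ++ p').length : ℤ) +
        (r.length + r'.length) + (n + 1) = m := by
      simp only [List.length_append, List.length_map] at hm ⊢
      push_cast at hm ⊢
      lia
    have h1 := elt_graft_push (M := M) γ γ' (a := a) hd hd' hp hp' hr hr' (m := m) x
    have h2 := elt_comul θ (a := leafMap γ a) β β' (isEnum_map_append hd hp) hr
      (isEnum_map_append hd' hp') hr' hm' x
    have h3 := elt_comul θ (a := a) (γ ≫ β) (γ' ≫ β') hd (isEnum_push hp hr) hd'
      (isEnum_push hp' hr') hm x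
    have h4 := eltTensor_push (M := M) γ γ' hd hd' hp hp' hr hr' hm hm'
      (((θ.θ T U (leafMap (γ ≫ β) a)).f n).hom x)
    refine (congrArg ((comul θ S' Q' (leafMap γ a)).f m).hom h1).trans ?_
    rw [map_units_smul']
    refine (congrArg _ h2).trans ?_
    exact (h4.symm.trans (congrArg (((Bar M).map γ ⊗ₘ (Bar M).map γ').f m).hom h3.symm))
  · obtain ⟨e, he⟩ := exists_isEnum (Set.range α)ᶜ
    obtain ⟨e', he'⟩ := exists_isEnum (Set.range α')ᶜ
    refine ⟨e, e', he, he', fun n hm x => ?_⟩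
    have h1 := elt_push_not (M := M) (γ := graftMap γ γ' a) (α := graftMap α α' a)
      (fun ⟨f, hf⟩ => h (graftMap_factor hf)) (graftInner a (innerEnum S) (innerEnum Q))
      (graftEnum (leafMap α a) e e') n m x
    have h3 := elt_comul θ (a := a) α α' hd he hd' he' hm x
    have h4 := eltTensor_push_not (M := M) γ γ' e e' h hm (((θ.θ T U (leafMap α a)).f n).hom x)
    refine (congrArg ((comul θ S' Q' (leafMap γ a)).f m).hom h1).trans ((map_zero _).trans ?_)
    exact (h4.symm.trans (congrArg (((Bar M).map γ ⊗ₘ (Bar M).map γ').f m).hom h3.symm))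

end naturality

section map
variable {M' : RTreeᵒᵖ ⥤ Ch R} (f : M ⟶ M')

theorem elt_map (α : S ⟶ T) (d : List S.Edge) (e : List T.Edge) (n m : ℤ)
    (x : (M.obj (op T)).X n) :
    (((Bar.map f).app S).f m).hom ((Bar.elt M α d e n m).hom x) =
      (Bar.elt M' α d e n m).hom (((f.app (op T)).f n).hom x) := by
  by_cases hv : Valid α d e (n + 1) m
  · refine (mapMod_gen (Functor.whiskerRight f Ch.susp) hv _).trans ?_
    rw [elt_apply, Ch.suspMap_naturality]
    rfl
  · rw [elt_of_not hv, elt_of_not hv]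
    exact map_zero _

theorem eltTensor_map (α : S ⟶ T) (β : Q ⟶ U) (d : List S.Edge) (e : List T.Edge)
    (d' : List Q.Edge) (e' : List U.Edge) (n m : ℤ) (hm)
    (z : (M.obj (op T) ⊗ M.obj (op U)).X n) :
    (((Bar.map f).app S ⊗ₘ (Bar.map f).app Q).f m).hom
      ((eltTensor M α β d e d' e' n m hm).hom z) =
    (eltTensor M' α β d e d' e' n m hm).hom
      (((f.app (op T) ⊗ₘ f.app (op U)).f n).hom z) := by
  suffices h : eltTensor M α β d e d' e' n m hm ≫ ((Bar.map f).app S ⊗ₘ (Bar.map f).app Q).f m =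
      (f.app (op T) ⊗ₘ f.app (op U)).f n ≫ eltTensor M' α β d e d' e' n m hm from
    congrArg (fun f => f.hom z) h
  apply Ch.hom_ext_tmul
  intro i j hij x y
  rw [ModuleCat.comp_apply, ModuleCat.comp_apply, Ch.map_tmul,
    eltTensor_tmul _ _ _ _ _ _ _ _ _ hij rfl rfl, eltTensor_tmul _ _ _ _ _ _ _ _ _ hij rfl rfl,
    map_units_smul', Ch.map_tmul, elt_map, elt_map]

theorem comul_map (θ : Preoperad M) (θ' : Preoperad M') (hf : θ.IsHom θ' f) (S Q : RTree)
    (a : S.Leaf) :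
    comul θ S Q a ≫ ((Bar.map f).app S ⊗ₘ (Bar.map f).app Q) =
      (Bar.map f).app (graft S Q a) ≫ comul θ' S Q a := by
  ext1 m
  have hd := isEnum_innerEnum S
  have hd' := isEnum_innerEnum Q
  apply bar_graft_ext hd hd'
  intro T U α β
  obtain ⟨e, he⟩ := exists_isEnum (Set.range α)ᶜ
  obtain ⟨e', he'⟩ := exists_isEnum (Set.range β)ᶜ
  refine ⟨e, e', he, he', fun n hm x => ?_⟩
  have h1 := elt_comul θ (a := a) α β hd he hd' he' hm x
  have h2 := elt_comul θ' (a := a) α β hd he hd' he' hm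
    (((f.app (op (graft T U (leafMap α a)))).f n).hom x)
  have h3 := elt_map f (graftMap α β a) (graftInner a (innerEnum S) (innerEnum Q))
    (graftEnum (leafMap α a) e e') n m x
  have h4 := eltTensor_map f α β (innerEnum S) e (innerEnum Q) e' n m hm
    (((θ.θ T U (leafMap α a)).f n).hom x)
  have h5 := congrArg (fun k => (k.f n).hom x) (hf T U (leafMap α a))
  refine (congrArg (((Bar.map f).app S ⊗ₘ (Bar.map f).app Q).f m).hom h1).trans (h4.trans ?_)
  refine Eq.trans ?_ (congrArg ((comul θ' S Q a).f m).hom h3).symm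
  refine Eq.trans ?_ h2.symm
  exact congrArg _ h5

end map

end Bar
end

/-! ### Triple graftings and triple tensor products -/

namespace RTree
variable {S T U Q P : RTree}

theorem seqHom_inl_inl (a : S.Leaf) (b : Q.Leaf) (s : S.Edge) :
    seqHom P a b (inl P (inrLeaf a b) (inl Q a s)) = inl (graft Q P b) a s :=
  (graftElim_inl _ _ _).trans (seqFun_inl a b s)

theorem seqHom_inl_inr (a : S.Leaf) (b : Q.Leaf) (q : Q.Edge) :
    seqHom P a b (inl P (inrLeaf a b) (inr a q)) = inr a (inl P b q) :=
  (graftElim_inl _ _ _).trans (seqFun_inr a b q)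

theorem seqHom_inr (a : S.Leaf) (b : Q.Leaf) (p : P.Edge) :
    seqHom P a b (inr (inrLeaf a b) p) = inr a (inr b p) :=
  graftElim_inr _ _ ((seqFun_inr a b b.1).trans (by rw [inr_root])) p

theorem seqHom_surjective (a : S.Leaf) (b : Q.Leaf) : Function.Surjective (seqHom P a b) := by
  intro x
  rcases graft_cases x with ⟨s, rfl⟩ | ⟨x, -, rfl⟩
  · exact ⟨_, seqHom_inl_inl a b s⟩
  · rcases graft_cases x with ⟨q, rfl⟩ | ⟨p, -, rfl⟩
    · exact ⟨_, seqHom_inl_inr a b q⟩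
    · exact ⟨_, seqHom_inr a b p⟩

theorem parHom_inl_inl (a b : S.Leaf) (h : b ≠ a) (s : S.Edge) :
    parHom Q P a b h (inl P (inlLeaf Q a b h) (inl Q a s)) =
      inl Q (inlLeaf P b a h.symm) (inl P b s) :=
  (graftElim_inl _ _ _).trans (parFun_inl a b h s)

theorem parHom_inl_inr (a b : S.Leaf) (h : b ≠ a) (q : Q.Edge) :
    parHom Q P a b h (inl P (inlLeaf Q a b h) (inr a q)) = inr (inlLeaf P b a h.symm) q :=
  (graftElim_inl _ _ _).trans (parFun_inr a b h q)

theorem parHom_inr (a b : S.Leaf) (h : b ≠ a) (p : P.Edge) :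
    parHom Q P a b h (inr (inlLeaf Q a b h) p) = inl Q (inlLeaf P b a h.symm) (inr b p) :=
  graftElim_inr _ _ ((parFun_inl a b h b.1).trans (by rw [inr_root])) p

theorem parHom_surjective (a b : S.Leaf) (h : b ≠ a) :
    Function.Surjective (parHom Q P a b h) := by
  intro x
  rcases graft_cases x with ⟨x, rfl⟩ | ⟨q, -, rfl⟩
  · rcases graft_cases x with ⟨s, rfl⟩ | ⟨p, -, rfl⟩
    · exact ⟨_, parHom_inl_inl a b h s⟩
    · exact ⟨_, parHom_inr a b h p⟩
  · exact ⟨_, parHom_inl_inr a b h q⟩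

end RTree

noncomputable section
namespace Ch
variable {R : Type u} [CommRing R] {K L P : Ch R}

theorem associator_inv_tmul {i j k ij jk n : ℤ} (hij : i + j = ij) (hjk : j + k = jk)
    (h : i + jk = n) (x : K.X i) (y : L.X j) (z : P.X k) :
    ((α_ K L P).inv.f n).hom (tmul n h x (tmul jk hjk y z)) =
      tmul n (by lia) (tmul ij hij x y) z := by
  rw [← associator_tmul hij (by lia) hjk x y z]
  exact congrArg (fun f : (K ⊗ L) ⊗ P ⟶ (K ⊗ L) ⊗ P => (f.f n).hom _) (α_ K L P).hom_inv_id

end Ch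

namespace Bar
open Opposite RTree
open scoped Classical
variable {R : Type u} [CommRing R] {M : RTreeᵒᵖ ⥤ Ch R}
variable {S S' T T' U U' Q Q' P W : RTree}

/-- The leaf `c` is a variable because, in the application, it is the image of `inrLeaf a b` under a
graft map, and this equals the required leaf only propositionally. -/
theorem exists_seqIso (θ : Preoperad M) (P : RTree) (a : S.Leaf) (b : Q.Leaf)
    {c : (graft S Q a).Leaf} (hc : c = inrLeaf a b) :
    ∃ κ : graft (graft S Q a) P c ≅ graft S (graft Q P b) a,
      (∀ s, κ.hom (inl P c (inl Q a s)) = inl (graft Q P b) a s) ∧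
      (∀ q, κ.hom (inl P c (inr a q)) = inr a (inl P b q)) ∧
      (∀ p, κ.hom (inr c p) = inr a (inr b p)) ∧
      M.map κ.hom.op ≫ θ.θ (graft S Q a) P c ≫ (θ.θ S Q a ▷ M.obj (op P)) ≫ (α_ _ _ _).hom =
        θ.θ S (graft Q P b) a ≫ (M.obj (op S) ◁ θ.θ Q P b) := by
  subst hc
  obtain ⟨κ, hκ⟩ := exists_iso_of_surjective (seqHom P a b) (seqHom_surjective a b)
  refine ⟨κ, ?_⟩
  rw [hκ]
  exact ⟨seqHom_inl_inl a b, seqHom_inl_inr a b, seqHom_inr a b, θ.assoc_sequential S Q P a b⟩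

theorem exists_parIso (θ : Preoperad M) (Q P : RTree) (a b : S.Leaf) (h : b ≠ a)
    {c : (graft S Q a).Leaf} (hc : c = inlLeaf Q a b h) {c' : (graft S P b).Leaf}
    (hc' : c' = inlLeaf P b a h.symm) :
    ∃ κ : graft (graft S Q a) P c ≅ graft (graft S P b) Q c',
      (∀ s, κ.hom (inl P c (inl Q a s)) = inl Q c' (inl P b s)) ∧
      (∀ q, κ.hom (inl P c (inr a q)) = inr c' q) ∧
      (∀ p, κ.hom (inr c p) = inl Q c' (inr b p)) ∧
      M.map κ.hom.op ≫ θ.θ (graft S Q a) P c ≫ (θ.θ S Q a ▷ M.obj (op P)) ≫ (α_ _ _ _).hom ≫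
          (M.obj (op S) ◁ Ch.swap (M.obj (op Q)) (M.obj (op P))) =
        θ.θ (graft S P b) Q c' ≫ (θ.θ S P b ▷ M.obj (op Q)) ≫ (α_ _ _ _).hom := by
  subst hc hc'
  obtain ⟨κ, hκ⟩ := exists_iso_of_surjective (parHom Q P a b h) (parHom_surjective a b h)
  refine ⟨κ, ?_⟩
  rw [hκ]
  exact ⟨parHom_inl_inl a b h, parHom_inl_inr a b h, parHom_inr a b h,
    θ.assoc_parallel S Q P a b h⟩

/-- Lets an element be written as a pullback along the comparison isomorphism, which is the form in
which the associativity of θ applies. -/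
theorem map_iso_surjective (k : T ≅ T') (n : ℤ) (x : (M.obj (op T)).X n) :
    ∃ x', ((M.map k.hom.op).f n).hom x' = x := by
  refine ⟨((M.map k.inv.op).f n).hom x, ?_⟩
  have h : M.map k.inv.op ≫ M.map k.hom.op = 𝟙 _ := by
    rw [← M.map_comp, ← op_comp, k.hom_inv_id]
    exact M.map_id _
  exact congrArg (fun f : M.obj (op T) ⟶ M.obj (op T) => (f.f n).hom x) h

/-- A surjective `f` misses no edge, so nothing is appended to the inner edges: this is `elt_push`
with `p = []`. -/
theorem elt_push_iso {f : S ⟶ S'} (hf : Function.Surjective f) {α : S ⟶ T} (k : T ≅ T')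
    {g : S' ⟶ T'} (hg : f ≫ g = α ≫ k.hom) {d : List S.Edge} {e : List T.Edge}
    (hd : IsEnum d {x | S.IsInner x}) (he : IsEnum e (Set.range α)ᶜ) {n m : ℤ}
    (x : (M.obj (op T')).X n) :
    (((Bar M).map f).f m).hom ((Bar.elt M α d e n m).hom (((M.map k.hom.op).f n).hom x)) =
      (Bar.elt M g (d.map f) (e.map k.hom) n m).hom x := by
  have h1 : Set.range g = Set.range (α ≫ k.hom) := by
    rw [← hg]
    exact (hf.range_comp g).symm
  have he' : IsEnum (e.map k.hom) (Set.range g)ᶜ := by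
    rw [h1]
    exact (isEnum_map (iso_bijective k) fun x => not_congr (range_iso_comp α k x).symm).2 he
  have h2 := elt_push (M := M) (γ := f) (β := g) (p := []) hd ⟨List.nodup_nil, fun y => by
    simp [hf.range_eq]⟩ he' (n := n) (m := m) x
  rw [elt_iso, ← hg]
  rw [List.append_nil] at h2
  exact h2

/-- The leaf `c` may belong to `S` or to `Q`, so both coassociativity conditions are covered. The 2
in the degree counts the two grafting edges. -/
theorem bar_graft_graft_ext {a : S.Leaf} {c : (graft S Q a).Leaf} {d : List S.Edge}
    {d' : List Q.Edge} {d'' : List P.Edge}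
    (hd : IsEnum d {x | S.IsInner x}) (hd' : IsEnum d' {x | Q.IsInner x})
    (hd'' : IsEnum d'' {x | P.IsInner x}) {m : ℤ}
    {V : ModuleCat.{u} R} {f g : ((Bar M).obj (graft (graft S Q a) P c)).X m ⟶ V}
    (h : ∀ {T U W : RTree} (α : S ⟶ T) (β : Q ⟶ U) (γ : P ⟶ W) (e : List T.Edge)
      (e' : List U.Edge) (e'' : List W.Edge), IsEnum e (Set.range α)ᶜ →
      IsEnum e' (Set.range β)ᶜ → IsEnum e'' (Set.range γ)ᶜ →
      ∀ (n : ℤ), (2 + d.length + d'.length + d''.length : ℤ) +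
          (e.length + e'.length + e''.length) + (n + 1) = m →
        ∀ x : (M.obj (op (graft (graft T U (leafMap α a)) W (leafMap (graftMap α β a) c)))).X n,
        f.hom ((Bar.elt M (graftMap (graftMap α β a) γ c) (graftInner c (graftInner a d d') d'')
          (graftEnum (leafMap (graftMap α β a) c) (graftEnum (leafMap α a) e e') e'') n m).hom x) =
        g.hom ((Bar.elt M (graftMap (graftMap α β a) γ c) (graftInner c (graftInner a d d') d'')
          (graftEnum (leafMap (graftMap α β a) c) (graftEnum (leafMap α a) e e') e'') n m).hom x)) :
    f = g := by
  apply bar_hom_ext (M := M)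
    (((Reps.canonical S).graft (Reps.canonical Q) a).graft (Reps.canonical P) c)
    (isEnum_cons_graft (a := c) (isEnum_cons_graft (a := a) hd hd') hd'')
  rintro ⟨⟨i, j⟩, k⟩ n hm
  ext x
  refine h ((Reps.canonical S).α i) ((Reps.canonical Q).α j) ((Reps.canonical P).α k)
    _ _ _ ((Reps.canonical S).enum i) ((Reps.canonical Q).enum j) ((Reps.canonical P).enum k) n ?_ x
  rw [← hm, length_graftInner, length_graftInner]
  have h2 : ((((Reps.canonical S).graft (Reps.canonical Q) a).graft (Reps.canonical P) c).e
    ((i, j), k)).length = (_ : ℤ) :=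
      (length_graftEnum _ _ _).trans (congrArg (· + _) (length_graftEnum _ _ _))
  rw [h2]
  ring

/-- The family of the maps `eltTensor` in all degrees. -/
def eltTensorFam (M : RTreeᵒᵖ ⥤ Ch R) (α : S ⟶ T) (β : Q ⟶ U) (d : List S.Edge)
    (e : List T.Edge) (d' : List Q.Edge) (e' : List U.Edge) (n m : ℤ) :
    (M.obj (op T) ⊗ M.obj (op U)).X n ⟶ ((Bar M).obj S ⊗ (Bar M).obj Q).X m :=
  if hm : (1 + d.length + d'.length : ℤ) + (e.length + e'.length) + (n + 1) = m then
    eltTensor M α β d e d' e' n m hm else 0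

theorem eltTensorFam_eq (α : S ⟶ T) (β : Q ⟶ U) (d : List S.Edge)
    (e : List T.Edge) (d' : List Q.Edge) (e' : List U.Edge) {n m : ℤ}
    (hm : (1 + d.length + d'.length : ℤ) + (e.length + e'.length) + (n + 1) = m) :
    eltTensorFam M α β d e d' e' n m = eltTensor M α β d e d' e' n m hm := dif_pos hm

theorem eltTensorFam_tmul (α : S ⟶ T) (β : Q ⟶ U) (d : List S.Edge) (e : List T.Edge)
    (d' : List Q.Edge) (e' : List U.Edge) {n m : ℤ}
    (hm : (1 + d.length + d'.length : ℤ) + (e.length + e'.length) + (n + 1) = m)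
    {i j k l : ℤ} (hij : i + j = n) (hk : (d.length : ℤ) + e.length + (i + 1) = k)
    (hl : (d'.length : ℤ) + e'.length + (j + 1) = l)
    (x : (M.obj (op T)).X i) (y : (M.obj (op U)).X j) :
    (eltTensorFam M α β d e d' e' n m).hom (Ch.tmul n hij x y) =
      graftSign d.length e.length d'.length e'.length i j •
        Ch.tmul m (by lia) ((Bar.elt M α d e i k).hom x) ((Bar.elt M β d' e' j l).hom y) := by
  rw [eltTensorFam_eq (hm := hm)]
  exact eltTensor_tmul α β d e d' e' n m hm hij hk hl x y

section triple
variable (α : S ⟶ T) (β : Q ⟶ U) (γ : P ⟶ W) (d : List S.Edge) (e : List T.Edge)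
  (d' : List Q.Edge) (e' : List U.Edge) (d'' : List P.Edge) (e'' : List W.Edge) {n m : ℤ}
  (hm : (2 + d.length + d'.length + d''.length : ℤ) +
    (e.length + e'.length + e''.length) + (n + 1) = m)

/-- The map `(x₁ ⊗ x₂) ⊗ x₃ ↦ ± ((α, s x₁) ⊗ (β, s x₂)) ⊗ (γ, s x₃)`. -/
def eltTensorLeft : ((M.obj (op T) ⊗ M.obj (op U)) ⊗ M.obj (op W)).X n ⟶
    (((Bar M).obj S ⊗ (Bar M).obj Q) ⊗ (Bar M).obj P).X m :=
  Ch.gtensor (graftSign (1 + d.length + d'.length) (e.length + e'.length) d''.length e''.length)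
    (eltTensorFam M α β d e d' e') (Bar.elt M γ d'' e'')
    (1 + d.length + d'.length + e.length + e'.length + 1) (d''.length + e''.length + 1) (by lia)

/-- The map `x₁ ⊗ (x₂ ⊗ x₃) ↦ ± (α, s x₁) ⊗ ((β, s x₂) ⊗ (γ, s x₃))`. -/
def eltTensorRight : (M.obj (op T) ⊗ (M.obj (op U) ⊗ M.obj (op W))).X n ⟶
    ((Bar M).obj S ⊗ ((Bar M).obj Q ⊗ (Bar M).obj P)).X m :=
  Ch.gtensor (graftSign d.length e.length (1 + d'.length + d''.length) (e'.length + e''.length))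
    (Bar.elt M α d e) (eltTensorFam M β γ d' e' d'' e'')
    (d.length + e.length + 1) (1 + d'.length + d''.length + e'.length + e''.length + 1) (by lia)

theorem eltTensorLeft_tmul {i j k ij i' j' k' : ℤ} (hij : i + j = ij) (h : ij + k = n)
    (hi : (d.length : ℤ) + e.length + (i + 1) = i') (hj : (d'.length : ℤ) + e'.length + (j + 1) = j')
    (hk : (d''.length : ℤ) + e''.length + (k + 1) = k')
    (x : (M.obj (op T)).X i) (y : (M.obj (op U)).X j) (z : (M.obj (op W)).X k) :
    (eltTensorLeft α β γ d e d' e' d'' e'' hm).hom (Ch.tmul n h (Ch.tmul ij hij x y) z) =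
      (graftSign (1 + d.length + d'.length) (e.length + e'.length) d''.length e''.length ij k *
        graftSign d.length e.length d'.length e'.length i j) •
      Ch.tmul m (by lia) (Ch.tmul (i' + j') rfl ((Bar.elt M α d e i i').hom x)
        ((Bar.elt M β d' e' j j').hom y)) ((Bar.elt M γ d'' e'' k k').hom z) := by
  refine (Ch.gtensor_tmul _ _ _ _ _ _ h (a := i' + j') (b := k') (by lia) (by lia) _ _).trans ?_
  rw [eltTensorFam_tmul _ _ _ _ _ _ (by lia) hij hi hj, Ch.units_smul_tmul, smul_smul]

theorem eltTensorRight_tmul {i j k jk i' j' k' : ℤ} (hjk : j + k = jk) (h : i + jk = n)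
    (hi : (d.length : ℤ) + e.length + (i + 1) = i') (hj : (d'.length : ℤ) + e'.length + (j + 1) = j')
    (hk : (d''.length : ℤ) + e''.length + (k + 1) = k')
    (x : (M.obj (op T)).X i) (y : (M.obj (op U)).X j) (z : (M.obj (op W)).X k) :
    (eltTensorRight α β γ d e d' e' d'' e'' hm).hom (Ch.tmul n h x (Ch.tmul jk hjk y z)) =
      (graftSign d.length e.length (1 + d'.length + d''.length) (e'.length + e''.length) i jk *
        graftSign d'.length e'.length d''.length e''.length j k) •
      Ch.tmul m (by lia) ((Bar.elt M α d e i i').hom x)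
        (Ch.tmul (j' + k') rfl ((Bar.elt M β d' e' j j').hom y)
          ((Bar.elt M γ d'' e'' k k').hom z)) := by
  refine (Ch.gtensor_tmul _ _ _ _ _ _ h (a := i') (b := j' + k') (by lia) (by lia) _ _).trans ?_
  rw [eltTensorFam_tmul _ _ _ _ _ _ (by lia) hjk hj hk, Ch.tmul_units_smul, smul_smul]

/-- The sign reflects a change of order of the inner edges. The left bracketing lists them as `(b,
a, d, d', d'')` and the right one as `(a, d, b, d', d'')`, so `b` moves past `1 + |d|` entries. -/
theorem eltTensorLeft_associator (z : ((M.obj (op T) ⊗ M.obj (op U)) ⊗ M.obj (op W)).X n) :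
    ((α_ ((Bar M).obj S) ((Bar M).obj Q) ((Bar M).obj P)).hom.f m).hom ((eltTensorLeft α β γ d e d' e' d'' e'' hm).hom z) =
      (1 + d.length : ℤ).negOnePow • (eltTensorRight α β γ d e d' e' d'' e'' hm).hom
        (((α_ (M.obj (op T)) (M.obj (op U)) (M.obj (op W))).hom.f n).hom z) := by
  suffices h : eltTensorLeft (M := M) α β γ d e d' e' d'' e'' hm ≫ (α_ ((Bar M).obj S) ((Bar M).obj Q) ((Bar M).obj P)).hom.f m =
      (1 + d.length : ℤ).negOnePow • ((α_ (M.obj (op T)) (M.obj (op U)) (M.obj (op W))).hom.f n ≫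
        eltTensorRight α β γ d e d' e' d'' e'' hm) by
    have h1 := congrArg (fun f => f.hom z) h
    rwa [ModuleCat.comp_apply, Ch.units_smul_hom_apply] at h1
  apply Ch.hom_ext_tmul₁₂
  intro i j ij k hij hn x y z
  rw [ModuleCat.comp_apply, Ch.units_smul_hom_apply, ModuleCat.comp_apply,
    eltTensorLeft_tmul _ _ _ _ _ _ _ _ _ _ hij hn rfl rfl rfl, Ch.associator_tmul hij hn rfl,
    eltTensorRight_tmul _ _ _ _ _ _ _ _ _ _ rfl _ rfl rfl rfl, map_units_smul',
    Ch.associator_tmul rfl _ rfl, smul_smul]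
  refine congrArg₂ (· • ·) ?_ rfl
  simp only [graftSign, ← Int.negOnePow_add]
  apply negOnePow_eq_of_zmod
  rw [← hij]
  push_cast
  grind

/-- The sign is that of exchanging the two grafting edges, the blocks `d'` and `d''`, and the blocks
`e'` and `e''`. The Koszul signs depending on the degrees of the elements are absorbed by the two
swaps. -/
theorem eltTensorLeft_swap (hm' : (2 + d.length + d''.length + d'.length : ℤ) +
    (e.length + e''.length + e'.length) + (n + 1) = m)
    (z : ((M.obj (op T) ⊗ M.obj (op U)) ⊗ M.obj (op W)).X n) :
    (((Bar M).obj S ◁ Ch.swap ((Bar M).obj Q) ((Bar M).obj P)).f m).hom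
      (((α_ ((Bar M).obj S) ((Bar M).obj Q) ((Bar M).obj P)).hom.f m).hom ((eltTensorLeft α β γ d e d' e' d'' e'' hm).hom z)) =
      (1 + d'.length * d''.length + e'.length * e''.length : ℤ).negOnePow •
        ((α_ ((Bar M).obj S) ((Bar M).obj P) ((Bar M).obj Q)).hom.f m).hom ((eltTensorLeft α γ β d e d'' e'' d' e' hm').hom
          (((α_ (M.obj (op T)) (M.obj (op W)) (M.obj (op U))).inv.f n).hom
            (((M.obj (op T) ◁ Ch.swap (M.obj (op U)) (M.obj (op W))).f n).hom
              (((α_ (M.obj (op T)) (M.obj (op U)) (M.obj (op W))).hom.f n).hom z)))) := by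
  suffices h : eltTensorLeft (M := M) α β γ d e d' e' d'' e'' hm ≫ (α_ ((Bar M).obj S) ((Bar M).obj Q) ((Bar M).obj P)).hom.f m ≫
      ((Bar M).obj S ◁ Ch.swap ((Bar M).obj Q) ((Bar M).obj P)).f m =
      (1 + d'.length * d''.length + e'.length * e''.length : ℤ).negOnePow •
        ((α_ (M.obj (op T)) (M.obj (op U)) (M.obj (op W))).hom.f n ≫ (M.obj (op T) ◁ Ch.swap (M.obj (op U)) (M.obj (op W))).f n ≫
          (α_ (M.obj (op T)) (M.obj (op W)) (M.obj (op U))).inv.f n ≫ eltTensorLeft α γ β d e d'' e'' d' e' hm' ≫ (α_ ((Bar M).obj S) ((Bar M).obj P) ((Bar M).obj Q)).hom.f m) by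
    have h1 := congrArg (fun f => f.hom z) h
    rwa [ModuleCat.comp_apply, Ch.units_smul_hom_apply] at h1
  apply Ch.hom_ext_tmul₁₂
  intro i j ij k hij hn x y z
  rw [Ch.units_smul_hom_apply]
  simp only [ModuleCat.comp_apply]
  rw [eltTensorLeft_tmul _ _ _ _ _ _ _ _ _ _ hij hn rfl rfl rfl, Ch.associator_tmul hij hn rfl,
    Ch.whiskerLeft_tmul, Ch.swap_tmul, Ch.tmul_units_smul, map_units_smul', map_units_smul',
    map_units_smul', map_units_smul', map_units_smul',
    Ch.associator_tmul rfl _ rfl, Ch.whiskerLeft_tmul, Ch.swap_tmul, Ch.tmul_units_smul,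
    Ch.associator_inv_tmul rfl,
    eltTensorLeft_tmul _ _ _ _ _ _ _ _ _ _ rfl _ rfl rfl rfl, map_units_smul',
    Ch.associator_tmul rfl _ (add_comm _ _), smul_smul, smul_smul, smul_smul]
  refine congrArg₂ (· • ·) ?_ rfl
  simp only [graftSign, ← Int.negOnePow_add]
  apply negOnePow_eq_of_zmod
  rw [← hij]
  push_cast
  grind

variable (θ : Preoperad M) {a : S.Leaf}
  (hd : IsEnum d {x | S.IsInner x}) (he : IsEnum e (Set.range α)ᶜ)
  (hd' : IsEnum d' {x | Q.IsInner x}) (he' : IsEnum e' (Set.range β)ᶜ)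
  (hd'' : IsEnum d'' {x | P.IsInner x}) (he'' : IsEnum e'' (Set.range γ)ᶜ)

include hd he hd' he' in
theorem eltTensor_comul_whiskerRight (hm')
    (z : (M.obj (op (graft T U (leafMap α a))) ⊗ M.obj (op W)).X n) :
    ((comul θ S Q a ▷ (Bar M).obj P).f m).hom ((eltTensor M (graftMap α β a) γ (graftInner a d d')
      (graftEnum (leafMap α a) e e') d'' e'' n m hm').hom z) =
    (eltTensorLeft α β γ d e d' e' d'' e'' hm).hom
      (((θ.θ T U (leafMap α a) ▷ M.obj (op W)).f n).hom z) := by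
  suffices h : eltTensor M (graftMap α β a) γ (graftInner a d d')
      (graftEnum (leafMap α a) e e') d'' e'' n m hm' ≫ (comul θ S Q a ▷ (Bar M).obj P).f m =
      (θ.θ T U (leafMap α a) ▷ M.obj (op W)).f n ≫ eltTensorLeft α β γ d e d' e' d'' e'' hm from
    congrArg (fun f => f.hom z) h
  apply Ch.hom_ext_tmul
  intro i j hij x y
  obtain ⟨k, hk⟩ : ∃ k, (1 + d.length + d'.length + e.length + e'.length + 1) + i = k := ⟨_, rfl⟩
  have hl1 := length_graftInner a d d'
  have hl2 := length_graftEnum (leafMap α a) e e'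
  rw [ModuleCat.comp_apply, ModuleCat.comp_apply,
    eltTensor_tmul _ _ _ _ _ _ _ _ _ hij (k := k) (by lia) rfl, map_units_smul',
    Ch.whiskerRight_tmul, Ch.whiskerRight_tmul, elt_comul θ α β hd he hd' he' (by lia)]
  refine Eq.trans ?_ (Ch.gtensor_tmul _ _ _ _ _ _ hij hk
    (b := d''.length + e''.length + (j + 1)) (by lia) _ _).symm
  rw [eltTensorFam_eq (hm := by lia)]
  refine congrArg₂ (· • ·) ?_ rfl
  rw [graftSign, graftSign, hl1, hl2]
  push_cast
  rfl

include hd' he' hd'' he'' in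
theorem eltTensor_comul_whiskerLeft {b : Q.Leaf} (hm')
    (z : (M.obj (op T) ⊗ M.obj (op (graft U W (leafMap β b)))).X n) :
    (((Bar M).obj S ◁ comul θ Q P b).f m).hom ((eltTensor M α (graftMap β γ b) d e
      (graftInner b d' d'') (graftEnum (leafMap β b) e' e'') n m hm').hom z) =
    (eltTensorRight α β γ d e d' e' d'' e'' hm).hom
      (((M.obj (op T) ◁ θ.θ U W (leafMap β b)).f n).hom z) := by
  suffices h : eltTensor M α (graftMap β γ b) d e
      (graftInner b d' d'') (graftEnum (leafMap β b) e' e'') n m hm' ≫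
        ((Bar M).obj S ◁ comul θ Q P b).f m =
      (M.obj (op T) ◁ θ.θ U W (leafMap β b)).f n ≫
        eltTensorRight α β γ d e d' e' d'' e'' hm from
    congrArg (fun f => f.hom z) h
  apply Ch.hom_ext_tmul
  intro i j hij x y
  obtain ⟨k, hk⟩ : ∃ k, (1 + d'.length + d''.length + e'.length + e''.length + 1) + j = k :=
    ⟨_, rfl⟩
  have hl1 := length_graftInner b d' d''
  have hl2 := length_graftEnum (leafMap β b) e' e''
  rw [ModuleCat.comp_apply, ModuleCat.comp_apply,
    eltTensor_tmul _ _ _ _ _ _ _ _ _ hij (l := k) rfl (by lia), map_units_smul',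
    Ch.whiskerLeft_tmul, Ch.whiskerLeft_tmul, elt_comul θ β γ hd' he' hd'' he'' (by lia)]
  refine Eq.trans ?_ (Ch.gtensor_tmul _ _ _ _ _ _ hij
    (a := d.length + e.length + (i + 1)) (by lia) hk _ _).symm
  rw [eltTensorFam_eq (hm := by lia)]
  refine congrArg₂ (· • ·) ?_ rfl
  rw [graftSign, graftSign, hl1, hl2]
  push_cast
  rfl

end triple

end Bar
end

/-! ### Coassociativity of Δ -/

noncomputable section
theorem Ch.congr_apply {R : Type u} [CommRing R] {K L : Ch R} {f g : K ⟶ L} (h : f = g) (n : ℤ)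
    (x : K.X n) : (f.f n).hom x = (g.f n).hom x := by rw [h]

namespace Bar
open Opposite RTree
open scoped Classical
variable {R : Type u} [CommRing R] {M : RTreeᵒᵖ ⥤ Ch R} {S Q : RTree}

theorem map_graftEnum {X : Type} {a : S.Leaf} (f : (graft S Q a).Edge → X) (e : List S.Edge)
    (e' : List Q.Edge) : (graftEnum a e e').map f =
      e.map (fun s => f (inl Q a s)) ++ e'.map (fun r => f (inr a r)) := by
  rw [List.map_append, List.map_map, List.map_map]
  rfl

/-- On a generator both sides are `eltTensorRight` applied to an iterated θ, and the two iterations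
agree by the associativity of θ. Both carry the sign of `1 + |d_S|`: on the left it comes from the
associator, on the right from reordering the inner edges after `seqHom`. -/
theorem comul_sequential (θ : Preoperad M) (P : RTree) (a : S.Leaf) (b : Q.Leaf) :
    comul θ (graft S Q a) P (inrLeaf a b) ≫ (comul θ S Q a ▷ (Bar M).obj P) ≫ (α_ _ _ _).hom =
      (Bar M).map (seqHom P a b) ≫ comul θ S (graft Q P b) a ≫
        ((Bar M).obj S ◁ comul θ Q P b) := by
  ext1 m
  have hd := isEnum_innerEnum S
  have hd' := isEnum_innerEnum Q
  have hd'' := isEnum_innerEnum P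
  apply bar_graft_graft_ext hd hd' hd''
  intro T U W α β γ e e' e'' he he' he'' n hm x
  have hl1 := length_graftInner a (innerEnum S) (innerEnum Q)
  have hl2 := length_graftEnum (leafMap α a) e e'
  have hl3 := length_graftInner b (innerEnum Q) (innerEnum P)
  have hl4 := length_graftEnum (leafMap β b) e' e''
  obtain ⟨κ, k1, k2, k3, k4⟩ := exists_seqIso θ W (leafMap α a) (leafMap β b)
    (c := leafMap (graftMap α β a) (inrLeaf a b)) (Subtype.ext (graftMap_inr α β a b.1))
  -- The associativity relation `k4` of θ begins with the pullback along `κ`, so `x` is brought into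
  -- this form.
  obtain ⟨x, rfl⟩ := map_iso_surjective κ n x
  have hg : seqHom P a b ≫ graftMap α (graftMap β γ b) a =
      graftMap (graftMap α β a) γ (inrLeaf a b) ≫ κ.hom := by
    apply graft_hom_ext
    · intro s
      rw [comp_apply, comp_apply, graftMap_inl]
      rcases graft_cases s with ⟨s, rfl⟩ | ⟨q, -, rfl⟩
      · rw [seqHom_inl_inl, graftMap_inl, graftMap_inl]
        exact (k1 _).symm
      · rw [seqHom_inl_inr, graftMap_inr, graftMap_inl, graftMap_inr]
        exact (k2 _).symm
    · intro p
      rw [comp_apply, comp_apply, graftMap_inr, seqHom_inr, graftMap_inr, graftMap_inr]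
      exact (k3 _).symm
  have l1 := elt_comul θ (a := inrLeaf a b) (graftMap α β a) γ (isEnum_cons_graft hd hd')
    (isEnum_append_graft he he') hd'' he'' (n := n) (m := m) (by lia)
    (((M.map κ.hom.op).f n).hom x)
  have l2 := eltTensor_comul_whiskerRight α β γ _ e _ e' (innerEnum P) e'' hm θ (a := a) hd he hd' he'
    (by lia) (((θ.θ (graft T U (leafMap α a)) W (leafMap (graftMap α β a) (inrLeaf a b))).f n).hom
      (((M.map κ.hom.op).f n).hom x))
  have l3 := eltTensorLeft_associator α β γ (innerEnum S) e (innerEnum Q) e' (innerEnum P) e'' hm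
    (((θ.θ T U (leafMap α a) ▷ M.obj (op W)).f n).hom
      (((θ.θ (graft T U (leafMap α a)) W (leafMap (graftMap α β a) (inrLeaf a b))).f n).hom
      (((M.map κ.hom.op).f n).hom x)))
  have l4 := Ch.congr_apply k4 n x
  have r1 := elt_push_iso (M := M) (seqHom_surjective a b) κ hg
    (isEnum_cons_graft (a := inrLeaf a b) (isEnum_cons_graft (a := a) hd hd') hd'')
    (isEnum_append_graft (a := inrLeaf a b) (isEnum_append_graft (a := a) he he') he'')
    (n := n) (m := m) x
  have e1 : (graftInner (inrLeaf a b) (graftInner a (innerEnum S) (innerEnum Q))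
      (innerEnum P)).map (seqHom P a b) = inr a (inl P b b.1) ::
        ((inl _ a a.1 :: (innerEnum S).map (inl _ a)) ++
          ((innerEnum Q).map (inl P b) ++ (innerEnum P).map (inr b)).map (inr a)) := by
    simp only [List.map_cons, List.map_append, List.map_map, List.cons_append, List.append_assoc]
    refine congrArg₂ List.cons (seqHom_inl_inr a b _) (congrArg₂ List.cons (seqHom_inl_inl a b _)
      (congrArg₂ (· ++ ·) (List.map_congr_left fun y _ => seqHom_inl_inl a b y)
        (congrArg₂ (· ++ ·) (List.map_congr_left fun y _ => seqHom_inl_inr a b y)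
          (List.map_congr_left fun y _ => seqHom_inr a b y))))
  have e2 : (graftEnum (leafMap (graftMap α β a) (inrLeaf a b))
      (graftEnum (leafMap α a) e e') e'').map κ.hom =
      graftEnum (leafMap α a) e (graftEnum (leafMap β b) e' e'') := by
    refine (map_graftEnum _ _ _).trans ((congrArg (· ++ _) (map_graftEnum _ _ _)).trans
      ((List.append_assoc ..).trans ?_))
    exact congrArg₂ (· ++ ·) (List.map_congr_left fun y _ => k1 y)
        ((congrArg₂ (· ++ ·) (List.map_congr_left fun y _ => k2 y)
          (List.map_congr_left fun y _ => k3 y)).trans (map_graftEnum _ _ _).symm)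
  -- Moves the upper grafting edge `b` behind `(a, d_S)`, the order prescribed by `S ∘_a (Q ∘_b P)`.
  have r2 := (elt_alternating_left (M := M) (graftMap α (graftMap β γ b) a)
    (graftEnum (leafMap α a) e (graftEnum (leafMap β b) e' e'')) n m x).cons_append []
      (inr a (inl P b b.1)) (inl _ a a.1 :: (innerEnum S).map (inl _ a))
      (((innerEnum Q).map (inl P b) ++ (innerEnum P).map (inr b)).map (inr a))
  have r3 := elt_comul θ (a := a) α (graftMap β γ b) hd he (isEnum_cons_graft (a := b) hd' hd'')
    (isEnum_append_graft he' he'') (n := n) (m := m) (by lia) x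
  have r4 := eltTensor_comul_whiskerLeft α β γ (innerEnum S) e (innerEnum Q) e' (innerEnum P) e'' hm
    θ hd' he' hd'' he'' (b := b) (by lia)
    (((θ.θ T (graft U W (leafMap β b)) (leafMap α a)).f n).hom x)
  change ((α_ ((Bar M).obj S) ((Bar M).obj Q) ((Bar M).obj P)).hom.f m).hom
    (((comul θ S Q a ▷ (Bar M).obj P).f m).hom
      (((comul θ (graft S Q a) P (inrLeaf a b)).f m).hom _)) =
    (((Bar M).obj S ◁ comul θ Q P b).f m).hom (((comul θ S (graft Q P b) a).f m).hom
      ((((Bar M).map (seqHom P a b)).f m).hom _))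
  refine (congrArg (fun z => ((α_ ((Bar M).obj S) ((Bar M).obj Q) ((Bar M).obj P)).hom.f m).hom
    (((comul θ S Q a ▷ (Bar M).obj P).f m).hom z)) l1).trans ?_
  refine (congrArg ((α_ ((Bar M).obj S) ((Bar M).obj Q) ((Bar M).obj P)).hom.f m).hom l2).trans
    (l3.trans ?_)
  refine Eq.trans ?_ (congrArg (fun z => (((Bar M).obj S ◁ comul θ Q P b).f m).hom
    (((comul θ S (graft Q P b) a).f m).hom z)) r1).symm
  rw [e1, e2]
  refine Eq.trans ?_ (congrArg (fun z => (((Bar M).obj S ◁ comul θ Q P b).f m).hom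
    (((comul θ S (graft Q P b) a).f m).hom z)) r2).symm
  rw [map_units_smul', map_units_smul']
  refine congrArg₂ (· • ·) (congrArg _ ?_) ?_
  · rw [List.length_cons, List.length_map]
    push_cast
    ring
  · refine Eq.trans ?_ (congrArg (((Bar M).obj S ◁ comul θ Q P b).f m).hom r3).symm
    exact (congrArg _ l4).trans r4.symm

/-- On a generator both sides become an iterated θ followed by `eltTensorLeft` and the associator,
and the parallel associativity of θ identifies them. The sign of `eltTensorLeft_swap` is matched on
the right by three reorderings of the enumerations. -/
theorem comul_parallel (θ : Preoperad M) (Q P : RTree) (a b : S.Leaf) (h : b ≠ a) :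
    comul θ (graft S Q a) P (inlLeaf Q a b h) ≫ (comul θ S Q a ▷ (Bar M).obj P) ≫
        (α_ _ _ _).hom ≫ ((Bar M).obj S ◁ Ch.swap ((Bar M).obj Q) ((Bar M).obj P)) =
      (Bar M).map (parHom Q P a b h) ≫ comul θ (graft S P b) Q (inlLeaf P b a h.symm) ≫
        (comul θ S P b ▷ (Bar M).obj Q) ≫ (α_ _ _ _).hom := by
  ext1 m
  have hd := isEnum_innerEnum S
  have hd' := isEnum_innerEnum Q
  have hd'' := isEnum_innerEnum P
  apply bar_graft_graft_ext hd hd' hd''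
  intro T U W α β γ e e' e'' he he' he'' n hm x
  have hl1 := length_graftInner a (innerEnum S) (innerEnum Q)
  have hl2 := length_graftEnum (leafMap α a) e e'
  have hl3 := length_graftInner b (innerEnum S) (innerEnum P)
  have hl4 := length_graftEnum (leafMap α b) e e''
  have hab : leafMap α b ≠ leafMap α a := fun h' =>
    h (Subtype.ext (inj α (congrArg Subtype.val h')))
  obtain ⟨κ, k1, k2, k3, k4⟩ := exists_parIso θ U W (leafMap α a) (leafMap α b) hab
    (c := leafMap (graftMap α β a) (inlLeaf Q a b h)) (Subtype.ext (graftMap_inl α β a b.1))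
    (c' := leafMap (graftMap α γ b) (inlLeaf P b a h.symm)) (Subtype.ext (graftMap_inl α γ b a.1))
  obtain ⟨x, rfl⟩ := map_iso_surjective κ n x
  have hg : parHom Q P a b h ≫ graftMap (graftMap α γ b) β (inlLeaf P b a h.symm) =
      graftMap (graftMap α β a) γ (inlLeaf Q a b h) ≫ κ.hom := by
    apply graft_hom_ext
    · intro s
      rw [comp_apply, comp_apply, graftMap_inl]
      rcases graft_cases s with ⟨s, rfl⟩ | ⟨q, -, rfl⟩
      · rw [parHom_inl_inl, graftMap_inl, graftMap_inl, graftMap_inl]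
        exact (k1 _).symm
      · rw [parHom_inl_inr, graftMap_inr, graftMap_inr]
        exact (k2 _).symm
    · intro p
      rw [comp_apply, comp_apply, graftMap_inr, parHom_inr, graftMap_inl, graftMap_inr]
      exact (k3 _).symm
  have l1 := elt_comul θ (a := inlLeaf Q a b h) (graftMap α β a) γ (isEnum_cons_graft hd hd')
    (isEnum_append_graft he he') hd'' he'' (n := n) (m := m) (by lia)
    (((M.map κ.hom.op).f n).hom x)
  have l2 := eltTensor_comul_whiskerRight α β γ _ e _ e' (innerEnum P) e'' hm θ (a := a) hd he hd' he'
    (by lia) (((θ.θ (graft T U (leafMap α a)) W (leafMap (graftMap α β a)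
      (inlLeaf Q a b h))).f n).hom (((M.map κ.hom.op).f n).hom x))
  have hm' : (2 + (innerEnum S).length + (innerEnum P).length + (innerEnum Q).length : ℤ) +
    (e.length + e''.length + e'.length) + (n + 1) = m := by lia
  have l3 := eltTensorLeft_swap α β γ (innerEnum S) e (innerEnum Q) e' (innerEnum P) e'' hm hm'
    (((θ.θ T U (leafMap α a) ▷ M.obj (op W)).f n).hom
      (((θ.θ (graft T U (leafMap α a)) W (leafMap (graftMap α β a) (inlLeaf Q a b h))).f n).hom
      (((M.map κ.hom.op).f n).hom x)))
  -- The associator is moved to the other side, as in the expression produced by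
  -- `eltTensorLeft_swap`.
  have k5 : M.map κ.hom.op ≫ θ.θ (graft T U (leafMap α a)) W _ ≫
      (θ.θ T U (leafMap α a) ▷ M.obj (op W)) ≫ (α_ _ _ _).hom ≫
          (M.obj (op T) ◁ Ch.swap (M.obj (op U)) (M.obj (op W))) ≫ (α_ _ _ _).inv =
        θ.θ (graft T W (leafMap α b)) U _ ≫ (θ.θ T W (leafMap α b) ▷ M.obj (op U)) := by
    rw [← cancel_mono (α_ _ _ _).hom]
    simp only [Category.assoc, Iso.inv_hom_id, Category.comp_id]
    exact k4
  have l4 := Ch.congr_apply k5 n x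
  have r1 := elt_push_iso (M := M) (parHom_surjective a b h) κ hg
    (isEnum_cons_graft (a := inlLeaf Q a b h) (isEnum_cons_graft (a := a) hd hd') hd'')
    (isEnum_append_graft (a := inlLeaf Q a b h) (isEnum_append_graft (a := a) he he') he'')
    (n := n) (m := m) x
  have e1 : (graftInner (inlLeaf Q a b h) (graftInner a (innerEnum S) (innerEnum Q))
      (innerEnum P)).map (parHom Q P a b h) =
        inl _ _ (inl P b b.1) :: inl _ _ (inl P b a.1) ::
        ((innerEnum S).map (fun s => inl Q (inlLeaf P b a h.symm) (inl P b s)) ++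
          ((innerEnum Q).map (inr (inlLeaf P b a h.symm)) ++
          ((innerEnum P).map (fun s => inl Q (inlLeaf P b a h.symm) (inr b s)) ++ []))) := by
    simp only [List.map_cons, List.map_append, List.map_map, List.cons_append, List.append_assoc,
      List.append_nil]
    refine congrArg₂ List.cons (parHom_inl_inl a b h _) (congrArg₂ List.cons (parHom_inl_inl a b h _)
      (congrArg₂ (· ++ ·) (List.map_congr_left fun y _ => parHom_inl_inl a b h y)
        (congrArg₂ (· ++ ·) (List.map_congr_left fun y _ => parHom_inl_inr a b h y)
          (List.map_congr_left fun y _ => parHom_inr a b h y))))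
  have e2 : (graftEnum (leafMap (graftMap α β a) (inlLeaf Q a b h))
      (graftEnum (leafMap α a) e e') e'').map κ.hom =
      e.map (fun s => inl _ _ (inl _ (leafMap α b) s)) ++ (e'.map (inr _) ++
        (e''.map (fun s => inl _ _ (inr (leafMap α b) s)) ++ [])) := by
    simp only [List.map_append, List.map_map, List.append_assoc, List.append_nil]
    exact congrArg₂ (· ++ ·) (List.map_congr_left fun y _ => k1 y)
        (congrArg₂ (· ++ ·) (List.map_congr_left fun y _ => k2 y)
          (List.map_congr_left fun y _ => k3 y))
  have e3 : inl Q (inlLeaf P b a h.symm) (inl P b a.1) :: inl _ _ (inl P b b.1) ::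
        ((innerEnum S).map (fun s => inl Q (inlLeaf P b a h.symm) (inl P b s)) ++
          ((innerEnum P).map (fun s => inl Q (inlLeaf P b a h.symm) (inr b s)) ++
          ((innerEnum Q).map (inr (inlLeaf P b a h.symm)) ++ []))) =
      graftInner (inlLeaf P b a h.symm) (graftInner b (innerEnum S) (innerEnum P))
        (innerEnum Q) := by
    simp only [graftInner, List.map_cons, List.map_append, List.map_map, List.cons_append,
      List.append_assoc, List.append_nil]
    rfl
  have e4 : e.map (fun s => inl _ _ (inl _ (leafMap α b) s)) ++
      (e''.map (fun s => inl _ _ (inr (leafMap α b) s)) ++ (e'.map (inr _) ++ [])) =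
      graftEnum (leafMap (graftMap α γ b) (inlLeaf P b a h.symm))
        (graftEnum (leafMap α b) e e'') e' := by
    rw [List.append_nil]
    exact (List.append_assoc ..).symm.trans (congrArg (· ++ _) (map_graftEnum _ _ _).symm)
  -- The three reorderings are: `r2` exchanges the grafting edges `a` and `b`, `r3` the inner edges
  -- of `Q` and `P`, and `r4` the missed edges `e'` and `e''`.
  have r2 := elt_alternating_left (M := M) (graftMap (graftMap α γ b) β (inlLeaf P b a h.symm))
    (graftEnum (leafMap (graftMap α γ b) (inlLeaf P b a h.symm)) (graftEnum (leafMap α b) e e'') e')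
      n m x [] ((innerEnum S).map (fun s => inl Q (inlLeaf P b a h.symm) (inl P b s)) ++
          ((innerEnum Q).map (inr (inlLeaf P b a h.symm)) ++
          ((innerEnum P).map (fun s => inl Q (inlLeaf P b a h.symm) (inr b s)) ++ [])))
      (inl _ _ (inl P b b.1)) (inl _ _ (inl P b a.1))
  have r3 := (elt_alternating_left (M := M) (graftMap (graftMap α γ b) β (inlLeaf P b a h.symm))
    (graftEnum (leafMap (graftMap α γ b) (inlLeaf P b a h.symm)) (graftEnum (leafMap α b) e e'') e')
      n m x).append_append (inl _ _ (inl P b a.1) :: inl _ _ (inl P b b.1) ::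
        (innerEnum S).map (fun s => inl Q (inlLeaf P b a h.symm) (inl P b s)))
      ((innerEnum Q).map (inr (inlLeaf P b a h.symm)))
      ((innerEnum P).map (fun s => inl Q (inlLeaf P b a h.symm) (inr b s))) []
  have r4 := (elt_alternating_right (M := M) (graftMap (graftMap α γ b) β (inlLeaf P b a h.symm))
    ((graftInner (inlLeaf Q a b h) (graftInner a (innerEnum S) (innerEnum Q))
      (innerEnum P)).map (parHom Q P a b h)) n m x).append_append
      (e.map (fun s => inl _ _ (inl _ (leafMap α b) s))) (e'.map (inr _))
      (e''.map (fun s => inl _ _ (inr (leafMap α b) s))) []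
  rw [e4] at r4
  rw [e2, r4] at r1
  have r5 := elt_comul θ (a := inlLeaf P b a h.symm) (graftMap α γ b) β (isEnum_cons_graft hd hd'')
    (isEnum_append_graft he he'') hd' he' (n := n) (m := m) (by lia) x
  have r6 := eltTensor_comul_whiskerRight α γ β _ e _ e'' (innerEnum Q) e' hm' θ (a := b) hd he
    hd'' he'' (by lia) (((θ.θ (graft T W (leafMap α b)) U (leafMap (graftMap α γ b)
      (inlLeaf P b a h.symm))).f n).hom x)
  have r7 : (Bar.elt M (graftMap (graftMap α γ b) β (inlLeaf P b a h.symm))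
      ((graftInner (inlLeaf Q a b h) (graftInner a (innerEnum S) (innerEnum Q))
        (innerEnum P)).map (parHom Q P a b h)) (graftEnum (leafMap (graftMap α γ b)
        (inlLeaf P b a h.symm)) (graftEnum (leafMap α b) e e'') e') n m).hom x =
      (1 + (innerEnum Q).length * (innerEnum P).length : ℤ).negOnePow •
        (Bar.elt M (graftMap (graftMap α γ b) β (inlLeaf P b a h.symm))
          (graftInner (inlLeaf P b a h.symm) (graftInner b (innerEnum S) (innerEnum P))
          (innerEnum Q)) (graftEnum (leafMap (graftMap α γ b)
        (inlLeaf P b a h.symm)) (graftEnum (leafMap α b) e e'') e') n m).hom x := by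
    rw [e1, ← e3]
    refine r2.trans ((congrArg Neg.neg r3).trans ?_)
    rw [add_comm, Int.negOnePow_succ, Units.neg_smul, List.length_map, List.length_map]
    rfl
  change (((Bar M).obj S ◁ Ch.swap ((Bar M).obj Q) ((Bar M).obj P)).f m).hom
    (((α_ ((Bar M).obj S) ((Bar M).obj Q) ((Bar M).obj P)).hom.f m).hom
    (((comul θ S Q a ▷ (Bar M).obj P).f m).hom
      (((comul θ (graft S Q a) P (inlLeaf Q a b h)).f m).hom _))) =
    ((α_ ((Bar M).obj S) ((Bar M).obj P) ((Bar M).obj Q)).hom.f m).hom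
    (((comul θ S P b ▷ (Bar M).obj Q).f m).hom
      (((comul θ (graft S P b) Q (inlLeaf P b a h.symm)).f m).hom
      ((((Bar M).map (parHom Q P a b h)).f m).hom _)))
  refine (congrArg (fun z => (((Bar M).obj S ◁ Ch.swap ((Bar M).obj Q) ((Bar M).obj P)).f m).hom
    (((α_ ((Bar M).obj S) ((Bar M).obj Q) ((Bar M).obj P)).hom.f m).hom
    (((comul θ S Q a ▷ (Bar M).obj P).f m).hom z))) l1).trans ?_
  refine (congrArg (fun z => (((Bar M).obj S ◁ Ch.swap ((Bar M).obj Q) ((Bar M).obj P)).f m).hom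
    (((α_ ((Bar M).obj S) ((Bar M).obj Q) ((Bar M).obj P)).hom.f m).hom z)) l2).trans
    (l3.trans ?_)
  refine Eq.trans ?_ (congrArg (fun z =>
    ((α_ ((Bar M).obj S) ((Bar M).obj P) ((Bar M).obj Q)).hom.f m).hom
    (((comul θ S P b ▷ (Bar M).obj Q).f m).hom
      (((comul θ (graft S P b) Q (inlLeaf P b a h.symm)).f m).hom z)))
      (r1.trans (congrArg _ r7))).symm
  rw [smul_smul, map_units_smul', map_units_smul', map_units_smul', ← Int.negOnePow_add]
  refine congrArg₂ (· • ·) (congrArg _ ?_) (congrArg _ ?_)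
  · rw [List.length_map, List.length_map]
    ring
  · refine Eq.trans ?_ (congrArg ((comul θ S P b ▷ (Bar M).obj Q).f m).hom r5).symm
    exact (congrArg _ l4).trans r6.symm

end Bar
end

/-! ### Quasi-isomorphisms between triangular complexes -/

noncomputable section
namespace Ch
variable {R : Type u} [CommRing R] {K L : Ch R}

theorem d_d_apply (K : Ch R) (i j k : ℤ) (x : K.X i) : (K.d j k).hom ((K.d i j).hom x) = 0 :=
  congrArg (fun f => f.hom x) (K.d_comp_d i j k)

theorem d_f_apply (f : K ⟶ L) (i j : ℤ) (x : K.X i) :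
    (L.d i j).hom ((f.f i).hom x) = (f.f j).hom ((K.d i j).hom x) :=
  congrArg (fun g => g.hom x) (f.comm i j)

theorem exists_iCycles_eq {i j : ℤ} (hij : j + 1 = i) {x : K.X i} (hx : (K.d i j).hom x = 0) :
    ∃ z : K.cycles i, (K.iCycles i).hom z = x := by
  have h := ShortComplex.exact_of_f_is_kernel (ShortComplex.mk _ _ (K.iCycles_d i j))
    (K.cyclesIsKernel i j (ComplexShape.next_eq' _ hij))
  exact (ShortComplex.moduleCat_exact_iff _).1 h x hx

theorem homologyπ_eq_zero_iff {i k : ℤ} (hik : i + 1 = k) (z : K.cycles i) :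
    (K.homologyπ i).hom z = 0 ↔ ∃ w : K.X k, (K.d k i).hom w = (K.iCycles i).hom z := by
  have hinj : Function.Injective (K.iCycles i).hom :=
    (ModuleCat.mono_iff_injective _).1 inferInstance
  have h := ShortComplex.exact_of_g_is_cokernel (ShortComplex.mk _ _ (K.toCycles_comp_homologyπ k i))
    (K.homologyIsCokernel k i (ComplexShape.prev_eq' _ hik))
  have ht : ∀ w : K.X k, (K.iCycles i).hom ((K.toCycles k i).hom w) = (K.d k i).hom w := fun w =>
    congrArg (fun f => f.hom w) (K.toCycles_i k i)
  constructor
  · intro hz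
    obtain ⟨w, hw⟩ := (ShortComplex.moduleCat_exact_iff _).1 h z hz
    exact ⟨w, by rw [← ht]; exact congrArg (K.iCycles i).hom hw⟩
  · rintro ⟨w, hw⟩
    have h1 : z = (K.toCycles k i).hom w := hinj (hw.symm.trans (ht w).symm)
    rw [h1]
    exact congrArg (fun f => f.hom w) (K.toCycles_comp_homologyπ k i)

theorem iCycles_cyclesMap (f : K ⟶ L) (i : ℤ) (z : K.cycles i) :
    (L.iCycles i).hom ((HomologicalComplex.cyclesMap f i).hom z) = (f.f i).hom ((K.iCycles i).hom z) :=
  congrArg (fun g => g.hom z) (HomologicalComplex.cyclesMap_i f i)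

theorem homologyMap_homologyπ (f : K ⟶ L) (i : ℤ) (z : K.cycles i) :
    (HomologicalComplex.homologyMap f i).hom ((K.homologyπ i).hom z) =
      (L.homologyπ i).hom ((HomologicalComplex.cyclesMap f i).hom z) :=
  congrArg (fun g => g.hom z) (HomologicalComplex.homologyπ_naturality f i)

theorem d_iCycles (i j : ℤ) (z : K.cycles i) : (K.d i j).hom ((K.iCycles i).hom z) = 0 :=
  congrArg (fun g => g.hom z) (K.iCycles_d i j)

/-- A chain map is a quasi-isomorphism if and only if its cone is acyclic. -/
theorem quasiIso_iff_cone (f : K ⟶ L) : QuasiIso f ↔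
    ∀ (i : ℤ) (x : K.X i) (y : L.X (i + 1)), (K.d i (i - 1)).hom x = 0 →
      (f.f i).hom x = (L.d (i + 1) i).hom y → ∃ (x' : K.X (i + 1)) (y' : L.X (i + 2)),
        (K.d (i + 1) i).hom x' = x ∧
          (f.f (i + 1)).hom x' = y + (L.d (i + 2) (i + 1)).hom y' := by
  have hπ : ∀ (K : Ch R) i, Function.Surjective (K.homologyπ i).hom := fun K i =>
    (ModuleCat.epi_iff_surjective _).1 inferInstance
  constructor
  -- Injectivity in degree `i` gives `x₀` with boundary `x`. Then `f x₀ - y` is a cycle, and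
  -- surjectivity in degree `i + 1` gives a cycle `w` with which `x₀` is corrected.
  · intro hf i x y hx hxy
    have hb : ∀ i, Function.Bijective (HomologicalComplex.homologyMap f i).hom := fun i =>
      ConcreteCategory.bijective_of_isIso (HomologicalComplex.homologyMap f i)
    obtain ⟨z, rfl⟩ := exists_iCycles_eq (sub_add_cancel i 1) hx
    have h1 : (K.homologyπ i).hom z = 0 := by
      apply (hb i).1
      rw [homologyMap_homologyπ, map_zero, homologyπ_eq_zero_iff (rfl : i + 1 = i + 1),
        iCycles_cyclesMap]
      exact ⟨y, hxy.symm⟩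
    obtain ⟨x₀, hx₀⟩ := (homologyπ_eq_zero_iff (rfl : i + 1 = i + 1) z).1 h1
    have h2 : (L.d (i + 1) i).hom ((f.f (i + 1)).hom x₀ - y) = 0 := by
      rw [map_sub, d_f_apply, hx₀, hxy, sub_self]
    obtain ⟨v, hv⟩ := exists_iCycles_eq (rfl : i + 1 = i + 1) h2
    obtain ⟨c, hc⟩ := (hb (i + 1)).2 ((L.homologyπ (i + 1)).hom v)
    obtain ⟨w, rfl⟩ := hπ K (i + 1) c
    rw [homologyMap_homologyπ, ← sub_eq_zero, ← map_sub,
      homologyπ_eq_zero_iff (show i + 1 + 1 = i + 2 by lia), map_sub, iCycles_cyclesMap, hv] at hc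
    obtain ⟨y', hy'⟩ := hc
    refine ⟨x₀ - (K.iCycles (i + 1)).hom w, -y', ?_, ?_⟩
    · rw [map_sub, d_iCycles, sub_zero, hx₀]
    · rw [map_sub, map_neg, hy']
      abel
  · intro H
    rw [quasiIso_iff]
    intro i
    rw [quasiIsoAt_iff_isIso_homologyMap, ConcreteCategory.isIso_iff_bijective]
    constructor
    · refine (injective_iff_map_eq_zero (HomologicalComplex.homologyMap f i).hom).2 fun c hc => ?_
      obtain ⟨z, rfl⟩ := hπ K i c
      rw [homologyMap_homologyπ, homologyπ_eq_zero_iff (rfl : i + 1 = i + 1),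
        iCycles_cyclesMap] at hc
      obtain ⟨y, hy⟩ := hc
      -- Injectivity uses only the first half of the conclusion.
      obtain ⟨x', -, h1, -⟩ := H i _ y (d_iCycles i (i - 1) z) hy.symm
      exact (homologyπ_eq_zero_iff (rfl : i + 1 = i + 1) z).2 ⟨x', h1⟩
    · intro c
      obtain ⟨z, rfl⟩ := hπ L i c
      obtain ⟨j, rfl⟩ : ∃ j, i = j + 1 := ⟨i - 1, by lia⟩
      -- Surjectivity is the case of a cycle of the cone whose first component is zero.
      obtain ⟨x', y', h1, h2⟩ := H j 0 ((L.iCycles (j + 1)).hom z) (map_zero _)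
        (by rw [map_zero, d_iCycles])
      obtain ⟨w, rfl⟩ := exists_iCycles_eq (rfl : j + 1 = j + 1) h1
      refine ⟨(K.homologyπ (j + 1)).hom w, ?_⟩
      refine (homologyMap_homologyπ f _ w).trans ?_
      rw [← sub_eq_zero, ← map_sub, homologyπ_eq_zero_iff (show j + 1 + 1 = j + 2 by lia), map_sub,
        iCycles_cyclesMap, h2]
      exact ⟨y', by abel⟩

/-- A decomposition of a chain complex `K` into a finite sum of shifts of complexes `A i` with rank
`p i`, for which the differential is triangular with diagonal part `± d`. -/
structure Splitting (K : Ch R) {I : Type} [Fintype I] (p : I → ℕ) (A : I → Ch R) (s : I → ℤ)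
    (ε : I → ℤˣ) where
  ι : ∀ (i : I) (n m : ℤ), n + s i = m → ((A i).X n ⟶ K.X m)
  π : ∀ (i : I) (m n : ℤ), n + s i = m → (K.X m ⟶ (A i).X n)
  ι_π_self : ∀ i n m h (x : (A i).X n), (π i m n h).hom ((ι i n m h).hom x) = x
  ι_π_ne : ∀ i j n n' m h h' (x : (A j).X n'), i ≠ j → (π i m n h).hom ((ι j n' m h').hom x) = 0
  sum_π_ι : ∀ m (n : I → ℤ) (h : ∀ i, n i + s i = m) (x : K.X m),
    ∑ i, (ι i (n i) m (h i)).hom ((π i m (n i) (h i)).hom x) = x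
  d_self : ∀ i n n' m m' h h' (x : (A i).X n), m' + 1 = m →
    (π i m' n' h').hom ((K.d m m').hom ((ι i n m h).hom x)) = ε i • ((A i).d n n').hom x
  d_ne : ∀ i j n n' m m' h h' (x : (A j).X n'), m' + 1 = m → i ≠ j → p j ≤ p i →
    (π i m' n h).hom ((K.d m m').hom ((ι j n' m h').hom x)) = 0

namespace Splitting
variable {I : Type} [Fintype I] {p : I → ℕ} {A B : I → Ch R} {s : I → ℤ} {ε : I → ℤˣ}

theorem eq_zero (𝒮 : Splitting K p A s ε) {m : ℤ} {x : K.X m}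
    (hx : ∀ i n h, (𝒮.π i m n h).hom x = 0) : x = 0 := by
  rw [← 𝒮.sum_π_ι m (fun i => m - s i) (fun i => by lia) x]
  exact Finset.sum_eq_zero fun i _ => by rw [hx, map_zero]

/-- When `x` has no component of rank above `p i`, the off-diagonal contributions to component `i`
start in rank at most `p i` and vanish by triangularity. Only the diagonal term remains. -/
theorem π_d (𝒮 : Splitting K p A s ε) {i : I} {n n' m m' : ℤ} (hm : m' + 1 = m) (h : n + s i = m)
    (h' : n' + s i = m') {x : K.X m}
    (hx : ∀ j k hk, p i < p j → (𝒮.π j m k hk).hom x = 0) :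
    (𝒮.π i m' n' h').hom ((K.d m m').hom x) =
      ε i • ((A i).d n n').hom ((𝒮.π i m n h).hom x) := by
  classical
  conv_lhs => rw [← 𝒮.sum_π_ι m (fun i => m - s i) (fun i => by lia) x]
  rw [map_sum, map_sum, Finset.sum_eq_single_of_mem i (Finset.mem_univ _)]
  · obtain rfl : n = m - s i := by lia
    exact 𝒮.d_self i _ _ _ _ _ _ _ hm
  · intro j _ hj
    by_cases hp : p j ≤ p i
    · exact 𝒮.d_ne i j _ _ _ _ _ _ _ hm hj.symm hp
    · rw [hx j _ _ (not_le.1 hp), map_zero, map_zero, map_zero]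

open scoped Classical in
/-- The element with prescribed components in rank `q` and no component in any other rank. -/
def lift (𝒮 : Splitting K p A s ε) (q : ℕ) (m : ℤ) (x : ∀ i, (A i).X (m - s i)) : K.X m :=
  ∑ i, if p i = q then (𝒮.ι i (m - s i) m (by lia)).hom (x i) else 0

theorem π_lift (𝒮 : Splitting K p A s ε) {q : ℕ} {m : ℤ} (x : ∀ i, (A i).X (m - s i)) {i : I}
    (hi : p i = q) : (𝒮.π i m (m - s i) (by lia)).hom (𝒮.lift q m x) = x i := by
  classical
  rw [lift, map_sum, Finset.sum_eq_single_of_mem i (Finset.mem_univ _)]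
  · rw [if_pos hi]
    exact 𝒮.ι_π_self ..
  · intro j _ hj
    split_ifs
    · exact 𝒮.ι_π_ne _ _ _ _ _ _ _ _ hj.symm
    · exact map_zero _

theorem π_lift_ne (𝒮 : Splitting K p A s ε) {q : ℕ} {m n : ℤ} (x : ∀ i, (A i).X (m - s i)) {i : I}
    (h : n + s i = m) (hi : p i ≠ q) : (𝒮.π i m n h).hom (𝒮.lift q m x) = 0 := by
  classical
  rw [lift, map_sum]
  refine Finset.sum_eq_zero fun j _ => ?_
  split_ifs with hj
  · refine 𝒮.ι_π_ne _ _ _ _ _ _ _ _ ?_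
    rintro rfl
    exact hi hj
  · exact map_zero _

/-- A chain map which is compatible with triangular decompositions is a quasi-isomorphism if its
components are. -/
theorem quasiIso (𝒮 : Splitting K p A s ε) (𝒯 : Splitting L p B s ε) (f : K ⟶ L)
    (g : ∀ i, A i ⟶ B i) (hg : ∀ i, QuasiIso (g i))
    (hfg : ∀ i m n h (x : K.X m), (𝒯.π i m n h).hom ((f.f m).hom x) =
      ((g i).f n).hom ((𝒮.π i m n h).hom x)) : QuasiIso f := by
  rw [quasiIso_iff_cone]
  intro m
  -- Induction on a bound `q` such that `x` and `y` have components only in ranks below `q`. The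
  -- bound may start at the maximal rank plus one, and `q = 0` means `x = y = 0`.
  suffices H : ∀ (q : ℕ) (x : K.X m) (y : L.X (m + 1)), (K.d m (m - 1)).hom x = 0 →
      (f.f m).hom x = (L.d (m + 1) m).hom y →
      (∀ i n h, q ≤ p i → (𝒮.π i m n h).hom x = 0) →
      (∀ i n h, q ≤ p i → (𝒯.π i (m + 1) n h).hom y = 0) →
      ∃ (x' : K.X (m + 1)) (y' : L.X (m + 2)), (K.d (m + 1) m).hom x' = x ∧
        (f.f (m + 1)).hom x' = y + (L.d (m + 2) (m + 1)).hom y' by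
    intro x y hx hxy
    refine H (Finset.univ.sup p + 1) x y hx hxy (fun i n h hi => ?_) (fun i n h hi => ?_) <;>
    · have := Finset.le_sup (f := p) (Finset.mem_univ i)
      omega
  intro q
  induction q with
  | zero =>
    intro x y _ _ hx hy
    obtain rfl := 𝒮.eq_zero fun i n h => hx i n h (Nat.zero_le _)
    obtain rfl := 𝒯.eq_zero fun i n h => hy i n h (Nat.zero_le _)
    exact ⟨0, 0, map_zero _, by rw [map_zero, map_zero, add_zero]⟩
  | succ q ih =>
    intro x y hx hxy hxq hyq
    -- In the top rank `q` the components of `(x, y)` form a cycle in the cone of `g i`, hence a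
    -- boundary. The signs `ε i` are absorbed into the witnesses.
    have key : ∀ (i : I) (n n₁ n₂ : ℤ) (h : n + s i = m) (h₁ : n₁ + s i = m + 1),
        n₂ + s i = m + 2 → p i = q → ∃ (x' : (A i).X n₁) (y' : (B i).X n₂),
        ε i • ((A i).d n₁ n).hom x' = (𝒮.π i m n h).hom x ∧
          ((g i).f n₁).hom x' = (𝒯.π i (m + 1) n₁ h₁).hom y + ε i • ((B i).d n₂ n₁).hom y' := by
      intro i n n₁ n₂ h h₁ h₂ hi
      obtain rfl : n₁ = n + 1 := by omega
      obtain rfl : n₂ = n + 2 := by omega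
      have e1 := (𝒮.π_d (sub_add_cancel m 1) h
        (show n - 1 + s i = m - 1 by omega) (fun j k hk hj => hxq j k hk (by omega))).symm
      rw [hx, map_zero, smul_eq_zero_iff_eq] at e1
      have e2 := 𝒯.π_d (rfl : m + 1 = m + 1) h₁ h (fun j k hk hj => hyq j k hk (by omega))
      rw [← hxy, hfg, ← Bar.map_units_smul'] at e2
      obtain ⟨x', y', hx', hy'⟩ := (quasiIso_iff_cone (g i)).1 (hg i) n _ _ e1 e2
      refine ⟨ε i • x', ε i • ε i • y', ?_, ?_⟩
      · rw [Bar.map_units_smul', hx', smul_smul, units_mul_self, one_smul]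
      · rw [Bar.map_units_smul', hy', smul_add, smul_smul, smul_smul, units_mul_self, one_smul,
          one_smul]
    have hc : ∀ i, ∃ (x' : (A i).X (m + 1 - s i)) (y' : (B i).X (m + 2 - s i)), p i = q →
        ε i • ((A i).d (m + 1 - s i) (m - s i)).hom x' = (𝒮.π i m (m - s i) (by omega)).hom x ∧
          ((g i).f (m + 1 - s i)).hom x' = (𝒯.π i (m + 1) (m + 1 - s i) (by omega)).hom y +
            ε i • ((B i).d (m + 2 - s i) (m + 1 - s i)).hom y' := by
      intro i
      by_cases hi : p i = q
      · obtain ⟨x', y', h⟩ := key i (m - s i) (m + 1 - s i) (m + 2 - s i) (by omega) (by omega)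
          (by omega) hi
        exact ⟨x', y', fun _ => h⟩
      -- An arbitrary value: `lift` uses only the components of rank `q`.
      · exact ⟨0, 0, fun h => absurd h hi⟩
    choose x₁ y₁ hc using hc
    obtain ⟨x₂, hx₂⟩ : ∃ x₂, x₂ = 𝒮.lift q (m + 1) x₁ := ⟨_, rfl⟩
    obtain ⟨y₂, hy₂⟩ : ∃ y₂, y₂ = 𝒯.lift q (m + 2) y₁ := ⟨_, rfl⟩
    -- Subtracting the cone boundary of `(x₂, y₂)` cancels the components of rank `q` and creates
    -- none in higher rank, so the induction hypothesis applies.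
    obtain ⟨x', y', h1, h2⟩ := ih (x - (K.d (m + 1) m).hom x₂)
      (y + (L.d (m + 2) (m + 1)).hom y₂ - (f.f (m + 1)).hom x₂)
      (by rw [map_sub, hx, d_d_apply, sub_zero])
      (by rw [map_sub, map_sub, map_add, d_d_apply, add_zero, d_f_apply, hxy])
      (by
        intro i n h hi
        rw [map_sub, 𝒮.π_d rfl (show m + 1 - s i + s i = m + 1 by omega) h (fun j k hk hj => by
          rw [hx₂, 𝒮.π_lift_ne _ _ (by omega)])]
        obtain rfl : n = m - s i := by omega
        by_cases hi' : p i = q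
        · rw [hx₂, 𝒮.π_lift _ hi', (hc i hi').1, sub_self]
        · rw [hx₂, 𝒮.π_lift_ne _ _ hi', map_zero, smul_zero, sub_zero, hxq i _ _ (by omega)])
      (by
        intro i n h hi
        rw [map_sub, map_add, 𝒯.π_d (show m + 1 + 1 = m + 2 by omega)
          (show m + 2 - s i + s i = m + 2 by omega) h (fun j k hk hj => by
          rw [hy₂, 𝒯.π_lift_ne _ _ (by omega)]), hfg]
        obtain rfl : n = m + 1 - s i := by omega
        by_cases hi' : p i = q
        · rw [hy₂, hx₂, 𝒮.π_lift _ hi', 𝒯.π_lift _ hi', (hc i hi').2, sub_self]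
        · rw [hy₂, hx₂, 𝒮.π_lift_ne _ _ hi', 𝒯.π_lift_ne _ _ hi', map_zero, map_zero, smul_zero,
            sub_zero, add_zero, hyq i _ _ (by omega)])
    refine ⟨x' + x₂, y' + y₂, ?_, ?_⟩
    · rw [map_add, h1, sub_add_cancel]
    · rw [map_add, h2, map_add]
      abel

end Splitting
end Ch
end

/-! ### Triangular decompositions of the bar constructions -/

noncomputable section
namespace Bar
open Opposite RTree
variable {R : Type u} [CommRing R] {M : RTreeᵒᵖ ⥤ Ch R}
variable {S S' T T' U U' Q Q' : RTree}

theorem hom_congr {V W : ModuleCat.{u} R} {f g : V ⟶ W} (h : f = g) (x : V) : f.hom x = g.hom x :=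
  congrArg (fun k => k.hom x) h

theorem smul_comp_apply_eq_zero {V W X : ModuleCat.{u} R} {f : V ⟶ W} {g : W ⟶ X} (h : f ≫ g = 0)
    (r : ℤˣ) (x : V) : r • g.hom (f.hom x) = 0 := by
  have := hom_congr h x
  rw [ModuleCat.comp_apply] at this
  rw [this]
  exact smul_zero r

section bar
variable (P : Reps S) {d₀ : List S.Edge} (hd : IsEnum d₀ {x | S.IsInner x})
include hd

/-- A generator with a component at `i` is isomorphic to the representative `i` and misses equally
many edges. This excludes the external differential, which removes one missed edge, from the
components of equal or higher rank. -/
theorem elt_eltProj_of_length_ne (α : S ⟶ T) (d : List S.Edge) {e : List T.Edge} {i : P.I}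
    (he : e.length ≠ (P.e i).length) (n n' m : ℤ) :
    Bar.elt M α d e n m ≫ eltProj M P d₀ i m n' = 0 := by
  by_cases hv : Valid α d e (n + 1) m
  swap
  · rw [elt_of_not hv, Limits.zero_comp]
  obtain ⟨j, k, rfl⟩ := P.exists_iso α
  have he2 := isEnum_map_inv k hv.2.1
  have hp := he2.perm (P.enum j)
  have hij : i ≠ j := by
    rintro rfl
    rw [← hp.length_eq, List.length_map] at he
    exact he rfl
  ext x
  have h1 : Bar.elt M (P.α j ≫ k.hom) d e n m =
      Bar.elt M (P.α j ≫ k.hom) d ((e.map k.inv).map k.hom) n m := by rw [map_map_inv]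
  rw [h1, ModuleCat.comp_apply, ← elt_iso, elt_perm _ (hv.1.perm hd) hv.1.1 hp he2.1, map_units_smul']
  have h2 := congrArg (fun f => f.hom (((M.map k.hom.op).f n).hom x))
    (elt_eltProj_ne (M := M) P hd hij n n' m)
  exact (congrArg _ h2).trans (smul_zero _)

/-- The decomposition of the bar construction given by representatives. -/
def splitting (p : P.I → ℕ) (s : P.I → ℤ) (ε : P.I → ℤˣ) (hp : ∀ i, p i = (P.e i).length)
    (hs : ∀ i, s i = d₀.length + (P.e i).length + 1)
    (hε : ∀ i, ε i = (d₀.length + (P.e i).length + 1 : ℤ).negOnePow) :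
    Ch.Splitting ((Bar M).obj S) p (fun i => M.obj (op (P.T i))) s ε where
  ι i n m _ := Bar.elt M (P.α i) d₀ (P.e i) n m
  π i m n _ := eltProj M P d₀ i m n
  ι_π_self i n m h x := congrArg (fun f => f.hom x)
    (elt_eltProj_self (M := M) P hd i (n := n) (m := m) (by have := hs i; lia))
  ι_π_ne i j n n' m _ _ x hij := congrArg (fun f => f.hom x)
    (elt_eltProj_ne (M := M) P hd hij n' n m)
  sum_π_ι m n h x := by
    have h1 := hom_congr
      (sum_eltProj_elt (M := M) P hd m n fun i => by have := hs i; have := h i; lia) x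
    rw [ModuleCat.hom_sum, LinearMap.sum_apply] at h1
    exact h1
  d_self i n n' m m' h h' x hm := by
    have hn : n' + 1 = n := by lia
    have hsi := hs i
    rw [elt_d (P.valid hd i (by lia)) hm hn, map_add, map_sum, Finset.sum_eq_zero, zero_add,
      map_units_smul', hε]
    · refine congrArg₂ (· • ·) ?_ ?_
      · push_cast
        rfl
      · exact hom_congr (elt_eltProj_self (M := M) P hd i (n := n') (m := m') (by lia)) _
    -- An external term misses one edge less than the representative `i`, so it has no component
    -- there.
    · intro w _
      rw [map_units_smul']
      have := IsEnum.length_pull (inj _) (range_faceHom (P.α i) w.1 w.2) (P.enum i).1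
        (((P.enum i).2 _).2 w.2)
      have h1 := elt_eltProj_of_length_ne (M := M) P hd (faceFactor (P.α i) w.1 w.2) d₀
        (e := pull (faceHom (P.α i) w.1 w.2) (P.e i)) (i := i) (by lia) n n' m'
      exact smul_comp_apply_eq_zero h1 _ _
  d_ne i j n n' m m' h h' x hm hij hpij := by
    have hsj := hs j
    rw [elt_d (P.valid hd j (by lia)) hm (sub_add_cancel n' 1), map_add, map_sum,
      Finset.sum_eq_zero, zero_add, map_units_smul']
    · have h1 := elt_eltProj_ne (M := M) P hd hij (n' - 1) n m'
      exact smul_comp_apply_eq_zero h1 _ _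
    · intro w _
      rw [map_units_smul']
      have := IsEnum.length_pull (inj _) (range_faceHom (P.α j) w.1 w.2) (P.enum j).1
        (((P.enum j).2 _).2 w.2)
      -- The external term misses `|e j| - 1` edges, fewer than `|e i|`.
      rw [hp, hp] at hpij
      have h1 := elt_eltProj_of_length_ne (M := M) P hd (faceFactor (P.α j) w.1 w.2) d₀
        (e := pull (faceHom (P.α j) w.1 w.2) (P.e j)) (i := i) (by lia) n' n m'
      exact smul_comp_apply_eq_zero h1 _ _

end bar

section tensor

/-- The projection of the tensor product to the summand of a pair of representatives. -/
def eltTensorProj (M : RTreeᵒᵖ ⥤ Ch R) (P : Reps S) (P' : Reps Q) (d : List S.Edge)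
    (d' : List Q.Edge) (i : P.I × P'.I) (m n : ℤ)
    (hm : (1 + d.length + d'.length : ℤ) + ((P.e i.1).length + (P'.e i.2).length) + (n + 1) = m) :
    ((Bar M).obj S ⊗ (Bar M).obj Q).X m ⟶ (M.obj (op (P.T i.1)) ⊗ M.obj (op (P'.T i.2))).X n :=
  -- The shifts recover the degrees of `x₁` and `x₂` from those of the generators. The sign is thus
  -- the one in `eltTensor` and cancels it.
  Ch.gtensor (fun k l => graftSign d.length (P.e i.1).length d'.length (P'.e i.2).length
      (k - (d.length + (P.e i.1).length + 1)) (l - (d'.length + (P'.e i.2).length + 1)))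
    (eltProj M P d i.1) (eltProj M P' d' i.2) (-(d.length + (P.e i.1).length + 1))
    (-(d'.length + (P'.e i.2).length + 1)) (by lia)

variable (P : Reps S) (P' : Reps Q) {d : List S.Edge} {d' : List Q.Edge}

theorem eltTensorProj_tmul (i : P.I × P'.I) (m n : ℤ)
    (hm : (1 + d.length + d'.length : ℤ) + ((P.e i.1).length + (P'.e i.2).length) + (n + 1) = m)
    {a b k l : ℤ} (hkl : k + l = m) (hk : (d.length : ℤ) + (P.e i.1).length + (a + 1) = k)
    (hl : (d'.length : ℤ) + (P'.e i.2).length + (b + 1) = l)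
    (x : ((Bar M).obj S).X k) (y : ((Bar M).obj Q).X l) :
    (eltTensorProj M P P' d d' i m n hm).hom (Ch.tmul m hkl x y) =
      graftSign d.length (P.e i.1).length d'.length (P'.e i.2).length a b •
        Ch.tmul n (by lia) ((eltProj M P d i.1 k a).hom x) ((eltProj M P' d' i.2 l b).hom y) := by
  obtain rfl : a = k - (d.length + (P.e i.1).length + 1) := by lia
  obtain rfl : b = l - (d'.length + (P'.e i.2).length + 1) := by lia
  exact Ch.gtensor_tmul _ (eltProj M P d i.1) (eltProj M P' d' i.2) _ _ _ hkl
    (a := k - (d.length + (P.e i.1).length + 1)) (b := l - (d'.length + (P'.e i.2).length + 1))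
    (by lia) (by lia) x y

theorem eltTensor_proj_eq_zero (i : P.I × P'.I) {α : S ⟶ T} {β : Q ⟶ U} {c : List S.Edge}
    {e : List T.Edge} {c' : List Q.Edge} {e' : List U.Edge}
    (h : (∀ n n' m, Bar.elt M α c e n m ≫ eltProj M P d i.1 m n' = 0) ∨
      ∀ n n' m, Bar.elt M β c' e' n m ≫ eltProj M P' d' i.2 m n' = 0) (n n' m : ℤ) (hm) (hm') :
    eltTensor M α β c e c' e' n m hm ≫ eltTensorProj M P P' d d' i m n' hm' = 0 := by
  apply Ch.hom_ext_tmul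
  intro a b hab x y
  obtain ⟨k, hk⟩ : ∃ k, k = (c.length : ℤ) + e.length + (a + 1) := ⟨_, rfl⟩
  obtain ⟨l, hl⟩ : ∃ l, l = (c'.length : ℤ) + e'.length + (b + 1) := ⟨_, rfl⟩
  rw [ModuleCat.comp_apply, eltTensor_tmul _ _ _ _ _ _ _ _ _ hab hk.symm hl.symm, map_units_smul',
    eltTensorProj_tmul (M := M) P P' (d := d) (d' := d') i m n' hm' (k := k) (l := l)
      (a := k - (d.length + (P.e i.1).length + 1))
      (b := l - (d'.length + (P'.e i.2).length + 1)) (by lia) (by lia) (by lia)]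
  rcases h with h | h
  · have h1 := hom_congr (h a (k - (d.length + (P.e i.1).length + 1)) k) x
    rw [ModuleCat.comp_apply] at h1
    rw [h1]
    refine (congrArg (_ • _ • ·) (Ch.zero_tmul _ _)).trans ?_
    rw [smul_zero, smul_zero]
    rfl
  · have h1 := hom_congr (h b (l - (d'.length + (P'.e i.2).length + 1)) l) y
    rw [ModuleCat.comp_apply] at h1
    rw [h1]
    refine (congrArg (_ • _ • ·) (Ch.tmul_zero _ _)).trans ?_
    rw [smul_zero, smul_zero]
    rfl

variable (hd : IsEnum d {x | S.IsInner x}) (hd' : IsEnum d' {x | Q.IsInner x})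
include hd hd'

theorem eltTensor_proj_self (i : P.I × P'.I) (n m : ℤ) (hm) :
    eltTensor M (P.α i.1) (P'.α i.2) d (P.e i.1) d' (P'.e i.2) n m hm ≫
      eltTensorProj M P P' d d' i m n hm = 𝟙 _ := by
  apply Ch.hom_ext_tmul
  intro a b hab x y
  rw [ModuleCat.comp_apply, eltTensor_tmul _ _ _ _ _ _ _ _ _ hab rfl rfl, map_units_smul',
    eltTensorProj_tmul (M := M) P P' (d := d) (d' := d') i m n hm _ rfl rfl, smul_smul,
    units_mul_self, one_smul]
  exact congrArg₂ (Ch.tmul n hab)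
    (congrArg (fun f => f.hom x) (elt_eltProj_self (M := M) P hd i.1 rfl))
    (congrArg (fun f => f.hom y) (elt_eltProj_self (M := M) P' hd' i.2 rfl))

theorem eltTensor_proj_ne {i j : P.I × P'.I} (hij : i ≠ j) (n n' m : ℤ) (hm) (hm') :
    eltTensor M (P.α j.1) (P'.α j.2) d (P.e j.1) d' (P'.e j.2) n m hm ≫
      eltTensorProj M P P' d d' i m n' hm' = 0 := by
  apply eltTensor_proj_eq_zero
  by_cases h : i.1 = j.1
  · exact Or.inr (elt_eltProj_ne (M := M) P' hd' fun h' => hij (Prod.ext h h'))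
  · exact Or.inl (elt_eltProj_ne (M := M) P hd h)

theorem sum_proj_eltTensor (m : ℤ) (n : P.I × P'.I → ℤ) (hn : ∀ i, (1 + d.length + d'.length : ℤ) +
      ((P.e i.1).length + (P'.e i.2).length) + (n i + 1) = m) :
    ∑ i, eltTensorProj M P P' d d' i m (n i) (hn i) ≫
      eltTensor M (P.α i.1) (P'.α i.2) d (P.e i.1) d' (P'.e i.2) (n i) m (hn i) = 𝟙 _ := by
  apply Ch.hom_ext_tmul
  intro k l hkl x y
  have h1 := hom_congr (sum_eltProj_elt (M := M) P hd k
    (fun i => k - (d.length + (P.e i).length + 1)) fun i => by lia) x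
  have h2 := hom_congr (sum_eltProj_elt (M := M) P' hd' l
    (fun i => l - (d'.length + (P'.e i).length + 1)) fun i => by lia) y
  rw [ModuleCat.hom_sum, LinearMap.sum_apply] at h1 h2
  rw [ModuleCat.hom_sum, LinearMap.sum_apply]
  refine Eq.trans ?_ (congrArg₂ (Ch.tmul m hkl) h1 h2)
  rw [Ch.sum_tmul, Fintype.sum_prod_type]
  refine Finset.sum_congr rfl fun i _ => ?_
  rw [Ch.tmul_sum]
  refine Finset.sum_congr rfl fun j _ => ?_
  have hij := hn (i, j)
  rw [ModuleCat.comp_apply, eltTensorProj_tmul (M := M) P P' (d := d) (d' := d') (i, j) m (n (i, j))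
      hij hkl (a := k - (d.length + (P.e i).length + 1))
      (b := l - (d'.length + (P'.e j).length + 1)) (by lia) (by lia), map_units_smul',
    eltTensor_tmul (M := M) (P.α i) (P'.α j) d (P.e i) d' (P'.e j) (n (i, j)) m hij
      (i := k - (d.length + (P.e i).length + 1)) (j := l - (d'.length + (P'.e j).length + 1))
      (by lia) (k := k) (l := l) (by lia) (by lia), smul_smul, units_mul_self, one_smul]
  rfl

/-- The decomposition of the tensor product of two bar constructions given by representatives. -/
def tensorSplitting : Ch.Splitting ((Bar M).obj S ⊗ (Bar M).obj Q)
    (fun i : P.I × P'.I => (P.e i.1).length + (P'.e i.2).length)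
    (fun i => M.obj (op (P.T i.1)) ⊗ M.obj (op (P'.T i.2)))
    (fun i => 1 + d.length + d'.length + ((P.e i.1).length + (P'.e i.2).length) + 1)
    (fun i => (d.length + d'.length + (P.e i.1).length + (P'.e i.2).length : ℤ).negOnePow) where
  ι i n m h := eltTensor M (P.α i.1) (P'.α i.2) d (P.e i.1) d' (P'.e i.2) n m (by lia)
  π i m n h := eltTensorProj M P P' d d' i m n (by lia)
  ι_π_self i n m h x := hom_congr (eltTensor_proj_self (M := M) P P' hd hd' i n m (by lia)) x
  ι_π_ne i j n n' m h h' x hij :=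
    hom_congr (eltTensor_proj_ne (M := M) P P' hd hd' hij n' n m (by lia) (by lia)) x
  sum_π_ι m n h x := by
    have h1 := hom_congr
      (sum_proj_eltTensor (M := M) P P' hd hd' m n fun i => by have := h i; lia) x
    rw [ModuleCat.hom_sum, LinearMap.sum_apply] at h1
    exact h1
  d_self i n n' m m' h h' x hm := by
    rw [eltTensor_d hd (P.enum i.1) hd' (P'.enum i.2) (by lia) hm (show n' + 1 = n by lia), map_add,
      map_add, map_sum, map_sum, Finset.sum_eq_zero, Finset.sum_eq_zero, zero_add, zero_add,
      map_units_smul']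
    · exact congrArg (_ • ·)
        (hom_congr (eltTensor_proj_self (M := M) P P' hd hd' i n' m' (by lia)) _)
    · intro w _
      rw [map_units_smul']
      have := IsEnum.length_pull (inj _) (range_faceHom (P'.α i.2) w.1 w.2) (P'.enum i.2).1
        (((P'.enum i.2).2 _).2 w.2)
      exact smul_comp_apply_eq_zero (eltTensor_proj_eq_zero (M := M) P P' i (Or.inr
        (elt_eltProj_of_length_ne P' hd' _ d' (by lia))) n n' m' _ _) _ _
    · intro w _
      rw [map_units_smul']
      have := IsEnum.length_pull (inj _) (range_faceHom (P.α i.1) w.1 w.2) (P.enum i.1).1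
        (((P.enum i.1).2 _).2 w.2)
      exact smul_comp_apply_eq_zero (eltTensor_proj_eq_zero (M := M) P P' i (Or.inl
        (elt_eltProj_of_length_ne P hd _ d (by lia))) n n' m' _ _) _ _
  d_ne i j n n' m m' h h' x hm hij hp := by
    rw [eltTensor_d hd (P.enum j.1) hd' (P'.enum j.2) (by lia) hm (sub_add_cancel n' 1), map_add,
      map_add, map_sum, map_sum, Finset.sum_eq_zero, Finset.sum_eq_zero, zero_add, zero_add,
      map_units_smul']
    · exact smul_comp_apply_eq_zero
        (eltTensor_proj_ne (M := M) P P' hd hd' hij (n' - 1) n m' (by lia) (by lia)) _ _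
    · intro w _
      rw [map_units_smul']
      have := IsEnum.length_pull (inj _) (range_faceHom (P'.α j.2) w.1 w.2) (P'.enum j.2).1
        (((P'.enum j.2).2 _).2 w.2)
      refine smul_comp_apply_eq_zero (eltTensor_proj_eq_zero (M := M) P P' i ?_ n' n m' _ _) _ _
      -- One of the two lengths must differ from that of `i`: if the first ones agree, then `|e' j|
      -- ≤ |e' i|`, and the face of the second factor has one missed edge less still.
      by_cases h1 : (P.e j.1).length = (P.e i.1).length
      · exact Or.inr (elt_eltProj_of_length_ne P' hd' _ d' (by lia))
      · exact Or.inl (elt_eltProj_of_length_ne P hd _ d h1)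
    · intro w _
      rw [map_units_smul']
      have := IsEnum.length_pull (inj _) (range_faceHom (P.α j.1) w.1 w.2) (P.enum j.1).1
        (((P.enum j.1).2 _).2 w.2)
      refine smul_comp_apply_eq_zero (eltTensor_proj_eq_zero (M := M) P P' i ?_ n' n m' _ _) _ _
      by_cases h1 : (P'.e j.2).length = (P'.e i.2).length
      · exact Or.inl (elt_eltProj_of_length_ne P hd _ d (by lia))
      · exact Or.inr (elt_eltProj_of_length_ne P' hd' _ d' h1)

/-- The Koszul sign of `eltTensor` is cancelled by that of `eltTensorProj`, so the component of Δ is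
θ without any sign. Generators at other pairs of representatives go to zero on both sides. -/
theorem comulDeg_proj (θ : Preoperad M) (a : S.Leaf) (i : P.I × P'.I) (m n : ℤ) (hm) :
    comulDeg θ P P' d d' a m ≫ eltTensorProj M P P' d d' i m n hm =
      eltProj M (P.graft P' a) (graftInner a d d') i m n ≫
        (θ.θ (P.T i.1) (P'.T i.2) (leafMap (P.α i.1) a)).f n := by
  have hD := isEnum_cons_graft (a := a) hd hd'
  apply bar_hom_ext (M := M) (P.graft P' a) hD
  intro j n' hn'
  have hn : (1 + d.length + d'.length : ℤ) + ((P.e j.1).length + (P'.e j.2).length) + (n' + 1) =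
      m := by
    rw [← hn', length_graftInner]
    exact congrArg (_ + · + _) (length_graftEnum (leafMap (P.α j.1) a) _ _).symm
  have h1 := elt_comulDeg_reps θ P P' hd hd' a j.1 j.2 n' m hn
  refine ((reassoc_of% h1) (eltTensorProj M P P' d d' i m n hm)).trans ?_
  by_cases hij : i = j
  · subst hij
    obtain rfl : n = n' := by lia
    have h2 := elt_eltProj_self (M := M) (P.graft P' a) hD i hn'
    rw [eltTensor_proj_self P P' hd hd']
    exact (Category.comp_id _).trans (((reassoc_of% h2) _).trans rfl).symm
  · have h2 := elt_eltProj_ne (M := M) (P.graft P' a) hD hij n' n m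
    rw [eltTensor_proj_ne P P' hd hd' hij, Limits.comp_zero]
    exact (((reassoc_of% h2) _).trans Limits.zero_comp).symm

end tensor

/-- Source and target are triangular with the same ranks, shifts and diagonal signs, and the
components of Δ are the quasi-isomorphisms θ. The three remaining goals compare rank, shift and
diagonal sign. -/
theorem quasiIso_comul (θ : Preoperad M) (hθ : θ.IsOperad) (S Q : RTree) (a : S.Leaf) :
    QuasiIso (comul θ S Q a) := by
  have hd := isEnum_innerEnum S
  have hd' := isEnum_innerEnum Q
  refine Ch.Splitting.quasiIso (splitting ((Reps.canonical S).graft (Reps.canonical Q) a)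
    (isEnum_cons_graft (a := a) hd hd') _ _ _ (fun i => ?_) (fun i => ?_) (fun i => ?_))
    (tensorSplitting (Reps.canonical S) (Reps.canonical Q) hd hd') (comul θ S Q a)
    (fun i => θ.θ _ _ (leafMap ((Reps.canonical S).α i.1) a)) (fun i => hθ _ _ _)
    (fun i m n h x => hom_congr
      (comulDeg_proj (Reps.canonical S) (Reps.canonical Q) hd hd' θ a i m n (by lia)) x)
  · have h1 : ((((Reps.canonical S).graft (Reps.canonical Q) a).e i).length : ℤ) =
        ((Reps.canonical S).e i.1).length + ((Reps.canonical Q).e i.2).length :=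
      length_graftEnum (leafMap ((Reps.canonical S).α i.1) a) _ _
    exact_mod_cast h1.symm
  · rw [length_graftInner]
    exact congrArg (_ + · + _) (length_graftEnum (leafMap ((Reps.canonical S).α i.1) a) _ _).symm
  · have h1 : ((((Reps.canonical S).graft (Reps.canonical Q) a).e i).length : ℤ) =
        ((Reps.canonical S).e i.1).length + ((Reps.canonical Q).e i.2).length :=
      length_graftEnum (leafMap ((Reps.canonical S).α i.1) a) _ _
    rw [h1, length_graftInner]
    -- The source sign has two additional units, one for the grafting edge and one for the
    -- suspension; they cancel modulo 2.
    apply negOnePow_eq_of_zmod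
    push_cast
    grind

end Bar
end

/-! ### The linear ∞-cooperad structure on the bar construction -/

theorem mainTheorem4 (R : Type u) [CommRing R] :
    ∃ Δ : ∀ (M : RTreeᵒᵖ ⥤ Ch R) (θ : Preoperad M), θ.IsOperad → Precooperad (Bar M),
      (∀ (M : RTreeᵒᵖ ⥤ Ch R) (θ : Preoperad M) (hθ : θ.IsOperad), (Δ M θ hθ).IsCooperad) ∧
      (∀ (M : RTreeᵒᵖ ⥤ Ch R) (θ : Preoperad M) (hθ : θ.IsOperad)
        {S Q T U : RTree} (a : S.Leaf) (α : S ⟶ T) (β : Q ⟶ U)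
        (dS : List S.Edge) (eS : List T.Edge) (dQ : List Q.Edge) (eQ : List U.Edge),
        Bar.IsEnum dS {x | S.IsInner x} → Bar.IsEnum eS (Set.range α)ᶜ →
        Bar.IsEnum dQ {x | Q.IsInner x} → Bar.IsEnum eQ (Set.range β)ᶜ →
        ∀ (n m : ℤ)
          (hm : (1 + dS.length + dQ.length : ℤ) + (eS.length + eQ.length) + (n + 1) = m),
        Bar.elt M (RTree.graftMap α β a)
            (RTree.inl Q a a.1 :: (dS.map (RTree.inl Q a) ++ dQ.map (RTree.inr a)))
            (eS.map (RTree.inl U (RTree.leafMap α a)) ++ eQ.map (RTree.inr (RTree.leafMap α a)))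
            n m ≫ ((Δ M θ hθ).Δ S Q a).f m =
          Bar.degraft θ a α β dS eS dQ eQ n m hm) ∧
      (∀ (M M' : RTreeᵒᵖ ⥤ Ch R) (θ : Preoperad M) (θ' : Preoperad M') (hθ : θ.IsOperad)
        (hθ' : θ'.IsOperad) (f : M ⟶ M'),
        θ.IsHom θ' f → (Δ M θ hθ).IsHom (Δ M' θ' hθ') (Bar.map f)) := by
  refine ⟨fun M θ _ =>
    { Δ := Bar.comul θ
      naturality := fun β γ a => Bar.comul_naturality β γ θ a
      coassoc_sequential := fun S Q P a b => Bar.comul_sequential θ P a b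
      coassoc_parallel := fun S Q P a b h => Bar.comul_parallel θ Q P a b h },
    fun M θ hθ S Q a => Bar.quasiIso_comul θ hθ S Q a, ?_, ?_⟩
  · intro M θ _ S Q T U a α β dS eS dQ eQ hdS heS hdQ heQ n m hm
    exact (Bar.elt_comulDeg θ (Bar.Reps.canonical S) (Bar.Reps.canonical Q)
      (Bar.isEnum_innerEnum S) (Bar.isEnum_innerEnum Q) α β hdS heS hdQ heQ n m hm).trans
      (Bar.degraft_eq θ a α β dS eS dQ eQ n m hm).symm
  · intro M M' θ θ' _ _ f hf S Q a
    exact Bar.comul_map f θ θ' hf S Q a
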